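/- **Setting.** Let $(\mathcal V,\mathcal E)$ be a finite connected directed graph with at least one edge and no loops; the edge $e$ is identified with an interval $(0,\ell^e)$, $\ell^e>0$. Let $\mathcal E(v)$ be the set of edges incident to $v$, $\mathcal V_\partial=\{v:|\mathcal E(v)|=1\}$, $\mathcal V_0=\mathcal V\setminus\mathcal V_\partial$, and for $e=(v_1,v_2)$ put $n^e(v_1)=-1$, $n^e(v_2)=1$, and $n^e(v)=0$ otherwise. Write $\langle u,v\rangle_{\mathcal E}=\sum_e\int_0^{\ell^e}u^ev^e\,dx$ and $\|u\|_{L^p(\mathcal E)}^p=\sum_e\|u^e\|_{L^p(0,\ell^e)}^p$. Let $\tau_{max}>0$. **Continuous problem.** For given constants $\varepsilon\ge 0$, $a^e,\gamma^e>0$, a function $P:(0,\infty)\to\mathbb R$ and boundary enthalpies $h_\partial^v(\tau)$, $v\in\mathcal V_\partial$, a classical solution is a pair $(\rho,w)$ with $\rho>0$ and, on every edge, $\rho^e,w^e\in C^1([0,\tau_{max}];L^2(0,\ell^e))\cap C^0([0,\tau_{max}];H^1(0,\ell^e))$, such that for all $\tau\in[0,\tau_{max}]$, with $m^e=a^e\rho^ew^e$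 and $h^e=\tfrac12\varepsilon^2(w^e)^2+P'(\rho^e)$, $$a^e\partial_\tau\rho^e+\partial_xm^e=0,\qquad \varepsilon^2\partial_\tau w^e+\partial_xh^e=-\gamma^e|w^e|w^e\qquad\text{a.e. on }(0,\ell^e),\ e\in\mathcal E,$$ $$\sum_{e\in\mathcal E(v)}m^e(v)n^e(v)=0,\quad h^e(v)=h^v\ \ (v\in\mathcal V_0,\ e\in\mathcal E(v)),\qquad h^e(v)=h^v_\partial\ \ (v\in\mathcal V_\partial,\ e\in\mathcal E(v)),$$ where the $h^v$, $v\in\mathcal V_0$, are additional unknowns. **Assumptions.** Fix positive constants $\bar\varepsilon,\underline\gamma,\bar\gamma,\underline a,\bar a,\underline\rho,\bar\rho,\bar w,\bar C$. * (A1) $P$ is smooth and strongly convex on $(0,\infty)$. * (A2) $0\le\varepsilon\le\bar\varepsilon$, $\underline\gamma\le\gamma^e\le\bar\gamma$, $\underline a\le a^e\le\bar a$ for all $e$, and $rP''(r)\ge4\bar\varepsilon^2\bar w^2$ for all $2\underline\rho/3\le r\le3\bar\rho/2$. * (A3) $(\rho,w)$ is a classical solution with $\underline\rho\le\rho\le\bar\rho$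 and $-\bar w\le w\le\bar w$. * (A4) $\rho^e$ and $w^e$ are, on every edge, bounded by $\bar C$ in $W^{2,\infty}(0,\tau_{max};L^2(0,\ell^e))$ and in $W^{1,\infty}(0,\tau_{max};H^1(0,\ell^e))$, in the sense that their time derivatives up to order $2$, respectively the time derivatives up to order $1$ of them and of their spatial derivatives, have $L^2(0,\ell^e)$-norm at most $\bar C$ at almost every time. **Scheme.** Let $\Delta\tau=\tau_{max}/N$, $\tau^n=n\Delta\tau$, divide each edge $e$ into $M^e\ge1$ elements of length $h^e=\ell^e/M^e$, and let $h=\max_eh^e$. Let $Q_h$ be the space of piecewise constant functions, and $R_h$ the space of functions $r$ that are continuous and piecewise linear on each edge with $\sum_{e\in\mathcal E(v)}r^e(v)n^e(v)=0$ for all $v\in\mathcal V_0$. Let $\rho_h^0$ be the $L^2$-orthogonal projection of $\rho(0)$ to $Q_h$ and $m_h^0$ the piecewise linear interpolant of $m(0)$. For $1\le n\le N$ one looks for $\rho_h^n\in Q_h$, $m_h^n\in R_h$ such that for all $q_h\in Q_h$, $r_h\in R_h$ $$\langle a\bar d_\tau\rho_h^n,q_h\rangle_{\mathcal E}+\langle\partial_xm_h^n,q_h\rangle_{\mathcal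 E}=0,$$ $$\langle\varepsilon^2\bar d_\tau w_h^n,r_h\rangle_{\mathcal E}-\langle h_h^n,\partial_xr_h\rangle_{\mathcal E}+\langle\gamma|w_h^n|w_h^n,r_h\rangle_{\mathcal E}=-\sum_{v\in\mathcal V_\partial}\sum_{e\in\mathcal E(v)}h_\partial^v(\tau^n)\,r_h^e(v)\,n^e(v),$$ where $\bar d_\tau u^n=(u^n-u^{n-1})/\Delta\tau$, $w_h^n=m_h^n/(a\rho_h^n)$ and $h_h^n=\tfrac12\varepsilon^2(w_h^n)^2+P'(\rho_h^n)$. A solution is called admissible if $2\underline\rho/3\le\rho_h^n\le3\bar\rho/2$ and $|w_h^n|\le3\bar w/2$ almost everywhere, for all $0\le n\le N$. **Theorem.** Assume (A1) and the inequality for $P''$ in (A2). There is a constant $C>0$, depending only on the network $(\mathcal V,\mathcal E,(\ell^e)_e)$, $\tau_{max}$, $P$ and the constants $\bar\varepsilon,\underline\gamma,\bar\gamma,\underline a,\bar a,\underline\rho,\bar\rho,\bar w,\bar C$, such that for all $c_1,c_2>0$ there is $\Delta\tau_0>0$, depending only on the same data and on $c_1,c_2$, with the following property. Let $\varepsilon$,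 $a^e$, $\gamma^e$, $h_\partial^v$ and $(\rho,w)$ satisfy (A2)–(A4), and let $\Delta\tau\le\Delta\tau_0$ and $c_1\Delta\tau\le h\le c_2\Delta\tau$. Then the scheme has a unique admissible solution $(\rho_h^n,m_h^n)_{0\le n\le N}$, and for all $0\le n\le N$ $$\|\rho(\tau^n)-\rho_h^n\|_{L^2(\mathcal E)}^2+\varepsilon^2\|m(\tau^n)-m_h^n\|_{L^2(\mathcal E)}^2+\sum_{k=1}^n\Delta\tau\,\|m(\tau^k)-m_h^k\|_{L^3(\mathcal E)}^3\le C\,(\Delta\tau^2+h^2).$$ In particular, $C$ and $\Delta\tau_0$ do not depend on $\varepsilon\in[0,\bar\varepsilon]$. -/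

import Mathlib

open MeasureTheory Set
open scoped ContDiff

namespace GasNet

/-! ### Function spaces on one pipe -/

/-- The Lebesgue space `L²(0,ℓ)`. -/
abbrev L2 (ℓ : ℝ) : Type := Lp ℝ 2 (volume.restrict (Ioo (0 : ℝ) ℓ))

open Classical in
/-- The element of `L²(0,ℓ)` represented by a square integrable function
(and `0` if the function is not square integrable on `(0,ℓ)`). -/
noncomputable def toL2 (ℓ : ℝ) (f : ℝ → ℝ) : L2 ℓ :=
  if hf : MemLp f 2 (volume.restrict (Ioo (0 : ℝ) ℓ)) then hf.toLp f else 0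

/-- `f ∈ H¹(0,ℓ)`, for the continuous representative on `[0,ℓ]`: the function is absolutely
continuous and its (almost everywhere existing) derivative is square integrable. -/
def IsH1 (ℓ : ℝ) (f : ℝ → ℝ) : Prop :=
  AbsolutelyContinuousOnInterval f 0 ℓ ∧ MemLp (deriv f) 2 (volume.restrict (Ioo (0 : ℝ) ℓ))

/-- `u ∈ C¹([0,T]; L²(0,ℓ)) ∩ C⁰([0,T]; H¹(0,ℓ))`, where `u t x` is the value at time `t` and
position `x`, and `u t` is the continuous representative. -/
structure IsClassicalTrajectory (T ℓ : ℝ) (u : ℝ → ℝ → ℝ) : Prop where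
  memH1 : ∀ t ∈ Icc 0 T, IsH1 ℓ (u t)
  contDiffL2 : ContDiffOn ℝ 1 (fun t => toL2 ℓ (u t)) (Icc 0 T)
  contH1 : ContinuousOn (fun t => toL2 ℓ (deriv (u t))) (Icc 0 T)

/-- The time derivative `∂_τ u(t) ∈ L²(0,ℓ)` on the time interval `[0,T]`. -/
noncomputable def timeDeriv (T ℓ : ℝ) (u : ℝ → ℝ → ℝ) (t : ℝ) : L2 ℓ :=
  derivWithin (fun s => toL2 ℓ (u s)) (Icc 0 T) t

/-- `U ∈ W^{k,∞}(0,T; X)`, with `U` and its weak derivatives up to order `k` bounded by `C` almost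
everywhere; for `k ≥ 1`, `U` is the continuous representative, and the weak derivative is the
function `U'` of which `U` is a primitive. -/
def BoundedWInfty {X : Type*} [NormedAddCommGroup X] [NormedSpace ℝ X] (T C : ℝ) :
    ℕ → (ℝ → X) → Prop
  | 0, U => AEStronglyMeasurable U (volume.restrict (Ioo 0 T)) ∧
      ∀ᵐ t ∂(volume.restrict (Ioo 0 T)), ‖U t‖ ≤ C
  | k + 1, U => AEStronglyMeasurable U (volume.restrict (Ioo 0 T)) ∧
      (∀ᵐ t ∂(volume.restrict (Ioo 0 T)), ‖U t‖ ≤ C) ∧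
      ∃ U' : ℝ → X, (∀ t ∈ Icc 0 T, U t = U 0 + ∫ s in (0 : ℝ)..t, U' s) ∧
        BoundedWInfty T C k U'

/-- `u` is bounded by `C` in `W^{2,∞}(0,T; L²(0,ℓ))` and in `W^{1,∞}(0,T; H¹(0,ℓ))`; the latter
means that `u` and `∂_x u` are bounded in `W^{1,∞}(0,T; L²(0,ℓ))`. -/
structure IsSmoothTrajectory (T ℓ C : ℝ) (u : ℝ → ℝ → ℝ) : Prop where
  w2L2 : BoundedWInfty T C 2 (fun t => toL2 ℓ (u t))
  w1L2 : BoundedWInfty T C 1 (fun t => toL2 ℓ (u t))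
  w1H1 : BoundedWInfty T C 1 (fun t => toL2 ℓ (deriv (u t)))

/-! ### The network -/

/-- A connected directed graph with vertices `V` and edges `E`; the edge `e` leads from `src e` to
`tgt e` and is identified with the interval `(0, len e)`. Parallel edges are allowed. -/
structure PipeNetwork (V E : Type*) where
  src : E → V
  tgt : E → V
  len : E → ℝ
  src_ne_tgt : ∀ e, src e ≠ tgt e
  len_pos : ∀ e, 0 < len e
  connected : (SimpleGraph.fromRel fun v v' => ∃ e, src e = v ∧ tgt e = v').Connected

namespace PipeNetwork

variable {V E : Type*} [Fintype V] [DecidableEq V] [Fintype E] (G : PipeNetwork V E)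

/-- The set `𝓔(v)` of the edges that are incident to `v`. -/
def incident (v : V) : Finset E := {e | G.src e = v ∨ G.tgt e = v}

/-- The boundary vertices: those with exactly one incident edge. -/
def boundary : Finset V := {v | (G.incident v).card = 1}

/-- The incidence number `n^e(v)`. -/
def sign (e : E) (v : V) : ℝ := if v = G.src e then -1 else if v = G.tgt e then 1 else 0

/-- The value `u^e(v)` at an end point `v` of the edge `e`. -/
noncomputable def atVertex (u : E → ℝ → ℝ) (e : E) (v : V) : ℝ :=
  u e (if v = G.tgt e then G.len e else 0)

/-- The balance condition `∑_{e ∈ 𝓔(v)} u^e(v) n^e(v) = 0` at all inner vertices. -/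
def Conservative (u : E → ℝ → ℝ) : Prop :=
  ∀ v, v ∉ G.boundary → ∑ e ∈ G.incident v, G.atVertex u e v * G.sign e v = 0

/-- The scalar product `⟨u,v⟩_𝓔` of `L²(𝓔)`. -/
noncomputable def inner (u v : E → ℝ → ℝ) : ℝ := ∑ e, ∫ x in (0 : ℝ)..G.len e, u e x * v e x

/-- The power `‖u‖_{L^p(𝓔)}^p` of the norm of `L^p(𝓔)`. -/
noncomputable def normPow (p : ℕ) (u : E → ℝ → ℝ) : ℝ :=
  ∑ e, ∫ x in (0 : ℝ)..G.len e, |u e x| ^ p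

/-! ### The continuous problem -/

/-- The mass flux `m = a ρ w`. -/
def flux (a : E → ℝ) (ρ w : E → ℝ → ℝ) (e : E) (x : ℝ) : ℝ := a e * ρ e x * w e x

/-- The mass flux `m(t)` of a trajectory, where `ρ e t x` and `w e t x` are the values on the edge
`e` at time `t` and position `x`. -/
def fluxAt (a : E → ℝ) (ρ w : E → ℝ → ℝ → ℝ) (t : ℝ) : E → ℝ → ℝ :=
  flux a (fun e => ρ e t) (fun e => w e t)

/-- The total specific enthalpy `h = ε² w² / 2 + P'(ρ)`. -/
noncomputable def enthalpy (P : ℝ → ℝ) (ε : ℝ) (ρ w : E → ℝ → ℝ) (e : E) (x : ℝ) : ℝ :=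
  ε ^ 2 * w e x ^ 2 / 2 + deriv P (ρ e x)

/-- The total specific enthalpy `h(t)` of a trajectory. -/
noncomputable def enthalpyAt (P : ℝ → ℝ) (ε : ℝ) (ρ w : E → ℝ → ℝ → ℝ) (t : ℝ) : E → ℝ → ℝ :=
  enthalpy P ε (fun e => ρ e t) (fun e => w e t)

/-- `(ρ, w)` is a classical solution on `[0,T]`, with boundary enthalpies `hb v` at the boundary
vertices. Here `ρ e t x` and `w e t x` are the values on the edge `e` at time `t` and position `x`.
The differential equations hold in `L²` on each edge, i.e. at almost every `x`. -/
structure IsClassicalSolution (P : ℝ → ℝ) (T ε : ℝ) (a γ : E → ℝ) (hb : V → ℝ → ℝ)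
    (ρ w : E → ℝ → ℝ → ℝ) : Prop where
  regρ : ∀ e, IsClassicalTrajectory T (G.len e) (ρ e)
  regw : ∀ e, IsClassicalTrajectory T (G.len e) (w e)
  pos : ∀ e, ∀ t ∈ Icc 0 T, ∀ x ∈ Icc 0 (G.len e), 0 < ρ e t x
  mass : ∀ e, ∀ t ∈ Icc 0 T, ∀ᵐ x ∂(volume.restrict (Ioo 0 (G.len e))),
    a e * timeDeriv T (G.len e) (ρ e) t x
      + deriv (fluxAt a ρ w t e) x = 0
  momentum : ∀ e, ∀ t ∈ Icc 0 T, ∀ᵐ x ∂(volume.restrict (Ioo 0 (G.len e))),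
    ε ^ 2 * timeDeriv T (G.len e) (w e) t x
      + deriv (enthalpyAt P ε ρ w t e) x
      = -(γ e * |w e t x| * w e t x)
  balance : ∀ t ∈ Icc 0 T, G.Conservative (fluxAt a ρ w t)
  continuity : ∀ t ∈ Icc 0 T, ∀ v, v ∉ G.boundary → ∃ hv : ℝ, ∀ e ∈ G.incident v,
    G.atVertex (enthalpyAt P ε ρ w t) e v = hv
  bdry : ∀ t ∈ Icc 0 T, ∀ v ∈ G.boundary, ∀ e ∈ G.incident v,
    G.atVertex (enthalpyAt P ε ρ w t) e v = hb v t

/-! ### The discretization -/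

/-- The mesh size `h^e` of the uniform mesh with `M e` elements on the edge `e`. -/
noncomputable def edgeMeshSize (M : E → ℕ) (e : E) : ℝ := G.len e / M e

/-- The global mesh size `h = max_e h^e`. -/
noncomputable def meshSize [Nonempty E] (M : E → ℕ) : ℝ :=
  Finset.univ.sup' Finset.univ_nonempty (G.edgeMeshSize M)

/-- The grid point `x_i^e = i h^e`. -/
noncomputable def gridPoint (M : E → ℕ) (e : E) (i : ℕ) : ℝ := i * G.edgeMeshSize M e

/-- The space `Q_h` of piecewise constant functions. -/
def InQ (M : E → ℕ) (q : E → ℝ → ℝ) : Prop :=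
  ∀ e, ∀ i < M e, ∃ c : ℝ, ∀ x ∈ Ioo (G.gridPoint M e i) (G.gridPoint M e (i + 1)), q e x = c

/-- The space `R_h` of functions that are continuous and piecewise linear on every edge and satisfy
the balance condition at the inner vertices (being affine on every closed element includes
continuity at the grid points). -/
def InR (M : E → ℕ) (r : E → ℝ → ℝ) : Prop :=
  (∀ e, ∀ i < M e, ∃ c d : ℝ,
    ∀ x ∈ Icc (G.gridPoint M e i) (G.gridPoint M e (i + 1)), r e x = c + d * x) ∧
  G.Conservative r

/-- The discrete velocity `w_h = m_h / (a ρ_h)`. -/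
noncomputable def discreteVelocity (a : E → ℝ) (ρh mh : E → ℝ → ℝ) (e : E) (x : ℝ) : ℝ :=
  mh e x / (a e * ρh e x)

/-- `(ρh n, mh n)`, `0 ≤ n ≤ N`, solves the fully discrete scheme with `N` time steps of size
`T / N` and `M e` elements on the edge `e`, with initial values `ρ₀`, `m₀`: the discrete initial
values are the `L²`-orthogonal projection of `ρ₀` to `Q_h` and the piecewise linear interpolant of
`m₀`. -/
structure IsDiscreteSolution (P : ℝ → ℝ) (T ε : ℝ) (a γ : E → ℝ) (hb : V → ℝ → ℝ)
    (ρ₀ m₀ : E → ℝ → ℝ) (N : ℕ) (M : E → ℕ) (ρh mh : ℕ → E → ℝ → ℝ) : Prop where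
  memQ : ∀ n ≤ N, G.InQ M (ρh n)
  memR : ∀ n ≤ N, G.InR M (mh n)
  initρ : ∀ q, G.InQ M q → G.inner (ρh 0) q = G.inner ρ₀ q
  initm : ∀ e, ∀ i ≤ M e, mh 0 e (G.gridPoint M e i) = m₀ e (G.gridPoint M e i)
  mass : ∀ n < N, ∀ q, G.InQ M q →
    G.inner (fun e x => a e * ((ρh (n + 1) e x - ρh n e x) / (T / N))) q
      + G.inner (fun e => deriv (mh (n + 1) e)) q = 0
  momentum : ∀ n < N, ∀ r, G.InR M r →
    G.inner (fun e x => ε ^ 2 * ((discreteVelocity a (ρh (n + 1)) (mh (n + 1)) e x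
        - discreteVelocity a (ρh n) (mh n) e x) / (T / N))) r
      - G.inner (enthalpy P ε (ρh (n + 1)) (discreteVelocity a (ρh (n + 1)) (mh (n + 1))))
          (fun e => deriv (r e))
      + G.inner (fun e x => γ e * |discreteVelocity a (ρh (n + 1)) (mh (n + 1)) e x|
          * discreteVelocity a (ρh (n + 1)) (mh (n + 1)) e x) r
      = -∑ v ∈ G.boundary, ∑ e ∈ G.incident v,
          hb v ((n + 1 : ℕ) * (T / N)) * G.atVertex r e v * G.sign e v

/-- The discrete states are admissible: `2 ρ_min / 3 ≤ ρ_h ≤ 3 ρ_max / 2` and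
`|w_h| ≤ 3 w_max / 2` at all time steps. -/
def Admissible (a : E → ℝ) (ρmin ρmax wmax : ℝ) (N : ℕ) (ρh mh : ℕ → E → ℝ → ℝ) : Prop :=
  ∀ n ≤ N, ∀ e, ∀ᵐ x ∂(volume.restrict (Ioo 0 (G.len e))),
    2 * ρmin / 3 ≤ ρh n e x ∧ ρh n e x ≤ 3 * ρmax / 2 ∧
      |discreteVelocity a (ρh n) (mh n) e x| ≤ 3 * wmax / 2

/-- `(ρh, mh)` is a discrete admissible state solution for the initial values given by a classical
solution `(ρ, w)`. -/
def IsAdmissibleSolution (P : ℝ → ℝ) (T ε : ℝ) (a γ : E → ℝ) (hb : V → ℝ → ℝ)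
    (ρ w : E → ℝ → ℝ → ℝ) (ρmin ρmax wmax : ℝ) (N : ℕ) (M : E → ℕ)
    (ρh mh : ℕ → E → ℝ → ℝ) : Prop :=
  G.IsDiscreteSolution P T ε a γ hb (fun e => ρ e 0) (fluxAt a ρ w 0) N M ρh mh ∧
    G.Admissible a ρmin ρmax wmax N ρh mh

end PipeNetwork

end GasNet

set_option linter.unusedSectionVars false

namespace GasNet

/-! ### Pointwise inequalities for the energy density and the friction law -/

/-- Bounds for the pressure potential `P` on the density range `[r₀, r₁]`, together with the
subsonic condition for velocities bounded by `W`. -/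
structure PressureBounds (P : ℝ → ℝ) (r₀ r₁ W εm q₀ q₁ q₂ : ℝ) : Prop where
  r₀_pos : 0 < r₀
  W_pos : 0 < W
  εm_pos : 0 < εm
  q₀_pos : 0 < q₀
  q₁_pos : 0 < q₁
  q₂_pos : 0 < q₂
  hasDeriv : ∀ r ∈ Icc r₀ r₁, HasDerivAt P (deriv P r) r
  hasDeriv2 : ∀ r ∈ Icc r₀ r₁, HasDerivAt (deriv P) (deriv (deriv P) r) r
  lower : ∀ r ∈ Icc r₀ r₁, q₀ ≤ deriv (deriv P) r
  upper : ∀ r ∈ Icc r₀ r₁, deriv (deriv P) r ≤ q₁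
  lip : ∀ r ∈ Icc r₀ r₁, ∀ s ∈ Icc r₀ r₁,
    |deriv (deriv P) r - deriv (deriv P) s| ≤ q₂ * |r - s|
  subsonic : ∀ r ∈ Icc r₀ r₁, 16 * (εm ^ 2 * W ^ 2) ≤ 9 * (r * deriv (deriv P) r)

/-- The enthalpy as a function of density and velocity. -/
noncomputable def enth (P : ℝ → ℝ) (ε r w : ℝ) : ℝ := ε ^ 2 * w ^ 2 / 2 + deriv P r

/-- The quadratic form of second derivatives of `P(r) + ε² r w² / 2`. -/
noncomputable def hessForm (P : ℝ → ℝ) (ε r w x y : ℝ) : ℝ :=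
  deriv (deriv P) r * x ^ 2 + 2 * ε ^ 2 * w * x * y + ε ^ 2 * r * y ^ 2

/-- The relative energy density of `(r, w)` with respect to `(s, z)`. -/
noncomputable def relEnergy (P : ℝ → ℝ) (ε r w s z : ℝ) : ℝ :=
  P r - P s - deriv P s * (r - s)
    + ε ^ 2 * (r * (w - z) ^ 2 / 2 + z * (r - s) * (w - z))

lemma mul_abs_sub_mono (w z : ℝ) :
    (|w| + |z|) * (w - z) ^ 2 / 2 ≤ (|w| * w - |z| * z) * (w - z) := by
  have h1 := sq_abs w
  have h2 := sq_abs z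
  have h : (|w| * w - |z| * z) * (w - z) - (|w| + |z|) * (w - z) ^ 2 / 2
      = (|w| - |z|) ^ 2 * (|w| + |z|) / 2 := by
    linear_combination (|w| - |z|) / 2 * (h2 - h1)
  have : 0 ≤ (|w| - |z|) ^ 2 * (|w| + |z|) / 2 := by positivity
  linarith

lemma abs_mul_abs_sub_le (w z : ℝ) :
    |(|w| * w - |z| * z)| ≤ (|w| + |z|) * |w - z| := by
  have h : |w| * w - |z| * z = |w| * (w - z) + z * (|w| - |z|) := by ring
  rw [h]
  calc _ ≤ |(|w| * (w - z))| + |z * (|w| - |z|)| := abs_add_le _ _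
    _ = |w| * |w - z| + |z| * |(|w| - |z|)| := by rw [abs_mul, abs_mul, abs_abs]
    _ ≤ |w| * |w - z| + |z| * |w - z| := by
      gcongr |w| * |w - z| + |z| * ?_; exact abs_abs_sub_abs_le_abs_sub w z
    _ = _ := by ring

lemma abs_sub_cube_le (w z : ℝ) : |w - z| ^ 3 ≤ (|w| + |z|) * (w - z) ^ 2 := by
  have : |w - z| ≤ |w| + |z| := abs_sub w z
  calc |w - z| ^ 3 = |w - z| * (w - z) ^ 2 := by rw [← sq_abs (w - z)]; ring
    _ ≤ _ := by gcongr

lemma exists_second_order_taylor {φ φ' φ'' : ℝ → ℝ} (h1 : ∀ s ∈ Icc (0 : ℝ) 1, HasDerivAt φ (φ' s) s)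
    (h2 : ∀ s ∈ Icc (0 : ℝ) 1, HasDerivAt φ' (φ'' s) s) :
    ∃ s ∈ Ioo (0 : ℝ) 1, φ 1 - φ 0 - φ' 0 = φ'' s / 2 := by
  have hψ : ∀ s ∈ Icc (0 : ℝ) 1, HasDerivAt (fun t => φ t + φ' t * (1 - t)) (φ'' s * (1 - s)) s := by
    intro s hs
    have := (h1 s hs).add ((h2 s hs).mul ((hasDerivAt_id s).const_sub 1))
    convert! this using 1
    simp
  have hχ : ∀ s ∈ Icc (0 : ℝ) 1, HasDerivAt (fun t : ℝ => -(1 - t) ^ 2 / 2) (1 - s) s := by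
    intro s hs
    have := ((((hasDerivAt_id s).const_sub 1).pow 2).neg).div_const 2
    convert! this using 1
    simp
  obtain ⟨s, hs, h⟩ := exists_ratio_hasDerivAt_eq_ratio_slope
    (fun t => φ t + φ' t * (1 - t)) (fun s => φ'' s * (1 - s)) one_pos
    (fun s hs => (hψ s hs).continuousAt.continuousWithinAt)
    (fun s hs => hψ s (Ioo_subset_Icc_self hs))
    (fun t : ℝ => -(1 - t) ^ 2 / 2) (fun s => 1 - s)
    (fun s hs => (hχ s hs).continuousAt.continuousWithinAt)
    (fun s hs => hχ s (Ioo_subset_Icc_self hs))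
  refine ⟨s, hs, ?_⟩
  have h1s : (1 - s) ≠ 0 := by have := hs.2; intro h0; linarith
  field_simp at h ⊢
  norm_num at h
  linarith

namespace PressureBounds

variable {P : ℝ → ℝ} {r₀ r₁ W εm q₀ q₁ q₂ : ℝ}

lemma seg_mem {α β s t u : ℝ} (hs : s ∈ Icc α β) (ht : t ∈ Icc α β) (hu : u ∈ Icc (0 : ℝ) 1) :
    s + u * (t - s) ∈ Icc α β := by
  have := (convex_Icc α β).add_smul_sub_mem hs ht hu
  simpa using this

lemma seg_abs_le {c s t u : ℝ} (hs : |s| ≤ c) (ht : |t| ≤ c) (hu : u ∈ Icc (0 : ℝ) 1) :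
    |s + u * (t - s)| ≤ c := by
  rw [abs_le] at *
  exact seg_mem (α := -c) (β := c) hs ht hu

variable (H : PressureBounds P r₀ r₁ W εm q₀ q₁ q₂)
include H

lemma hessForm_ge {ε r w : ℝ} (hε : 0 ≤ ε) (hεm : ε ≤ εm) (hr : r ∈ Icc r₀ r₁) (hw : |w| ≤ W)
    (x y : ℝ) : (q₀ * x ^ 2 + ε ^ 2 * r₀ * y ^ 2) / 4 ≤ hessForm P ε r w x y := by
  have hA := H.lower r hr
  have hq := H.q₀_pos
  have hr0 := H.r₀_pos
  have hs := H.subsonic r hr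
  have hw2 : w ^ 2 ≤ W ^ 2 := by
    rw [← sq_abs]; gcongr
  have he2 : ε ^ 2 ≤ εm ^ 2 := by gcongr
  have hr1 := hr.1
  unfold hessForm
  set A := deriv (deriv P) r
  have hApos : 0 < A := lt_of_lt_of_le hq hA
  have key : 0 ≤ 3 / 4 * A * x ^ 2 + 2 * ε ^ 2 * w * x * y + 3 / 4 * (ε ^ 2 * r * y ^ 2) := by
    have h1 : ε ^ 2 * w ^ 2 ≤ εm ^ 2 * W ^ 2 := by gcongr
    have h2 : 16 * (ε ^ 2 * w ^ 2) ≤ 9 * (r * A) := by linarith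
    have h3 : 0 ≤ (ε * y) ^ 2 * (9 * (r * A) - 16 * (ε ^ 2 * w ^ 2)) :=
      mul_nonneg (sq_nonneg _) (by linarith)
    have h4 : 0 ≤ A * (3 / 4 * A * x ^ 2 + 2 * ε ^ 2 * w * x * y + 3 / 4 * (ε ^ 2 * r * y ^ 2)) := by
      nlinarith [sq_nonneg (3 * A * x + 4 * ε ^ 2 * w * y)]
    exact nonneg_of_mul_nonneg_right h4 hApos
  have h5 : q₀ * x ^ 2 ≤ A * x ^ 2 := by gcongr
  have h6 : ε ^ 2 * r₀ * y ^ 2 ≤ ε ^ 2 * r * y ^ 2 := by gcongr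
  linarith

lemma hessForm_nonneg {ε r w : ℝ} (hε : 0 ≤ ε) (hεm : ε ≤ εm) (hr : r ∈ Icc r₀ r₁) (hw : |w| ≤ W)
    (x y : ℝ) : 0 ≤ hessForm P ε r w x y := by
  refine le_trans ?_ (H.hessForm_ge hε hεm hr hw x y)
  have := H.q₀_pos
  have := H.r₀_pos
  positivity

lemma hessForm_le {ε r w : ℝ} (hr : r ∈ Icc r₀ r₁) (hw : |w| ≤ W) (hε : 0 ≤ ε) (hεm : ε ≤ εm)
    (x y : ℝ) : hessForm P ε r w x y ≤ (q₁ + εm ^ 2 * W + W + r₁) * (x ^ 2 + ε ^ 2 * y ^ 2) := by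
  have hA := H.upper r hr
  have hW := H.W_pos
  have hr0 := H.r₀_pos
  have hr1 : 0 < r₁ := lt_of_lt_of_le (hr0.trans_le hr.1) hr.2
  have he2 : ε ^ 2 ≤ εm ^ 2 := by gcongr
  have h1 : deriv (deriv P) r * x ^ 2 ≤ q₁ * x ^ 2 := by gcongr
  have h2 : ε ^ 2 * r * y ^ 2 ≤ ε ^ 2 * r₁ * y ^ 2 := by
    have := hr.2; gcongr
  have h3 : 2 * ε ^ 2 * w * x * y ≤ W * (εm ^ 2 * x ^ 2 + ε ^ 2 * y ^ 2) := by
    calc 2 * ε ^ 2 * w * x * y ≤ |2 * ε ^ 2 * w * x * y| := le_abs_self _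
      _ = ε ^ 2 * |w| * (2 * |x| * |y|) := by
        rw [abs_mul, abs_mul, abs_mul, abs_mul, abs_of_nonneg (sq_nonneg ε)]
        rw [abs_of_pos (two_pos : (0 : ℝ) < 2)]; ring
      _ ≤ ε ^ 2 * W * (x ^ 2 + y ^ 2) := by
        gcongr
        nlinarith [sq_nonneg (|x| - |y|), sq_abs x, sq_abs y]
      _ = W * (ε ^ 2 * x ^ 2 + ε ^ 2 * y ^ 2) := by ring
      _ ≤ _ := by gcongr
  unfold hessForm
  have hq := H.q₁_pos
  have e1 : 0 ≤ (q₁ + εm ^ 2 * W) * (ε ^ 2 * y ^ 2) := by positivity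
  have e2 : 0 ≤ (W + r₁) * x ^ 2 := by positivity
  nlinarith

lemma relEnergy_eq (ε : ℝ) {r w s z : ℝ} (hr : r ∈ Icc r₀ r₁) (hs : s ∈ Icc r₀ r₁) :
    ∃ u ∈ Ioo (0 : ℝ) 1, relEnergy P ε r w s z
      = hessForm P ε (s + u * (r - s)) (z + u * (w - z)) (r - s) (w - z) / 2 := by
  set φ : ℝ → ℝ := fun u => P (s + u * (r - s))
    + ε ^ 2 * ((s + u * (r - s)) * (z + u * (w - z)) ^ 2 / 2) with hφ
  set φ' : ℝ → ℝ := fun u => deriv P (s + u * (r - s)) * (r - s)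
    + ε ^ 2 * ((r - s) * (z + u * (w - z)) ^ 2 / 2
      + (s + u * (r - s)) * (z + u * (w - z)) * (w - z)) with hφ'
  have hl : ∀ (α β u : ℝ), HasDerivAt (fun u : ℝ => α + u * β) β u := by
    intro α β u
    simpa using ((hasDerivAt_id u).mul_const β).const_add α
  obtain ⟨u, hu, h⟩ := exists_second_order_taylor (φ := φ) (φ' := φ')
    (φ'' := fun u => hessForm P ε (s + u * (r - s)) (z + u * (w - z)) (r - s) (w - z))
    (by
      intro u hu
      have h1 := (H.hasDeriv _ (seg_mem hs hr hu)).comp u (hl s (r - s) u)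
      have h2 := ((((hl s (r - s) u).mul ((hl z (w - z) u).pow 2)).div_const 2).const_mul (ε ^ 2))
      convert! h1.add h2 using 1
      simp only [hφ', Pi.pow_apply]
      push_cast
      ring)
    (by
      intro u hu
      have h1 := ((H.hasDeriv2 _ (seg_mem hs hr hu)).comp u (hl s (r - s) u)).mul_const (r - s)
      have h2 := ((((hl z (w - z) u).pow 2).const_mul (r - s)).div_const 2)
      have h3 := ((hl s (r - s) u).mul (hl z (w - z) u)).mul_const (w - z)
      convert! h1.add ((h2.add h3).const_mul (ε ^ 2)) using 1
      simp only [hessForm]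
      norm_num
      ring)
  refine ⟨u, hu, ?_⟩
  rw [← h]
  simp only [hφ, hφ', relEnergy]
  norm_num
  ring

lemma relEnergy_ge {ε r w s z : ℝ} (hε : 0 ≤ ε) (hεm : ε ≤ εm) (hr : r ∈ Icc r₀ r₁)
    (hs : s ∈ Icc r₀ r₁) (hw : |w| ≤ W) (hz : |z| ≤ W) :
    (q₀ * (r - s) ^ 2 + ε ^ 2 * r₀ * (w - z) ^ 2) / 8 ≤ relEnergy P ε r w s z := by
  obtain ⟨u, hu, h⟩ := H.relEnergy_eq ε (w := w) (z := z) hr hs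
  have hu' := Ioo_subset_Icc_self hu
  have := H.hessForm_ge hε hεm (seg_mem hs hr hu') (seg_abs_le hz hw hu') (r - s) (w - z)
  linarith

lemma relEnergy_le {ε r w s z : ℝ} (hε : 0 ≤ ε) (hεm : ε ≤ εm) (hr : r ∈ Icc r₀ r₁)
    (hs : s ∈ Icc r₀ r₁) (hw : |w| ≤ W) (hz : |z| ≤ W) :
    relEnergy P ε r w s z
      ≤ (q₁ + εm ^ 2 * W + W + r₁) / 2 * ((r - s) ^ 2 + ε ^ 2 * (w - z) ^ 2) := by
  obtain ⟨u, hu, h⟩ := H.relEnergy_eq ε (w := w) (z := z) hr hs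
  have hu' := Ioo_subset_Icc_self hu
  have := H.hessForm_le (seg_mem hs hr hu') (seg_abs_le hz hw hu') hε hεm (r - s) (w - z)
  linarith

/-- Mean value theorem for the derivative of `P`. -/
lemma deriv_sub_eq {r s : ℝ} (hr : r ∈ Icc r₀ r₁) (hs : s ∈ Icc r₀ r₁) :
    ∃ u ∈ Icc (0 : ℝ) 1, deriv P r - deriv P s = deriv (deriv P) (s + u * (r - s)) * (r - s) := by
  have hl : ∀ u : ℝ, HasDerivAt (fun u : ℝ => s + u * (r - s)) (r - s) u := by
    intro u
    simpa using ((hasDerivAt_id u).mul_const (r - s)).const_add s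
  have hd : ∀ u ∈ Icc (0 : ℝ) 1, HasDerivAt (fun u => deriv P (s + u * (r - s)))
      (deriv (deriv P) (s + u * (r - s)) * (r - s)) u :=
    fun u hu => by
      have := (H.hasDeriv2 _ (seg_mem hs hr hu)).comp u (hl u)
      exact this
  obtain ⟨u, hu, h⟩ := exists_hasDerivAt_eq_slope _ _ (one_pos : (0 : ℝ) < 1)
    (fun u hu => (hd u hu).continuousAt.continuousWithinAt)
    (fun u hu => hd u (Ioo_subset_Icc_self hu))
  refine ⟨u, Ioo_subset_Icc_self hu, ?_⟩
  rw [h]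
  norm_num

lemma abs_deriv_sub_le {r s : ℝ} (hr : r ∈ Icc r₀ r₁) (hs : s ∈ Icc r₀ r₁) :
    |deriv P r - deriv P s| ≤ q₁ * |r - s| := by
  obtain ⟨u, hu, h⟩ := H.deriv_sub_eq hr hs
  have hm := seg_mem hs hr hu
  rw [h, abs_mul, abs_of_nonneg (H.q₀_pos.le.trans (H.lower _ hm))]
  gcongr
  exact H.upper _ hm

lemma mono {ε r w s z : ℝ} (hε : 0 ≤ ε) (hεm : ε ≤ εm) (hr : r ∈ Icc r₀ r₁)
    (hs : s ∈ Icc r₀ r₁) (hw : |w| ≤ W) (hz : |z| ≤ W) :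
    (q₀ * (r - s) ^ 2 + ε ^ 2 * r₀ * (w - z) ^ 2) / 4
      ≤ (enth P ε r w - enth P ε s z) * (r - s) + ε ^ 2 * (w - z) * (r * w - s * z) := by
  have h1 := H.relEnergy_ge hε hεm hr hs hw hz
  have h2 := H.relEnergy_ge hε hεm hs hr hz hw
  have h3 : relEnergy P ε r w s z + relEnergy P ε s z r w
    = (enth P ε r w - enth P ε s z) * (r - s) + ε ^ 2 * (w - z) * (r * w - s * z) := by
    unfold relEnergy enth; ring
  have h4 : (s - r) ^ 2 = (r - s) ^ 2 := by ring
  have h5 : (z - w) ^ 2 = (w - z) ^ 2 := by ring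
  rw [h4, h5] at h2
  linarith

lemma abs_enth_sub_le {ε r w s z : ℝ} (hr : r ∈ Icc r₀ r₁)
    (hs : s ∈ Icc r₀ r₁) (hw : |w| ≤ W) (hz : |z| ≤ W) :
    |enth P ε r w - enth P ε s z| ≤ q₁ * |r - s| + ε ^ 2 * W * |w - z| := by
  have h1 := H.abs_deriv_sub_le hr hs
  have h : enth P ε r w - enth P ε s z
    = (deriv P r - deriv P s) + ε ^ 2 * ((w + z) / 2) * (w - z) := by unfold enth; ring
  have hwz : |(w + z) / 2| ≤ W := by
    rw [abs_le] at *; constructor <;> linarith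
  rw [h]
  calc _ ≤ |deriv P r - deriv P s| + |ε ^ 2 * ((w + z) / 2) * (w - z)| := abs_add_le _ _
    _ ≤ _ := by
      rw [abs_mul, abs_mul, abs_of_nonneg (sq_nonneg ε)]
      gcongr

end PressureBounds

lemma mul_mul_le_of_abs {a b c A B C : ℝ} (ha : |a| ≤ A) (hb : |b| ≤ B) (hc : |c| ≤ C) :
    a * b * c ≤ A * B * C := by
  have h0 : 0 ≤ A := (abs_nonneg a).trans ha
  have h1 : 0 ≤ B := (abs_nonneg b).trans hb
  calc a * b * c ≤ |a * b * c| := le_abs_self _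
    _ = |a| * |b| * |c| := by rw [abs_mul, abs_mul]
    _ ≤ _ := by gcongr

lemma friction_mono {r₀ W r w s z : ℝ} (hr₀ : 0 < r₀) (hr : r₀ ≤ r) (hw : |w| ≤ W) (hz : |z| ≤ W) :
    r₀ / 4 * ((|w| + |z|) * (w - z) ^ 2) - 2 * W ^ 3 / r₀ * (r - s) ^ 2
      ≤ (|w| * w - |z| * z) * (r * w - s * z) := by
  have h1 := mul_abs_sub_mono w z
  have h2 := abs_mul_abs_sub_le w z
  set S := |w| + |z| with hS
  have hS0 : 0 ≤ S := by positivity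
  have hS2 : S ≤ 2 * W := by linarith
  have hW : 0 ≤ W := (abs_nonneg w).trans hw
  have h3 : (|w| * w - |z| * z) * (r * w - s * z)
    = r * ((|w| * w - |z| * z) * (w - z)) + (|w| * w - |z| * z) * z * (r - s) := by ring
  have h4 : -((|w| * w - |z| * z) * z * (r - s)) ≤ S * |w - z| * W * |r - s| := by
    have := mul_mul_le_of_abs (a := -(|w| * w - |z| * z)) (b := z) (c := r - s)
      (by rw [abs_neg]) hz le_rfl
    have e : |(|w| * w - |z| * z)| * W * |r - s| ≤ S * |w - z| * W * |r - s| := by gcongr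
    linarith
  have h5 : S * |w - z| * W * |r - s|
      ≤ r₀ / 4 * (S * (w - z) ^ 2) + S * (W ^ 2 / r₀ * (r - s) ^ 2) := by
    have e : 0 ≤ S * (r₀ / 4) * (|w - z| - 2 * W / r₀ * |r - s|) ^ 2 := by positivity
    have e2 : S * (r₀ / 4) * (|w - z| - 2 * W / r₀ * |r - s|) ^ 2
      = r₀ / 4 * (S * |w - z| ^ 2) - S * |w - z| * W * |r - s|
        + S * (W ^ 2 / r₀ * |r - s| ^ 2) := by
      field_simp
      ring
    rw [e2, sq_abs, sq_abs] at e
    linarith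
  have h6 : S * (W ^ 2 / r₀ * (r - s) ^ 2) ≤ (2 * W) * (W ^ 2 / r₀ * (r - s) ^ 2) := by
    gcongr
  have h7 : r₀ * (S * (w - z) ^ 2 / 2) ≤ r * ((|w| * w - |z| * z) * (w - z)) :=
    mul_le_mul hr h1 (by positivity) (hr₀.le.trans hr)
  have h8 : (2 * W) * (W ^ 2 / r₀ * (r - s) ^ 2) = 2 * W ^ 3 / r₀ * (r - s) ^ 2 := by ring
  rw [h3]
  linarith

lemma kinetic_remainder_le {a b x₀ x₁ y₀ y₁ o e d V : ℝ} (hds : |a| ≤ d) (hdz : |b| ≤ d)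
    (hx₀ : |x₀| ≤ V) (hx₁ : |x₁| ≤ V) (hy₀ : |y₀| ≤ V) (hy₁ : |y₁| ≤ V) (ho : |o| ≤ V)
    (he : |e| ≤ V) (hdV : d ≤ V) :
    b * x₁ * (y₁ - o) + b * x₀ * (o + b / 2) + a * y₁ * (y₁ / 2 - o) - b * y₁ * e
      + (a * y₀ * o + b * y₀ * e + a * y₀ * b)
      - a * b * o - b * b * (e / 2) - a * b * (b / 2) ≤ 12 * d * V ^ 2 := by
  have hV := (abs_nonneg _).trans hx₀
  have k1 : b * x₁ * (y₁ - o) ≤ d * V * (2 * V) :=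
    mul_mul_le_of_abs hdz (by linarith) ((abs_sub _ _).trans (by linarith))
  have k2 : b * x₀ * (o + b / 2) ≤ d * V * (2 * V) := by
    refine mul_mul_le_of_abs hdz (by linarith) ((abs_add_le _ _).trans ?_)
    rw [abs_div, abs_of_pos (two_pos : (0 : ℝ) < 2)]; linarith
  have k3 : a * y₁ * (y₁ / 2 - o) ≤ d * V * (2 * V) := by
    refine mul_mul_le_of_abs hds (by linarith) ((abs_sub _ _).trans ?_)
    rw [abs_div, abs_of_pos (two_pos : (0 : ℝ) < 2)]; linarith
  have k4 : (-b) * y₁ * e ≤ d * V * V :=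
    mul_mul_le_of_abs (by rwa [abs_neg]) (by linarith) (by linarith)
  have k5 : a * y₀ * o ≤ d * V * V := mul_mul_le_of_abs hds (by linarith) (by linarith)
  have k6 : b * y₀ * e ≤ d * V * V := mul_mul_le_of_abs hdz (by linarith) (by linarith)
  have k7 : a * y₀ * b ≤ d * V * V := mul_mul_le_of_abs hds (by linarith) (by linarith)
  have k8 : (-a) * b * o ≤ d * V * V :=
    mul_mul_le_of_abs (by rwa [abs_neg]) (by linarith) (by linarith)
  have k9 : (-b) * b * (e / 2) ≤ d * V * (V / 2) := by
    refine mul_mul_le_of_abs (by rwa [abs_neg]) (by linarith) ?_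
    rw [abs_div, abs_of_pos (two_pos : (0 : ℝ) < 2)]; linarith
  have k10 : (-a) * b * (b / 2) ≤ d * V * (V / 2) := by
    refine mul_mul_le_of_abs (by rwa [abs_neg]) (by linarith) ?_
    rw [abs_div, abs_of_pos (two_pos : (0 : ℝ) < 2)]; linarith
  have hd : 0 ≤ d := (abs_nonneg _).trans hds
  have : 0 ≤ d * V ^ 2 := by positivity
  linarith

lemma remainder_sum_le {x₀ x₁ y₀ y₁ d ε εm q₂ : ℝ} (hd : 0 ≤ d) (hε : 0 ≤ ε) (hεm : ε ≤ εm)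
    (hq2 : 0 ≤ q₂) :
    d * (2 * q₂ * (|x₀| + |x₁| + d) ^ 2)
      + ε ^ 2 * (12 * d * (|x₀| + |x₁| + |y₀| + |y₁| + 2 * d) ^ 2)
      ≤ (6 * q₂ + 240 * εm ^ 2 + 60) * d * (x₁ ^ 2 + x₀ ^ 2
          + ε ^ 2 * (y₁ ^ 2 + y₀ ^ 2) + d ^ 2) := by
  have hS2 : (|x₀| + |x₁| + d) ^ 2 ≤ 3 * (x₀ ^ 2 + x₁ ^ 2 + d ^ 2) := by
    rw [← sq_abs x₀, ← sq_abs x₁]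
    linarith [sq_nonneg (|x₀| - |x₁|), sq_nonneg (|x₀| - d), sq_nonneg (|x₁| - d)]
  have hV2 : (|x₀| + |x₁| + |y₀| + |y₁| + 2 * d) ^ 2 ≤ 5 * (x₀ ^ 2 + x₁ ^ 2 + y₀ ^ 2 + y₁ ^ 2 + (2 * d) ^ 2) := by
    rw [← sq_abs x₀, ← sq_abs x₁, ← sq_abs y₀, ← sq_abs y₁]
    linarith [sq_nonneg (|x₀| - |x₁|), sq_nonneg (|x₀| - |y₀|), sq_nonneg (|x₀| - |y₁|),
      sq_nonneg (|x₀| - 2 * d), sq_nonneg (|x₁| - |y₀|), sq_nonneg (|x₁| - |y₁|),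
      sq_nonneg (|x₁| - 2 * d), sq_nonneg (|y₀| - |y₁|), sq_nonneg (|y₀| - 2 * d),
      sq_nonneg (|y₁| - 2 * d)]
  have he2 : ε ^ 2 ≤ εm ^ 2 := by gcongr
  have fin1 : d * (2 * q₂ * (|x₀| + |x₁| + d) ^ 2) ≤ d * (2 * q₂ * (3 * (x₀ ^ 2 + x₁ ^ 2 + d ^ 2))) := by gcongr
  have fin2 : ε ^ 2 * (12 * d * (|x₀| + |x₁| + |y₀| + |y₁| + 2 * d) ^ 2) ≤ ε ^ 2 * (12 * d *
      (5 * (x₀ ^ 2 + x₁ ^ 2 + y₀ ^ 2 + y₁ ^ 2 + (2 * d) ^ 2))) := by gcongr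
  have fin3 : ε ^ 2 * (d * (x₀ ^ 2 + x₁ ^ 2 + (2 * d) ^ 2))
      ≤ εm ^ 2 * (d * (x₀ ^ 2 + x₁ ^ 2 + (2 * d) ^ 2)) := by gcongr
  have p1 : 0 ≤ d * (x₀ ^ 2 + x₁ ^ 2) := by positivity
  have p2 : 0 ≤ εm ^ 2 * (d * (x₀ ^ 2 + x₁ ^ 2)) := by positivity
  have p3 : 0 ≤ d * (ε ^ 2 * (y₀ ^ 2 + y₁ ^ 2)) := by positivity
  have p4 : 0 ≤ (q₂ + 40 * εm ^ 2) * (d * (ε ^ 2 * (y₀ ^ 2 + y₁ ^ 2))) := by positivity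
  have p5 : 0 ≤ d * d ^ 2 := by positivity
  have g1 : ε ^ 2 * (12 * d * (5 * (x₀ ^ 2 + x₁ ^ 2 + y₀ ^ 2 + y₁ ^ 2 + (2 * d) ^ 2)))
      = 60 * (ε ^ 2 * (d * (x₀ ^ 2 + x₁ ^ 2 + (2 * d) ^ 2))) + 60 * (d * (ε ^ 2 * (y₀ ^ 2 + y₁ ^ 2))) := by
    ring
  have g2 : 60 * (εm ^ 2 * (d * (x₀ ^ 2 + x₁ ^ 2 + (2 * d) ^ 2)))
      = 60 * (εm ^ 2 * (d * (x₀ ^ 2 + x₁ ^ 2))) + 240 * (εm ^ 2 * (d * d ^ 2)) := by ring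
  have g3 : (6 * q₂ + 240 * εm ^ 2 + 60) * d * (x₁ ^ 2 + x₀ ^ 2 + ε ^ 2 * (y₁ ^ 2 + y₀ ^ 2) + d ^ 2)
      = d * (2 * q₂ * (3 * (x₀ ^ 2 + x₁ ^ 2 + d ^ 2))) + 240 * (εm ^ 2 * (d * (x₀ ^ 2 + x₁ ^ 2)))
        + 240 * (εm ^ 2 * (d * d ^ 2)) + 60 * (d * (ε ^ 2 * (y₀ ^ 2 + y₁ ^ 2)))
        + (6 * ((q₂ + 40 * εm ^ 2) * (d * (ε ^ 2 * (y₀ ^ 2 + y₁ ^ 2))))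
        + 60 * (d * (x₀ ^ 2 + x₁ ^ 2)) + 60 * (d * d ^ 2)) := by ring
  linarith

namespace PressureBounds

variable {P : ℝ → ℝ} {r₀ r₁ W εm q₀ q₁ q₂ : ℝ} (H : PressureBounds P r₀ r₁ W εm q₀ q₁ q₂)
include H

/-- Discrete time evolution of the relative energy. -/
lemma relEnergy_step {ε r w s z r' w' s' z' d : ℝ} (hε : 0 ≤ ε) (hεm : ε ≤ εm)
    (hr : r ∈ Icc r₀ r₁) (hs : s ∈ Icc r₀ r₁) (hr' : r' ∈ Icc r₀ r₁) (hs' : s' ∈ Icc r₀ r₁)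
    (hw : |w| ≤ W) (hw' : |w'| ≤ W)
    (hds : |s - s'| ≤ d) (hdz : |z - z'| ≤ d) :
    relEnergy P ε r w s z - relEnergy P ε r' w' s' z'
      ≤ (enth P ε r w - enth P ε s z) * ((r - r') - (s - s'))
        + ε ^ 2 * (r * w - s * z) * ((w - w') - (z - z'))
        + (6 * q₂ + 240 * εm ^ 2 + 60) * d * ((r - s) ^ 2 + (r' - s') ^ 2
          + ε ^ 2 * ((w - z) ^ 2 + (w' - z') ^ 2) + d ^ 2) := by
  have hd : 0 ≤ d := (abs_nonneg _).trans hds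
  have hq2 := H.q₂_pos
  obtain ⟨u, hu, e1⟩ := H.relEnergy_eq ε (w := w') (z := w) hr' hr
  obtain ⟨v, hv, e2⟩ := H.relEnergy_eq 0 (w := z') (z := z) hs' hs
  obtain ⟨u1, hu1, e3⟩ := H.deriv_sub_eq hr hs
  obtain ⟨u2, hu2, e4⟩ := H.deriv_sub_eq hs hs'
  have hu' := Ioo_subset_Icc_self hu
  have hv' := Ioo_subset_Icc_self hv
  have mρ := seg_mem hr hr' hu'
  have mv := seg_mem hs hs' hv'
  have m1 := seg_mem hs hr hu1
  have m2 := seg_mem hs' hs hu2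
  have mϖ := seg_abs_le hw hw' hu'
  set ρ := r + u * (r' - r) with hρ
  set ϖ := w + u * (w' - w) with hϖ
  have hH := H.hessForm_nonneg hε hεm mρ mϖ ((r - r') - (s - s')) ((w - w') - (z - z'))
  set a := s - s' with ha
  set b := z - z' with hb
  set x₁ := r - s with hx₁
  set x₀ := r' - s' with hx₀
  set y₁ := w - z with hy₁
  set y₀ := w' - z' with hy₀
  set S := |x₀| + |x₁| + d with hS
  set V := |x₀| + |x₁| + |y₀| + |y₁| + 2 * d with hV
  set A := deriv (deriv P) ρ with hA
  set B := deriv (deriv P) (s + v * (s' - s)) with hB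
  set D₁ := deriv (deriv P) (s + u1 * (r - s)) with hD₁
  set D₂ := deriv (deriv P) (s' + u2 * (s - s')) with hD₂
  have key : relEnergy P ε r w s z - relEnergy P ε r' w' s' z'
      - (enth P ε r w - enth P ε s z) * ((r - r') - (s - s'))
        - ε ^ 2 * (r * w - s * z) * ((w - w') - (z - z'))
      = - hessForm P ε ρ ϖ ((r - r') - (s - s')) ((w - w') - (z - z')) / 2
        + (a * x₁ * (D₁ - A) + a * x₀ * (A - D₂) + a * (a / 2) * (B - A))
        + ε ^ 2 * (b * x₁ * (y₁ - (ϖ - z)) + b * x₀ * ((ϖ - z) + b / 2)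
          + a * y₁ * (y₁ / 2 - (ϖ - z)) - b * y₁ * (ρ - s)
          + (a * y₀ * (ϖ - z) + b * y₀ * (ρ - s) + a * y₀ * b)
          - a * b * (ϖ - z) - b * b * ((ρ - s) / 2) - a * b * (b / 2)) := by
    have e1' : relEnergy P ε r' w' r w = hessForm P ε ρ ϖ (r' - r) (w' - w) / 2 := e1
    have e2' : relEnergy P 0 s' z' s z = B * (s' - s) ^ 2 / 2 := by
      rw [e2, hB]; unfold hessForm; ring
    unfold hessForm at e1' ⊢
    rw [← hA] at e1' ⊢
    unfold relEnergy at e1' e2' ⊢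
    unfold enth
    simp only [ha, hb, hx₁, hx₀, hy₁, hy₀]
    linear_combination (-1 : ℝ) * e1' + e2' + (s - s') * e3 - (r' - s') * e4
  -- bounds for the single terms
  have hu0 := hu'.1
  have hu1' := hu'.2
  have bϖ : |ϖ - z| ≤ |y₀| + |y₁| + d := by
    have : ϖ - z = (1 - u) * y₁ + u * (y₀ - b) := by simp only [hϖ, hy₁, hy₀, hb]; ring
    rw [this]
    calc _ ≤ |(1 - u) * y₁| + |u * (y₀ - b)| := abs_add_le _ _
      _ = (1 - u) * |y₁| + u * |y₀ - b| := by
        rw [abs_mul, abs_mul, abs_of_nonneg hu0, abs_of_nonneg (by linarith : 0 ≤ 1 - u)]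
      _ ≤ 1 * |y₁| + 1 * (|y₀| + |b|) := by
        gcongr
        · linarith
        · exact abs_sub _ _
      _ ≤ _ := by linarith
  have bρ : |ρ - s| ≤ S := by
    have : ρ - s = (1 - u) * x₁ + u * (x₀ - a) := by simp only [hρ, hx₁, hx₀, ha]; ring
    rw [this]
    calc _ ≤ |(1 - u) * x₁| + |u * (x₀ - a)| := abs_add_le _ _
      _ = (1 - u) * |x₁| + u * |x₀ - a| := by
        rw [abs_mul, abs_mul, abs_of_nonneg hu0, abs_of_nonneg (by linarith : 0 ≤ 1 - u)]
      _ ≤ 1 * |x₁| + 1 * (|x₀| + |a|) := by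
        gcongr
        · linarith
        · exact abs_sub _ _
      _ ≤ _ := by linarith
  have nx₀ := abs_nonneg x₀
  have nx₁ := abs_nonneg x₁
  have ny₀ := abs_nonneg y₀
  have ny₁ := abs_nonneg y₁
  have hS0 : 0 ≤ S := by positivity
  have hV0 : 0 ≤ V := by positivity
  have m1' : |s + u1 * (r - s) - s| ≤ S := by
    rw [add_sub_cancel_left, abs_mul, abs_of_nonneg hu1.1]
    have : u1 * |r - s| ≤ 1 * |r - s| := by gcongr; exact hu1.2
    linarith
  have m2' : |s' + u2 * (s - s') - s| ≤ S := by
    have : s' + u2 * (s - s') - s = -((1 - u2) * a) := by simp only [ha]; ring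
    rw [this, abs_neg, abs_mul, abs_of_nonneg (by linarith [hu2.2] : 0 ≤ 1 - u2)]
    have : (1 - u2) * |a| ≤ 1 * |a| := by gcongr; linarith [hu2.1]
    linarith
  have mv2 : |s + v * (s' - s) - s| ≤ S := by
    have : s + v * (s' - s) - s = -(v * a) := by simp only [ha]; ring
    rw [this, abs_neg, abs_mul, abs_of_nonneg hv'.1]
    have : v * |a| ≤ 1 * |a| := by gcongr; exact hv'.2
    linarith
  have lipb : ∀ {p q c : ℝ}, p ∈ Icc r₀ r₁ → q ∈ Icc r₀ r₁ → |p - s| ≤ S → |q - s| ≤ S →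
      |c| ≤ S → a * c * (deriv (deriv P) p - deriv (deriv P) q) ≤ d * |c| * (2 * q₂ * S) := by
    intro p q c hp hq h1 h2 hc
    refine mul_mul_le_of_abs hds le_rfl ?_
    refine (H.lip p hp q hq).trans ?_
    have : |p - q| ≤ 2 * S := by
      have : p - q = (p - s) - (q - s) := by ring
      rw [this]; exact (abs_sub _ _).trans (by linarith)
    calc q₂ * |p - q| ≤ q₂ * (2 * S) := by gcongr
      _ = _ := by ring
  have t1 := lipb (c := x₁) m1 mρ m1' bρ (by linarith)
  have t2 := lipb (c := x₀) mρ m2 bρ m2' (by linarith)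
  have hah : |a / 2| ≤ d / 2 := by
    rw [abs_div, abs_of_pos (two_pos : (0 : ℝ) < 2)]; linarith
  have t3 := lipb (c := a / 2) mv mρ mv2 bρ (by linarith)
  have tP : a * x₁ * (D₁ - A) + a * x₀ * (A - D₂) + a * (a / 2) * (B - A)
      ≤ d * (2 * q₂ * S ^ 2) := by
    have e : d * |a / 2| * (2 * q₂ * S) ≤ d * d * (2 * q₂ * S) := by gcongr; linarith
    have e' : d * (2 * q₂ * S ^ 2) = d * |x₁| * (2 * q₂ * S) + d * |x₀| * (2 * q₂ * S)
      + d * d * (2 * q₂ * S) := by rw [hS]; ring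
    linarith
  have tK := kinetic_remainder_le (x₀ := x₀) (x₁ := x₁) (y₀ := y₀) (y₁ := y₁) (V := V) hds hdz
    (by linarith) (by linarith) (by linarith) (by linarith) (bϖ.trans (by linarith))
    (bρ.trans (by linarith)) (by linarith)
  have tK' := mul_le_mul_of_nonneg_left tK (sq_nonneg ε)
  have hfin := remainder_sum_le (x₀ := x₀) (x₁ := x₁) (y₀ := y₀) (y₁ := y₁) hd hε hεm hq2.le
  linarith

end PressureBounds

lemma abs_flux_sub_le {W r₁ r w s z : ℝ} (hr0 : 0 ≤ r) (hr : r ≤ r₁) (hz : |z| ≤ W) :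
    |r * w - s * z| ≤ r₁ * |w - z| + W * |r - s| := by
  have : r * w - s * z = r * (w - z) + z * (r - s) := by ring
  rw [this]
  calc _ ≤ |r * (w - z)| + |z * (r - s)| := abs_add_le _ _
    _ = r * |w - z| + |z| * |r - s| := by rw [abs_mul, abs_mul, abs_of_nonneg hr0]
    _ ≤ _ := by gcongr

lemma mul_le_half_sq_add (a b : ℝ) : a * b ≤ (a ^ 2 + b ^ 2) / 2 := by
  linarith [sq_nonneg (a - b)]

/-- The squared distance of two states, with the weight `ε²` for the velocity. -/
def distSq (ε r w s z : ℝ) : ℝ := (r - s) ^ 2 + ε ^ 2 * (w - z) ^ 2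

lemma distSq_nonneg (ε r w s z : ℝ) : 0 ≤ distSq ε r w s z := by unfold distSq; positivity

/-- The density of the error equation, tested with the differences of enthalpies and fluxes. -/
noncomputable def errorDensity (P : ℝ → ℝ) (ε a γ Δ r w s z r' w' s' z' y α β : ℝ) : ℝ :=
  a * ((r - r') - (s - s')) * (enth P ε r w - enth P ε s z)
    + ε ^ 2 * ((w - w') - (z - z')) * (a * r * w - a * s * z + y)
    + Δ * (γ * (|w| * w - |z| * z) * (a * r * w - a * s * z + y))
    + Δ * (a * α * (enth P ε r w - enth P ε s z))
    + Δ * (ε ^ 2 * β * (a * r * w - a * s * z + y))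

/-- The density of the modified relative energy. -/
noncomputable def energyDensity (P : ℝ → ℝ) (ε a r w s z y : ℝ) : ℝ :=
  a * relEnergy P ε r w s z + ε ^ 2 * (w - z) * y

/-- The density of the dissipation caused by friction. -/
def dissDensity (w z : ℝ) : ℝ := (|w| + |z|) * (w - z) ^ 2

lemma dissDensity_nonneg (w z : ℝ) : 0 ≤ dissDensity w z := by unfold dissDensity; positivity

namespace PressureBounds

variable {P : ℝ → ℝ} {r₀ r₁ W εm q₀ q₁ q₂ : ℝ}

lemma friction_lower {r₀ W amin amax γmin γmax : ℝ} (hr₀ : 0 < r₀) (hW : 0 < W)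
    (hamin : 0 < amin) (hγmin : 0 < γmin) {a γ r w s z y : ℝ}
    (ha : a ∈ Icc amin amax) (hγ : γ ∈ Icc γmin γmax)
    (hr : r₀ ≤ r) (hw : |w| ≤ W) (hz : |z| ≤ W) :
    γmin * amin * r₀ / 8 * dissDensity w z
      ≤ γ * (|w| * w - |z| * z) * (a * r * w - a * s * z + y)
        + (γmax * amax * (2 * W ^ 3 / r₀)) * (r - s) ^ 2
        + γmax ^ 2 * W / (γmin * amin * r₀ / 4) * y ^ 2 := by
  set c := γmin * amin * r₀ / 8 with hc
  have hc0 : 0 < c := by positivity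
  have h1 := friction_mono (s := s) hr₀ hr hw hz
  have h2 := abs_mul_abs_sub_le w z
  unfold dissDensity
  set S := |w| + |z| with hS
  have hS0 : 0 ≤ S := by positivity
  have hS2 : S ≤ 2 * W := by linarith
  have ha0 : 0 < a := hamin.trans_le ha.1
  have hγ0 : 0 < γ := hγmin.trans_le hγ.1
  have hγm : 0 < γmax := hγ0.trans_le hγ.2
  have ham : 0 < amax := ha0.trans_le ha.2
  have h3 := mul_le_mul_of_nonneg_left h1 (mul_pos hγ0 ha0).le
  have h4 : γmin * amin * (r₀ / 4 * (S * (w - z) ^ 2)) ≤ γ * a * (r₀ / 4 * (S * (w - z) ^ 2)) := by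
    gcongr
    · exact hγ.1
    · exact ha.1
  have h5 : γ * a * (2 * W ^ 3 / r₀ * (r - s) ^ 2) ≤ γmax * amax * (2 * W ^ 3 / r₀ * (r - s) ^ 2) := by
    gcongr
    · exact hγ.2
    · exact ha.2
  have h6 : -(γ * (|w| * w - |z| * z) * y) ≤ γmax * (S * |w - z|) * |y| := by
    have := mul_mul_le_of_abs (a := -γ) (b := (|w| * w - |z| * z)) (c := y) (A := γmax)
      (by rw [abs_neg, abs_of_pos hγ0]; exact hγ.2) h2 le_rfl
    linarith
  have h7 : γmax * (S * |w - z|) * |y| ≤ c * (S * (w - z) ^ 2) + γmax ^ 2 * W / (2 * c) * y ^ 2 := by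
    have e1 : 0 ≤ S * (c * (|w - z| - γmax / (2 * c) * |y|) ^ 2) := by positivity
    have e2 : S * (c * (|w - z| - γmax / (2 * c) * |y|) ^ 2)
      = c * (S * |w - z| ^ 2) - γmax * (S * |w - z|) * |y| + S * (γmax ^ 2 / (4 * c) * |y| ^ 2) := by
      field_simp
      ring
    have e3 : S * (γmax ^ 2 / (4 * c) * |y| ^ 2) ≤ (2 * W) * (γmax ^ 2 / (4 * c) * |y| ^ 2) := by
      gcongr
    have e4 : (2 * W) * (γmax ^ 2 / (4 * c) * |y| ^ 2) = γmax ^ 2 * W / (2 * c) * |y| ^ 2 := by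
      field_simp
      ring
    rw [e2, sq_abs] at e1
    rw [sq_abs] at *
    linarith
  have h8 : γmin * amin * r₀ / 4 = 2 * c := by rw [hc]; ring
  have h9 : γ * (|w| * w - |z| * z) * (a * r * w - a * s * z + y)
    = γ * a * ((|w| * w - |z| * z) * (r * w - s * z)) + γ * (|w| * w - |z| * z) * y := by ring
  have h10 : γmin * amin * (r₀ / 4 * (S * (w - z) ^ 2)) = 2 * (c * (S * (w - z) ^ 2)) := by
    rw [hc]; ring
  rw [h8, h9]
  linarith

variable (H : PressureBounds P r₀ r₁ W εm q₀ q₁ q₂)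
include H

/-- The one-step inequality for the modified relative energy. -/
lemma exists_step_inequality {amin amax γmin γmax L : ℝ} (hamin : 0 < amin)
    (hamm : amin ≤ amax) (hγmin : 0 < γmin) (hγmm : γmin ≤ γmax) (hL : 0 < L) :
    ∃ c C : ℝ, 0 < c ∧ 0 < C ∧ ∀ ε a γ Δ r w s z r' w' s' z' y y' η α β : ℝ,
      0 ≤ ε → ε ≤ εm → a ∈ Icc amin amax → γ ∈ Icc γmin γmax → 0 < Δ →
      r ∈ Icc r₀ r₁ → s ∈ Icc r₀ r₁ → r' ∈ Icc r₀ r₁ → s' ∈ Icc r₀ r₁ →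
      |w| ≤ W → |z| ≤ W → |w'| ≤ W → |z'| ≤ W →
      |s - s'| ≤ L * Δ → |z - z'| ≤ L * Δ → y - y' = Δ * η →
      energyDensity P ε a r w s z y - energyDensity P ε a r' w' s' z' y'
        + c * (Δ * dissDensity w z)
      ≤ errorDensity P ε a γ Δ r w s z r' w' s' z' y α β
        + C * (Δ * (distSq ε r w s z + distSq ε r' w' s' z'
          + (Δ ^ 2 + α ^ 2 + β ^ 2 + y ^ 2 + η ^ 2))) := by
  have hr₀ := H.r₀_pos
  have hW := H.W_pos
  have hq2 := H.q₂_pos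
  have hq1 := H.q₁_pos
  have ham : 0 < amax := hamin.trans_le hamm
  have hγm : 0 < γmax := hγmin.trans_le hγmm
  set C1 := amax * ((6 * q₂ + 240 * εm ^ 2 + 60) * L * (1 + L ^ 2)) with hC1
  set C3 := γmax * amax * (2 * W ^ 3 / r₀) + γmax ^ 2 * W / (γmin * amin * r₀ / 4) with hC3
  set C4 := amax * (1 + q₁ ^ 2 + εm ^ 2 * W ^ 2) with hC4
  set C5 := 2 * εm ^ 2 + amax ^ 2 * r₁ ^ 2 + εm ^ 2 * (amax ^ 2 * W ^ 2) + εm ^ 2 with hC5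
  refine ⟨γmin * amin * r₀ / 8, C1 + (1 + εm ^ 2) + C3 + C4 + C5, by positivity, by positivity, ?_⟩
  intro ε a γ Δ r w s z r' w' s' z' y y' η α β hε hεm ha hγ hΔ hr hs hr' hs' hw hz hw' hz' hds hdz hη
  have ha0 : 0 < a := hamin.trans_le ha.1
  have he2 : ε ^ 2 ≤ εm ^ 2 := by gcongr
  have hr1 : 0 < r₁ := hr₀.trans_le (hr.1.trans hr.2)
  -- the relative energy
  have s1 := mul_le_mul_of_nonneg_left
    (H.relEnergy_step hε hεm hr hs hr' hs' hw hw' hds hdz) ha0.le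
  set D := distSq ε r w s z with hD
  set D' := distSq ε r' w' s' z' with hD'
  have hD0 : 0 ≤ D := distSq_nonneg _ _ _ _ _
  have hD'0 : 0 ≤ D' := distSq_nonneg _ _ _ _ _
  set X := D + D' + (Δ ^ 2 + α ^ 2 + β ^ 2 + y ^ 2 + η ^ 2) with hX
  have b1 : a * ((6 * q₂ + 240 * εm ^ 2 + 60) * (L * Δ) * ((r - s) ^ 2 + (r' - s') ^ 2
      + ε ^ 2 * ((w - z) ^ 2 + (w' - z') ^ 2) + (L * Δ) ^ 2)) ≤ Δ * (C1 * X) := by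
    have e : (r - s) ^ 2 + (r' - s') ^ 2 + ε ^ 2 * ((w - z) ^ 2 + (w' - z') ^ 2) + (L * Δ) ^ 2
        ≤ (1 + L ^ 2) * X := by
      have e1 : (r - s) ^ 2 + (r' - s') ^ 2 + ε ^ 2 * ((w - z) ^ 2 + (w' - z') ^ 2) = D + D' := by
        simp only [hD, hD', distSq]; ring
      have e2 : 0 ≤ L ^ 2 * (D + D') := by positivity
      have e3 : 0 ≤ (1 + L ^ 2) * (α ^ 2 + β ^ 2 + y ^ 2 + η ^ 2) := by positivity
      rw [e1, hX]
      linarith [sq_nonneg Δ]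
    calc _ ≤ amax * ((6 * q₂ + 240 * εm ^ 2 + 60) * (L * Δ) * ((1 + L ^ 2) * X)) := by
          gcongr
          exact ha.2
      _ = _ := by rw [hC1]; ring
  have hDx : (r - s) ^ 2 + ε ^ 2 * (w - z) ^ 2 = D := rfl
  have hDx' : (r' - s') ^ 2 + ε ^ 2 * (w' - z') ^ 2 = D' := rfl
  have px := sq_nonneg (r - s)
  have px' := sq_nonneg (r' - s')
  have pe : 0 ≤ ε ^ 2 * (w - z) ^ 2 := by positivity
  have pe' : 0 ≤ ε ^ 2 * (w' - z') ^ 2 := by positivity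
  have pα := sq_nonneg α
  have pβ := sq_nonneg β
  have py := sq_nonneg y
  have pη := sq_nonneg η
  have pΔ := sq_nonneg Δ
  -- the correction by the interpolation error
  have b2 : ε ^ 2 * (w' - z') * (Δ * η) ≤ Δ * ((1 + εm ^ 2) * X) := by
    have e1 : ε ^ 2 * (w' - z') * η ≤ ε ^ 2 * ((w' - z') ^ 2 + η ^ 2) / 2 := by
      have := mul_le_mul_of_nonneg_left (mul_le_half_sq_add (w' - z') η) (sq_nonneg ε)
      linarith
    have e2 : ε ^ 2 * η ^ 2 ≤ εm ^ 2 * η ^ 2 := by gcongr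
    have e3 : 0 ≤ εm ^ 2 * (D + D' + (Δ ^ 2 + α ^ 2 + β ^ 2 + y ^ 2)) := by positivity
    have e4 : 0 ≤ εm ^ 2 * η ^ 2 := by positivity
    have e5 : ε ^ 2 * (w' - z') * η ≤ (1 + εm ^ 2) * X := by rw [hX]; linarith
    calc _ = Δ * (ε ^ 2 * (w' - z') * η) := by ring
      _ ≤ _ := by gcongr
  -- friction
  have b3 := friction_lower (s := s) (y := y) hr₀ hW hamin hγmin ha hγ hr.1 hw hz
  have b3' : (γmax * amax * (2 * W ^ 3 / r₀)) * (r - s) ^ 2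
        + γmax ^ 2 * W / (γmin * amin * r₀ / 4) * y ^ 2 ≤ C3 * X := by
    have e1 : (r - s) ^ 2 ≤ X := by rw [hX]; linarith
    have e2 : y ^ 2 ≤ X := by rw [hX]; linarith
    rw [hC3, add_mul]
    gcongr
  -- consistency error of the mass balance
  have b4 : -(a * α * (enth P ε r w - enth P ε s z)) ≤ C4 * X := by
    have e1 := H.abs_enth_sub_le (ε := ε) hr hs hw hz
    have e2 := mul_mul_le_of_abs (a := -a) (b := α) (A := amax)
      (by rw [abs_neg, abs_of_pos ha0]; exact ha.2) le_rfl e1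
    have e3 : |α| * (q₁ * |r - s| + ε ^ 2 * W * |w - z|)
        ≤ α ^ 2 + (q₁ ^ 2 * (r - s) ^ 2 + ε ^ 2 * W ^ 2 * (ε ^ 2 * (w - z) ^ 2)) / 2 := by
      have f1 := mul_le_half_sq_add |α| (q₁ * |r - s|)
      have f2 := mul_le_half_sq_add |α| (ε ^ 2 * W * |w - z|)
      rw [mul_pow, sq_abs, sq_abs] at f1
      have f3 : (ε ^ 2 * W * |w - z|) ^ 2 = ε ^ 2 * W ^ 2 * (ε ^ 2 * (w - z) ^ 2) := by
        rw [← sq_abs (w - z)]; ring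
      rw [f3, sq_abs] at f2
      linarith
    have e4 : ε ^ 2 * W ^ 2 * (ε ^ 2 * (w - z) ^ 2) ≤ εm ^ 2 * W ^ 2 * (ε ^ 2 * (w - z) ^ 2) := by
      gcongr
    have e5 : α ^ 2 + (q₁ ^ 2 * (r - s) ^ 2 + ε ^ 2 * W ^ 2 * (ε ^ 2 * (w - z) ^ 2)) / 2
        ≤ (1 + q₁ ^ 2 + εm ^ 2 * W ^ 2) * X := by
      have g1 : q₁ ^ 2 * (r - s) ^ 2 ≤ q₁ ^ 2 * X := by gcongr; rw [hX]; linarith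
      have g2 : εm ^ 2 * W ^ 2 * (ε ^ 2 * (w - z) ^ 2) ≤ εm ^ 2 * W ^ 2 * X := by
        gcongr; rw [hX]; linarith
      have g3 : α ^ 2 ≤ X := by rw [hX]; linarith
      have g4 : 0 ≤ q₁ ^ 2 * (r - s) ^ 2 := by positivity
      have g5 : 0 ≤ εm ^ 2 * W ^ 2 * (ε ^ 2 * (w - z) ^ 2) := by positivity
      linarith
    calc _ = -a * α * (enth P ε r w - enth P ε s z) := by ring
      _ ≤ amax * |α| * (q₁ * |r - s| + ε ^ 2 * W * |w - z|) := e2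
      _ = amax * (|α| * (q₁ * |r - s| + ε ^ 2 * W * |w - z|)) := by ring
      _ ≤ amax * ((1 + q₁ ^ 2 + εm ^ 2 * W ^ 2) * X) := mul_le_mul_of_nonneg_left (e3.trans e5) ham.le
      _ = _ := by rw [hC4]; ring
  -- consistency error of the momentum balance
  have b5 : -(ε ^ 2 * β * (a * r * w - a * s * z + y)) ≤ C5 * X := by
    have e1 := abs_flux_sub_le (s := s) (w := w) (hr₀.le.trans hr.1) hr.2 hz
    have e2 : -(β * (a * (r * w - s * z))) ≤ |β| * (amax * (r₁ * |w - z| + W * |r - s|)) := by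
      have := mul_mul_le_of_abs (a := -β) (b := a) (c := r * w - s * z) (B := amax)
        (by rw [abs_neg]) (by rw [abs_of_pos ha0]; exact ha.2) e1
      linarith
    have e3 : -(β * y) ≤ (β ^ 2 + y ^ 2) / 2 := by linarith [sq_nonneg (β + y)]
    have e4 : |β| * (amax * (r₁ * |w - z| + W * |r - s|)) ≤ β ^ 2 +
        (amax ^ 2 * r₁ ^ 2 * (w - z) ^ 2 + amax ^ 2 * W ^ 2 * (r - s) ^ 2) / 2 := by
      have f1 := mul_le_half_sq_add |β| (amax * r₁ * |w - z|)
      have f2 := mul_le_half_sq_add |β| (amax * W * |r - s|)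
      rw [mul_pow, mul_pow, sq_abs, sq_abs] at f1 f2
      linarith
    have e5 := mul_le_mul_of_nonneg_left (add_le_add (e2.trans e4) e3) (sq_nonneg ε)
    have f1 : ε ^ 2 * β ^ 2 ≤ εm ^ 2 * X := by
      calc _ ≤ εm ^ 2 * β ^ 2 := by gcongr
        _ ≤ _ := by gcongr; rw [hX]; linarith
    have f2 : ε ^ 2 * y ^ 2 ≤ εm ^ 2 * X := by
      calc _ ≤ εm ^ 2 * y ^ 2 := by gcongr
        _ ≤ _ := by gcongr; rw [hX]; linarith
    have f3 : amax ^ 2 * r₁ ^ 2 * (ε ^ 2 * (w - z) ^ 2) ≤ amax ^ 2 * r₁ ^ 2 * X := by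
      gcongr; rw [hX]; linarith
    have f4 : ε ^ 2 * (amax ^ 2 * W ^ 2 * (r - s) ^ 2) ≤ εm ^ 2 * (amax ^ 2 * W ^ 2 * X) := by
      gcongr; rw [hX]; linarith
    have f5 : 0 ≤ amax ^ 2 * r₁ ^ 2 * (ε ^ 2 * (w - z) ^ 2) := by positivity
    have f6 : 0 ≤ ε ^ 2 * (amax ^ 2 * W ^ 2 * (r - s) ^ 2) := by positivity
    have f7 : 0 ≤ ε ^ 2 * β ^ 2 := by positivity
    have f8 : 0 ≤ ε ^ 2 * y ^ 2 := by positivity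
    rw [hC5]
    linarith
  have b35 := mul_le_mul_of_nonneg_left (add_le_add (add_le_add b3 b4) b5) hΔ.le
  have b3'' := mul_le_mul_of_nonneg_left b3' hΔ.le
  have hy : y' = y - Δ * η := by linarith
  unfold energyDensity errorDensity
  rw [hy]
  linarith

/-- Monotonicity of one step of the scheme. -/
lemma exists_mono_inequality {amin amax γmin γmax : ℝ} (hamin : 0 < amin)
    (hamm : amin ≤ amax) (hγmin : 0 < γmin) (hγmm : γmin ≤ γmax) :
    ∃ c δ : ℝ, 0 < c ∧ 0 < δ ∧ ∀ ε a γ Δ r w s z : ℝ,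
      0 ≤ ε → ε ≤ εm → a ∈ Icc amin amax → γ ∈ Icc γmin γmax → 0 < Δ → Δ ≤ δ →
      r ∈ Icc r₀ r₁ → s ∈ Icc r₀ r₁ → |w| ≤ W → |z| ≤ W →
      c * (distSq ε r w s z + Δ * dissDensity w z)
        ≤ a * (r - s) * (enth P ε r w - enth P ε s z)
          + ε ^ 2 * (w - z) * (a * r * w - a * s * z)
          + Δ * (γ * (|w| * w - |z| * z) * (a * r * w - a * s * z)) := by
  have hr₀ := H.r₀_pos
  have hW := H.W_pos
  have hq0 := H.q₀_pos
  have ham : 0 < amax := hamin.trans_le hamm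
  have hγm : 0 < γmax := hγmin.trans_le hγmm
  set B := γmax * amax * (2 * W ^ 3 / r₀) with hB
  have hBpos : 0 < B := by positivity
  set c := min (min (amin * q₀ / 8) (amin * r₀ / 4)) (γmin * amin * r₀ / 8) with hc
  have hc1 : c ≤ amin * q₀ / 8 := (min_le_left _ _).trans (min_le_left _ _)
  have hc2 : c ≤ amin * r₀ / 4 := (min_le_left _ _).trans (min_le_right _ _)
  have hc3 : c ≤ γmin * amin * r₀ / 8 := min_le_right _ _
  have hcpos : 0 < c := by rw [hc]; positivity
  refine ⟨c, amin * q₀ / (8 * B), hcpos, by positivity, ?_⟩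
  intro ε a γ Δ r w s z hε hεm ha hγ hΔ hΔ' hr hs hw hz
  have ha0 : 0 < a := hamin.trans_le ha.1
  have h1 := mul_le_mul_of_nonneg_left (H.mono hε hεm hr hs hw hz) ha0.le
  have h2 := mul_le_mul_of_nonneg_left
    (friction_lower (s := s) (y := 0) hr₀ hW hamin hγmin ha hγ hr.1 hw hz) hΔ.le
  rw [← hB] at h2
  have h3 : amin * ((q₀ * (r - s) ^ 2 + ε ^ 2 * r₀ * (w - z) ^ 2) / 4)
    ≤ a * ((q₀ * (r - s) ^ 2 + ε ^ 2 * r₀ * (w - z) ^ 2) / 4) := by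
    gcongr; exact ha.1
  have h4 : Δ * B ≤ amin * q₀ / 8 := by
    rw [le_div_iff₀ (by positivity)] at hΔ'
    linarith
  have h5 : Δ * B * (r - s) ^ 2 ≤ amin * q₀ / 8 * (r - s) ^ 2 := by gcongr
  have h6 : c * (r - s) ^ 2 ≤ amin * q₀ / 8 * (r - s) ^ 2 := by gcongr
  have h7 : c * (ε ^ 2 * (w - z) ^ 2) ≤ amin * r₀ / 4 * (ε ^ 2 * (w - z) ^ 2) := by gcongr
  have h8 : c * (Δ * dissDensity w z) ≤ γmin * amin * r₀ / 8 * (Δ * dissDensity w z) := by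
    have := dissDensity_nonneg w z
    gcongr
  unfold distSq
  rw [add_zero] at h2
  linarith

end PressureBounds

/-! ### Auxiliary results from analysis -/

/-- A discrete Gronwall inequality. -/
lemma discrete_gronwall {a F : ℕ → ℝ} {N : ℕ} {k Δ b : ℝ} (hk : 0 ≤ k) (hΔ : 0 ≤ Δ) (hb : 0 ≤ b)
    (hkΔ : k * Δ ≤ 1 / 2) (ha : ∀ n ≤ N, 0 ≤ a n) (hF : ∀ n, 0 ≤ F n)
    (hstep : ∀ n < N, a (n + 1) + F (n + 1) ≤ a n + k * Δ * (a (n + 1) + a n) + Δ * b) :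
    ∀ n ≤ N, a n + ∑ j ∈ Finset.Icc 1 n, F j
      ≤ Real.exp (4 * k * (N * Δ)) * (a 0 + 2 * (N * Δ) * b) := by
  set x := k * Δ with hx
  have hx0 : 0 ≤ x := mul_nonneg hk hΔ
  have key : ∀ n ≤ N, a n + ∑ j ∈ Finset.Icc 1 n, F j
      ≤ (1 + 4 * x) ^ n * (a 0 + 2 * (n * Δ) * b) := by
    intro n
    induction n with
    | zero => intro _; simp
    | succ n ih =>
      intro hn
      have ih := ih (by omega)
      have hs := hstep n (by omega)
      have han := ha n (by omega)
      have han1 := ha (n + 1) hn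
      have hF1 := hF (n + 1)
      have hΔb : 0 ≤ Δ * b := mul_nonneg hΔ hb
      have h1 : a (n + 1) + F (n + 1) ≤ (1 + 4 * x) * a n + 2 * (Δ * b) := by
        have e1 : (1 - x) * (a (n + 1) + F (n + 1)) ≤ (1 + x) * a n + Δ * b := by
          have : 0 ≤ x * F (n + 1) := mul_nonneg hx0 hF1
          linarith
        have e2 : (1 + x) * a n + Δ * b ≤ (1 - x) * ((1 + 4 * x) * a n + 2 * (Δ * b)) := by
          have f1 : 0 ≤ (1 - 2 * x) * (2 * x * a n + Δ * b) :=
            mul_nonneg (by linarith) (by positivity)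
          linarith
        exact le_of_mul_le_mul_left (e1.trans e2) (by linarith)
      rw [Finset.sum_Icc_succ_top (by omega)]
      have hSF : 0 ≤ ∑ j ∈ Finset.Icc 1 n, F j := Finset.sum_nonneg fun j _ => hF j
      have h2 : a (n + 1) + (∑ j ∈ Finset.Icc 1 n, F j + F (n + 1))
          ≤ (1 + 4 * x) * (a n + ∑ j ∈ Finset.Icc 1 n, F j) + 2 * (Δ * b) := by
        have : 0 ≤ 4 * x * ∑ j ∈ Finset.Icc 1 n, F j := by positivity
        linarith
      have h3 : (1 + 4 * x) * (a n + ∑ j ∈ Finset.Icc 1 n, F j)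
          ≤ (1 + 4 * x) * ((1 + 4 * x) ^ n * (a 0 + 2 * (n * Δ) * b)) := by gcongr
      have h4 : 1 * (2 * (Δ * b)) ≤ (1 + 4 * x) ^ (n + 1) * (2 * (Δ * b)) := by
        gcongr
        exact one_le_pow₀ (by linarith)
      push_cast
      calc _ ≤ _ := h2
        _ ≤ (1 + 4 * x) * ((1 + 4 * x) ^ n * (a 0 + 2 * (n * Δ) * b))
            + (1 + 4 * x) ^ (n + 1) * (2 * (Δ * b)) := by linarith
        _ = _ := by ring
  intro n hn
  refine (key n hn).trans ?_
  have hn' : (n : ℝ) ≤ N := by exact_mod_cast hn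
  have ha0 := ha 0 (by omega)
  have h1 : (1 + 4 * x) ^ n ≤ Real.exp (4 * k * (N * Δ)) := by
    calc (1 + 4 * x) ^ n ≤ (Real.exp (4 * x)) ^ n := by
          gcongr
          linarith [Real.add_one_le_exp (4 * x)]
      _ = Real.exp (n * (4 * x)) := by rw [← Real.exp_nat_mul]
      _ ≤ Real.exp (N * (4 * x)) := by gcongr
      _ = _ := by rw [hx]; ring_nf
  gcongr

/-- A function that is Hölder continuous up to the scale `h` and small in `Lᵖ` is small. -/
lemma exists_sup_small (p : ℕ) {ℓ K κ : ℝ} (hℓ : 0 < ℓ) (hK : 0 < K) (hκ : 0 < κ) :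
    ∃ η : ℝ, 0 < η ∧ ∀ (f : ℝ → ℝ) (h : ℝ), 0 ≤ h → h ≤ η →
      (∀ x ∈ Ioo 0 ℓ, ∀ y ∈ Ioo 0 ℓ, |f x - f y| ≤ K * √(|x - y| + h)) →
      IntervalIntegrable (fun x => |f x| ^ p) volume 0 ℓ →
      ∫ x in (0 : ℝ)..ℓ, |f x| ^ p ≤ η → ∀ x ∈ Ioo 0 ℓ, |f x| ≤ κ := by
  set δ := κ ^ 2 / (8 * K ^ 2) with hδ
  have hδ0 : 0 < δ := by positivity
  set len := min δ (ℓ / 2) with hlen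
  have hlen0 : 0 < len := by positivity
  refine ⟨min δ (len * (κ / 2) ^ p / 2), by positivity, ?_⟩
  intro f h h0 hh hf hint hη x hx
  by_contra! hc
  have hsq : K * √(2 * δ) = κ / 2 := by
    have : 2 * δ = (κ / (2 * K)) ^ 2 := by rw [hδ]; field_simp; ring
    rw [this, Real.sqrt_sq (by positivity)]
    field_simp
  have hlow : ∀ y ∈ Ioo 0 ℓ, |x - y| ≤ δ → κ / 2 ≤ |f y| := by
    intro y hy hxy
    have h1 := hf x hx y hy
    have h2 : K * √(|x - y| + h) ≤ K * √(2 * δ) := by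
      gcongr
      have := hh.trans (min_le_left _ _)
      linarith
    have h3 := abs_sub_abs_le_abs_sub (f x) (f y)
    linarith
  obtain ⟨α, hα0, hαℓ, hα⟩ : ∃ α, 0 ≤ α ∧ α + len ≤ ℓ ∧ ∀ y ∈ Ioo α (α + len), |x - y| ≤ δ := by
    have hl1 : len ≤ δ := min_le_left _ _
    have hl2 : len ≤ ℓ / 2 := min_le_right _ _
    rcases le_total x (ℓ / 2) with hx2 | hx2
    · refine ⟨x, hx.1.le, by linarith, fun y hy => ?_⟩
      rw [abs_le]; constructor <;> linarith [hy.1, hy.2]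
    · refine ⟨x - len, by linarith, by linarith [hx.2], fun y hy => ?_⟩
      rw [abs_le]; constructor <;> linarith [hy.1, hy.2]
  have h1 : ∫ x in α..(α + len), |f x| ^ p ≤ ∫ x in (0 : ℝ)..ℓ, |f x| ^ p := by
    apply intervalIntegral.integral_mono_interval hα0 (by linarith) hαℓ _ hint
    exact Filter.Eventually.of_forall fun x => by positivity
  have h2 : ∫ x in α..(α + len), (κ / 2) ^ p ≤ ∫ x in α..(α + len), |f x| ^ p := by
    apply intervalIntegral.integral_mono_on_of_le_Ioo (by linarith) (by simp)
    · apply hint.mono_set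
      rw [uIcc_of_le (by linarith), uIcc_of_le hℓ.le]
      exact Icc_subset_Icc hα0 hαℓ
    · intro y hy
      have := hlow y ⟨by linarith [hy.1], by linarith [hy.2]⟩ (hα y hy)
      gcongr
  simp only [intervalIntegral.integral_const, add_sub_cancel_left, smul_eq_mul] at h2
  have h3 := hη.trans (min_le_right _ _)
  have h4 : 0 < len * (κ / 2) ^ p := by positivity
  linarith

lemma exists_pos_forall_le {E : Type*} [Fintype E] {η : E → ℝ} (hη : ∀ e, 0 < η e) :
    ∃ δ : ℝ, 0 < δ ∧ ∀ e, δ ≤ η e := by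
  rcases isEmpty_or_nonempty E with h | h
  · exact ⟨1, one_pos, fun e => h.elim e⟩
  · refine ⟨Finset.univ.inf' Finset.univ_nonempty η, ?_, fun e => Finset.inf'_le _ (Finset.mem_univ e)⟩
    rw [Finset.lt_inf'_iff]
    exact fun e _ => hη e

section Continuation

variable {X : Type*} [NormedAddCommGroup X] [InnerProductSpace ℝ X]

/-- A strongly monotone Lipschitz operator on a ball attains the values close to the value at the
center. -/
lemma exists_solution_of_strongly_monotone [CompleteSpace X] {c L r : ℝ} (hc : 0 < c) (hL : c ≤ L)
    (hr : 0 < r) :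
    ∃ η : ℝ, 0 < η ∧ ∀ (B : X → X) (x₁ y : X),
      (∀ x ∈ Metric.closedBall x₁ r, ∀ z ∈ Metric.closedBall x₁ r,
        c * ‖x - z‖ ^ 2 ≤ inner ℝ (B x - B z) (x - z) ∧ ‖B x - B z‖ ≤ L * ‖x - z‖) →
      ‖B x₁ - y‖ ≤ η → ∃ x ∈ Metric.closedBall x₁ r, B x = y := by
  have hL0 : 0 < L := hc.trans_le hL
  set t := c / L ^ 2 with ht
  have ht0 : 0 < t := by positivity
  set q := √(1 - c ^ 2 / L ^ 2) with hq
  have hq1 : q < 1 := by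
    rw [hq, Real.sqrt_lt' one_pos]
    have : 0 < c ^ 2 / L ^ 2 := by positivity
    linarith
  have hq0 : 0 ≤ q := Real.sqrt_nonneg _
  have hcL : c ^ 2 / L ^ 2 ≤ 1 := by
    rw [div_le_one (by positivity)]; gcongr
  refine ⟨(1 - q) * r / t, by have := sub_pos.2 hq1; positivity, ?_⟩
  intro B x₁ y hB hy
  set Φ : X → X := fun x => x - t • (B x - y) with hΦ
  have hcontr : ∀ x ∈ Metric.closedBall x₁ r, ∀ z ∈ Metric.closedBall x₁ r,
      ‖Φ x - Φ z‖ ≤ q * ‖x - z‖ := by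
    intro x hx z hz
    obtain ⟨h1, h2⟩ := hB x hx z hz
    have e1 : Φ x - Φ z = (x - z) - t • (B x - B z) := by
      simp only [hΦ, smul_sub]; abel
    have e2 : ‖Φ x - Φ z‖ ^ 2 ≤ (q * ‖x - z‖) ^ 2 := by
      rw [e1, norm_sub_sq_real, norm_smul, inner_smul_right, mul_pow, mul_pow, hq,
        Real.sq_sqrt (by linarith), real_inner_comm, Real.norm_eq_abs, sq_abs]
      have h3 : ‖B x - B z‖ ^ 2 ≤ (L * ‖x - z‖) ^ 2 := by gcongr
      have h4 : t ^ 2 * ‖B x - B z‖ ^ 2 ≤ t ^ 2 * (L * ‖x - z‖) ^ 2 := by gcongr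
      have h5 : t ^ 2 * (L * ‖x - z‖) ^ 2 = c ^ 2 / L ^ 2 * ‖x - z‖ ^ 2 := by
        rw [ht]; field_simp
      have h6 : t * (c * ‖x - z‖ ^ 2) ≤ t * inner ℝ (B x - B z) (x - z) := by gcongr
      have h7 : t * (c * ‖x - z‖ ^ 2) = c ^ 2 / L ^ 2 * ‖x - z‖ ^ 2 := by
        rw [ht]; field_simp
      linarith
    exact (sq_le_sq₀ (norm_nonneg _) (by positivity)).1 e2
  have hself : ‖Φ x₁ - x₁‖ ≤ (1 - q) * r := by
    have : Φ x₁ - x₁ = -(t • (B x₁ - y)) := by simp only [hΦ]; abel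
    rw [this, norm_neg, norm_smul, Real.norm_eq_abs, abs_of_pos ht0]
    calc t * ‖B x₁ - y‖ ≤ t * ((1 - q) * r / t) := by gcongr
      _ = _ := by field_simp
  have hmem : x₁ ∈ Metric.closedBall x₁ r := Metric.mem_closedBall_self hr.le
  have hmaps : MapsTo Φ (Metric.closedBall x₁ r) (Metric.closedBall x₁ r) := by
    intro x hx
    rw [mem_closedBall_iff_norm] at hx ⊢
    calc ‖Φ x - x₁‖ = ‖(Φ x - Φ x₁) + (Φ x₁ - x₁)‖ := by congr 1; abel
      _ ≤ ‖Φ x - Φ x₁‖ + ‖Φ x₁ - x₁‖ := norm_add_le _ _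
      _ ≤ q * ‖x - x₁‖ + (1 - q) * r := by
        gcongr
        exact hcontr x (by rwa [mem_closedBall_iff_norm]) x₁ hmem
      _ ≤ q * r + (1 - q) * r := by gcongr
      _ = r := by ring
  have hCW : ContractingWith ⟨q, hq0⟩ (hmaps.restrict Φ _ _) := by
    refine ⟨by exact_mod_cast hq1, LipschitzWith.of_dist_le_mul fun x z => ?_⟩
    have := hcontr x x.2 z z.2
    rw [← dist_eq_norm, ← dist_eq_norm] at this
    exact this
  obtain ⟨x, hx, hfix, -⟩ := ContractingWith.exists_fixedPoint'
    (Metric.isClosed_closedBall.isComplete) hmaps hCW hmem (edist_ne_top _ _)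
  refine ⟨x, hx, ?_⟩
  have h1 : x - t • (B x - y) = x := hfix
  have h2 : t • (B x - y) = 0 := by simpa using h1
  rcases smul_eq_zero.1 h2 with h3 | h3
  · exact absurd h3 ht0.ne'
  · exact sub_eq_zero.1 h3

/-- The continuation method for a monotone operator on a compact set: if the solutions of the
regularized problems stay in the interior, the problem has a solution. -/
lemma exists_zero_of_continuation [CompleteSpace X] {K : Set X} (hK : IsCompact K) {A : X → X}
    {L : ℝ} (hLip : ∀ x ∈ K, ∀ y ∈ K, ‖A x - A y‖ ≤ L * ‖x - y‖)
    (hmono : ∀ x ∈ K, ∀ y ∈ K, 0 ≤ inner ℝ (A x - A y) (x - y)) {x₀ : X} (hx₀ : x₀ ∈ K)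
    {κ : ℝ} (hκ : 0 < κ)
    (hint : ∀ θ ∈ Ioc (0 : ℝ) 1, ∀ x ∈ K, A x + (θ * κ) • (x - x₀) = θ • A x₀ →
      x ∈ interior K) :
    ∃ x ∈ K, A x = 0 := by
  have hAc : ContinuousOn A K := by
    have : LipschitzOnWith L.toNNReal A K := LipschitzOnWith.of_dist_le_mul fun x hx y hy => by
      rw [dist_eq_norm, dist_eq_norm]
      refine (hLip x hx y hy).trans ?_
      gcongr
      exact Real.le_coe_toNNReal L
    exact this.continuousOn
  set Z : Set (ℝ × X) := {p ∈ Icc (0 : ℝ) 1 ×ˢ K |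
    A p.2 + (p.1 * κ) • (p.2 - x₀) - p.1 • A x₀ = 0} with hZ
  have hZc : IsCompact Z := by
    have hcl : IsClosed Z := by
      have hcont : ContinuousOn (fun p : ℝ × X => A p.2 + (p.1 * κ) • (p.2 - x₀) - p.1 • A x₀)
          (Icc (0 : ℝ) 1 ×ˢ K) := by
        have h1 : ContinuousOn (fun p : ℝ × X => A p.2) (Icc (0 : ℝ) 1 ×ˢ K) :=
          hAc.comp continuousOn_snd fun p hp => hp.2
        have h2 : Continuous (fun p : ℝ × X => (p.1 * κ) • (p.2 - x₀)) := by fun_prop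
        have h3 : Continuous (fun p : ℝ × X => p.1 • A x₀) := by fun_prop
        exact (h1.add h2.continuousOn).sub h3.continuousOn
      exact hcont.preimage_isClosed_of_isClosed (isClosed_Icc.prod hK.isClosed) isClosed_singleton
    exact (isCompact_Icc.prod hK).of_isClosed_subset hcl fun p hp => hp.1
  set Θ := Prod.fst '' Z with hΘ
  have hΘc : IsCompact Θ := hZc.image continuous_fst
  have hone : (1 : ℝ) ∈ Θ := ⟨(1, x₀), ⟨⟨by simp, hx₀⟩, by simp⟩, rfl⟩
  have hinf : sInf Θ ∈ Θ := hΘc.sInf_mem ⟨1, hone⟩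
  obtain ⟨⟨θ, x⟩, ⟨⟨hθI, hxK⟩, hx⟩, hθ⟩ := hinf
  simp only at hθ hθI hxK hx
  rcases hθI.1.eq_or_lt with h0 | h0
  · refine ⟨x, hxK, ?_⟩
    rw [← h0] at hx
    simpa using hx
  · exfalso
    have hxi := hint θ ⟨h0, hθI.2⟩ x hxK (sub_eq_zero.1 hx)
    obtain ⟨r, hr, hball⟩ := Metric.nhds_basis_closedBall.mem_iff.1 (mem_interior_iff_mem_nhds.1 hxi)
    set L' := max L 0 + κ with hL'
    obtain ⟨η, hη, hsol⟩ := exists_solution_of_strongly_monotone (X := X) (c := θ * κ / 2)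
      (L := L') (r := r) (by positivity) (by
        have : θ * κ ≤ 1 * κ := by gcongr; exact hθI.2
        have h2 := le_max_right L 0
        rw [hL']
        have : 0 < θ * κ := by positivity
        linarith) hr
    set R := ‖κ • (x - x₀) - A x₀‖ with hR
    have hR0 : 0 ≤ R := norm_nonneg _
    set ξ := min (θ / 2) (η / (R + 1)) with hξ
    have hξ0 : 0 < ξ := by positivity
    have hξ1 : ξ ≤ θ / 2 := min_le_left _ _
    have hξ2 : ξ * R ≤ η := by
      calc ξ * R ≤ η / (R + 1) * (R + 1) := by
            gcongr
            · exact min_le_right _ _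
            · linarith
        _ = η := by field_simp
    set θ' := θ - ξ with hθ'
    obtain ⟨x', hx', hBx'⟩ := hsol (fun z => A z + (θ' * κ) • (z - x₀)) x (θ' • A x₀) (by
      intro u hu z hz
      have huK := hball hu
      have hzK := hball hz
      have e : A u + (θ' * κ) • (u - x₀) - (A z + (θ' * κ) • (z - x₀))
        = (A u - A z) + (θ' * κ) • (u - z) := by
        rw [smul_sub, smul_sub, smul_sub]; abel
      have hθ'0 : 0 ≤ θ' * κ := mul_nonneg (by linarith) hκ.le
      simp only [e]
      constructor
      · rw [inner_add_left, inner_smul_left, real_inner_self_eq_norm_sq]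
        have h1 := hmono u huK z hzK
        have h2 : θ * κ / 2 * ‖u - z‖ ^ 2 ≤ θ' * κ * ‖u - z‖ ^ 2 := by
          have : θ / 2 ≤ θ' := by linarith
          have := mul_le_mul_of_nonneg_right this hκ.le
          gcongr
          linarith
        simpa using by linarith
      · refine (norm_add_le _ _).trans ?_
        rw [norm_smul, Real.norm_eq_abs, abs_of_nonneg hθ'0, hL', add_mul]
        have h1 := hLip u huK z hzK
        have h2 : L * ‖u - z‖ ≤ max L 0 * ‖u - z‖ := by gcongr; exact le_max_left _ _
        have h3 : θ' * κ * ‖u - z‖ ≤ κ * ‖u - z‖ := by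
          have : θ' ≤ 1 := by linarith [hθI.2]
          have := mul_le_mul_of_nonneg_right this hκ.le
          gcongr
          linarith
        linarith) (by
      have e : A x + (θ' * κ) • (x - x₀) - θ' • A x₀ = -(ξ • (κ • (x - x₀) - A x₀)) := by
        have h1 : A x = θ • A x₀ - (θ * κ) • (x - x₀) := by
          rw [← sub_eq_zero]
          rw [← hx]
          abel
        rw [h1, hθ']
        module
      simp only [e]
      rw [norm_neg, norm_smul, Real.norm_eq_abs, abs_of_pos hξ0]
      exact hξ2)
    have hmem : θ' ∈ Θ := by
      refine ⟨(θ', x'), ⟨⟨⟨by simp only; linarith, by simp only; linarith [hθI.2]⟩, hball hx'⟩, ?_⟩, rfl⟩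
      simp only
      exact sub_eq_zero.2 hBx'
    have := csInf_le hΘc.bddBelow hmem
    linarith

end Continuation

/-! ### Integration over one pipe -/

/-- The Lebesgue measure on `(0,ℓ)`. -/
noncomputable abbrev pipeMeasure (ℓ : ℝ) : Measure ℝ := volume.restrict (Ioo (0 : ℝ) ℓ)

lemma integral_pipe {ℓ : ℝ} (hℓ : 0 ≤ ℓ) (f : ℝ → ℝ) :
    ∫ x in (0 : ℝ)..ℓ, f x = ∫ x, f x ∂(pipeMeasure ℓ) := by
  rw [intervalIntegral.integral_of_le hℓ, integral_Ioc_eq_integral_Ioo]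

lemma intervalIntegrable_pipe {ℓ : ℝ} (hℓ : 0 ≤ ℓ) {f : ℝ → ℝ} :
    IntervalIntegrable f volume 0 ℓ ↔ Integrable f (pipeMeasure ℓ) := by
  rw [intervalIntegrable_iff_integrableOn_Ioo_of_le hℓ]; rfl

/-- Essentially bounded functions on `(0,ℓ)`. -/
def Bdd (ℓ : ℝ) (f : ℝ → ℝ) : Prop := MemLp f ⊤ (pipeMeasure ℓ)

/-- Square integrable functions on `(0,ℓ)`. -/
def Sq (ℓ : ℝ) (f : ℝ → ℝ) : Prop := MemLp f 2 (pipeMeasure ℓ)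

/-- Integrable functions on `(0,ℓ)`. -/
def Itg (ℓ : ℝ) (f : ℝ → ℝ) : Prop := Integrable f (pipeMeasure ℓ)

section Classes

variable {ℓ : ℝ} {f g : ℝ → ℝ}

lemma Bdd.of_bound (hf : AEStronglyMeasurable f (pipeMeasure ℓ)) {C : ℝ}
    (h : ∀ᵐ x ∂(pipeMeasure ℓ), |f x| ≤ C) : Bdd ℓ f := memLp_top_of_bound hf C h

lemma Bdd.const (c : ℝ) : Bdd ℓ (fun _ => c) := memLp_const c
lemma Bdd.add (hf : Bdd ℓ f) (hg : Bdd ℓ g) : Bdd ℓ (fun x => f x + g x) := MemLp.add hf hg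
lemma Bdd.sub (hf : Bdd ℓ f) (hg : Bdd ℓ g) : Bdd ℓ (fun x => f x - g x) := MemLp.sub hf hg
lemma Bdd.mul (hf : Bdd ℓ f) (hg : Bdd ℓ g) : Bdd ℓ (fun x => f x * g x) :=
  MemLp.mul' (p := ⊤) (q := ⊤) (r := ⊤) hg hf
lemma Bdd.cmul (c : ℝ) (hf : Bdd ℓ f) : Bdd ℓ (fun x => c * f x) := (Bdd.const c).mul hf
lemma Bdd.abs (hf : Bdd ℓ f) : Bdd ℓ (fun x => |f x|) := MemLp.abs hf
lemma Bdd.pow (hf : Bdd ℓ f) : ∀ n : ℕ, Bdd ℓ (fun x => f x ^ n)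
  | 0 => by simpa using Bdd.const 1
  | n + 1 => by simpa only [pow_succ] using (hf.pow n).mul hf
lemma Bdd.sq (hf : Bdd ℓ f) : Sq ℓ f := MemLp.mono_exponent hf le_top
lemma Bdd.itg (hf : Bdd ℓ f) : Itg ℓ f := (MemLp.mono_exponent hf le_top).integrable le_rfl
lemma Sq.itg (hf : Sq ℓ f) : Itg ℓ f := MemLp.integrable one_le_two hf
lemma Sq.add (hf : Sq ℓ f) (hg : Sq ℓ g) : Sq ℓ (fun x => f x + g x) := MemLp.add hf hg
lemma Sq.sub (hf : Sq ℓ f) (hg : Sq ℓ g) : Sq ℓ (fun x => f x - g x) := MemLp.sub hf hg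
lemma Sq.cmul (c : ℝ) (hf : Sq ℓ f) : Sq ℓ (fun x => c * f x) := MemLp.const_mul hf c
lemma Sq.mul (hf : Sq ℓ f) (hg : Sq ℓ g) : Itg ℓ (fun x => f x * g x) :=
  MemLp.integrable_mul hf hg
lemma Sq.sq (hf : Sq ℓ f) : Itg ℓ (fun x => f x ^ 2) := MemLp.integrable_sq hf
lemma Itg.add (hf : Itg ℓ f) (hg : Itg ℓ g) : Itg ℓ (fun x => f x + g x) := Integrable.add hf hg
lemma Itg.sub (hf : Itg ℓ f) (hg : Itg ℓ g) : Itg ℓ (fun x => f x - g x) := Integrable.sub hf hg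
lemma Itg.cmul (c : ℝ) (hf : Itg ℓ f) : Itg ℓ (fun x => c * f x) := Integrable.const_mul hf c
lemma Bdd.congr (hf : Bdd ℓ f) (h : ∀ᵐ x ∂(pipeMeasure ℓ), f x = g x) : Bdd ℓ g :=
  (memLp_congr_ae h).1 hf
lemma Sq.congr (hf : Sq ℓ f) (h : ∀ᵐ x ∂(pipeMeasure ℓ), f x = g x) : Sq ℓ g :=
  (memLp_congr_ae h).1 hf
lemma Bdd.of_continuousOn (hf : ContinuousOn f (Icc 0 ℓ)) : Bdd ℓ f := by
  obtain ⟨C, hC⟩ := isCompact_Icc.exists_bound_of_continuousOn hf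
  refine Bdd.of_bound ((hf.mono Ioo_subset_Icc_self).aestronglyMeasurable measurableSet_Ioo)
    (C := C) ?_
  filter_upwards [ae_restrict_mem measurableSet_Ioo] with x hx using hC x (Ioo_subset_Icc_self hx)

end Classes

lemma sq_integral_abs_le {a b : ℝ} (hab : a ≤ b) {g : ℝ → ℝ}
    (hg : IntervalIntegrable g volume a b) (hg2 : IntervalIntegrable (fun x => g x ^ 2) volume a b) :
    (∫ x in a..b, |g x|) ^ 2 ≤ (b - a) * ∫ x in a..b, g x ^ 2 := by
  rcases hab.eq_or_lt with rfl | hab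
  · simp
  set I := ∫ x in a..b, |g x| with hI
  set t := I / (b - a) with ht
  have hba : 0 < b - a := sub_pos.2 hab
  have h1 : 0 ≤ ∫ x in a..b, (|g x| - t) ^ 2 :=
    intervalIntegral.integral_nonneg hab.le fun x _ => sq_nonneg _
  have h2 : ∫ x in a..b, (|g x| - t) ^ 2
      = (∫ x in a..b, g x ^ 2) - 2 * t * I + t ^ 2 * (b - a) := by
    have e : ∀ x, (|g x| - t) ^ 2 = g x ^ 2 - 2 * t * |g x| + t ^ 2 := by
      intro x; rw [← sq_abs (g x)]; ring
    simp only [e]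
    rw [intervalIntegral.integral_add (hg2.sub (hg.abs.const_mul _)) (by simp),
      intervalIntegral.integral_sub hg2 (hg.abs.const_mul _), intervalIntegral.integral_const_mul]
    simp only [intervalIntegral.integral_const, smul_eq_mul]
    ring
  have h3 : t * (b - a) = I := by rw [ht]; field_simp
  rw [h2] at h1
  have h4 : (b - a) * ((∫ x in a..b, g x ^ 2) - 2 * t * I + t ^ 2 * (b - a))
      = (b - a) * (∫ x in a..b, g x ^ 2) - I ^ 2 := by rw [← h3]; ring
  have := mul_nonneg hba.le h1
  linarith

/-- `f` is a primitive on `[0,ℓ]` of the square integrable function `g`. -/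
def IsPrimitive (ℓ : ℝ) (f g : ℝ → ℝ) : Prop :=
  Sq ℓ g ∧ ∀ x ∈ Icc 0 ℓ, ∀ y ∈ Icc 0 ℓ, f y - f x = ∫ t in x..y, g t

section Primitive

variable {ℓ : ℝ} {f g : ℝ → ℝ}

lemma Itg.ii_of_mem (hg : Itg ℓ g) {x y : ℝ} (hx : x ∈ Icc 0 ℓ) (hy : y ∈ Icc 0 ℓ) :
    IntervalIntegrable g volume x y := by
  have hℓ : 0 ≤ ℓ := hx.1.trans hx.2
  refine ((intervalIntegrable_pipe hℓ).2 hg).mono_set ?_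
  rw [uIcc_of_le hℓ]
  exact uIcc_subset_Icc hx hy

lemma integral_le_of_nonneg (hg : Itg ℓ g) (h0 : ∀ x, 0 ≤ g x) {x y : ℝ} (hx : x ∈ Icc 0 ℓ)
    (hy : y ∈ Icc 0 ℓ) (hxy : x ≤ y) : ∫ t in x..y, g t ≤ ∫ t in (0 : ℝ)..ℓ, g t := by
  have hℓ : 0 ≤ ℓ := hx.1.trans hx.2
  exact intervalIntegral.integral_mono_interval hx.1 hxy hy.2
    (Filter.Eventually.of_forall h0) ((intervalIntegrable_pipe hℓ).2 hg)

lemma sq_integral_le_pipe (hg : Sq ℓ g) {x y : ℝ} (hx : x ∈ Icc 0 ℓ) (hy : y ∈ Icc 0 ℓ)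
    (hxy : x ≤ y) : (∫ t in x..y, |g t|) ^ 2 ≤ (y - x) * ∫ t in (0 : ℝ)..ℓ, g t ^ 2 := by
  refine (sq_integral_abs_le hxy (hg.itg.ii_of_mem hx hy) (hg.sq.ii_of_mem hx hy)).trans ?_
  exact mul_le_mul_of_nonneg_left
    (integral_le_of_nonneg hg.sq (fun x => sq_nonneg _) hx hy hxy) (sub_nonneg.2 hxy)

lemma IsPrimitive.abs_sub_le_integral (h : IsPrimitive ℓ f g) {a b x y : ℝ} (ha : a ∈ Icc 0 ℓ)
    (hb : b ∈ Icc 0 ℓ) (hx : x ∈ Icc a b) (hy : y ∈ Icc a b) :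
    |f y - f x| ≤ ∫ t in a..b, |g t| := by
  have hab : a ≤ b := hx.1.trans hx.2
  have hsub : ∀ z ∈ Icc a b, z ∈ Icc 0 ℓ := fun z hz => ⟨ha.1.trans hz.1, hz.2.trans hb.2⟩
  rw [h.2 x (hsub x hx) y (hsub y hy)]
  wlog hxy : x ≤ y generalizing x y
  · rw [intervalIntegral.integral_symm, abs_neg]
    exact this hy hx (le_of_not_ge hxy)
  refine (intervalIntegral.abs_integral_le_integral_abs hxy).trans ?_
  exact intervalIntegral.integral_mono_interval hx.1 hxy hy.2
    (Filter.Eventually.of_forall fun x => abs_nonneg _) (h.1.itg.ii_of_mem ha hb).abs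

lemma IsPrimitive.holder (h : IsPrimitive ℓ f g) {B : ℝ} (hB0 : 0 ≤ B)
    (hB : ∫ t in (0 : ℝ)..ℓ, g t ^ 2 ≤ B ^ 2) {x y : ℝ} (hx : x ∈ Icc 0 ℓ) (hy : y ∈ Icc 0 ℓ) :
    |f x - f y| ≤ B * √(|x - y|) := by
  wlog hxy : x ≤ y generalizing x y
  · rw [abs_sub_comm, abs_sub_comm x y]
    exact this hy hx (le_of_not_ge hxy)
  have h1 := h.abs_sub_le_integral hx hy (right_mem_Icc.2 hxy) (left_mem_Icc.2 hxy)
  have h2 := sq_integral_le_pipe h.1 hx hy hxy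
  refine h1.trans ?_
  have h3 : (∫ t in x..y, |g t|) ^ 2 ≤ (B * √(|x - y|)) ^ 2 := by
    rw [mul_pow, Real.sq_sqrt (abs_nonneg _), abs_sub_comm, abs_of_nonneg (sub_nonneg.2 hxy)]
    refine h2.trans ?_
    rw [mul_comm]
    exact mul_le_mul_of_nonneg_right hB (sub_nonneg.2 hxy)
  exact le_of_sq_le_sq h3 (by positivity)
  where le_of_sq_le_sq {a b : ℝ} (h : a ^ 2 ≤ b ^ 2) (hb : 0 ≤ b) : a ≤ b :=
    le_of_abs_le (abs_le_of_sq_le_sq h hb)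

lemma IsPrimitive.continuousOn (h : IsPrimitive ℓ f g) : ContinuousOn f (Icc 0 ℓ) := by
  rcases lt_or_ge ℓ 0 with hℓ | hℓ
  · rw [Icc_eq_empty (not_le.2 hℓ)]; exact continuousOn_empty f
  have h0 : (0 : ℝ) ∈ Icc 0 ℓ := ⟨le_rfl, hℓ⟩
  have hc : ContinuousOn (fun y => f 0 + ∫ t in (0 : ℝ)..y, g t) (Icc 0 ℓ) := by
    refine continuousOn_const.add ?_
    have := intervalIntegral.continuousOn_primitive_interval (μ := volume) (a := 0) (b := ℓ) (f := g)
      (by rw [uIcc_of_le hℓ, integrableOn_Icc_iff_integrableOn_Ioo]; exact h.1.itg)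
    rwa [uIcc_of_le hℓ] at this
  refine hc.congr fun y hy => ?_
  have := h.2 0 h0 y hy
  simp only
  linarith

lemma IsPrimitive.bdd (h : IsPrimitive ℓ f g) : Bdd ℓ f := Bdd.of_continuousOn h.continuousOn

/-- The Sobolev inequality. -/
lemma IsPrimitive.sobolev (h : IsPrimitive ℓ f g) (hℓ : 0 < ℓ) {B : ℝ} (hB0 : 0 ≤ B)
    (hf : ∫ t in (0 : ℝ)..ℓ, f t ^ 2 ≤ B ^ 2) (hg : ∫ t in (0 : ℝ)..ℓ, g t ^ 2 ≤ B ^ 2)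
    {x : ℝ} (hx : x ∈ Icc 0 ℓ) : |f x| ≤ B * (1 / √ℓ + √ℓ) := by
  by_contra! hc
  have hpos : 0 < √ℓ := Real.sqrt_pos.2 hℓ
  have hlow : ∀ y ∈ Icc 0 ℓ, (B / √ℓ) < |f y| := by
    intro y hy
    have h1 := h.holder hB0 hg hx hy
    have h2 : B * √(|x - y|) ≤ B * √ℓ := by
      gcongr
      rw [abs_le]; constructor <;> linarith [hx.1, hx.2, hy.1, hy.2]
    have h3 := abs_sub_abs_le_abs_sub (f x) (f y)
    have h4 : B * (1 / √ℓ + √ℓ) = B / √ℓ + B * √ℓ := by ring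
    linarith
  have hcont : ContinuousOn (fun t => f t ^ 2) (Icc 0 ℓ) := h.continuousOn.pow 2
  have hlt : ∫ t in (0 : ℝ)..ℓ, (B / √ℓ) ^ 2 < ∫ t in (0 : ℝ)..ℓ, f t ^ 2 := by
    apply intervalIntegral.integral_lt_integral_of_continuousOn_of_le_of_exists_lt hℓ
      continuousOn_const hcont
    · intro y hy
      rw [← sq_abs (f y)]
      have := hlow y (Ioc_subset_Icc_self hy)
      gcongr
    · refine ⟨0, ⟨le_rfl, hℓ.le⟩, ?_⟩
      rw [← sq_abs (f 0)]
      have := hlow 0 ⟨le_rfl, hℓ.le⟩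
      gcongr
  have e : ∫ t in (0 : ℝ)..ℓ, (B / √ℓ) ^ 2 = B ^ 2 := by
    rw [intervalIntegral.integral_const, smul_eq_mul, div_pow, Real.sq_sqrt hℓ.le]
    field_simp
    ring
  rw [e] at hlt
  linarith

lemma IsPrimitive.sub {f' g' : ℝ → ℝ} (h : IsPrimitive ℓ f g) (h' : IsPrimitive ℓ f' g') :
    IsPrimitive ℓ (fun x => f x - f' x) (fun x => g x - g' x) := by
  refine ⟨h.1.sub h'.1, fun x hx y hy => ?_⟩
  rw [intervalIntegral.integral_sub (h.1.itg.ii_of_mem hx hy) (h'.1.itg.ii_of_mem hx hy),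
    ← h.2 x hx y hy, ← h'.2 x hx y hy]
  ring

lemma IsPrimitive.cmul (c : ℝ) (h : IsPrimitive ℓ f g) :
    IsPrimitive ℓ (fun x => c * f x) (fun x => c * g x) := by
  refine ⟨h.1.cmul c, fun x hx y hy => ?_⟩
  rw [intervalIntegral.integral_const_mul, ← h.2 x hx y hy]
  ring

lemma isPrimitive_of_ac (hf : AbsolutelyContinuousOnInterval f 0 ℓ) (hℓ : 0 ≤ ℓ)
    (hg : Sq ℓ g) (hd : ∀ᵐ x ∂(pipeMeasure ℓ), deriv f x = g x) : IsPrimitive ℓ f g := by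
  refine ⟨hg, fun x hx y hy => ?_⟩
  have hsub : uIcc x y ⊆ uIcc 0 ℓ := by rw [uIcc_of_le hℓ]; exact uIcc_subset_Icc hx hy
  rw [← (hf.mono hsub).integral_deriv_eq_sub]
  apply intervalIntegral.integral_congr_ae
  rw [ae_restrict_iff' measurableSet_Ioo] at hd
  have hne : ∀ᵐ t : ℝ, t ≠ ℓ := by simp [ae_iff]
  filter_upwards [hd, hne] with t ht htne htm
  refine ht ⟨?_, ?_⟩
  · exact (le_min hx.1 hy.1).trans_lt htm.1
  · exact lt_of_le_of_ne (htm.2.trans (max_le hx.2 hy.2)) htne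

end Primitive

/-! ### Piecewise constant and piecewise linear functions on a uniform mesh -/

/-- The piecewise constant function with the values `d i` on the cells `(i h, (i+1) h)`. -/
noncomputable def pc (h : ℝ) (d : ℕ → ℝ) (x : ℝ) : ℝ := d ⌊x / h⌋₊

/-- The piecewise linear function with the values `c i` at the grid points `i h`. -/
noncomputable def lin (h : ℝ) (c : ℕ → ℝ) (x : ℝ) : ℝ :=
  c ⌊x / h⌋₊ + (x / h - ⌊x / h⌋₊) * (c (⌊x / h⌋₊ + 1) - c ⌊x / h⌋₊)

/-- The slopes of a piecewise linear function. -/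
noncomputable def slopes (h : ℝ) (c : ℕ → ℝ) (i : ℕ) : ℝ := (c (i + 1) - c i) / h

/-- The closed cell `[i h, (i+1) h]`. -/
def cell (h : ℝ) (i : ℕ) : Set ℝ := Icc (i * h) ((i + 1) * h)

section Mesh

variable {ℓ h : ℝ} {m : ℕ}

lemma floor_eq_of_mem (hh : 0 < h) {i : ℕ} {x : ℝ} (hx : x ∈ Ico (i * h) ((i + 1) * h)) :
    ⌊x / h⌋₊ = i := by
  have h0 : 0 ≤ x / h := div_nonneg ((mul_nonneg (Nat.cast_nonneg i) hh.le).trans hx.1) hh.le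
  rw [Nat.floor_eq_iff h0, le_div_iff₀ hh, div_lt_iff₀ hh]
  exact hx

lemma pc_eq_of_mem (hh : 0 < h) (d : ℕ → ℝ) {i : ℕ} {x : ℝ} (hx : x ∈ Ico (i * h) ((i + 1) * h)) :
    pc h d x = d i := by
  rw [pc, floor_eq_of_mem hh hx]

lemma lin_eq_of_mem (hh : 0 < h) (c : ℕ → ℝ) {i : ℕ} {x : ℝ} (hx : x ∈ cell h i) :
    lin h c x = c i + slopes h c i * (x - i * h) := by
  unfold cell at hx
  rcases hx.2.lt_or_eq with hlt | heq
  · rw [lin, floor_eq_of_mem hh ⟨hx.1, hlt⟩, slopes]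
    field_simp
  · have hf : ⌊x / h⌋₊ = i + 1 := by
      apply floor_eq_of_mem hh
      push_cast
      constructor
      · exact heq.ge
      · rw [heq]; linarith
    rw [lin, hf, slopes, heq]
    push_cast
    field_simp
    ring

lemma lin_grid (hh : 0 < h) (c : ℕ → ℝ) (i : ℕ) : lin h c (i * h) = c i := by
  have : (i * h : ℝ) ∈ cell h i := ⟨le_rfl, by linarith⟩
  rw [lin_eq_of_mem hh c this]
  simp

lemma cell_subset (hh : 0 < h) (hm : m * h = ℓ) {i : ℕ} (hi : i < m) : cell h i ⊆ Icc 0 ℓ := by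
  intro x hx
  have h1 : ((i : ℝ) + 1) ≤ m := by exact_mod_cast hi
  refine ⟨(by positivity : (0 : ℝ) ≤ i * h).trans hx.1, hx.2.trans ?_⟩
  rw [← hm]; gcongr

lemma left_mem_cell (hh : 0 < h) (i : ℕ) : (i * h : ℝ) ∈ cell h i := ⟨le_rfl, by linarith⟩

lemma right_mem_cell (hh : 0 < h) (i : ℕ) : ((i + 1) * h : ℝ) ∈ cell h i := ⟨by linarith, le_rfl⟩

lemma exists_mem_cell (hh : 0 < h) (hm : m * h = ℓ) {x : ℝ} (hx : x ∈ Ico 0 ℓ) :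
    ∃ i < m, x ∈ Ico (i * h) ((i + 1) * h) := by
  have h0 : 0 ≤ x / h := div_nonneg hx.1 hh.le
  refine ⟨⌊x / h⌋₊, ?_, ?_, ?_⟩
  · rw [Nat.floor_lt h0, div_lt_iff₀ hh, hm]; exact hx.2
  · rw [← le_div_iff₀ hh]; exact Nat.floor_le h0
  · rw [← div_lt_iff₀ hh]; exact Nat.lt_floor_add_one _

lemma exists_mem_cell' (hh : 0 < h) (hm : m * h = ℓ) (hℓ : 0 < ℓ) {x : ℝ} (hx : x ∈ Icc 0 ℓ) :
    ∃ i < m, x ∈ cell h i := by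
  rcases hx.2.lt_or_eq with hlt | heq
  · obtain ⟨i, hi, hx'⟩ := exists_mem_cell hh hm ⟨hx.1, hlt⟩
    exact ⟨i, hi, hx'.1, hx'.2.le⟩
  · have hm0 : 0 < m := by
      rcases Nat.eq_zero_or_pos m with h0 | h0
      · rw [h0] at hm; simp at hm; linarith
      · exact h0
    refine ⟨m - 1, by omega, ?_, ?_⟩
    · rw [heq, ← hm, Nat.cast_pred hm0]; linarith
    · rw [heq, ← hm, Nat.cast_pred hm0]; linarith

lemma ae_mem_cell (hh : 0 < h) (hm : m * h = ℓ) :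
    ∀ᵐ x ∂(pipeMeasure ℓ), ∃ i < m, x ∈ Ioo (i * h) ((i + 1) * h) := by
  have hc : ∀ᵐ x : ℝ, x ∉ range fun i : ℕ => (i * h : ℝ) :=
    (countable_range _).ae_notMem volume
  filter_upwards [ae_restrict_mem measurableSet_Ioo, ae_restrict_of_ae hc] with x hx hxc
  obtain ⟨i, hi, hxi⟩ := exists_mem_cell hh hm (Ioo_subset_Ico_self hx)
  refine ⟨i, hi, lt_of_le_of_ne hxi.1 ?_, hxi.2⟩
  intro heq
  exact hxc ⟨i, heq⟩

lemma measurable_pc (h : ℝ) (d : ℕ → ℝ) : Measurable (pc h d) :=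
  (measurable_from_nat (f := d)).comp (Nat.measurable_floor.comp (measurable_id.div_const h))

lemma abs_pc_le (hh : 0 < h) (hm : m * h = ℓ) (d : ℕ → ℝ) {x : ℝ} (hx : x ∈ Ico 0 ℓ) :
    |pc h d x| ≤ ∑ i ∈ Finset.range m, |d i| := by
  obtain ⟨i, hi, hx'⟩ := exists_mem_cell hh hm hx
  rw [pc_eq_of_mem hh d hx']
  exact Finset.single_le_sum (f := fun i => |d i|) (fun i _ => abs_nonneg _) (Finset.mem_range.2 hi)

lemma bdd_pc (hh : 0 < h) (hm : m * h = ℓ) (d : ℕ → ℝ) : Bdd ℓ (pc h d) := by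
  refine Bdd.of_bound (measurable_pc h d).aestronglyMeasurable
    (C := ∑ i ∈ Finset.range m, |d i|) ?_
  filter_upwards [ae_restrict_mem measurableSet_Ioo] with x hx
  exact abs_pc_le hh hm d (Ioo_subset_Ico_self hx)

lemma integral_pc_mul_cell (hh : 0 < h) (d : ℕ → ℝ) (i : ℕ) {x y : ℝ} (hx : x ∈ cell h i)
    (hy : y ∈ cell h i) (f : ℝ → ℝ) :
    ∫ t in x..y, pc h d t * f t = d i * ∫ t in x..y, f t := by
  rw [← intervalIntegral.integral_const_mul]
  apply intervalIntegral.integral_congr_ae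
  have hne : ∀ᵐ t : ℝ, t ≠ (i + 1) * h := by simp [ae_iff]
  filter_upwards [hne] with t ht htm
  rw [pc_eq_of_mem hh d ⟨(le_min hx.1 hy.1).trans htm.1.le,
    lt_of_le_of_ne (htm.2.trans (max_le hx.2 hy.2)) ht⟩]

lemma integral_pc_cell (hh : 0 < h) (d : ℕ → ℝ) (i : ℕ) {x y : ℝ} (hx : x ∈ cell h i)
    (hy : y ∈ cell h i) : ∫ t in x..y, pc h d t = d i * (y - x) := by
  have := integral_pc_mul_cell hh d i hx hy (fun _ => 1)
  simpa using this

lemma sum_integral_cells (hh : 0 < h) (hm : m * h = ℓ) {f : ℝ → ℝ} (hf : Itg ℓ f) :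
    ∑ i ∈ Finset.range m, ∫ x in (i * h)..((i + 1) * h), f x = ∫ x in (0 : ℝ)..ℓ, f x := by
  have := intervalIntegral.sum_integral_adjacent_intervals (μ := volume) (f := f)
    (a := fun i : ℕ => (i * h : ℝ)) (n := m) (fun i hi => by
      have h1 := cell_subset hh hm hi (left_mem_cell hh i)
      have h2 := cell_subset hh hm hi (right_mem_cell hh i)
      have h3 := hf.ii_of_mem h1 h2
      push_cast
      exact h3)
  simp only [Nat.cast_zero, zero_mul, hm] at this
  rw [← this]
  apply Finset.sum_congr rfl
  intro i _
  push_cast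
  rfl

lemma integral_pc_mul (hh : 0 < h) (hm : m * h = ℓ) (d : ℕ → ℝ) {f : ℝ → ℝ} (hf : Itg ℓ f) :
    ∫ x in (0 : ℝ)..ℓ, pc h d x * f x
      = ∑ i ∈ Finset.range m, d i * ∫ x in (i * h)..((i + 1) * h), f x := by
  have hi : Itg ℓ (fun x => pc h d x * f x) := by
    have := Integrable.bdd_mul (μ := pipeMeasure ℓ) (c := ∑ i ∈ Finset.range m, |d i|) hf
      (measurable_pc h d).aestronglyMeasurable (by
        filter_upwards [ae_restrict_mem measurableSet_Ioo] with x hx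
        exact abs_pc_le hh hm d (Ioo_subset_Ico_self hx))
    exact this
  rw [← sum_integral_cells hh hm hi]
  apply Finset.sum_congr rfl
  intro i _
  exact integral_pc_mul_cell hh d i (left_mem_cell hh i) (right_mem_cell hh i) f

lemma lin_eq_integral (hh : 0 < h) (hm : m * h = ℓ) (c : ℕ → ℝ) {x : ℝ} (hx : x ∈ Icc 0 ℓ) :
    lin h c x = c 0 + ∫ t in (0 : ℝ)..x, pc h (slopes h c) t := by
  have hI := (bdd_pc hh hm (slopes h c)).itg
  have hℓ : 0 ≤ ℓ := hx.1.trans hx.2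
  have h00 : (0 : ℝ) ∈ Icc 0 ℓ := ⟨le_rfl, hℓ⟩
  have hgrid : ∀ i ≤ m, c i = c 0 + ∫ t in (0 : ℝ)..(i * h), pc h (slopes h c) t := by
    intro i
    induction i with
    | zero => intro _; simp
    | succ i ih =>
      intro hi
      have h1 := cell_subset hh hm (Nat.lt_of_succ_le hi) (left_mem_cell hh i)
      have h2 := cell_subset hh hm (Nat.lt_of_succ_le hi) (right_mem_cell hh i)
      push_cast
      rw [← intervalIntegral.integral_add_adjacent_intervals (hI.ii_of_mem h00 h1)
        (hI.ii_of_mem h1 h2), ← add_assoc, ← ih (by omega),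
        integral_pc_cell hh _ i (left_mem_cell hh i) (right_mem_cell hh i), slopes]
      field_simp
      ring
  rcases hℓ.eq_or_lt with h0 | hℓ
  · have : x = 0 := le_antisymm (by rw [h0]; exact hx.2) hx.1
    subst this
    have := lin_grid hh c 0
    simpa using this
  obtain ⟨i, hi, hxi⟩ := exists_mem_cell' hh hm hℓ hx
  have h1 := cell_subset hh hm hi (left_mem_cell hh i)
  rw [lin_eq_of_mem hh c hxi, ← intervalIntegral.integral_add_adjacent_intervals
    (hI.ii_of_mem h00 h1) (hI.ii_of_mem h1 hx), ← add_assoc, ← hgrid i hi.le,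
    integral_pc_cell hh _ i (left_mem_cell hh i) hxi]

lemma isPrimitive_lin (hh : 0 < h) (hm : m * h = ℓ) (c : ℕ → ℝ) :
    IsPrimitive ℓ (lin h c) (pc h (slopes h c)) := by
  refine ⟨(bdd_pc hh hm _).sq, fun x hx y hy => ?_⟩
  have hI := (bdd_pc hh hm (slopes h c)).itg
  have h00 : (0 : ℝ) ∈ Icc 0 ℓ := ⟨le_rfl, hx.1.trans hx.2⟩
  rw [lin_eq_integral hh hm c hx, lin_eq_integral hh hm c hy,
    ← intervalIntegral.integral_interval_sub_left (hI.ii_of_mem h00 hy) (hI.ii_of_mem h00 hx)]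
  ring

lemma lin_convex (hh : 0 < h) (c : ℕ → ℝ) {i : ℕ} {x : ℝ} (hx : x ∈ cell h i) :
    ∃ s ∈ Icc (0 : ℝ) 1, lin h c x = (1 - s) * c i + s * c (i + 1) := by
  refine ⟨(x - i * h) / h, ⟨div_nonneg (sub_nonneg.2 hx.1) hh.le, ?_⟩, ?_⟩
  · rw [div_le_one hh]; have := hx.2; linarith
  · rw [lin_eq_of_mem hh c hx, slopes]; field_simp; ring

lemma abs_sub_lin_le (hh : 0 < h) (c : ℕ → ℝ) {i : ℕ} {x y K : ℝ} (hx : x ∈ cell h i)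
    (h1 : |y - c i| ≤ K) (h2 : |y - c (i + 1)| ≤ K) : |y - lin h c x| ≤ K := by
  obtain ⟨s, hs, e⟩ := lin_convex hh c hx
  have e2 : y - lin h c x = (1 - s) * (y - c i) + s * (y - c (i + 1)) := by rw [e]; ring
  rw [e2]
  calc _ ≤ |(1 - s) * (y - c i)| + |s * (y - c (i + 1))| := abs_add_le _ _
    _ = (1 - s) * |y - c i| + s * |y - c (i + 1)| := by
      rw [abs_mul, abs_mul, abs_of_nonneg hs.1, abs_of_nonneg (sub_nonneg.2 hs.2)]
    _ ≤ (1 - s) * K + s * K := by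
      have := hs.1
      have := sub_nonneg.2 hs.2
      gcongr
    _ = K := by ring

lemma abs_lin_le (hh : 0 < h) (c : ℕ → ℝ) {i : ℕ} {x K : ℝ} (hx : x ∈ cell h i)
    (h1 : |c i| ≤ K) (h2 : |c (i + 1)| ≤ K) : |lin h c x| ≤ K := by
  have := abs_sub_lin_le (y := 0) hh c hx (by simpa using h1) (by simpa using h2)
  simpa using this

lemma lin_add (h : ℝ) (c d : ℕ → ℝ) (x : ℝ) :
    lin h (fun i => c i + d i) x = lin h c x + lin h d x := by unfold lin; ring

lemma lin_sub (h : ℝ) (c d : ℕ → ℝ) (x : ℝ) :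
    lin h (fun i => c i - d i) x = lin h c x - lin h d x := by unfold lin; ring

lemma lin_smul (h a : ℝ) (c : ℕ → ℝ) (x : ℝ) :
    lin h (fun i => a * c i) x = a * lin h c x := by unfold lin; ring

lemma slopes_add (h : ℝ) (c d : ℕ → ℝ) (i : ℕ) :
    slopes h (fun i => c i + d i) i = slopes h c i + slopes h d i := by unfold slopes; ring

lemma slopes_sub (h : ℝ) (c d : ℕ → ℝ) (i : ℕ) :
    slopes h (fun i => c i - d i) i = slopes h c i - slopes h d i := by unfold slopes; ring

lemma slopes_smul (h a : ℝ) (c : ℕ → ℝ) (i : ℕ) :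
    slopes h (fun i => a * c i) i = a * slopes h c i := by unfold slopes; ring

lemma pc_slopes_sub (h : ℝ) (c d : ℕ → ℝ) (x : ℝ) :
    pc h (slopes h (fun i => c i - d i)) x = pc h (slopes h c) x - pc h (slopes h d) x :=
  slopes_sub h c d _

/-- A function that is affine on the cells is the interpolant of its nodal values. -/
lemma eq_lin_of_affine (hh : 0 < h) {r : ℝ → ℝ} {i : ℕ} {c d : ℝ}
    (hr : ∀ x ∈ cell h i, r x = c + d * x) {x : ℝ} (hx : x ∈ cell h i) :
    r x = lin h (fun k => r (k * h)) x := by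
  rw [lin_eq_of_mem hh _ hx, slopes]
  have h1 := hr _ (left_mem_cell hh i)
  have h2 := hr _ (right_mem_cell hh i)
  push_cast
  rw [hr x hx, h1, h2]
  field_simp
  ring

lemma deriv_eq_slope_of_eq_lin (hh : 0 < h) {r : ℝ → ℝ} {c : ℕ → ℝ} {i : ℕ}
    (hr : ∀ x ∈ cell h i, r x = lin h c x) {x : ℝ} (hx : x ∈ Ioo (i * h) ((i + 1) * h)) :
    deriv r x = pc h (slopes h c) x := by
  rw [pc_eq_of_mem hh _ (Ioo_subset_Ico_self hx)]
  have : r =ᶠ[nhds x] fun y => c i + slopes h c i * (y - i * h) := by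
    filter_upwards [Ioo_mem_nhds hx.1 hx.2] with y hy
    have hy' : y ∈ cell h i := Ioo_subset_Icc_self hy
    rw [hr y hy', lin_eq_of_mem hh c hy']
  rw [this.deriv_eq]
  simp

/-- A local bound by the oscillation of a primitive yields a global bound. -/
lemma integral_sq_le_of_local (hh : 0 < h) (hm : m * h = ℓ) {F g : ℝ → ℝ}
    (hF : Itg ℓ (fun x => F x ^ 2)) (hg : Itg ℓ (fun x => g x ^ 2)) {K : ℝ}
    (hloc : ∀ i < m, ∀ x ∈ Ioo (i * h) ((i + 1) * h),
      F x ^ 2 ≤ K * ∫ t in (i * h)..((i + 1) * h), g t ^ 2) :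
    ∫ x in (0 : ℝ)..ℓ, F x ^ 2 ≤ h * K * ∫ t in (0 : ℝ)..ℓ, g t ^ 2 := by
  rw [← sum_integral_cells hh hm hF, ← sum_integral_cells hh hm hg, Finset.mul_sum]
  apply Finset.sum_le_sum
  intro i hi
  have hi := Finset.mem_range.1 hi
  have h1 := cell_subset hh hm hi (left_mem_cell hh i)
  have h2 := cell_subset hh hm hi (right_mem_cell hh i)
  have := intervalIntegral.integral_mono_on_of_le_Ioo (μ := volume)
    (by linarith : (i * h : ℝ) ≤ (i + 1) * h) (hF.ii_of_mem h1 h2)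
    (g := fun _ => K * ∫ t in (i * h)..((i + 1) * h), g t ^ 2) (by simp) (hloc i hi)
  refine this.trans (le_of_eq ?_)
  rw [intervalIntegral.integral_const, smul_eq_mul]
  ring

lemma IsPrimitive.sq_sub_le_cell {f g : ℝ → ℝ} (hfg : IsPrimitive ℓ f g) (hh : 0 < h)
    (hm : m * h = ℓ) {i : ℕ} (hi : i < m) {x y : ℝ} (hx : x ∈ cell h i) (hy : y ∈ cell h i) :
    |f x - f y| ≤ √(h * ∫ t in (i * h)..((i + 1) * h), g t ^ 2) := by
  have h1 := cell_subset hh hm hi (left_mem_cell hh i)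
  have h2 := cell_subset hh hm hi (right_mem_cell hh i)
  apply Real.le_sqrt_of_sq_le
  have e1 := hfg.abs_sub_le_integral h1 h2 hy hx
  have e2 := sq_integral_abs_le (by linarith : (i * h : ℝ) ≤ (i + 1) * h)
    (hfg.1.itg.ii_of_mem h1 h2) (hfg.1.sq.ii_of_mem h1 h2)
  calc |f x - f y| ^ 2 ≤ (∫ t in (i * h)..((i + 1) * h), |g t|) ^ 2 := by gcongr
    _ ≤ _ := e2
    _ = _ := by ring

/-- The interpolation error. -/
lemma IsPrimitive.integral_sub_lin_le {f g : ℝ → ℝ} (hfg : IsPrimitive ℓ f g) (hh : 0 < h)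
    (hm : m * h = ℓ) :
    ∫ x in (0 : ℝ)..ℓ, (f x - lin h (fun i => f (i * h)) x) ^ 2
      ≤ h ^ 2 * ∫ t in (0 : ℝ)..ℓ, g t ^ 2 := by
  have hl := isPrimitive_lin hh hm (fun i => f (i * h))
  have := integral_sq_le_of_local (K := h) hh hm
    (F := fun x => f x - lin h (fun i => f (i * h)) x) (g := g)
    ((hfg.bdd.sub hl.bdd).sq.sq) hfg.1.sq (by
      intro i hi x hx
      have hx' : x ∈ cell h i := Ioo_subset_Icc_self hx
      have hI : 0 ≤ ∫ t in (i * h)..((i + 1) * h), g t ^ 2 :=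
        intervalIntegral.integral_nonneg (by linarith) fun x _ => sq_nonneg _
      have e := abs_sub_lin_le (y := f x) hh (fun i => f (i * h)) hx'
        (hfg.sq_sub_le_cell hh hm hi hx' (left_mem_cell hh i))
        (by have := hfg.sq_sub_le_cell hh hm hi hx' (right_mem_cell hh i)
            push_cast; exact this)
      rw [← sq_abs]
      calc _ ≤ (√(h * ∫ t in (i * h)..((i + 1) * h), g t ^ 2)) ^ 2 := by gcongr
        _ = _ := Real.sq_sqrt (by positivity))
  calc _ ≤ _ := this
    _ = _ := by ring

/-- The approximation error of the cell averages of a nearby function. -/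
lemma IsPrimitive.integral_sub_average_le {f g F : ℝ → ℝ} (hfg : IsPrimitive ℓ f g) (hF : Sq ℓ F)
    (hh : 0 < h) (hm : m * h = ℓ) :
    ∫ x in (0 : ℝ)..ℓ, (f x - pc h (fun i => (∫ t in (i * h)..((i + 1) * h), F t) / h) x) ^ 2
      ≤ 2 * (h ^ 2 * ∫ t in (0 : ℝ)..ℓ, g t ^ 2) + 2 * ∫ t in (0 : ℝ)..ℓ, (f t - F t) ^ 2 := by
  have hp := bdd_pc hh hm (fun i => (∫ t in (i * h)..((i + 1) * h), F t) / h)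
  have hD : Itg ℓ (fun x => (f x - pc h (fun i => (∫ t in (i * h)..((i + 1) * h), F t) / h) x) ^ 2) :=
    (hfg.bdd.sub hp).sq.sq
  have hG := (hfg.bdd.sq.sub hF)
  rw [← sum_integral_cells hh hm hD, ← sum_integral_cells hh hm hfg.1.sq,
    ← sum_integral_cells hh hm hG.sq, Finset.mul_sum, Finset.mul_sum, Finset.mul_sum,
    ← Finset.sum_add_distrib]
  apply Finset.sum_le_sum
  intro i hi
  have hi := Finset.mem_range.1 hi
  have h1 := cell_subset hh hm hi (left_mem_cell hh i)
  have h2 := cell_subset hh hm hi (right_mem_cell hh i)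
  have hab : (i * h : ℝ) ≤ (i + 1) * h := by linarith
  set I := ∫ t in (i * h)..((i + 1) * h), g t ^ 2 with hI
  set J := ∫ t in (i * h)..((i + 1) * h), (f t - F t) ^ 2 with hJ
  have hI0 : 0 ≤ I := intervalIntegral.integral_nonneg hab fun x _ => sq_nonneg _
  have hloc : ∀ x ∈ Ioo (i * h) ((i + 1) * h),
      (f x - pc h (fun i => (∫ t in (i * h)..((i + 1) * h), F t) / h) x) ^ 2
        ≤ 2 * (h * I) + 2 * (J / h) := by
    intro x hx
    have hx' : x ∈ cell h i := Ioo_subset_Icc_self hx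
    rw [pc_eq_of_mem hh _ (Ioo_subset_Ico_self hx)]
    have fi := hfg.bdd.itg.ii_of_mem h1 h2
    have Fi := hF.itg.ii_of_mem h1 h2
    have e0 : f x - (∫ t in (i * h)..((i + 1) * h), F t) / h
        = (∫ t in (i * h)..((i + 1) * h), (f x - f t)) / h
          + (∫ t in (i * h)..((i + 1) * h), (f t - F t)) / h := by
      rw [intervalIntegral.integral_sub (by simp) fi, intervalIntegral.integral_sub fi Fi,
        intervalIntegral.integral_const, smul_eq_mul]
      field_simp
      ring
    have e1 : ((∫ t in (i * h)..((i + 1) * h), (f x - f t)) / h) ^ 2 ≤ h * I := by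
      have b : |∫ t in (i * h)..((i + 1) * h), (f x - f t)| ≤ √(h * I) * h := by
        have := intervalIntegral.norm_integral_le_of_norm_le_const (a := (i * h : ℝ))
          (b := (i + 1) * h) (f := fun t => f x - f t) (C := √(h * I)) (by
            intro t ht
            rw [uIoc_of_le hab] at ht
            exact hfg.sq_sub_le_cell hh hm hi hx' (Ioc_subset_Icc_self ht))
        rw [Real.norm_eq_abs] at this
        have e : |((i : ℝ) + 1) * h - i * h| = h := by
          rw [show ((i : ℝ) + 1) * h - i * h = h by ring, abs_of_pos hh]
        rwa [e] at this
      rw [div_pow, div_le_iff₀ (by positivity), ← sq_abs]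
      calc _ ≤ (√(h * I) * h) ^ 2 := by gcongr
        _ = _ := by rw [mul_pow, Real.sq_sqrt (by positivity)]
    have e2 : ((∫ t in (i * h)..((i + 1) * h), (f t - F t)) / h) ^ 2 ≤ J / h := by
      have c1 := sq_integral_abs_le hab (hG.itg.ii_of_mem h1 h2) (hG.sq.ii_of_mem h1 h2)
      have c2 : |∫ t in (i * h)..((i + 1) * h), (f t - F t)|
        ≤ ∫ t in (i * h)..((i + 1) * h), |f t - F t| :=
        intervalIntegral.abs_integral_le_integral_abs hab
      rw [div_pow, div_le_iff₀ (by positivity), ← sq_abs]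
      calc _ ≤ (∫ t in (i * h)..((i + 1) * h), |f t - F t|) ^ 2 := by gcongr
        _ ≤ _ := c1
        _ = _ := by field_simp; ring
    rw [e0]
    linarith [sq_nonneg ((∫ t in (i * h)..((i + 1) * h), (f x - f t)) / h
      - (∫ t in (i * h)..((i + 1) * h), (f t - F t)) / h)]
  have := intervalIntegral.integral_mono_on_of_le_Ioo (μ := volume) hab (hD.ii_of_mem h1 h2)
    (g := fun _ => 2 * (h * I) + 2 * (J / h)) (by simp) hloc
  refine this.trans (le_of_eq ?_)
  rw [intervalIntegral.integral_const, smul_eq_mul]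
  field_simp
  ring

/-- The nodal values of the trapezoidal function that is `1` between the cells `j` and `i`. -/
def trapezoid (j i k : ℕ) : ℝ := if j < k ∧ k ≤ i then 1 else 0

lemma slopes_trapezoid {j i : ℕ} (hji : j < i) (k : ℕ) :
    slopes h (trapezoid j i) k = (if k = j then 1 / h else 0) - (if k = i then 1 / h else 0) := by
  unfold slopes trapezoid
  rcases lt_trichotomy k j with hk | hk | hk
  · rw [if_neg (by omega), if_neg (by omega), if_neg (by omega), if_neg (by omega)]; simp
  · rw [if_pos (by omega), if_neg (by omega), if_pos (by omega), if_neg (by omega)]; simp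
  · rcases lt_trichotomy k i with hk' | hk' | hk'
    · rw [if_pos (by omega), if_pos (by omega), if_neg (by omega), if_neg (by omega)]; simp
    · rw [if_neg (by omega), if_pos (by omega), if_neg (by omega), if_pos (by omega)]
      simp; ring
    · rw [if_neg (by omega), if_neg (by omega), if_neg (by omega), if_neg (by omega)]; simp

lemma integral_slopes_trapezoid (hh : 0 < h) (hm : m * h = ℓ) {j i : ℕ} (hji : j < i) (hi : i < m)
    {f : ℝ → ℝ} (hf : Itg ℓ f) :
    ∫ x in (0 : ℝ)..ℓ, f x * pc h (slopes h (trapezoid j i)) x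
      = (∫ x in (j * h)..((j + 1) * h), f x) / h - (∫ x in (i * h)..((i + 1) * h), f x) / h := by
  have e : ∀ x, f x * pc h (slopes h (trapezoid j i)) x
    = pc h (slopes h (trapezoid j i)) x * f x := fun x => mul_comm _ _
  simp only [e]
  rw [integral_pc_mul hh hm _ hf]
  simp only [slopes_trapezoid hji, sub_mul, ite_mul, zero_mul, Finset.sum_sub_distrib,
    Finset.sum_ite_eq', Finset.mem_range]
  rw [if_pos (by omega), if_pos hi]
  ring

lemma abs_lin_trapezoid_le (hh : 0 < h) {j i : ℕ} {x : ℝ} (hx : 0 ≤ x) :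
    |lin h (trapezoid j i) x| ≤ 1 := by
  have h0 : 0 ≤ x / h := div_nonneg hx hh.le
  have hx' : x ∈ cell h ⌊x / h⌋₊ := by
    constructor
    · rw [← le_div_iff₀ hh]; exact Nat.floor_le h0
    · rw [← div_le_iff₀ hh]; exact (Nat.lt_floor_add_one _).le
  apply abs_lin_le hh _ hx' <;> unfold trapezoid <;> split_ifs <;> simp

lemma lin_trapezoid_eq_zero (hh : 0 < h) {j i : ℕ} {x : ℝ} (hx : 0 ≤ x)
    (hx' : x < j * h ∨ (i + 1) * h ≤ x) : lin h (trapezoid j i) x = 0 := by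
  have h0 : 0 ≤ x / h := div_nonneg hx hh.le
  have hk : ⌊x / h⌋₊ < j ∨ i + 1 ≤ ⌊x / h⌋₊ := by
    rcases hx' with hx' | hx'
    · left
      rw [Nat.floor_lt h0, div_lt_iff₀ hh]; exact hx'
    · right
      rw [Nat.le_floor_iff h0, le_div_iff₀ hh]; push_cast; exact hx'
  unfold lin trapezoid
  rw [if_neg (by omega), if_neg (by omega)]
  simp

/-- Testing with a trapezoidal function. -/
lemma abs_integral_mul_trapezoid_le (hh : 0 < h) (hm : m * h = ℓ) {j i : ℕ} (hji : j < i)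
    (hi : i < m) {g : ℝ → ℝ} (hg : Sq ℓ g) :
    |∫ x in (0 : ℝ)..ℓ, g x * lin h (trapezoid j i) x|
      ≤ √((((i : ℝ) + 1) * h - j * h) * ∫ t in (0 : ℝ)..ℓ, g t ^ 2) := by
  have h1 := cell_subset hh hm (hji.trans hi) (left_mem_cell hh j)
  have h2 := cell_subset hh hm hi (right_mem_cell hh i)
  have hl := isPrimitive_lin hh hm (trapezoid j i)
  have hI : Itg ℓ (fun x => g x * lin h (trapezoid j i) x) := hg.mul hl.bdd.sq
  have hℓ : 0 ≤ ℓ := h1.1.trans h1.2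
  have h00 : (0 : ℝ) ∈ Icc 0 ℓ := ⟨le_rfl, hℓ⟩
  have hll : ℓ ∈ Icc 0 ℓ := ⟨hℓ, le_rfl⟩
  have hjc : (j : ℝ) + 1 ≤ i := by exact_mod_cast hji
  have hab : (j * h : ℝ) ≤ (i + 1) * h := by gcongr; linarith
  have z1 : ∫ x in (0 : ℝ)..(j * h), g x * lin h (trapezoid j i) x = 0 := by
    apply intervalIntegral.integral_zero_ae
    have hne : ∀ᵐ t : ℝ, t ≠ j * h := by simp [ae_iff]
    filter_upwards [hne] with t ht htm
    rw [uIoc_of_le h1.1] at htm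
    rw [lin_trapezoid_eq_zero hh htm.1.le (Or.inl (lt_of_le_of_ne htm.2 ht)), mul_zero]
  have z2 : ∫ x in ((i + 1) * h)..ℓ, g x * lin h (trapezoid j i) x = 0 := by
    apply intervalIntegral.integral_zero_ae
    filter_upwards with t htm
    rw [uIoc_of_le h2.2] at htm
    rw [lin_trapezoid_eq_zero hh (h2.1.trans htm.1.le) (Or.inr htm.1.le), mul_zero]
  rw [← intervalIntegral.integral_add_adjacent_intervals (hI.ii_of_mem h00 h1) (hI.ii_of_mem h1 hll),
    ← intervalIntegral.integral_add_adjacent_intervals (hI.ii_of_mem h1 h2) (hI.ii_of_mem h2 hll),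
    z1, z2, zero_add, add_zero]
  apply Real.le_sqrt_of_sq_le
  have e1 : |∫ x in (j * h)..((i + 1) * h), g x * lin h (trapezoid j i) x|
      ≤ ∫ x in (j * h)..((i + 1) * h), |g x| := by
    refine (intervalIntegral.abs_integral_le_integral_abs hab).trans ?_
    apply intervalIntegral.integral_mono_on hab (hI.ii_of_mem h1 h2).abs
      (hg.itg.ii_of_mem h1 h2).abs
    intro x hx
    rw [abs_mul]
    exact mul_le_of_le_one_right (abs_nonneg _) (abs_lin_trapezoid_le hh (h1.1.trans hx.1))
  calc _ ≤ (∫ x in (j * h)..((i + 1) * h), |g x|) ^ 2 := by gcongr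
    _ ≤ _ := sq_integral_le_pipe hg h1 h2 hab

end Mesh

/-! ### Regularity in time -/

section Time

variable {X : Type*} [NormedAddCommGroup X] [NormedSpace ℝ X] {T C : ℝ} {U : ℝ → X}

lemma norm_integral_le_of_ae {U' : ℝ → X}
    (hb : ∀ᵐ t ∂(volume.restrict (Ioo 0 T)), ‖U' t‖ ≤ C) {t s : ℝ} (ht : t ∈ Icc 0 T)
    (hs : s ∈ Icc 0 T) : ‖∫ r in s..t, U' r‖ ≤ C * |t - s| := by
  apply intervalIntegral.norm_integral_le_of_norm_le_const_ae
  rw [ae_restrict_iff' measurableSet_Ioo] at hb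
  have hne : ∀ᵐ r : ℝ, r ≠ T := by simp [ae_iff]
  filter_upwards [hb, hne] with r hr hne hrm
  refine hr ⟨?_, ?_⟩
  · exact (le_min hs.1 ht.1).trans_lt hrm.1
  · exact lt_of_le_of_ne (hrm.2.trans (max_le hs.2 ht.2)) hne

lemma intervalIntegrable_of_ae_bound {U' : ℝ → X}
    (hm : AEStronglyMeasurable U' (volume.restrict (Ioo 0 T)))
    (hb : ∀ᵐ t ∂(volume.restrict (Ioo 0 T)), ‖U' t‖ ≤ C) {t s : ℝ} (ht : t ∈ Icc 0 T)
    (hs : s ∈ Icc 0 T) : IntervalIntegrable U' volume s t := by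
  have hT : 0 ≤ T := ht.1.trans ht.2
  have h1 : IntegrableOn U' (Ioo 0 T) volume :=
    Integrable.of_bound hm C hb
  have h2 := (intervalIntegrable_iff_integrableOn_Ioo_of_le hT).2 h1
  refine h2.mono_set ?_
  rw [uIcc_of_le hT]
  exact uIcc_subset_Icc hs ht

lemma sub_eq_integral_of_primitive {U' : ℝ → X}
    (hm : AEStronglyMeasurable U' (volume.restrict (Ioo 0 T)))
    (hb : ∀ᵐ t ∂(volume.restrict (Ioo 0 T)), ‖U' t‖ ≤ C)
    (hU : ∀ t ∈ Icc 0 T, U t = U 0 + ∫ s in (0 : ℝ)..t, U' s) {t s : ℝ} (ht : t ∈ Icc 0 T)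
    (hs : s ∈ Icc 0 T) : U t - U s = ∫ r in s..t, U' r := by
  have h0 : (0 : ℝ) ∈ Icc 0 T := ⟨le_rfl, ht.1.trans ht.2⟩
  rw [hU t ht, hU s hs, ← intervalIntegral.integral_interval_sub_left
    (intervalIntegrable_of_ae_bound hm hb ht h0) (intervalIntegrable_of_ae_bound hm hb hs h0)]
  abel

lemma BoundedWInfty.lipschitz (h : BoundedWInfty T C 1 U) {t s : ℝ} (ht : t ∈ Icc 0 T)
    (hs : s ∈ Icc 0 T) : ‖U t - U s‖ ≤ C * |t - s| := by
  obtain ⟨-, -, U', hU, hm, hb⟩ := h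
  rw [sub_eq_integral_of_primitive hm hb hU ht hs]
  exact norm_integral_le_of_ae hb ht hs

lemma norm_le_of_ae_of_lipschitz (hT : 0 < T)
    (hae : ∀ᵐ t ∂(volume.restrict (Ioo 0 T)), ‖U t‖ ≤ C)
    (hL : ∀ t ∈ Icc 0 T, ∀ s ∈ Icc 0 T, ‖U t - U s‖ ≤ C * |t - s|) {t : ℝ} (ht : t ∈ Icc 0 T) :
    ‖U t‖ ≤ C := by
  apply le_of_forall_pos_le_add
  intro δ hδ
  have hC : 0 ≤ C := by
    have := hL 0 ⟨le_rfl, hT.le⟩ T ⟨hT.le, le_rfl⟩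
    have h2 := (norm_nonneg _).trans this
    rw [zero_sub, abs_neg, abs_of_pos hT] at h2
    exact nonneg_of_mul_nonneg_left h2 hT
  set ξ := δ / (C + 1) with hξ
  have hξ0 : 0 < ξ := by positivity
  obtain ⟨α, β, hαβ, h0, h1, hd⟩ : ∃ α β : ℝ, α < β ∧ 0 ≤ α ∧ β ≤ T ∧
      ∀ s ∈ Ioo α β, |t - s| ≤ ξ := by
    rcases lt_or_ge t T with htT | htT
    · refine ⟨t, min T (t + ξ), lt_min htT (by linarith), ht.1, min_le_left _ _, fun s hs => ?_⟩
      have := hs.2.trans_le (min_le_right _ _)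
      rw [abs_le]; constructor <;> linarith [hs.1]
    · refine ⟨max 0 (t - ξ), t, max_lt (by linarith) (by linarith), le_max_left _ _, ht.2,
        fun s hs => ?_⟩
      have := (le_max_right 0 (t - ξ)).trans_lt hs.1
      rw [abs_le]; constructor <;> linarith [hs.2]
  rw [ae_restrict_iff' measurableSet_Ioo] at hae
  have hpos : volume (Ioo α β) ≠ 0 := by
    rw [Real.volume_Ioo]; simpa using hαβ
  have : ∃ s ∈ Ioo α β, (s ∈ Ioo 0 T → ‖U s‖ ≤ C) := by
    by_contra! hc
    apply hpos
    refine measure_mono_null (fun s hs => ?_) (ae_iff.1 hae)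
    have := hc s hs
    simp only [mem_ofPred_eq]
    intro hh
    exact absurd (hh this.1) (not_le.2 this.2)
  obtain ⟨s, hs, hsC⟩ := this
  have hsT : s ∈ Ioo 0 T := ⟨h0.trans_lt hs.1, hs.2.trans_le h1⟩
  have h2 := hL t ht s (Ioo_subset_Icc_self hsT)
  have h3 : C * |t - s| ≤ C * ξ := by gcongr; exact hd s hs
  have h4 : C * ξ ≤ δ := by
    rw [hξ, mul_div_assoc', div_le_iff₀ (by positivity)]
    linarith
  calc ‖U t‖ = ‖U s + (U t - U s)‖ := by congr 1; abel
    _ ≤ ‖U s‖ + ‖U t - U s‖ := norm_add_le _ _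
    _ ≤ C + δ := by linarith [hsC hsT]

lemma BoundedWInfty.norm_le (hT : 0 < T) (h : BoundedWInfty T C 1 U) {t : ℝ} (ht : t ∈ Icc 0 T) :
    ‖U t‖ ≤ C :=
  norm_le_of_ae_of_lipschitz hT h.2.1 (fun _ ht _ hs => h.lipschitz ht hs) ht

lemma BoundedWInfty.exists_deriv [CompleteSpace X] (hT : 0 < T) (h : BoundedWInfty T C 2 U) :
    ∃ U' : ℝ → X, (∀ t ∈ Icc 0 T, derivWithin U (Icc 0 T) t = U' t) ∧
      (∀ t ∈ Icc 0 T, ‖U' t‖ ≤ C) ∧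
      (∀ t ∈ Icc 0 T, ∀ s ∈ Icc 0 T, ‖U' t - U' s‖ ≤ C * |t - s|) ∧
      ∀ t ∈ Icc 0 T, ∀ s ∈ Icc 0 T, ‖U t - U s - (t - s) • U' t‖ ≤ C * |t - s| ^ 2 := by
  obtain ⟨-, -, U', hU, hU'⟩ := h
  have hL : ∀ t ∈ Icc 0 T, ∀ s ∈ Icc 0 T, ‖U' t - U' s‖ ≤ C * |t - s| :=
    fun t ht s hs => BoundedWInfty.lipschitz hU' ht hs
  have hC : 0 ≤ C := by
    have := hL 0 ⟨le_rfl, hT.le⟩ T ⟨hT.le, le_rfl⟩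
    have h2 := (norm_nonneg _).trans this
    rw [zero_sub, abs_neg, abs_of_pos hT] at h2
    exact nonneg_of_mul_nonneg_left h2 hT
  have hquad : ∀ t ∈ Icc 0 T, ∀ s ∈ Icc 0 T,
      ‖U t - U s - (t - s) • U' t‖ ≤ C * |t - s| ^ 2 := by
    intro t ht s hs
    have hi := intervalIntegrable_of_ae_bound hU'.1 hU'.2.1 ht hs
    have e : U t - U s - (t - s) • U' t = ∫ r in s..t, (U' r - U' t) := by
      rw [intervalIntegral.integral_sub hi (by simp),
        ← sub_eq_integral_of_primitive hU'.1 hU'.2.1 hU ht hs, intervalIntegral.integral_const]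
    rw [e, sq, ← mul_assoc]
    apply intervalIntegral.norm_integral_le_of_norm_le_const
    intro r hr
    have hr' : r ∈ uIcc s t := uIoc_subset_uIcc hr
    have hrT : r ∈ Icc 0 T := uIcc_subset_Icc hs ht hr'
    refine (hL r hrT t ht).trans ?_
    have : |r - t| ≤ |t - s| := by
      rw [abs_sub_comm r t]
      exact abs_sub_right_of_mem_uIcc hr'
    gcongr
  refine ⟨U', fun t ht => ?_, fun t ht => hU'.norm_le hT ht, hL, hquad⟩
  have hd : HasDerivWithinAt U (U' t) (Icc 0 T) t := by
    rw [hasDerivWithinAt_iff_isLittleO]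
    have h1 : (fun s => U s - U t - (s - t) • U' t) =O[nhdsWithin t (Icc 0 T)]
        fun s => (s - t) ^ 2 := by
      refine Asymptotics.IsBigO.of_bound (2 * C) ?_
      filter_upwards [self_mem_nhdsWithin] with s hs
      have e : U s - U t - (s - t) • U' t = (U s - U t - (s - t) • U' s) + (s - t) • (U' s - U' t) := by
        rw [smul_sub]; abel
      rw [e, Real.norm_eq_abs, abs_pow]
      refine (norm_add_le _ _).trans ?_
      have h1 := hquad s hs t ht
      have h2 : ‖(s - t) • (U' s - U' t)‖ ≤ |s - t| * (C * |s - t|) := by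
        rw [norm_smul, Real.norm_eq_abs]
        gcongr
        exact hL s hs t ht
      linarith
    have h2 := (Asymptotics.isLittleO_pow_sub_sub t one_lt_two).mono
      (nhdsWithin_le_nhds (s := Icc 0 T))
    simp only [Real.norm_eq_abs, sq_abs] at h2
    exact h1.trans_isLittleO h2
  exact hd.derivWithin ((uniqueDiffOn_Icc hT) t ht)

end Time

section SpaceTime

variable {ℓ : ℝ}

lemma norm_sq_eq_integral (hℓ : 0 ≤ ℓ) (F : L2 ℓ) {f : ℝ → ℝ}
    (hF : ∀ᵐ x ∂(pipeMeasure ℓ), F x = f x) : ‖F‖ ^ 2 = ∫ x in (0 : ℝ)..ℓ, f x ^ 2 := by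
  rw [integral_pipe hℓ, ← real_inner_self_eq_norm_sq, MeasureTheory.L2.inner_def]
  apply integral_congr_ae
  filter_upwards [hF] with x hx
  rw [hx]
  simp [sq]

lemma toL2_ae {f : ℝ → ℝ} (hf : Sq ℓ f) : ∀ᵐ x ∂(pipeMeasure ℓ), toL2 ℓ f x = f x := by
  unfold toL2
  rw [dif_pos (show MemLp f 2 (volume.restrict (Ioo 0 ℓ)) from hf)]
  exact MemLp.coeFn_toLp hf

lemma integral_sq_le_of_norm_le (hℓ : 0 ≤ ℓ) {F : L2 ℓ} {f : ℝ → ℝ} {B : ℝ}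
    (hF : ∀ᵐ x ∂(pipeMeasure ℓ), F x = f x) (hB : ‖F‖ ≤ B) :
    ∫ x in (0 : ℝ)..ℓ, f x ^ 2 ≤ B ^ 2 := by
  rw [← norm_sq_eq_integral hℓ F hF]
  gcongr

lemma sub_ae {F H : L2 ℓ} {f g : ℝ → ℝ} (hF : ∀ᵐ x ∂(pipeMeasure ℓ), F x = f x)
    (hH : ∀ᵐ x ∂(pipeMeasure ℓ), H x = g x) :
    ∀ᵐ x ∂(pipeMeasure ℓ), (F - H : L2 ℓ) x = f x - g x := by
  filter_upwards [hF, hH, Lp.coeFn_sub F H] with x h1 h2 h3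
  rw [h3, Pi.sub_apply, h1, h2]

lemma smul_ae {F : L2 ℓ} {f : ℝ → ℝ} (c : ℝ) (hF : ∀ᵐ x ∂(pipeMeasure ℓ), F x = f x) :
    ∀ᵐ x ∂(pipeMeasure ℓ), (c • F : L2 ℓ) x = c * f x := by
  filter_upwards [hF, Lp.coeFn_smul c F] with x h1 h3
  rw [h3, Pi.smul_apply, h1, smul_eq_mul]

/-- The quantitative regularity of a function on one pipe, with time derivative `ut`. -/
structure PipeRegular (T ℓ B : ℝ) (u ut : ℝ → ℝ → ℝ) : Prop where
  prim : ∀ t ∈ Icc 0 T, IsPrimitive ℓ (u t) (deriv (u t))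
  sq_t : ∀ t ∈ Icc 0 T, Sq ℓ (ut t)
  bound_x : ∀ t ∈ Icc 0 T, ∫ x in (0 : ℝ)..ℓ, deriv (u t) x ^ 2 ≤ B ^ 2
  bound_t : ∀ t ∈ Icc 0 T, ∫ x in (0 : ℝ)..ℓ, ut t x ^ 2 ≤ B ^ 2
  lip_x : ∀ t ∈ Icc 0 T, ∀ s ∈ Icc 0 T,
    ∫ x in (0 : ℝ)..ℓ, (deriv (u t) x - deriv (u s) x) ^ 2 ≤ (B * |t - s|) ^ 2
  lip_t : ∀ t ∈ Icc 0 T, ∀ s ∈ Icc 0 T,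
    ∫ x in (0 : ℝ)..ℓ, (ut t x - ut s x) ^ 2 ≤ (B * |t - s|) ^ 2
  consist : ∀ t ∈ Icc 0 T, ∀ s ∈ Icc 0 T,
    ∫ x in (0 : ℝ)..ℓ, (u t x - u s x - (t - s) * ut t x) ^ 2 ≤ (B * |t - s| ^ 2) ^ 2
  lip_sup : ∀ t ∈ Icc 0 T, ∀ s ∈ Icc 0 T, ∀ x ∈ Icc 0 ℓ,
    |u t x - u s x| ≤ B * (1 / √ℓ + √ℓ) * |t - s|

lemma pipeRegular_of_trajectory {T B : ℝ} {u : ℝ → ℝ → ℝ} (hT : 0 < T) (hℓ : 0 < ℓ) (hB : 0 ≤ B)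
    (hc : IsClassicalTrajectory T ℓ u) (hs : IsSmoothTrajectory T ℓ B u) :
    PipeRegular T ℓ B u (fun t x => timeDeriv T ℓ u t x) := by
  have hprim : ∀ t ∈ Icc 0 T, IsPrimitive ℓ (u t) (deriv (u t)) := fun t ht =>
    isPrimitive_of_ac (hc.memH1 t ht).1 hℓ.le (hc.memH1 t ht).2 (Filter.Eventually.of_forall
      fun _ => rfl)
  have hu : ∀ t ∈ Icc 0 T, ∀ᵐ x ∂(pipeMeasure ℓ), toL2 ℓ (u t) x = u t x :=
    fun t ht => toL2_ae (hprim t ht).bdd.sq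
  have hux : ∀ t ∈ Icc 0 T, ∀ᵐ x ∂(pipeMeasure ℓ), toL2 ℓ (deriv (u t)) x = deriv (u t) x :=
    fun t ht => toL2_ae (hprim t ht).1
  obtain ⟨U', hU', hb', hL', hq⟩ := hs.w2L2.exists_deriv hT
  have hut : ∀ t ∈ Icc 0 T, ∀ᵐ x ∂(pipeMeasure ℓ), U' t x = timeDeriv T ℓ u t x := by
    intro t ht
    unfold timeDeriv
    rw [hU' t ht]
    exact Filter.Eventually.of_forall fun _ => rfl
  have hlx : ∀ t ∈ Icc 0 T, ∀ s ∈ Icc 0 T,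
      ∫ x in (0 : ℝ)..ℓ, (deriv (u t) x - deriv (u s) x) ^ 2 ≤ (B * |t - s|) ^ 2 :=
    fun t ht s hs' => integral_sq_le_of_norm_le hℓ.le (sub_ae (hux t ht) (hux s hs'))
      (hs.w1H1.lipschitz ht hs')
  refine ⟨hprim, fun t ht => Lp.memLp _, fun t ht => ?_, fun t ht => ?_, hlx, fun t ht s hs' => ?_,
    fun t ht s hs' => ?_, fun t ht s hs' x hx => ?_⟩
  · exact integral_sq_le_of_norm_le hℓ.le (hux t ht) (hs.w1H1.norm_le hT ht)
  · exact integral_sq_le_of_norm_le hℓ.le (hut t ht) (hb' t ht)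
  · exact integral_sq_le_of_norm_le hℓ.le (sub_ae (hut t ht) (hut s hs')) (hL' t ht s hs')
  · exact integral_sq_le_of_norm_le hℓ.le
      (sub_ae (sub_ae (hu t ht) (hu s hs')) (smul_ae _ (hut t ht))) (hq t ht s hs')
  · have h1 := ((hprim t ht).sub (hprim s hs')).sobolev hℓ (B := B * |t - s|) (by positivity)
      (integral_sq_le_of_norm_le hℓ.le (sub_ae (hu t ht) (hu s hs')) (hs.w1L2.lipschitz ht hs'))
      (hlx t ht s hs') hx
    calc _ ≤ _ := h1
      _ = _ := by ring

lemma ac_comp_of_lipschitz {f g : ℝ → ℝ} {K : ℝ} {s : Set ℝ} (hℓ : 0 ≤ ℓ)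
    (hf : AbsolutelyContinuousOnInterval f 0 ℓ) (hfs : ∀ x ∈ Icc 0 ℓ, f x ∈ s) (hK : 0 ≤ K)
    (hg : ∀ x ∈ s, ∀ y ∈ s, |g x - g y| ≤ K * |x - y|) :
    AbsolutelyContinuousOnInterval (fun x => g (f x)) 0 ℓ := by
  rw [absolutelyContinuousOnInterval_iff] at hf ⊢
  intro δ hδ
  obtain ⟨η, hη, h⟩ := hf (δ / (K + 1)) (by positivity)
  refine ⟨η, hη, fun I hI hsum => ?_⟩
  have h1 := h I hI hsum
  have hmem : ∀ i ∈ Finset.range I.1, (I.2 i).1 ∈ Icc 0 ℓ ∧ (I.2 i).2 ∈ Icc 0 ℓ := by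
    intro i hi
    have := hI.1 i hi
    rw [uIcc_of_le hℓ] at this
    exact this
  calc _ ≤ ∑ i ∈ Finset.range I.1, K * dist (f (I.2 i).1) (f (I.2 i).2) := by
        apply Finset.sum_le_sum
        intro i hi
        rw [Real.dist_eq, Real.dist_eq]
        exact hg _ (hfs _ (hmem i hi).1) _ (hfs _ (hmem i hi).2)
    _ = K * ∑ i ∈ Finset.range I.1, dist (f (I.2 i).1) (f (I.2 i).2) := by rw [Finset.mul_sum]
    _ ≤ K * (δ / (K + 1)) := by gcongr
    _ < δ := by
      rw [mul_div_assoc', div_lt_iff₀ (by positivity)]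
      linarith

end SpaceTime

/-! ### Quantitative description of the exact solution on the network -/

/-- The constants of the problem. -/
structure Consts where
  T : ℝ
  εm : ℝ
  γmin : ℝ
  γmax : ℝ
  amin : ℝ
  amax : ℝ
  ρmin : ℝ
  ρmax : ℝ
  wmax : ℝ
  T_pos : 0 < T
  εm_pos : 0 < εm
  γmin_pos : 0 < γmin
  γ_le : γmin ≤ γmax
  amin_pos : 0 < amin
  a_le : amin ≤ amax
  ρmin_pos : 0 < ρmin
  ρ_le : ρmin ≤ ρmax
  wmax_pos : 0 < wmax

namespace Consts

variable (c : Consts)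

/-- The lower bound for the density of admissible states. -/
noncomputable def r₀ : ℝ := 2 * c.ρmin / 3

/-- The upper bound for the density of admissible states. -/
noncomputable def r₁ : ℝ := 3 * c.ρmax / 2

/-- The bound for the velocity of admissible states. -/
noncomputable def W : ℝ := 3 * c.wmax / 2

lemma amax_pos : 0 < c.amax := c.amin_pos.trans_le c.a_le
lemma γmax_pos : 0 < c.γmax := c.γmin_pos.trans_le c.γ_le
lemma r₀_pos : 0 < c.r₀ := by have := c.ρmin_pos; unfold r₀; positivity
lemma ρmax_pos : 0 < c.ρmax := c.ρmin_pos.trans_le c.ρ_le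
lemma r₁_pos : 0 < c.r₁ := by have := c.ρmax_pos; unfold r₁; positivity
lemma W_pos : 0 < c.W := by have := c.wmax_pos; unfold W; positivity
lemma wmax_le_W : c.wmax ≤ c.W := by have := c.wmax_pos; unfold W; linarith

lemma mem_J {r : ℝ} (h1 : c.ρmin ≤ r) (h2 : r ≤ c.ρmax) : r ∈ Icc c.r₀ c.r₁ := by
  have := c.ρmin_pos
  have := c.ρmax_pos
  unfold r₀ r₁
  constructor <;> linarith

end Consts

lemma exists_pressureBounds (c : Consts) {P : ℝ → ℝ} (hP : ContDiffOn ℝ ∞ P (Ioi 0))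
    (hsub : ∀ r ∈ Icc (2 * c.ρmin / 3) (3 * c.ρmax / 2),
      4 * c.εm ^ 2 * c.wmax ^ 2 ≤ r * deriv (deriv P) r) :
    ∃ q₀ q₁ q₂, PressureBounds P c.r₀ c.r₁ c.W c.εm q₀ q₁ q₂ := by
  have hJ : Icc c.r₀ c.r₁ ⊆ Ioi 0 := fun r hr => c.r₀_pos.trans_le hr.1
  have h1 : ContDiffOn ℝ ∞ (deriv P) (Ioi 0) := hP.deriv_of_isOpen isOpen_Ioi le_rfl
  have h2 : ContDiffOn ℝ ∞ (deriv (deriv P)) (Ioi 0) := h1.deriv_of_isOpen isOpen_Ioi le_rfl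
  have h3 : ContDiffOn ℝ ∞ (deriv (deriv (deriv P))) (Ioi 0) := h2.deriv_of_isOpen isOpen_Ioi le_rfl
  have hd : ∀ {f : ℝ → ℝ}, ContDiffOn ℝ ∞ f (Ioi 0) → ∀ r ∈ Ioi (0 : ℝ), HasDerivAt f (deriv f r) r :=
    fun hf r hr => ((hf.differentiableOn (by simp)).differentiableAt (isOpen_Ioi.mem_nhds hr)).hasDerivAt
  obtain ⟨K1, hK1⟩ := isCompact_Icc.exists_bound_of_continuousOn (h2.continuousOn.mono hJ)
  obtain ⟨K2, hK2⟩ := isCompact_Icc.exists_bound_of_continuousOn (h3.continuousOn.mono hJ)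
  have hε := c.εm_pos
  have hw := c.wmax_pos
  have hr1 := c.r₁_pos
  refine ⟨4 * c.εm ^ 2 * c.wmax ^ 2 / c.r₁, |K1| + 1, |K2| + 1, c.r₀_pos, c.W_pos, hε, by positivity,
    by positivity, by positivity, fun r hr => hd hP r (hJ hr), fun r hr => hd h1 r (hJ hr),
    fun r hr => ?_, fun r hr => ?_, fun r hr s hs => ?_, fun r hr => ?_⟩
  · have h0 := hJ hr
    have := hsub r hr
    rw [div_le_iff₀ hr1]
    have hpos : 0 < deriv (deriv P) r := by
      have h5 : 0 < r * deriv (deriv P) r := lt_of_lt_of_le (by positivity) this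
      exact pos_of_mul_pos_of_pos_left h5 h0.le
    calc _ ≤ _ := this
      _ = deriv (deriv P) r * r := mul_comm _ _
      _ ≤ _ := by gcongr; exact hr.2
  · have := hK1 r hr
    rw [Real.norm_eq_abs] at this
    linarith [le_abs_self (deriv (deriv P) r), le_abs_self K1]
  · have := (convex_Icc c.r₀ c.r₁).norm_image_sub_le_of_norm_hasDerivWithin_le
      (f := deriv (deriv P)) (f' := deriv (deriv (deriv P))) (C := |K2| + 1)
      (fun r hr => (hd h2 r (hJ hr)).hasDerivWithinAt)
      (fun r hr => (hK2 r hr).trans (by linarith [le_abs_self K2])) hs hr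
    simpa [Real.norm_eq_abs] using this
  · have := hsub r hr
    unfold Consts.W
    nlinarith
  where
    pos_of_mul_pos_of_pos_left {a b : ℝ} (h : 0 < a * b) (ha : 0 ≤ a) : 0 < b :=
      pos_of_mul_pos_right h ha

namespace PipeNetwork

variable {V E : Type*} [Fintype V] [DecidableEq V] [Fintype E] (G : PipeNetwork V E)

/-- The integral over the network. -/
noncomputable def tot (f : E → ℝ → ℝ) : ℝ := ∑ e, ∫ x in (0 : ℝ)..G.len e, f e x

/-- Integrability over the network. -/
def Integ (f : E → ℝ → ℝ) : Prop := ∀ e, Itg (G.len e) (f e)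

section Total

variable {G} {f g : E → ℝ → ℝ}

lemma Integ.add (hf : G.Integ f) (hg : G.Integ g) : G.Integ (fun e x => f e x + g e x) :=
  fun e => (hf e).add (hg e)
lemma Integ.sub (hf : G.Integ f) (hg : G.Integ g) : G.Integ (fun e x => f e x - g e x) :=
  fun e => (hf e).sub (hg e)
lemma Integ.cmul (c : ℝ) (hf : G.Integ f) : G.Integ (fun e x => c * f e x) :=
  fun e => (hf e).cmul c
lemma Integ.ii (hf : G.Integ f) (e : E) : IntervalIntegrable (f e) volume 0 (G.len e) :=
  (intervalIntegrable_pipe (G.len_pos e).le).2 (hf e)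

lemma tot_add (hf : G.Integ f) (hg : G.Integ g) :
    G.tot (fun e x => f e x + g e x) = G.tot f + G.tot g := by
  unfold tot
  rw [← Finset.sum_add_distrib]
  exact Finset.sum_congr rfl fun e _ => intervalIntegral.integral_add (hf.ii e) (hg.ii e)

lemma tot_sub (hf : G.Integ f) (hg : G.Integ g) :
    G.tot (fun e x => f e x - g e x) = G.tot f - G.tot g := by
  unfold tot
  rw [← Finset.sum_sub_distrib]
  exact Finset.sum_congr rfl fun e _ => intervalIntegral.integral_sub (hf.ii e) (hg.ii e)

lemma tot_cmul (c : ℝ) (f : E → ℝ → ℝ) : G.tot (fun e x => c * f e x) = c * G.tot f := by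
  unfold tot
  rw [Finset.mul_sum]
  exact Finset.sum_congr rfl fun e _ => intervalIntegral.integral_const_mul _ _

lemma tot_mono (hf : G.Integ f) (hg : G.Integ g)
    (h : ∀ e, ∀ᵐ x ∂(pipeMeasure (G.len e)), f e x ≤ g e x) : G.tot f ≤ G.tot g := by
  unfold tot
  refine Finset.sum_le_sum fun e _ => ?_
  rw [integral_pipe (G.len_pos e).le, integral_pipe (G.len_pos e).le]
  exact integral_mono_ae (hf e) (hg e) (h e)

lemma tot_congr (h : ∀ e, ∀ᵐ x ∂(pipeMeasure (G.len e)), f e x = g e x) : G.tot f = G.tot g := by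
  unfold tot
  refine Finset.sum_congr rfl fun e _ => ?_
  rw [integral_pipe (G.len_pos e).le, integral_pipe (G.len_pos e).le]
  exact integral_congr_ae (h e)

lemma tot_nonneg (h : ∀ e x, 0 ≤ f e x) : 0 ≤ G.tot f :=
  Finset.sum_nonneg fun e _ => intervalIntegral.integral_nonneg (G.len_pos e).le fun x _ => h e x

lemma integral_le_tot (h : ∀ e x, 0 ≤ f e x) (e : E) :
    ∫ x in (0 : ℝ)..G.len e, f e x ≤ G.tot f :=
  Finset.single_le_sum (f := fun e => ∫ x in (0 : ℝ)..G.len e, f e x)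
    (fun e _ => intervalIntegral.integral_nonneg (G.len_pos e).le fun x _ => h e x)
    (Finset.mem_univ e)

lemma tot_le_card_mul {K : ℝ} (h : ∀ e, ∫ x in (0 : ℝ)..G.len e, f e x ≤ K) :
    G.tot f ≤ Fintype.card E * K := by
  unfold tot
  calc _ ≤ ∑ _e : E, K := Finset.sum_le_sum fun e _ => h e
    _ = _ := by simp

end Total

section MeshFunctions

variable (M : E → ℕ)

/-- The piecewise linear function on the network with given nodal values. -/
noncomputable def interp (c : E → ℕ → ℝ) (e : E) (x : ℝ) : ℝ := lin (G.edgeMeshSize M e) (c e) x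

/-- The derivative of a piecewise linear function on the network. -/
noncomputable def slopeFn (c : E → ℕ → ℝ) (e : E) (x : ℝ) : ℝ :=
  pc (G.edgeMeshSize M e) (slopes (G.edgeMeshSize M e) (c e)) x

/-- The nodal values of a function on the network. -/
noncomputable def nodal (u : E → ℝ → ℝ) (e : E) (i : ℕ) : ℝ := u e (i * G.edgeMeshSize M e)

variable {M}

lemma mesh_pos {e : E} (hM : 0 < M e) : 0 < G.edgeMeshSize M e :=
  div_pos (G.len_pos e) (by exact_mod_cast hM)

lemma mesh_mul {e : E} (hM : 0 < M e) : (M e : ℝ) * G.edgeMeshSize M e = G.len e := by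
  have : (M e : ℝ) ≠ 0 := by exact_mod_cast hM.ne'
  unfold edgeMeshSize
  field_simp

lemma interp_end {e : E} (hM : 0 < M e) (c : E → ℕ → ℝ) :
    G.interp M c e (G.len e) = c e (M e) := by
  rw [← G.mesh_mul hM]; exact lin_grid (G.mesh_pos hM) _ _

lemma interp_start {e : E} (hM : 0 < M e) (c : E → ℕ → ℝ) : G.interp M c e 0 = c e 0 := by
  have := lin_grid (G.mesh_pos hM) (c e) 0
  simpa [interp] using this

/-- Conservation in terms of the values at the end points of the pipes. -/
lemma conservative_iff_of_ends {u u' : E → ℝ → ℝ} (h0 : ∀ e, u e 0 = u' e 0)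
    (h1 : ∀ e, u e (G.len e) = u' e (G.len e)) : G.Conservative u ↔ G.Conservative u' := by
  have : ∀ e v, G.atVertex u e v = G.atVertex u' e v := by
    intro e v
    unfold atVertex
    split_ifs
    · exact h1 e
    · exact h0 e
  unfold Conservative
  simp only [this]

lemma conservative_interp_nodal (hM : ∀ e, 0 < M e) {u : E → ℝ → ℝ} :
    G.Conservative (G.interp M (G.nodal M u)) ↔ G.Conservative u := by
  apply G.conservative_iff_of_ends
  · intro e; rw [G.interp_start (hM e)]; simp [nodal]
  · intro e; rw [G.interp_end (hM e)]; simp [nodal, G.mesh_mul (hM e)]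

lemma isPrimitive_interp {e : E} (hM : 0 < M e) (c : E → ℕ → ℝ) :
    IsPrimitive (G.len e) (G.interp M c e) (G.slopeFn M c e) :=
  isPrimitive_lin (G.mesh_pos hM) (G.mesh_mul hM) (c e)

lemma ac_interp {e : E} (hM : 0 < M e) (c : E → ℕ → ℝ) :
    AbsolutelyContinuousOnInterval (G.interp M c e) 0 (G.len e) := by
  have hh := G.mesh_pos hM
  have hm := G.mesh_mul hM
  set K := ∑ i ∈ Finset.range (M e), |slopes (G.edgeMeshSize M e) (c e) i| with hK
  have hK0 : 0 ≤ K := Finset.sum_nonneg fun _ _ => abs_nonneg _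
  have : LipschitzOnWith ⟨K, hK0⟩ (G.interp M c e) (uIcc 0 (G.len e)) := by
    rw [uIcc_of_le (G.len_pos e).le]
    refine LipschitzOnWith.of_dist_le_mul fun x hx y hy => ?_
    rw [dist_comm, Real.dist_eq, dist_comm, Real.dist_eq,
      (G.isPrimitive_interp hM c).2 x hx y hy]
    have key : ‖∫ t in x..y, G.slopeFn M c e t‖ ≤ K * |y - x| := by
      apply intervalIntegral.norm_integral_le_of_norm_le_const_ae
      have hne : ∀ᵐ r : ℝ, r ≠ G.len e := by simp [ae_iff]
      filter_upwards [hne] with t ht htm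
      exact abs_pc_le hh hm _ ⟨(le_min hx.1 hy.1).trans htm.1.le,
        lt_of_le_of_ne (htm.2.trans (max_le hx.2 hy.2)) ht⟩
    exact key
  exact this.absolutelyContinuousOnInterval

lemma deriv_interp_ae {e : E} (hM : 0 < M e) (c : E → ℕ → ℝ) :
    ∀ᵐ x ∂(pipeMeasure (G.len e)), deriv (G.interp M c e) x = G.slopeFn M c e x := by
  filter_upwards [ae_mem_cell (G.mesh_pos hM) (G.mesh_mul hM)] with x hx
  obtain ⟨i, -, hx⟩ := hx
  exact deriv_eq_slope_of_eq_lin (G.mesh_pos hM) (fun x _ => rfl) hx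

end MeshFunctions

/-- The sum of the boundary terms of all pipes, reordered by vertices. -/
lemma sum_ends_eq (u v : E → ℝ → ℝ) :
    ∑ e, (u e (G.len e) * v e (G.len e) - u e 0 * v e 0)
      = ∑ z, ∑ e ∈ G.incident z, G.atVertex u e z * G.atVertex v e z * G.sign e z := by
  have h1 : ∀ z, ∑ e ∈ G.incident z, G.atVertex u e z * G.atVertex v e z * G.sign e z
      = ∑ e, if G.src e = z ∨ G.tgt e = z then
          G.atVertex u e z * G.atVertex v e z * G.sign e z else 0 := by
    intro z
    rw [← Finset.sum_filter]
    rfl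
  simp only [h1]
  rw [Finset.sum_comm]
  refine Finset.sum_congr rfl fun e _ => ?_
  have hne := G.src_ne_tgt e
  rw [← Finset.sum_filter]
  have hset : (Finset.univ.filter fun z => G.src e = z ∨ G.tgt e = z) = {G.src e, G.tgt e} := by
    ext z; simp [eq_comm]
  rw [hset, Finset.sum_pair hne]
  simp only [atVertex, sign, if_neg hne, if_neg hne.symm, if_true]
  ring

/-- The boundary functional of the momentum balance. -/
noncomputable def bdryTerm (hb : V → ℝ → ℝ) (t : ℝ) (r : E → ℝ → ℝ) : ℝ :=
  ∑ v ∈ G.boundary, ∑ e ∈ G.incident v, hb v t * G.atVertex r e v * G.sign e v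

lemma bdryTerm_congr {hb : V → ℝ → ℝ} {t : ℝ} {r r' : E → ℝ → ℝ} (h0 : ∀ e, r e 0 = r' e 0)
    (h1 : ∀ e, r e (G.len e) = r' e (G.len e)) : G.bdryTerm hb t r = G.bdryTerm hb t r' := by
  have : ∀ e v, G.atVertex r e v = G.atVertex r' e v := by
    intro e v
    unfold atVertex
    split_ifs
    · exact h1 e
    · exact h0 e
  unfold bdryTerm
  simp only [this]

/-- The relevant properties of the exact solution, with quantitative bounds. -/
structure Exact (P : ℝ → ℝ) (c : Consts) (B ε : ℝ) (a γ : E → ℝ) (hb : V → ℝ → ℝ)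
    (ρ w ρt wt : E → ℝ → ℝ → ℝ) : Prop where
  ε_nonneg : 0 ≤ ε
  ε_le : ε ≤ c.εm
  a_mem : ∀ e, a e ∈ Icc c.amin c.amax
  γ_mem : ∀ e, γ e ∈ Icc c.γmin c.γmax
  ρ_mem : ∀ e, ∀ t ∈ Icc 0 c.T, ∀ x ∈ Icc 0 (G.len e), c.ρmin ≤ ρ e t x ∧ ρ e t x ≤ c.ρmax
  w_mem : ∀ e, ∀ t ∈ Icc 0 c.T, ∀ x ∈ Icc 0 (G.len e), |w e t x| ≤ c.wmax
  prim_ρ : ∀ e, ∀ t ∈ Icc 0 c.T, IsPrimitive (G.len e) (ρ e t) (deriv (ρ e t))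
  prim_w : ∀ e, ∀ t ∈ Icc 0 c.T, IsPrimitive (G.len e) (w e t) (deriv (w e t))
  prim_m : ∀ e, ∀ t ∈ Icc 0 c.T,
    IsPrimitive (G.len e) (fluxAt a ρ w t e) (fun x => -(a e * ρt e t x))
  prim_h : ∀ e, ∀ t ∈ Icc 0 c.T, IsPrimitive (G.len e) (enthalpyAt P ε ρ w t e)
    (fun x => -(ε ^ 2 * wt e t x + γ e * |w e t x| * w e t x))
  bound_ρx : ∀ e, ∀ t ∈ Icc 0 c.T, ∫ x in (0 : ℝ)..G.len e, deriv (ρ e t) x ^ 2 ≤ B ^ 2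
  bound_m : ∀ e, ∀ t ∈ Icc 0 c.T, ∫ x in (0 : ℝ)..G.len e, (-(a e * ρt e t x)) ^ 2 ≤ B ^ 2
  bound_h : ∀ e, ∀ t ∈ Icc 0 c.T, ∫ x in (0 : ℝ)..G.len e,
    (-(ε ^ 2 * wt e t x + γ e * |w e t x| * w e t x)) ^ 2 ≤ B ^ 2
  sq_ρt : ∀ e, ∀ t ∈ Icc 0 c.T, Sq (G.len e) (ρt e t)
  sq_wt : ∀ e, ∀ t ∈ Icc 0 c.T, Sq (G.len e) (wt e t)
  lip_ρx : ∀ e, ∀ t ∈ Icc 0 c.T, ∀ s ∈ Icc 0 c.T,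
    ∫ x in (0 : ℝ)..G.len e, (deriv (ρ e t) x - deriv (ρ e s) x) ^ 2 ≤ (B * |t - s|) ^ 2
  lip_m : ∀ e, ∀ t ∈ Icc 0 c.T, ∀ s ∈ Icc 0 c.T,
    ∫ x in (0 : ℝ)..G.len e, (-(a e * ρt e t x) - -(a e * ρt e s x)) ^ 2 ≤ (B * |t - s|) ^ 2
  consist_ρ : ∀ e, ∀ t ∈ Icc 0 c.T, ∀ s ∈ Icc 0 c.T,
    ∫ x in (0 : ℝ)..G.len e, (ρ e t x - ρ e s x - (t - s) * ρt e t x) ^ 2 ≤ (B * |t - s| ^ 2) ^ 2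
  consist_w : ∀ e, ∀ t ∈ Icc 0 c.T, ∀ s ∈ Icc 0 c.T,
    ∫ x in (0 : ℝ)..G.len e, (w e t x - w e s x - (t - s) * wt e t x) ^ 2 ≤ (B * |t - s| ^ 2) ^ 2
  lip_ρ : ∀ e, ∀ t ∈ Icc 0 c.T, ∀ s ∈ Icc 0 c.T, ∀ x ∈ Icc 0 (G.len e),
    |ρ e t x - ρ e s x| ≤ B * |t - s|
  lip_w : ∀ e, ∀ t ∈ Icc 0 c.T, ∀ s ∈ Icc 0 c.T, ∀ x ∈ Icc 0 (G.len e),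
    |w e t x - w e s x| ≤ B * |t - s|
  balance : ∀ t ∈ Icc 0 c.T, G.Conservative (fluxAt a ρ w t)
  weak : ∀ t ∈ Icc 0 c.T, ∀ M : E → ℕ, (∀ e, 0 < M e) → ∀ r : E → ℕ → ℝ,
    G.Conservative (G.interp M r) →
    G.tot (fun e x => ε ^ 2 * wt e t x * G.interp M r e x)
      - G.tot (fun e x => enthalpyAt P ε ρ w t e x * G.slopeFn M r e x)
      + G.tot (fun e x => γ e * |w e t x| * w e t x * G.interp M r e x)
      = -G.bdryTerm hb t (G.interp M r)

end PipeNetwork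

lemma integral_mono_pipe {ℓ : ℝ} (hℓ : 0 ≤ ℓ) {f g : ℝ → ℝ} (hf : Itg ℓ f) (hg : Itg ℓ g)
    (h : ∀ᵐ x ∂(pipeMeasure ℓ), f x ≤ g x) :
    ∫ x in (0 : ℝ)..ℓ, f x ≤ ∫ x in (0 : ℝ)..ℓ, g x := by
  rw [integral_pipe hℓ, integral_pipe hℓ]
  exact integral_mono_ae hf hg h

lemma integral_congr_pipe {ℓ : ℝ} (hℓ : 0 ≤ ℓ) {f g : ℝ → ℝ}
    (h : ∀ᵐ x ∂(pipeMeasure ℓ), f x = g x) :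
    ∫ x in (0 : ℝ)..ℓ, f x = ∫ x in (0 : ℝ)..ℓ, g x := by
  rw [integral_pipe hℓ, integral_pipe hℓ]
  exact integral_congr_ae h

lemma ae_mem_pipe (ℓ : ℝ) : ∀ᵐ x ∂(pipeMeasure ℓ), x ∈ Ioo 0 ℓ := ae_restrict_mem measurableSet_Ioo

namespace PipeNetwork

variable {V E : Type*} [Fintype V] [DecidableEq V] [Fintype E] (G : PipeNetwork V E)

/-- A continuous enthalpy with prescribed boundary values, tested with a conservative function. -/
lemma sum_ends_eq_bdryTerm {hb : V → ℝ → ℝ} {t : ℝ} {u r : E → ℝ → ℝ}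
    (hcont : ∀ v, v ∉ G.boundary → ∃ hv : ℝ, ∀ e ∈ G.incident v, G.atVertex u e v = hv)
    (hbd : ∀ v ∈ G.boundary, ∀ e ∈ G.incident v, G.atVertex u e v = hb v t)
    (hr : G.Conservative r) :
    ∑ e, (u e (G.len e) * r e (G.len e) - u e 0 * r e 0) = G.bdryTerm hb t r := by
  rw [G.sum_ends_eq, bdryTerm, ← Finset.sum_subset (Finset.subset_univ G.boundary)]
  · refine Finset.sum_congr rfl fun v hv => Finset.sum_congr rfl fun e he => ?_
    rw [hbd v hv e he]
  · intro v _ hv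
    obtain ⟨k, hk⟩ := hcont v hv
    calc _ = ∑ e ∈ G.incident v, k * (G.atVertex r e v * G.sign e v) :=
          Finset.sum_congr rfl fun e he => by rw [hk e he]; ring
      _ = 0 := by rw [← Finset.mul_sum, hr v hv, mul_zero]

lemma exists_exact {P : ℝ → ℝ} {c : Consts} {q₀ q₁ q₂ Cbar : ℝ}
    (hPB : PressureBounds P c.r₀ c.r₁ c.W c.εm q₀ q₁ q₂) (hCbar : 0 < Cbar) :
    ∃ B : ℝ, 0 < B ∧ ∀ (ε : ℝ) (a γ : E → ℝ) (hb : V → ℝ → ℝ) (ρ w : E → ℝ → ℝ → ℝ),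
      0 ≤ ε → ε ≤ c.εm →
      (∀ e, c.γmin ≤ γ e ∧ γ e ≤ c.γmax) → (∀ e, c.amin ≤ a e ∧ a e ≤ c.amax) →
      G.IsClassicalSolution P c.T ε a γ hb ρ w →
      (∀ e, ∀ t ∈ Icc 0 c.T, ∀ x ∈ Icc 0 (G.len e),
        c.ρmin ≤ ρ e t x ∧ ρ e t x ≤ c.ρmax ∧ -c.wmax ≤ w e t x ∧ w e t x ≤ c.wmax) →
      (∀ e, IsSmoothTrajectory c.T (G.len e) Cbar (ρ e) ∧
        IsSmoothTrajectory c.T (G.len e) Cbar (w e)) →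
      G.Exact P c B ε a γ hb ρ w (fun e t x => timeDeriv c.T (G.len e) (ρ e) t x)
        (fun e t x => timeDeriv c.T (G.len e) (w e) t x) := by
  set S := ∑ e, (1 / √(G.len e) + √(G.len e)) with hS
  have hSe : ∀ e, 1 / √(G.len e) + √(G.len e) ≤ S := fun e =>
    Finset.single_le_sum (f := fun e => 1 / √(G.len e) + √(G.len e))
      (fun e _ => by positivity) (Finset.mem_univ e)
  have hS0 : 0 ≤ S := Finset.sum_nonneg fun e _ => by positivity
  have ham := c.amax_pos
  have hγm := c.γmax_pos
  have hεm := c.εm_pos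
  have hwm := c.wmax_pos
  refine ⟨Cbar * (1 + c.amax + 2 * c.εm ^ 2 + S) + 2 * c.γmax * c.wmax ^ 2 * S, by positivity, ?_⟩
  intro ε a γ hb ρ w hε0 hε hγ ha hsol hrange hsm
  set B := Cbar * (1 + c.amax + 2 * c.εm ^ 2 + S) + 2 * c.γmax * c.wmax ^ 2 * S with hB
  have hBC : Cbar ≤ B := by
    have : B - Cbar = Cbar * (c.amax + 2 * c.εm ^ 2 + S) + 2 * c.γmax * c.wmax ^ 2 * S := by
      rw [hB]; ring
    have : 0 ≤ B - Cbar := by rw [this]; positivity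
    linarith
  have hBa : c.amax * Cbar ≤ B := by
    have : B - c.amax * Cbar = Cbar * (1 + 2 * c.εm ^ 2 + S) + 2 * c.γmax * c.wmax ^ 2 * S := by
      rw [hB]; ring
    have : 0 ≤ B - c.amax * Cbar := by rw [this]; positivity
    linarith
  have hBS : Cbar * S ≤ B := by
    have : B - Cbar * S = Cbar * (1 + c.amax + 2 * c.εm ^ 2) + 2 * c.γmax * c.wmax ^ 2 * S := by
      rw [hB]; ring
    have : 0 ≤ B - Cbar * S := by rw [this]; positivity
    linarith
  have hBh : 2 * (c.εm ^ 2 * Cbar + c.γmax * c.wmax ^ 2 * S) ≤ B := by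
    have : B - 2 * (c.εm ^ 2 * Cbar + c.γmax * c.wmax ^ 2 * S) = Cbar * (1 + c.amax + S) := by
      rw [hB]; ring
    have : 0 ≤ B - 2 * (c.εm ^ 2 * Cbar + c.γmax * c.wmax ^ 2 * S) := by rw [this]; positivity
    linarith
  clear_value B
  have hB0 : 0 < B := hCbar.trans_le hBC
  have hρR := fun e => pipeRegular_of_trajectory c.T_pos (G.len_pos e) hCbar.le (hsol.regρ e) (hsm e).1
  have hwR := fun e => pipeRegular_of_trajectory c.T_pos (G.len_pos e) hCbar.le (hsol.regw e) (hsm e).2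
  have hwabs : ∀ e, ∀ t ∈ Icc 0 c.T, ∀ x ∈ Icc 0 (G.len e), |w e t x| ≤ c.wmax := fun e t ht x hx =>
    abs_le.2 ⟨(hrange e t ht x hx).2.2.1, (hrange e t ht x hx).2.2.2⟩
  have ha0 : ∀ e, 0 < a e := fun e => c.amin_pos.trans_le (ha e).1
  have hγ0 : ∀ e, 0 < γ e := fun e => c.γmin_pos.trans_le (hγ e).1
  have hacm : ∀ e, ∀ t ∈ Icc 0 c.T,
      AbsolutelyContinuousOnInterval (fluxAt a ρ w t e) 0 (G.len e) := fun e t ht =>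
    (((hsol.regρ e).memH1 t ht).1.const_mul (a e)).mul ((hsol.regw e).memH1 t ht).1
  have hach : ∀ e, ∀ t ∈ Icc 0 c.T,
      AbsolutelyContinuousOnInterval (enthalpyAt P ε ρ w t e) 0 (G.len e) := by
    intro e t ht
    have h1 := ac_comp_of_lipschitz (s := Icc c.r₀ c.r₁) (g := deriv P) (G.len_pos e).le
      ((hsol.regρ e).memH1 t ht).1
      (fun x hx => c.mem_J (hrange e t ht x hx).1 (hrange e t ht x hx).2.1) hPB.q₁_pos.le
      fun x hx y hy => hPB.abs_deriv_sub_le hx hy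
    have h2 := ((((hsol.regw e).memH1 t ht).1.mul ((hsol.regw e).memH1 t ht).1).const_mul
      (ε ^ 2 / 2)).add h1
    refine cast (congrArg (fun f => AbsolutelyContinuousOnInterval f 0 (G.len e)) ?_) h2
    funext x
    simp only [enthalpyAt, enthalpy, Pi.add_apply, Pi.mul_apply]
    ring
  have hwb : ∀ e, ∀ t ∈ Icc 0 c.T, Bdd (G.len e) (w e t) := fun e t ht => ((hwR e).prim t ht).bdd
  have hfric : ∀ e, ∀ t ∈ Icc 0 c.T, Bdd (G.len e) (fun x => γ e * |w e t x| * w e t x) :=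
    fun e t ht => ((hwb e t ht).abs.cmul (γ e)).mul (hwb e t ht)
  have hsqh : ∀ e, ∀ t ∈ Icc 0 c.T, Sq (G.len e)
      (fun x => -(ε ^ 2 * timeDeriv c.T (G.len e) (w e) t x + γ e * |w e t x| * w e t x)) := by
    intro e t ht
    have := (((hwR e).sq_t t ht).cmul (ε ^ 2)).add (hfric e t ht).sq
    exact (this.cmul (-1)).congr (Filter.Eventually.of_forall fun x => by ring)
  have hdm : ∀ e, ∀ t ∈ Icc 0 c.T, ∀ᵐ x ∂(pipeMeasure (G.len e)),
      deriv (fluxAt a ρ w t e) x = -(a e * timeDeriv c.T (G.len e) (ρ e) t x) := by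
    intro e t ht
    filter_upwards [hsol.mass e t ht] with x hx
    linarith
  have hdh : ∀ e, ∀ t ∈ Icc 0 c.T, ∀ᵐ x ∂(pipeMeasure (G.len e)),
      deriv (enthalpyAt P ε ρ w t e) x
        = -(ε ^ 2 * timeDeriv c.T (G.len e) (w e) t x + γ e * |w e t x| * w e t x) := by
    intro e t ht
    filter_upwards [hsol.momentum e t ht] with x hx
    linarith
  have hamul : ∀ e (f : ℝ → ℝ) (K : ℝ), 0 ≤ K → ∫ x in (0 : ℝ)..G.len e, f x ^ 2 ≤ (Cbar * K) ^ 2 →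
      ∫ x in (0 : ℝ)..G.len e, (-(a e * f x)) ^ 2 ≤ (B * K) ^ 2 := by
    intro e f K hK hf
    have e1 : ∀ x, (-(a e * f x)) ^ 2 = a e ^ 2 * f x ^ 2 := fun x => by ring
    simp only [e1]
    rw [intervalIntegral.integral_const_mul]
    calc _ ≤ a e ^ 2 * (Cbar * K) ^ 2 := by gcongr
      _ = (a e * Cbar * K) ^ 2 := by ring
      _ ≤ (c.amax * Cbar * K) ^ 2 := by
          have := ha0 e
          have := (ha e).2
          gcongr
      _ ≤ _ := by gcongr
  have hmono : ∀ {K L : ℝ}, 0 ≤ K → K ≤ L → K ^ 2 ≤ L ^ 2 := fun h0 h => by gcongr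
  have hsup : ∀ e (t s : ℝ), Cbar * (1 / √(G.len e) + √(G.len e)) * |t - s| ≤ B * |t - s| := by
    intro e t s
    have : Cbar * (1 / √(G.len e) + √(G.len e)) ≤ Cbar * S := by gcongr; exact hSe e
    have := this.trans hBS
    gcongr
  refine ⟨hε0, hε, ha, hγ, fun e t ht x hx => ⟨(hrange e t ht x hx).1, (hrange e t ht x hx).2.1⟩,
    hwabs, fun e => (hρR e).prim, fun e => (hwR e).prim, fun e t ht => ?_, fun e t ht => ?_,
    fun e t ht => ((hρR e).bound_x t ht).trans (hmono hCbar.le hBC), fun e t ht => ?_,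
    fun e t ht => ?_, fun e => (hρR e).sq_t, fun e => (hwR e).sq_t,
    fun e t ht s hs => ((hρR e).lip_x t ht s hs).trans
      (hmono (mul_nonneg hCbar.le (abs_nonneg _)) (by gcongr)), fun e t ht s hs => ?_,
    fun e t ht s hs => ((hρR e).consist t ht s hs).trans (hmono (by positivity) (by gcongr)),
    fun e t ht s hs => ((hwR e).consist t ht s hs).trans (hmono (by positivity) (by gcongr)),
    fun e t ht s hs x hx => ((hρR e).lip_sup t ht s hs x hx).trans (hsup e t s),
    fun e t ht s hs x hx => ((hwR e).lip_sup t ht s hs x hx).trans (hsup e t s),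
    hsol.balance, ?_⟩
  · exact isPrimitive_of_ac (hacm e t ht) (G.len_pos e).le
      ((((hρR e).sq_t t ht).cmul (-a e)).congr (Filter.Eventually.of_forall fun x => by ring))
      (hdm e t ht)
  · exact isPrimitive_of_ac (hach e t ht) (G.len_pos e).le (hsqh e t ht) (hdh e t ht)
  · have := hamul e (timeDeriv c.T (G.len e) (ρ e) t) 1 zero_le_one (by simpa using (hρR e).bound_t t ht)
    simpa using this
  · have hl := G.len_pos e
    have hsq1 := ((hwR e).sq_t t ht).sq
    have h1 : ∫ x in (0 : ℝ)..G.len e,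
        (-(ε ^ 2 * timeDeriv c.T (G.len e) (w e) t x + γ e * |w e t x| * w e t x)) ^ 2
        ≤ ∫ x in (0 : ℝ)..G.len e, (2 * c.εm ^ 4 * (timeDeriv c.T (G.len e) (w e) t x) ^ 2
          + 2 * (c.γmax * c.wmax ^ 2) ^ 2) := by
      refine integral_mono_pipe hl.le (hsqh e t ht).sq
        ((hsq1.cmul _).add (Bdd.const _).itg) ?_
      filter_upwards [ae_mem_pipe (G.len e)] with x hx
      have hw := hwabs e t ht x (Ioo_subset_Icc_self hx)
      set y := timeDeriv c.T (G.len e) (w e) t x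
      have e1 : (γ e * |w e t x| * w e t x) ^ 2 ≤ (c.γmax * c.wmax ^ 2) ^ 2 := by
        have e2 : (γ e * |w e t x| * w e t x) ^ 2 = (γ e * |w e t x| ^ 2) ^ 2 := by
          rw [mul_pow, mul_pow, sq_abs]
          ring
        rw [e2]
        have := hγ0 e
        have := (hγ e).2
        gcongr
      have e3 : (ε ^ 2 * y) ^ 2 ≤ c.εm ^ 4 * y ^ 2 := by
        have : (ε ^ 2 * y) ^ 2 = ε ^ 4 * y ^ 2 := by ring
        rw [this]; gcongr
      nlinarith [sq_nonneg (ε ^ 2 * y - γ e * |w e t x| * w e t x)]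
    refine h1.trans ?_
    rw [intervalIntegral.integral_add ((intervalIntegrable_pipe hl.le).2 (hsq1.cmul _)) (by simp),
      intervalIntegral.integral_const_mul, intervalIntegral.integral_const, smul_eq_mul, sub_zero]
    have h2 := (hwR e).bound_t t ht
    have h3 : G.len e ≤ S ^ 2 := by
      have : √(G.len e) ≤ S := by
        have := hSe e
        have h5 : 0 ≤ 1 / √(G.len e) := by positivity
        linarith
      calc G.len e = √(G.len e) ^ 2 := (Real.sq_sqrt hl.le).symm
        _ ≤ _ := by gcongr
    calc _ ≤ 2 * c.εm ^ 4 * Cbar ^ 2 + S ^ 2 * (2 * (c.γmax * c.wmax ^ 2) ^ 2) := by gcongr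
      _ ≤ (2 * (c.εm ^ 2 * Cbar + c.γmax * c.wmax ^ 2 * S)) ^ 2 := by
          have : 0 ≤ (c.εm ^ 2 * Cbar) * (c.γmax * c.wmax ^ 2 * S) := by positivity
          nlinarith [sq_nonneg (c.εm ^ 2 * Cbar), sq_nonneg (c.γmax * c.wmax ^ 2 * S)]
      _ ≤ _ := by gcongr
  · have := hamul e (fun x => timeDeriv c.T (G.len e) (ρ e) t x - timeDeriv c.T (G.len e) (ρ e) s x)
      |t - s| (abs_nonneg _) ((hρR e).lip_t t ht s hs)
    refine le_of_eq_of_le ?_ this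
    congr 1
    funext x
    ring
  · intro t ht M hM r hr
    rw [← G.sum_ends_eq_bdryTerm (hsol.continuity t ht) (hsol.bdry t ht) hr]
    unfold tot
    rw [← Finset.sum_sub_distrib, ← Finset.sum_add_distrib, ← Finset.sum_neg_distrib]
    refine Finset.sum_congr rfl fun e _ => ?_
    have hl := (G.len_pos e).le
    have hri := (G.isPrimitive_interp (hM e) r).bdd
    have hparts := (hach e t ht).integral_mul_deriv_eq_deriv_mul (G.ac_interp (hM e) r)
    have e1 : ∫ x in (0 : ℝ)..G.len e, enthalpyAt P ε ρ w t e x * deriv (G.interp M r e) x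
        = ∫ x in (0 : ℝ)..G.len e, enthalpyAt P ε ρ w t e x * G.slopeFn M r e x := by
      apply integral_congr_pipe hl
      filter_upwards [G.deriv_interp_ae (hM e) r] with x hx
      rw [hx]
    have e2 : ∫ x in (0 : ℝ)..G.len e, deriv (enthalpyAt P ε ρ w t e) x * G.interp M r e x
        = ∫ x in (0 : ℝ)..G.len e, -(ε ^ 2 * timeDeriv c.T (G.len e) (w e) t x * G.interp M r e x
          + γ e * |w e t x| * w e t x * G.interp M r e x) := by
      apply integral_congr_pipe hl
      filter_upwards [hdh e t ht] with x hx
      rw [hx]; ring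
    rw [intervalIntegral.integral_neg, intervalIntegral.integral_add] at e2
    · rw [e1, e2] at hparts
      linarith
    · rw [intervalIntegrable_pipe hl]
      exact (((hwR e).sq_t t ht).cmul (ε ^ 2)).mul hri.sq
    · rw [intervalIntegrable_pipe hl]
      exact ((hfric e t ht).mul hri).itg

end PipeNetwork

lemma Bdd.div_const {ℓ : ℝ} {f : ℝ → ℝ} (hf : Bdd ℓ f) (k : ℝ) : Bdd ℓ (fun x => f x / k) := by
  simpa only [div_eq_inv_mul] using hf.cmul k⁻¹

lemma integral_sq_nonneg {ℓ : ℝ} (hℓ : 0 ≤ ℓ) (f : ℝ → ℝ) : 0 ≤ ∫ x in (0 : ℝ)..ℓ, f x ^ 2 :=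
  intervalIntegral.integral_nonneg hℓ fun _ _ => sq_nonneg _

namespace PipeNetwork

variable {V E : Type*} [Fintype V] [DecidableEq V] [Fintype E] (G : PipeNetwork V E)

/-! ### Discrete states -/

/-- The piecewise constant density with the cell values `d`. -/
noncomputable def dens (M : E → ℕ) (d : E → ℕ → ℝ) (e : E) (x : ℝ) : ℝ :=
  pc (G.edgeMeshSize M e) (d e) x

/-- The velocity of the state with the cell densities `d` and the nodal fluxes `m`. -/
noncomputable def vel (M : E → ℕ) (a : E → ℝ) (d m : E → ℕ → ℝ) (e : E) (x : ℝ) : ℝ :=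
  G.interp M m e x / (a e * G.dens M d e x)

/-- The interpolation error of the exact flux. -/
noncomputable def fluxErr (M : E → ℕ) (a : E → ℝ) (ρ w : E → ℝ → ℝ → ℝ) (t : ℝ) (e : E) (x : ℝ) : ℝ :=
  fluxAt a ρ w t e x - G.interp M (G.nodal M (fluxAt a ρ w t)) e x

/-- Admissibility of a discrete state. -/
def AdmState (c : Consts) (M : E → ℕ) (a : E → ℝ) (d m : E → ℕ → ℝ) : Prop :=
  ∀ e, ∀ i < M e, d e i ∈ Icc c.r₀ c.r₁ ∧ |m e i| ≤ c.W * (a e * d e i) ∧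
    |m e (i + 1)| ≤ c.W * (a e * d e i)

/-- One step of the scheme, from the state `(d', m')` to the state `(d, m)` at time `t`. -/
structure IsStep (P : ℝ → ℝ) (ε Δ : ℝ) (a γ : E → ℝ) (hb : V → ℝ → ℝ) (t : ℝ) (M : E → ℕ)
    (d' m' d m : E → ℕ → ℝ) : Prop where
  mass : ∀ e, ∀ i < M e, a e * (d e i - d' e i) + Δ * slopes (G.edgeMeshSize M e) (m e) i = 0
  cons : G.Conservative (G.interp M m)
  momentum : ∀ r : E → ℕ → ℝ, G.Conservative (G.interp M r) →
    G.tot (fun e x => ε ^ 2 * ((G.vel M a d m e x - G.vel M a d' m' e x) / Δ) * G.interp M r e x)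
      - G.tot (fun e x => enth P ε (G.dens M d e x) (G.vel M a d m e x) * G.slopeFn M r e x)
      + G.tot (fun e x => γ e * |G.vel M a d m e x| * G.vel M a d m e x * G.interp M r e x)
      = -G.bdryTerm hb t (G.interp M r)

section

variable {G} {M : E → ℕ} {a γ : E → ℝ} {d m d' m' : E → ℕ → ℝ} {c : Consts}

lemma bdd_dens {e : E} (hM : 0 < M e) (d : E → ℕ → ℝ) : Bdd (G.len e) (G.dens M d e) :=
  bdd_pc (G.mesh_pos hM) (G.mesh_mul hM) (d e)

lemma bdd_comp_dens {e : E} (hM : 0 < M e) (d : E → ℕ → ℝ) (f : ℝ → ℝ) :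
    Bdd (G.len e) (fun x => f (G.dens M d e x)) :=
  bdd_pc (G.mesh_pos hM) (G.mesh_mul hM) (fun i => f (d e i))

lemma bdd_slopeFn {e : E} (hM : 0 < M e) (r : E → ℕ → ℝ) : Bdd (G.len e) (G.slopeFn M r e) :=
  bdd_pc (G.mesh_pos hM) (G.mesh_mul hM) _

lemma bdd_interp {e : E} (hM : 0 < M e) (r : E → ℕ → ℝ) : Bdd (G.len e) (G.interp M r e) :=
  (G.isPrimitive_interp hM r).bdd

lemma bdd_vel {e : E} (hM : 0 < M e) (a : E → ℝ) (d m : E → ℕ → ℝ) :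
    Bdd (G.len e) (G.vel M a d m e) := by
  have := (bdd_interp (G := G) hM m).mul (bdd_comp_dens (G := G) hM d (fun r => 1 / (a e * r)))
  refine this.congr (Filter.Eventually.of_forall fun x => ?_)
  simp only [vel]
  ring

lemma bdd_enth {e : E} (hM : 0 < M e) (P : ℝ → ℝ) (ε : ℝ) (a : E → ℝ) (d m : E → ℕ → ℝ) :
    Bdd (G.len e) (fun x => enth P ε (G.dens M d e x) (G.vel M a d m e x)) :=
  ((((bdd_vel hM a d m).pow 2).cmul (ε ^ 2)).div_const 2).add (bdd_comp_dens hM d (deriv P))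

/-- The pointwise properties of admissible states. -/
lemma AdmState.on_Ico (h : AdmState c M a d m) (ha : ∀ e, 0 < a e) {e : E} (hM : 0 < M e) {i : ℕ}
    (hi : i < M e) {x : ℝ} (hx : x ∈ Ico (i * G.edgeMeshSize M e) ((i + 1) * G.edgeMeshSize M e)) :
    G.dens M d e x ∈ Icc c.r₀ c.r₁ ∧ |G.vel M a d m e x| ≤ c.W ∧
      a e * G.dens M d e x * G.vel M a d m e x = G.interp M m e x := by
  have e1 : G.dens M d e x = d e i := pc_eq_of_mem (G.mesh_pos hM) _ hx
  obtain ⟨h1, h2, h3⟩ := h e i hi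
  have hpos : 0 < a e * d e i := mul_pos (ha e) (c.r₀_pos.trans_le h1.1)
  refine ⟨e1 ▸ h1, ?_, ?_⟩
  · rw [vel, e1, abs_div, abs_of_pos hpos, div_le_iff₀ hpos]
    exact abs_lin_le (G.mesh_pos hM) _ (Ico_subset_Icc_self hx) h2 h3
  · rw [vel, e1, mul_div_assoc', mul_div_cancel_left₀ _ hpos.ne']

lemma AdmState.on_cell (h : AdmState c M a d m) (ha : ∀ e, 0 < a e) {e : E} (hM : 0 < M e) {i : ℕ}
    (hi : i < M e) {x : ℝ} (hx : x ∈ Ioo (i * G.edgeMeshSize M e) ((i + 1) * G.edgeMeshSize M e)) :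
    G.dens M d e x ∈ Icc c.r₀ c.r₁ ∧ |G.vel M a d m e x| ≤ c.W ∧
      a e * G.dens M d e x * G.vel M a d m e x = G.interp M m e x :=
  h.on_Ico ha hM hi (Ioo_subset_Ico_self hx)

lemma AdmState.ae (h : AdmState c M a d m) (ha : ∀ e, 0 < a e) {e : E} (hM : 0 < M e) :
    ∀ᵐ x ∂(pipeMeasure (G.len e)), G.dens M d e x ∈ Icc c.r₀ c.r₁ ∧ |G.vel M a d m e x| ≤ c.W ∧
      a e * G.dens M d e x * G.vel M a d m e x = G.interp M m e x := by
  filter_upwards [ae_mem_cell (G.mesh_pos hM) (G.mesh_mul hM)] with x hx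
  obtain ⟨i, hi, hx⟩ := hx
  exact h.on_cell ha hM hi hx

lemma IsStep.mass_ae {P : ℝ → ℝ} {ε Δ t : ℝ} {hb : V → ℝ → ℝ}
    (h : G.IsStep P ε Δ a γ hb t M d' m' d m) {e : E} (hM : 0 < M e) :
    ∀ᵐ x ∂(pipeMeasure (G.len e)),
      a e * (G.dens M d e x - G.dens M d' e x) + Δ * G.slopeFn M m e x = 0 := by
  filter_upwards [ae_mem_cell (G.mesh_pos hM) (G.mesh_mul hM)] with x hx
  obtain ⟨i, hi, hx⟩ := hx
  have hx' := Ioo_subset_Ico_self hx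
  rw [dens, dens, slopeFn, pc_eq_of_mem (G.mesh_pos hM) _ hx', pc_eq_of_mem (G.mesh_pos hM) _ hx',
    pc_eq_of_mem (G.mesh_pos hM) _ hx']
  exact h.mass e i hi

lemma interp_sub (r s : E → ℕ → ℝ) (e : E) (x : ℝ) :
    G.interp M (fun e i => r e i - s e i) e x = G.interp M r e x - G.interp M s e x := lin_sub _ _ _ _

lemma slopeFn_sub (r s : E → ℕ → ℝ) (e : E) (x : ℝ) :
    G.slopeFn M (fun e i => r e i - s e i) e x = G.slopeFn M r e x - G.slopeFn M s e x :=
  pc_slopes_sub _ _ _ _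

lemma atVertex_sub (u v : E → ℝ → ℝ) (e : E) (z : V) :
    G.atVertex (fun e x => u e x - v e x) e z = G.atVertex u e z - G.atVertex v e z := rfl

lemma Conservative.sub {u v : E → ℝ → ℝ} (hu : G.Conservative u) (hv : G.Conservative v) :
    G.Conservative (fun e x => u e x - v e x) := by
  intro z hz
  have h1 := hu z hz
  have h2 := hv z hz
  simp only [atVertex_sub, sub_mul, Finset.sum_sub_distrib, h1, h2, sub_zero]

lemma conservative_interp_sub {r s : E → ℕ → ℝ} (hr : G.Conservative (G.interp M r))
    (hs : G.Conservative (G.interp M s)) :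
    G.Conservative (G.interp M (fun e i => r e i - s e i)) := by
  have := hr.sub hs
  have e : G.interp M (fun e i => r e i - s e i) = fun e x => G.interp M r e x - G.interp M s e x := by
    funext e x; exact interp_sub r s e x
  rwa [e]

end

/-! ### Consistency -/

namespace Exact

variable {G} {P : ℝ → ℝ} {c : Consts} {B ε : ℝ} {a γ : E → ℝ} {hb : V → ℝ → ℝ}
  {ρ w ρt wt : E → ℝ → ℝ → ℝ} (X : G.Exact P c B ε a γ hb ρ w ρt wt)
  {M : E → ℕ} {t t' Δ H : ℝ} {e : E}

include X

lemma a_pos (e : E) : 0 < a e := c.amin_pos.trans_le (X.a_mem e).1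

lemma integral_fluxErr_sq_le (hM : 0 < M e) (hH : G.edgeMeshSize M e ≤ H) (ht : t ∈ Icc 0 c.T) :
    ∫ x in (0 : ℝ)..G.len e, G.fluxErr M a ρ w t e x ^ 2 ≤ (B * H) ^ 2 := by
  have hh := G.mesh_pos hM
  refine ((X.prim_m e t ht).integral_sub_lin_le hh (G.mesh_mul hM)).trans ?_
  have h0 := integral_sq_nonneg (G.len_pos e).le (fun x => -(a e * ρt e t x))
  have h1 := X.bound_m e t ht
  calc _ ≤ H ^ 2 * B ^ 2 := by gcongr
    _ = _ := by ring

lemma integral_fluxErr_diff_sq_le (hM : 0 < M e) (hH : G.edgeMeshSize M e ≤ H) (ht : t ∈ Icc 0 c.T)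
    (ht' : t' ∈ Icc 0 c.T) (hΔ : 0 < Δ) (htt : t = t' + Δ) :
    ∫ x in (0 : ℝ)..G.len e, ((G.fluxErr M a ρ w t e x - G.fluxErr M a ρ w t' e x) / Δ) ^ 2
      ≤ (B * H) ^ 2 := by
  have hh := G.mesh_pos hM
  have hp := ((X.prim_m e t ht).sub (X.prim_m e t' ht')).cmul (1 / Δ)
  have h1 := hp.integral_sub_lin_le hh (G.mesh_mul hM)
  have h2 : ∫ x in (0 : ℝ)..G.len e, (1 / Δ * (-(a e * ρt e t x) - -(a e * ρt e t' x))) ^ 2 ≤ B ^ 2 := by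
    simp only [mul_pow]
    rw [intervalIntegral.integral_const_mul]
    have := X.lip_m e t ht t' ht'
    have e1 : |t - t'| = Δ := by rw [htt, add_sub_cancel_left, abs_of_pos hΔ]
    rw [e1] at this
    calc _ ≤ (1 / Δ) ^ 2 * (B * Δ) ^ 2 := by gcongr
      _ = _ := by field_simp
  have h0 := integral_sq_nonneg (G.len_pos e).le
    (fun x => 1 / Δ * (-(a e * ρt e t x) - -(a e * ρt e t' x)))
  calc _ = ∫ x in (0 : ℝ)..G.len e, (1 / Δ * (fluxAt a ρ w t e x - fluxAt a ρ w t' e x)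
      - lin (G.edgeMeshSize M e) (fun i => 1 / Δ * (fluxAt a ρ w t e (i * G.edgeMeshSize M e)
        - fluxAt a ρ w t' e (i * G.edgeMeshSize M e))) x) ^ 2 := by
        congr 1
        funext x
        rw [lin_smul, lin_sub]
        have e1 : ∀ t, lin (G.edgeMeshSize M e) (G.nodal M (fluxAt a ρ w t) e) x = lin
          (G.edgeMeshSize M e) (fun i => fluxAt a ρ w t e (i * G.edgeMeshSize M e)) x := fun _ => rfl
        simp only [fluxErr, interp, e1]
        congr 1
        ring
    _ ≤ _ := h1
    _ ≤ H ^ 2 * B ^ 2 := by gcongr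
    _ = _ := by ring

lemma sq_consist_w (ht : t ∈ Icc 0 c.T) (ht' : t' ∈ Icc 0 c.T) (hΔ : 0 < Δ) (htt : t = t' + Δ) :
    Sq (G.len e) (fun x => (w e t x - w e t' x) / Δ - wt e t x) ∧
    ∫ x in (0 : ℝ)..G.len e, ((w e t x - w e t' x) / Δ - wt e t x) ^ 2 ≤ (B * Δ) ^ 2 := by
  refine ⟨(((X.prim_w e t ht).bdd.sub (X.prim_w e t' ht').bdd).div_const Δ).sq.sub
    (X.sq_wt e t ht), ?_⟩
  have := X.consist_w e t ht t' ht'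
  have e1 : t - t' = Δ := by rw [htt, add_sub_cancel_left]
  rw [e1, abs_of_pos hΔ] at this
  calc _ = ∫ x in (0 : ℝ)..G.len e, (1 / Δ) ^ 2 * (w e t x - w e t' x - Δ * wt e t x) ^ 2 := by
        congr 1; funext x; field_simp
    _ = (1 / Δ) ^ 2 * ∫ x in (0 : ℝ)..G.len e, (w e t x - w e t' x - Δ * wt e t x) ^ 2 :=
        intervalIntegral.integral_const_mul _ _
    _ ≤ (1 / Δ) ^ 2 * (B * Δ ^ 2) ^ 2 := by gcongr
    _ = _ := by field_simp

lemma sq_consist_ρ (ht : t ∈ Icc 0 c.T) (ht' : t' ∈ Icc 0 c.T) (hΔ : 0 < Δ) (htt : t = t' + Δ) :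
    Sq (G.len e) (fun x => (ρ e t x - ρ e t' x) / Δ - ρt e t x) ∧
    ∫ x in (0 : ℝ)..G.len e, ((ρ e t x - ρ e t' x) / Δ - ρt e t x) ^ 2 ≤ (B * Δ) ^ 2 := by
  refine ⟨(((X.prim_ρ e t ht).bdd.sub (X.prim_ρ e t' ht').bdd).div_const Δ).sq.sub
    (X.sq_ρt e t ht), ?_⟩
  have := X.consist_ρ e t ht t' ht'
  have e1 : t - t' = Δ := by rw [htt, add_sub_cancel_left]
  rw [e1, abs_of_pos hΔ] at this
  calc _ = ∫ x in (0 : ℝ)..G.len e, (1 / Δ) ^ 2 * (ρ e t x - ρ e t' x - Δ * ρt e t x) ^ 2 := by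
        congr 1; funext x; field_simp
    _ = (1 / Δ) ^ 2 * ∫ x in (0 : ℝ)..G.len e, (ρ e t x - ρ e t' x - Δ * ρt e t x) ^ 2 :=
        intervalIntegral.integral_const_mul _ _
    _ ≤ (1 / Δ) ^ 2 * (B * Δ ^ 2) ^ 2 := by gcongr
    _ = _ := by field_simp

/-- The slopes of the interpolated exact flux. -/
lemma slopes_nodal (hM : 0 < M e) (ht : t ∈ Icc 0 c.T) {i : ℕ} (hi : i < M e) :
    slopes (G.edgeMeshSize M e) (G.nodal M (fluxAt a ρ w t) e) i
      = -a e * ((∫ x in (i * G.edgeMeshSize M e)..((i + 1) * G.edgeMeshSize M e), ρt e t x)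
        / G.edgeMeshSize M e) := by
  have hh := G.mesh_pos hM
  have h1 := (X.prim_m e t ht).2 _ (cell_subset hh (G.mesh_mul hM) hi (left_mem_cell hh i))
    _ (cell_subset hh (G.mesh_mul hM) hi (right_mem_cell hh i))
  rw [intervalIntegral.integral_neg, intervalIntegral.integral_const_mul] at h1
  simp only [slopes, nodal]
  push_cast
  rw [h1]
  ring

lemma integral_consist_mass_sq_le (hM : 0 < M e) (hH : G.edgeMeshSize M e ≤ H) (ht : t ∈ Icc 0 c.T)
    (ht' : t' ∈ Icc 0 c.T) (hΔ : 0 < Δ) (htt : t = t' + Δ) :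
    ∫ x in (0 : ℝ)..G.len e, ((ρ e t x - ρ e t' x) / Δ
      + G.slopeFn M (G.nodal M (fluxAt a ρ w t)) e x / a e) ^ 2 ≤ 2 * (B * H) ^ 2 + 2 * (B * Δ) ^ 2 := by
  have hh := G.mesh_pos hM
  have hp := ((X.prim_ρ e t ht).sub (X.prim_ρ e t' ht')).cmul (1 / Δ)
  have h1 := hp.integral_sub_average_le (X.sq_ρt e t ht) hh (G.mesh_mul hM)
  have h2 : ∫ x in (0 : ℝ)..G.len e, (1 / Δ * (deriv (ρ e t) x - deriv (ρ e t') x)) ^ 2 ≤ B ^ 2 := by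
    simp only [mul_pow]
    rw [intervalIntegral.integral_const_mul]
    have := X.lip_ρx e t ht t' ht'
    have e1 : |t - t'| = Δ := by rw [htt, add_sub_cancel_left, abs_of_pos hΔ]
    rw [e1] at this
    calc _ ≤ (1 / Δ) ^ 2 * (B * Δ) ^ 2 := by gcongr
      _ = _ := by field_simp
  have h3 := (X.sq_consist_ρ (e := e) ht ht' hΔ htt).2
  have h0 := integral_sq_nonneg (G.len_pos e).le
    (fun x => 1 / Δ * (deriv (ρ e t) x - deriv (ρ e t') x))
  calc _ = ∫ x in (0 : ℝ)..G.len e, (1 / Δ * (ρ e t x - ρ e t' x)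
      - pc (G.edgeMeshSize M e) (fun i => (∫ t_1 in (i * G.edgeMeshSize M e)..((i + 1)
          * G.edgeMeshSize M e), ρt e t t_1) / G.edgeMeshSize M e) x) ^ 2 := by
        apply integral_congr_pipe (G.len_pos e).le
        filter_upwards [ae_mem_cell hh (G.mesh_mul hM)] with x hx
        obtain ⟨i, hi, hx⟩ := hx
        rw [slopeFn, pc_eq_of_mem hh _ (Ioo_subset_Ico_self hx),
          pc_eq_of_mem hh _ (Ioo_subset_Ico_self hx), X.slopes_nodal hM ht hi]
        have := (X.a_pos e).ne'
        congr 1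
        field_simp
        ring
    _ ≤ _ := h1
    _ ≤ 2 * (H ^ 2 * B ^ 2) + 2 * (B * Δ) ^ 2 := by
        have e1 : ∀ x, (1 / Δ * (ρ e t x - ρ e t' x) - ρt e t x)
          = (ρ e t x - ρ e t' x) / Δ - ρt e t x := fun x => by ring
        simp only [e1]
        gcongr
    _ = _ := by ring

end Exact

end PipeNetwork

lemma PressureBounds.continuousOn {P : ℝ → ℝ} {r₀ r₁ W εm q₀ q₁ q₂ : ℝ}
    (hPB : PressureBounds P r₀ r₁ W εm q₀ q₁ q₂) : ContinuousOn P (Icc r₀ r₁) :=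
  fun r hr => (hPB.hasDeriv r hr).continuousAt.continuousWithinAt

lemma PressureBounds.continuousOn_deriv {P : ℝ → ℝ} {r₀ r₁ W εm q₀ q₁ q₂ : ℝ}
    (hPB : PressureBounds P r₀ r₁ W εm q₀ q₁ q₂) : ContinuousOn (deriv P) (Icc r₀ r₁) :=
  fun r hr => (hPB.hasDeriv2 r hr).continuousAt.continuousWithinAt

namespace PipeNetwork

variable {V E : Type*} [Fintype V] [DecidableEq V] [Fintype E] (G : PipeNetwork V E)

/-! ### The relative energy estimate -/

/-- The squared distance of a discrete state to the exact solution. -/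
noncomputable def errSq (ε : ℝ) (M : E → ℕ) (a : E → ℝ) (ρ w : E → ℝ → ℝ → ℝ) (t : ℝ)
    (d m : E → ℕ → ℝ) (e : E) (x : ℝ) : ℝ :=
  distSq ε (G.dens M d e x) (G.vel M a d m e x) (ρ e t x) (w e t x)

/-- The dissipation density of a discrete state relative to the exact solution. -/
noncomputable def errDiss (M : E → ℕ) (a : E → ℝ) (w : E → ℝ → ℝ → ℝ) (t : ℝ)
    (d m : E → ℕ → ℝ) (e : E) (x : ℝ) : ℝ :=
  dissDensity (G.vel M a d m e x) (w e t x)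

/-- The energy density of a discrete state relative to the exact solution. -/
noncomputable def errEnergy (P : ℝ → ℝ) (ε : ℝ) (M : E → ℕ) (a : E → ℝ) (ρ w : E → ℝ → ℝ → ℝ) (t : ℝ)
    (d m : E → ℕ → ℝ) (e : E) (x : ℝ) : ℝ :=
  energyDensity P ε (a e) (G.dens M d e x) (G.vel M a d m e x) (ρ e t x) (w e t x)
    (G.fluxErr M a ρ w t e x)

namespace Exact

variable {G} {P : ℝ → ℝ} {c : Consts} {B ε : ℝ} {a γ : E → ℝ} {hb : V → ℝ → ℝ}
  {ρ w ρt wt : E → ℝ → ℝ → ℝ} (X : G.Exact P c B ε a γ hb ρ w ρt wt)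
  {M : E → ℕ} {t t' Δ H : ℝ} {e : E} {d m d' m' : E → ℕ → ℝ} {q₀ q₁ q₂ : ℝ}

include X

lemma bdd_ρ (ht : t ∈ Icc 0 c.T) : Bdd (G.len e) (ρ e t) := (X.prim_ρ e t ht).bdd
lemma bdd_w (ht : t ∈ Icc 0 c.T) : Bdd (G.len e) (w e t) := (X.prim_w e t ht).bdd

lemma bdd_fluxErr (hM : 0 < M e) (ht : t ∈ Icc 0 c.T) : Bdd (G.len e) (G.fluxErr M a ρ w t e) :=
  (X.prim_m e t ht).bdd.sub (bdd_interp hM _)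

lemma mem_J (ht : t ∈ Icc 0 c.T) : ∀ x ∈ Icc 0 (G.len e), ρ e t x ∈ Icc c.r₀ c.r₁ := fun x hx =>
  c.mem_J (X.ρ_mem e t ht x hx).1 (X.ρ_mem e t ht x hx).2

lemma abs_w_le_W (ht : t ∈ Icc 0 c.T) : ∀ x ∈ Icc 0 (G.len e), |w e t x| ≤ c.W := fun x hx =>
  (X.w_mem e t ht x hx).trans c.wmax_le_W

lemma bdd_comp_ρ (ht : t ∈ Icc 0 c.T) {f : ℝ → ℝ} (hf : ContinuousOn f (Icc c.r₀ c.r₁)) :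
    Bdd (G.len e) (fun x => f (ρ e t x)) :=
  Bdd.of_continuousOn (hf.comp (X.prim_ρ e t ht).continuousOn (X.mem_J ht))

lemma bdd_errSq (hM : 0 < M e) (ht : t ∈ Icc 0 c.T) (d m : E → ℕ → ℝ) :
    Bdd (G.len e) (G.errSq ε M a ρ w t d m e) :=
  (((bdd_dens hM d).sub (X.bdd_ρ ht)).pow 2).add
    ((((bdd_vel hM a d m).sub (X.bdd_w ht)).pow 2).cmul (ε ^ 2))

lemma bdd_errDiss (hM : 0 < M e) (ht : t ∈ Icc 0 c.T) (d m : E → ℕ → ℝ) :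
    Bdd (G.len e) (G.errDiss M a w t d m e) :=
  ((bdd_vel hM a d m).abs.add (X.bdd_w ht).abs).mul (((bdd_vel hM a d m).sub (X.bdd_w ht)).pow 2)

lemma bdd_errEnergy (hPB : PressureBounds P c.r₀ c.r₁ c.W c.εm q₀ q₁ q₂) (hM : 0 < M e)
    (ht : t ∈ Icc 0 c.T) (d m : E → ℕ → ℝ) :
    Bdd (G.len e) (G.errEnergy P ε M a ρ w t d m e) := by
  have h1 := (bdd_dens (G := G) hM d).sub (X.bdd_ρ (e := e) ht)
  have h2 := (bdd_vel (G := G) hM a d m).sub (X.bdd_w (e := e) ht)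
  have h3 : Bdd (G.len e) (fun x => relEnergy P ε (G.dens M d e x) (G.vel M a d m e x)
      (ρ e t x) (w e t x)) :=
    (((bdd_comp_dens hM d P).sub (X.bdd_comp_ρ ht hPB.continuousOn)).sub
      ((X.bdd_comp_ρ ht hPB.continuousOn_deriv).mul h1)).add
      (((((bdd_dens hM d).mul (h2.pow 2)).div_const 2).add (((X.bdd_w ht).mul h1).mul h2)).cmul (ε ^ 2))
  exact (h3.cmul (a e)).add ((h2.cmul (ε ^ 2)).mul (X.bdd_fluxErr hM ht))

/-- The weak forms of the exact and of the discrete momentum balance are compatible: the error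
equation, tested with the difference of the discrete flux and the interpolated exact flux. -/
lemma galerkin_identity (hM : ∀ e, 0 < M e) (ht : t ∈ Icc 0 c.T) (hΔ : 0 < Δ)
    (hst : G.IsStep P ε Δ a γ hb t M d' m' d m) :
    let r : E → ℕ → ℝ := fun e i => m e i - G.nodal M (fluxAt a ρ w t) e i
    G.tot (fun e x =>
      ε ^ 2 * ((G.vel M a d m e x - G.vel M a d' m' e x) - Δ * wt e t x) * G.interp M r e x
      - Δ * ((enth P ε (G.dens M d e x) (G.vel M a d m e x) - enth P ε (ρ e t x) (w e t x))
        * G.slopeFn M r e x)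
      + Δ * (γ e * (|G.vel M a d m e x| * G.vel M a d m e x - |w e t x| * w e t x)
        * G.interp M r e x)) = 0 := by
  intro r
  have hr : G.Conservative (G.interp M r) :=
    conservative_interp_sub hst.cons ((G.conservative_interp_nodal hM).2 (X.balance t ht))
  have h1 := hst.momentum r hr
  have h2 := X.weak t ht M hM r hr
  have bR := fun e => bdd_interp (G := G) (hM e) r
  have bS := fun e => bdd_slopeFn (G := G) (hM e) r
  have bv := fun e => bdd_vel (G := G) (hM e) a d m
  have bv' := fun e => bdd_vel (G := G) (hM e) a d' m'
  have bw := fun e => X.bdd_w (e := e) ht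
  have i1 : G.Integ (fun e x => ε ^ 2 * ((G.vel M a d m e x - G.vel M a d' m' e x) / Δ)
      * G.interp M r e x) := fun e =>
    (((((bv e).sub (bv' e)).div_const Δ).cmul (ε ^ 2)).mul (bR e)).itg
  have i2 : G.Integ (fun e x => enth P ε (G.dens M d e x) (G.vel M a d m e x) * G.slopeFn M r e x) :=
    fun e => ((bdd_enth (hM e) P ε a d m).mul (bS e)).itg
  have i3 : G.Integ (fun e x => γ e * |G.vel M a d m e x| * G.vel M a d m e x * G.interp M r e x) :=
    fun e => ((((bv e).abs.cmul (γ e)).mul (bv e)).mul (bR e)).itg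
  have i4 : G.Integ (fun e x => ε ^ 2 * wt e t x * G.interp M r e x) :=
    fun e => ((X.sq_wt e t ht).cmul (ε ^ 2)).mul (bR e).sq
  have i5 : G.Integ (fun e x => enthalpyAt P ε ρ w t e x * G.slopeFn M r e x) :=
    fun e => ((X.prim_h e t ht).bdd.mul (bS e)).itg
  have i6 : G.Integ (fun e x => γ e * |w e t x| * w e t x * G.interp M r e x) :=
    fun e => ((((bw e).abs.cmul (γ e)).mul (bw e)).mul (bR e)).itg
  have h3 := tot_add (i1.sub i2) i3
  have h4 := tot_add (i4.sub i5) i6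
  rw [tot_sub i1 i2] at h3
  rw [tot_sub i4 i5] at h4
  have h5 := tot_sub ((i1.sub i2).add i3) ((i4.sub i5).add i6)
  have h6 := G.tot_cmul Δ (fun e x =>
    ε ^ 2 * ((G.vel M a d m e x - G.vel M a d' m' e x) / Δ) * G.interp M r e x
      - enth P ε (G.dens M d e x) (G.vel M a d m e x) * G.slopeFn M r e x
      + γ e * |G.vel M a d m e x| * G.vel M a d m e x * G.interp M r e x
    - (ε ^ 2 * wt e t x * G.interp M r e x - enthalpyAt P ε ρ w t e x * G.slopeFn M r e x
      + γ e * |w e t x| * w e t x * G.interp M r e x))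
  rw [h5, h3, h4, h1, h2, sub_self, mul_zero] at h6
  rw [← h6]
  congr 1
  funext e x
  simp only [enthalpyAt, enthalpy, enth]
  field_simp
  ring

end Exact

/-- One step of the modified relative energy estimate. -/
lemma exists_energy_step {P : ℝ → ℝ} {c : Consts} {B q₀ q₁ q₂ : ℝ} (hB : 0 < B)
    (hPB : PressureBounds P c.r₀ c.r₁ c.W c.εm q₀ q₁ q₂) :
    ∃ κ C : ℝ, 0 < κ ∧ 0 < C ∧ ∀ (ε : ℝ) (a γ : E → ℝ) (hb : V → ℝ → ℝ)
      (ρ w ρt wt : E → ℝ → ℝ → ℝ) (M : E → ℕ) (t t' Δ H : ℝ) (d m d' m' : E → ℕ → ℝ),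
      G.Exact P c B ε a γ hb ρ w ρt wt → (∀ e, 0 < M e) → (∀ e, G.edgeMeshSize M e ≤ H) →
      t ∈ Icc 0 c.T → t' ∈ Icc 0 c.T → 0 < Δ → t = t' + Δ →
      AdmState c M a d m → AdmState c M a d' m' → G.IsStep P ε Δ a γ hb t M d' m' d m →
      G.tot (G.errEnergy P ε M a ρ w t d m) - G.tot (G.errEnergy P ε M a ρ w t' d' m')
        + κ * Δ * G.tot (G.errDiss M a w t d m)
      ≤ C * (Δ * (G.tot (G.errSq ε M a ρ w t d m) + G.tot (G.errSq ε M a ρ w t' d' m')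
        + (Δ ^ 2 + H ^ 2))) := by
  obtain ⟨κ, C, hκ, hC, hstep⟩ := hPB.exists_step_inequality c.amin_pos c.a_le c.γmin_pos c.γ_le hB
  set S := ∑ e, (G.len e + 5 * B ^ 2) with hS
  have hS0 : 0 ≤ S := Finset.sum_nonneg fun e _ => by have := G.len_pos e; positivity
  refine ⟨κ, C * (1 + S), hκ, by positivity, ?_⟩
  intro ε a γ hb ρ w ρt wt M t t' Δ H d m d' m' X hM hH ht ht' hΔ htt hadm hadm' hst
  -- the consistency errors
  let α : E → ℝ → ℝ := fun e x => (ρ e t x - ρ e t' x) / Δ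
    + G.slopeFn M (G.nodal M (fluxAt a ρ w t)) e x / a e
  let β : E → ℝ → ℝ := fun e x => (w e t x - w e t' x) / Δ - wt e t x
  let y : E → ℝ → ℝ := G.fluxErr M a ρ w t
  let y' : E → ℝ → ℝ := G.fluxErr M a ρ w t'
  let η : E → ℝ → ℝ := fun e x => (y e x - y' e x) / Δ
  let Z : E → ℝ → ℝ := fun e x => errorDensity P ε (a e) (γ e) Δ (G.dens M d e x) (G.vel M a d m e x)
    (ρ e t x) (w e t x) (G.dens M d' e x) (G.vel M a d' m' e x) (ρ e t' x) (w e t' x)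
    (y e x) (α e x) (β e x)
  let R : E → ℝ → ℝ := fun e x => Δ ^ 2 + α e x ^ 2 + β e x ^ 2 + y e x ^ 2 + η e x ^ 2
  have ha := X.a_pos
  have bα : ∀ e, Bdd (G.len e) (α e) := fun e =>
    (((X.bdd_ρ ht).sub (X.bdd_ρ ht')).div_const Δ).add ((bdd_slopeFn (hM e) _).div_const (a e))
  have sβ : ∀ e, Sq (G.len e) (β e) := fun e => (X.sq_consist_w ht ht' hΔ htt).1
  have by_ : ∀ e, Bdd (G.len e) (y e) := fun e => X.bdd_fluxErr (hM e) ht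
  have by' : ∀ e, Bdd (G.len e) (y' e) := fun e => X.bdd_fluxErr (hM e) ht'
  have bη : ∀ e, Bdd (G.len e) (η e) := fun e => ((by_ e).sub (by' e)).div_const Δ
  have iR : G.Integ R := fun e => (((((Bdd.const (Δ ^ 2)).itg.add ((bα e).pow 2).itg).add (sβ e).sq).add
    ((by_ e).pow 2).itg).add ((bη e).pow 2).itg)
  have hR : G.tot R ≤ S * (Δ ^ 2 + H ^ 2) := by
    unfold tot
    rw [hS, Finset.sum_mul]
    refine Finset.sum_le_sum fun e _ => ?_
    have hl := G.len_pos e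
    have ii : ∀ {f : ℝ → ℝ}, Itg (G.len e) f → IntervalIntegrable f volume 0 (G.len e) := fun hf =>
      (intervalIntegrable_pipe hl.le).2 hf
    have j0 := (Bdd.const (ℓ := G.len e) (Δ ^ 2)).itg
    have j1 := ((bα e).pow 2).itg
    have j2 := (sβ e).sq
    have j3 := ((by_ e).pow 2).itg
    have j4 := ((bη e).pow 2).itg
    have e1 : ∫ x in (0 : ℝ)..G.len e, R e x = G.len e * Δ ^ 2 + (∫ x in (0 : ℝ)..G.len e, α e x ^ 2)
        + (∫ x in (0 : ℝ)..G.len e, β e x ^ 2) + (∫ x in (0 : ℝ)..G.len e, y e x ^ 2)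
        + ∫ x in (0 : ℝ)..G.len e, η e x ^ 2 := by
      simp only [R]
      rw [intervalIntegral.integral_add (ii (((j0.add j1).add j2).add j3)) (ii j4),
        intervalIntegral.integral_add (ii ((j0.add j1).add j2)) (ii j3),
        intervalIntegral.integral_add (ii (j0.add j1)) (ii j2),
        intervalIntegral.integral_add (ii j0) (ii j1)]
      simp
    have k1 := X.integral_consist_mass_sq_le (hM e) (hH e) ht ht' hΔ htt
    have k2 := (X.sq_consist_w (e := e) ht ht' hΔ htt).2
    have k3 := X.integral_fluxErr_sq_le (hM e) (hH e) ht
    have k4 := X.integral_fluxErr_diff_sq_le (hM e) (hH e) ht ht' hΔ htt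
    rw [e1]
    have hBH : 0 ≤ B ^ 2 * Δ ^ 2 := by positivity
    have hBH2 : 0 ≤ B ^ 2 * H ^ 2 := by positivity
    have hlH : 0 ≤ G.len e * H ^ 2 := by positivity
    simp only [mul_pow] at k1 k2 k3 k4
    simp only [α, β, y, η, y']
    nlinarith [k1, k2, k3, k4]
  -- the error equation
  have hZ : G.tot Z = 0 := by
    rw [← X.galerkin_identity hM ht hΔ hst]
    refine tot_congr fun e => ?_
    filter_upwards [hadm.ae ha (hM e), hst.mass_ae (hM e)] with x h1 h2
    have hae := (ha e).ne'
    have hR : a e * G.dens M d e x * G.vel M a d m e x - a e * ρ e t x * w e t x + y e x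
        = G.interp M m e x - G.interp M (G.nodal M (fluxAt a ρ w t)) e x := by
      simp only [y, fluxErr, h1.2.2, fluxAt, flux]
      ring
    have hA : a e * ((G.dens M d e x - G.dens M d' e x) - (ρ e t x - ρ e t' x)) + Δ * (a e * α e x)
        = -Δ * (G.slopeFn M m e x - G.slopeFn M (G.nodal M (fluxAt a ρ w t)) e x) := by
      simp only [α]
      field_simp
      linarith
    have hB : (G.vel M a d m e x - G.vel M a d' m' e x - (w e t x - w e t' x)) + Δ * β e x
        = G.vel M a d m e x - G.vel M a d' m' e x - Δ * wt e t x := by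
      simp only [β]
      field_simp
      ring
    simp only [Z, errorDensity, interp_sub, slopeFn_sub, hR]
    linear_combination (enth P ε (G.dens M d e x) (G.vel M a d m e x)
      - enth P ε (ρ e t x) (w e t x)) * hA + ε ^ 2 * (G.interp M m e x
      - G.interp M (G.nodal M (fluxAt a ρ w t)) e x) * hB
  have iZ : G.Integ Z := by
    intro e
    have b1 := bdd_enth (G := G) (hM e) P ε a d m
    have b2 : Bdd (G.len e) (fun x => enth P ε (ρ e t x) (w e t x)) := (X.prim_h e t ht).bdd
    have b3 := bdd_dens (G := G) (hM e) d
    have b4 := bdd_vel (G := G) (hM e) a d m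
    have b5 := bdd_dens (G := G) (hM e) d'
    have b6 := bdd_vel (G := G) (hM e) a d' m'
    have b7 := X.bdd_ρ (e := e) ht
    have b8 := X.bdd_ρ (e := e) ht'
    have b9 := X.bdd_w (e := e) ht
    have b10 := X.bdd_w (e := e) ht'
    have bf := (((b3.cmul (a e)).mul b4).sub ((b7.cmul (a e)).mul b9)).add (by_ e)
    have bh := b1.sub b2
    refine (((((((b3.sub b5).sub (b7.sub b8)).cmul (a e)).mul bh).add
      ((((b4.sub b6).sub (b9.sub b10)).cmul (ε ^ 2)).mul bf)).add
      (((((b4.abs.mul b4).sub (b9.abs.mul b9)).cmul (γ e)).mul bf).cmul Δ)).add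
      ((((bα e).cmul (a e)).mul bh).cmul Δ)).itg.add ?_
    exact (((sβ e).cmul (ε ^ 2)).mul bf.sq).cmul Δ
  have iE := fun e => (X.bdd_errEnergy hPB (hM e) ht d m).itg
  have iE' := fun e => (X.bdd_errEnergy hPB (hM e) ht' d' m').itg
  have iD : G.Integ (G.errDiss M a w t d m) := fun e => (X.bdd_errDiss (hM e) ht d m).itg
  have iS : G.Integ (G.errSq ε M a ρ w t d m) := fun e => (X.bdd_errSq (hM e) ht d m).itg
  have iS' : G.Integ (G.errSq ε M a ρ w t' d' m') := fun e => (X.bdd_errSq (hM e) ht' d' m').itg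
  have hle := tot_mono (G := G) (f := fun e x => G.errEnergy P ε M a ρ w t d m e x
      - G.errEnergy P ε M a ρ w t' d' m' e x + κ * Δ * G.errDiss M a w t d m e x)
    (g := fun e x => Z e x + C * Δ * (G.errSq ε M a ρ w t d m e x + G.errSq ε M a ρ w t' d' m' e x
      + R e x)) ((Integ.sub iE iE').add (iD.cmul _)) (iZ.add (((iS.add iS').add iR).cmul _)) (by
    intro e
    filter_upwards [hadm.ae ha (hM e), hadm'.ae ha (hM e), ae_mem_pipe (G.len e)] with x h1 h2 hx
    have hx' := Ioo_subset_Icc_self hx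
    have htt' : |t - t'| = Δ := by rw [htt, add_sub_cancel_left, abs_of_pos hΔ]
    have h3 := X.lip_ρ e t ht t' ht' x hx'
    have h4 := X.lip_w e t ht t' ht' x hx'
    rw [htt'] at h3 h4
    have := hstep ε (a e) (γ e) Δ (G.dens M d e x) (G.vel M a d m e x)
      (ρ e t x) (w e t x) (G.dens M d' e x) (G.vel M a d' m' e x) (ρ e t' x) (w e t' x)
      (y e x) (y' e x) (η e x) (α e x) (β e x) X.ε_nonneg X.ε_le (X.a_mem e) (X.γ_mem e) hΔ
      h1.1 (X.mem_J ht x hx') h2.1 (X.mem_J ht' x hx') h1.2.1 (X.abs_w_le_W ht x hx') h2.2.1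
      (X.abs_w_le_W ht' x hx') h3 h4 (by simp only [η]; field_simp)
    simp only [errEnergy, errDiss, errSq, Z, R]
    linarith)
  rw [tot_add (Integ.sub iE iE') (iD.cmul _), tot_sub iE iE', tot_cmul,
    tot_add iZ (((iS.add iS').add iR).cmul _), hZ, tot_cmul, tot_add (iS.add iS') iR, tot_add iS iS',
    zero_add] at hle
  refine hle.trans ?_
  have n1 : 0 ≤ G.tot (G.errSq ε M a ρ w t d m) := tot_nonneg fun e x => distSq_nonneg _ _ _ _ _
  have n2 : 0 ≤ G.tot (G.errSq ε M a ρ w t' d' m') := tot_nonneg fun e x => distSq_nonneg _ _ _ _ _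
  have hCΔ : 0 ≤ C * Δ := by positivity
  have n3 : 0 ≤ S * (G.tot (G.errSq ε M a ρ w t d m) + G.tot (G.errSq ε M a ρ w t' d' m'))
    + (Δ ^ 2 + H ^ 2) := by positivity
  calc _ ≤ C * Δ * ((G.tot (G.errSq ε M a ρ w t d m) + G.tot (G.errSq ε M a ρ w t' d' m')
      + S * (Δ ^ 2 + H ^ 2))) := by gcongr
    _ ≤ C * Δ * ((1 + S) * (G.tot (G.errSq ε M a ρ w t d m) + G.tot (G.errSq ε M a ρ w t' d' m')
      + (Δ ^ 2 + H ^ 2))) := by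
        gcongr
        linarith
    _ = _ := by ring

end PipeNetwork

lemma energyDensity_bounds {P : ℝ → ℝ} {r₀ r₁ W εm q₀ q₁ q₂ amin amax : ℝ}
    (hPB : PressureBounds P r₀ r₁ W εm q₀ q₁ q₂) (ham : 0 < amin) (haM : amin ≤ amax) (hr₁ : 0 < r₁) :
    ∃ k K : ℝ, 0 < k ∧ 0 < K ∧ ∀ ε a r w s z y : ℝ, 0 ≤ ε → ε ≤ εm → a ∈ Icc amin amax →
      r ∈ Icc r₀ r₁ → s ∈ Icc r₀ r₁ → |w| ≤ W → |z| ≤ W →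
      k * distSq ε r w s z - K * y ^ 2 ≤ energyDensity P ε a r w s z y ∧
      energyDensity P ε a r w s z y ≤ K * (distSq ε r w s z + y ^ 2) := by
  have hq := hPB.q₀_pos
  have hq1 := hPB.q₁_pos
  have hr := hPB.r₀_pos
  have hW := hPB.W_pos
  have hεm := hPB.εm_pos
  set A := amin * r₀ with hA
  have hA0 : 0 < A := by positivity
  set L := (q₁ + εm ^ 2 * W + W + r₁) / 2 with hL
  have hL0 : 0 < L := by positivity
  have haM0 : 0 < amax := ham.trans_le haM
  refine ⟨amin * min q₀ r₀ / 16, 4 * εm ^ 2 / A + amax * L + 1 + εm ^ 2, by positivity, by positivity,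
    fun ε a r w s z y hε hεm' ha hr' hs hw hz => ?_⟩
  have h1 := hPB.relEnergy_ge hε hεm' hr' hs hw hz
  have h2 := hPB.relEnergy_le hε hεm' hr' hs hw hz
  have ha0 : 0 < a := ham.trans_le ha.1
  have hε2 : ε ^ 2 ≤ εm ^ 2 := by gcongr
  have hy0 := sq_nonneg y
  have hdw := sq_nonneg (w - z)
  have hdr := sq_nonneg (r - s)
  have hdd := distSq_nonneg ε r w s z
  constructor
  · have h3 : amin * ((q₀ * (r - s) ^ 2 + ε ^ 2 * r₀ * (w - z) ^ 2) / 8) ≤ a * relEnergy P ε r w s z :=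
      mul_le_mul ha.1 h1 (by positivity) ha0.le
    have h4 : -(A / 16 * (w - z) ^ 2 + 4 / A * y ^ 2) ≤ (w - z) * y := by
      have : A / 16 * (w - z) ^ 2 + 4 / A * y ^ 2 + (w - z) * y
          = (A / 4 * (w - z) + 2 * y) ^ 2 / A := by field_simp; ring
      have h5 : 0 ≤ (A / 4 * (w - z) + 2 * y) ^ 2 / A := by positivity
      linarith
    have h5 := mul_le_mul_of_nonneg_left h4 (sq_nonneg ε)
    have h6 : 4 * ε ^ 2 / A * y ^ 2 ≤ (4 * εm ^ 2 / A + amax * L + 1 + εm ^ 2) * y ^ 2 := by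
      apply mul_le_mul_of_nonneg_right _ hy0
      have : 4 * ε ^ 2 / A ≤ 4 * εm ^ 2 / A := by gcongr
      have : 0 < amax * L := by positivity
      have := sq_nonneg εm
      linarith
    have h7 : amin * min q₀ r₀ / 16 * distSq ε r w s z
        ≤ amin * (q₀ * (r - s) ^ 2 + ε ^ 2 * r₀ * (w - z) ^ 2) / 16 := by
      have : min q₀ r₀ * distSq ε r w s z ≤ q₀ * (r - s) ^ 2 + ε ^ 2 * r₀ * (w - z) ^ 2 := by
        unfold distSq
        have := min_le_left q₀ r₀
        have := min_le_right q₀ r₀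
        have i1 : min q₀ r₀ * (r - s) ^ 2 ≤ q₀ * (r - s) ^ 2 := by gcongr
        have i2 : min q₀ r₀ * (ε ^ 2 * (w - z) ^ 2) ≤ r₀ * (ε ^ 2 * (w - z) ^ 2) := by gcongr
        linarith
      have := mul_le_mul_of_nonneg_left this ham.le
      linarith
    have h8 : 0 ≤ amin * (q₀ * (r - s) ^ 2) := by positivity
    have h9 : ε ^ 2 * (4 / A * y ^ 2) = 4 * ε ^ 2 / A * y ^ 2 := by ring
    have h10 : ε ^ 2 * (A / 16 * (w - z) ^ 2) = amin * (ε ^ 2 * r₀ * (w - z) ^ 2) / 16 := by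
      rw [hA]; ring
    unfold energyDensity
    linarith
  · have h3 : a * relEnergy P ε r w s z ≤ amax * (L * distSq ε r w s z) :=
      (mul_le_mul_of_nonneg_left h2 ha0.le).trans
        (mul_le_mul_of_nonneg_right ha.2 (mul_nonneg hL0.le hdd))
    have h4 : ε ^ 2 * (w - z) * y ≤ ε ^ 2 * (w - z) ^ 2 + εm ^ 2 * y ^ 2 := by
      have := mul_le_half_sq_add (w - z) y
      have h5 := mul_le_mul_of_nonneg_left this (sq_nonneg ε)
      have h6 : ε ^ 2 * y ^ 2 ≤ εm ^ 2 * y ^ 2 := by gcongr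
      have h7 : 0 ≤ ε ^ 2 * (w - z) ^ 2 := by positivity
      have h8 : 0 ≤ ε ^ 2 * y ^ 2 := by positivity
      linarith
    have h5 : ε ^ 2 * (w - z) ^ 2 ≤ distSq ε r w s z := by unfold distSq; linarith
    have h6 : 0 ≤ 4 * εm ^ 2 / A := by positivity
    have h7 : 0 ≤ amax * L := by positivity
    unfold energyDensity
    nlinarith [mul_nonneg h6 hdd, mul_nonneg h6 hy0, mul_nonneg h7 hy0,
      mul_nonneg (sq_nonneg εm) hdd]

/-- The difference of the velocities in terms of the fluxes and densities. -/
lemma sq_vel_sub_le {a r w s z μ W r₀ amin amax : ℝ} (ham : 0 < amin) (hr₀ : 0 < r₀)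
    (ha : a ∈ Icc amin amax) (hr : r₀ ≤ r) (hz : |z| ≤ W) (hμ : a * r * w = μ) :
    (w - z) ^ 2 ≤ 2 / (amin * r₀) ^ 2 * ((μ - a * s * z) ^ 2 + (amax * W) ^ 2 * (r - s) ^ 2) := by
  have ha0 : 0 < a := ham.trans_le ha.1
  have h1 : a * r * (w - z) = (μ - a * s * z) - a * z * (r - s) := by rw [← hμ]; ring
  have h2 : (amin * r₀) ^ 2 * (w - z) ^ 2 ≤ (a * r * (w - z)) ^ 2 := by
    rw [mul_pow (a * r)]
    have : amin * r₀ ≤ a * r := mul_le_mul ha.1 hr hr₀.le ha0.le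
    gcongr
  have h3 : (a * z * (r - s)) ^ 2 ≤ (amax * W) ^ 2 * (r - s) ^ 2 := by
    rw [mul_pow]
    apply mul_le_mul_of_nonneg_right _ (sq_nonneg _)
    rw [← sq_abs, abs_mul, abs_of_pos ha0]
    have h4 := ha.2
    have h5 : 0 ≤ amax := ha0.le.trans h4
    gcongr
  rw [div_mul_eq_mul_div, le_div_iff₀ (by positivity)]
  rw [h1] at h2
  nlinarith [sq_nonneg ((μ - a * s * z) + a * z * (r - s))]

namespace PipeNetwork

variable {V E : Type*} [Fintype V] [DecidableEq V] [Fintype E] (G : PipeNetwork V E)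

/-- The discrete initial state. -/
structure IsInitial (M : E → ℕ) (a : E → ℝ) (ρ w : E → ℝ → ℝ → ℝ) (d m : E → ℕ → ℝ) : Prop where
  dens : ∀ e, ∀ i < M e, d e i = (∫ x in (i * G.edgeMeshSize M e)..((i + 1) * G.edgeMeshSize M e),
    ρ e 0 x) / G.edgeMeshSize M e
  flux : ∀ e, ∀ i ≤ M e, m e i = G.nodal M (fluxAt a ρ w 0) e i

lemma exists_initial_error {P : ℝ → ℝ} (c : Consts) {B : ℝ} :
    ∃ C : ℝ, 0 < C ∧ ∀ (ε : ℝ) (a γ : E → ℝ) (hb : V → ℝ → ℝ)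
      (ρ w ρt wt : E → ℝ → ℝ → ℝ) (M : E → ℕ) (H : ℝ) (d m : E → ℕ → ℝ),
      G.Exact P c B ε a γ hb ρ w ρt wt → (∀ e, 0 < M e) → (∀ e, G.edgeMeshSize M e ≤ H) →
      AdmState c M a d m → G.IsInitial M a ρ w d m → G.tot (G.errSq ε M a ρ w 0 d m) ≤ C * H ^ 2 := by
  have hεm := c.εm_pos
  have ham := c.amin_pos
  have hr₀ := c.r₀_pos
  set K := 1 + c.εm ^ 2 * (2 / (c.amin * c.r₀) ^ 2) * (1 + (c.amax * c.W) ^ 2) with hK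
  have hK0 : 0 < K := by positivity
  refine ⟨Fintype.card E * (K * (3 * B ^ 2)) + 1, by positivity, ?_⟩
  intro ε a γ hb ρ w ρt wt M H d m X hM hH hadm hin
  have h0 : (0 : ℝ) ∈ Icc 0 c.T := ⟨le_rfl, c.T_pos.le⟩
  have key : ∀ e, ∫ x in (0 : ℝ)..G.len e, G.errSq ε M a ρ w 0 d m e x ≤ K * (3 * B ^ 2) * H ^ 2 := by
    intro e
    have hl := G.len_pos e
    have hh := G.mesh_pos (hM e)
    have bd := ((X.bdd_ρ (e := e) h0).sub (bdd_pc hh (G.mesh_mul (hM e))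
      (fun i => (∫ t in (i * G.edgeMeshSize M e)..((i + 1) * G.edgeMeshSize M e), ρ e 0 t)
        / G.edgeMeshSize M e))).pow 2
    have by_ := (X.bdd_fluxErr (hM e) h0).pow 2
    have h1 := (X.prim_ρ e 0 h0).integral_sub_average_le (X.bdd_ρ h0).sq hh (G.mesh_mul (hM e))
    have h2 := X.integral_fluxErr_sq_le (hM e) (hH e) h0
    have h3 : ∫ x in (0 : ℝ)..G.len e, G.errSq ε M a ρ w 0 d m e x ≤ ∫ x in (0 : ℝ)..G.len e,
        K * ((ρ e 0 x - pc (G.edgeMeshSize M e) (fun i => (∫ t in (i * G.edgeMeshSize M e)..((i + 1)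
          * G.edgeMeshSize M e), ρ e 0 t) / G.edgeMeshSize M e) x) ^ 2
          + G.fluxErr M a ρ w 0 e x ^ 2) := by
      refine integral_mono_pipe hl.le (X.bdd_errSq (hM e) h0 d m).itg ((bd.add by_).cmul K).itg ?_
      filter_upwards [ae_mem_cell hh (G.mesh_mul (hM e)), ae_mem_pipe (G.len e)] with x hx hxl
      obtain ⟨i, hi, hx⟩ := hx
      obtain ⟨g1, g2, g3⟩ := hadm.on_cell X.a_pos (hM e) hi hx
      have hx' := Ioo_subset_Icc_self hxl
      have e1 : G.interp M m e x = G.interp M (G.nodal M (fluxAt a ρ w 0)) e x := by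
        simp only [interp]
        rw [lin_eq_of_mem hh _ (Ioo_subset_Icc_self hx), lin_eq_of_mem hh _ (Ioo_subset_Icc_self hx),
          slopes, slopes, hin.flux e i hi.le, hin.flux e (i + 1) hi]
      have e2 : pc (G.edgeMeshSize M e) (fun i => (∫ t in (i * G.edgeMeshSize M e)..((i + 1)
          * G.edgeMeshSize M e), ρ e 0 t) / G.edgeMeshSize M e) x = G.dens M d e x := by
        rw [PipeNetwork.dens, pc_eq_of_mem hh _ (Ioo_subset_Ico_self hx),
          pc_eq_of_mem hh _ (Ioo_subset_Ico_self hx), hin.dens e i hi]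
      have h4 := sq_vel_sub_le (s := ρ e 0 x) ham hr₀ (X.a_mem e) g1.1 (X.abs_w_le_W h0 x hx') g3
      rw [e2]
      have e3 : G.interp M m e x - a e * ρ e 0 x * w e 0 x = - G.fluxErr M a ρ w 0 e x := by
        rw [e1]; simp only [fluxErr, fluxAt, flux]; ring
      rw [e3, neg_sq] at h4
      have h5 := mul_le_mul (show ε ^ 2 ≤ c.εm ^ 2 by
        have := X.ε_nonneg; have := X.ε_le; gcongr) h4 (sq_nonneg _) (sq_nonneg _)
      simp only [errSq, distSq]
      have e4 : (ρ e 0 x - G.dens M d e x) ^ 2 = (G.dens M d e x - ρ e 0 x) ^ 2 := by ring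
      rw [e4, hK]
      set D := (G.dens M d e x - ρ e 0 x) ^ 2
      set Y := G.fluxErr M a ρ w 0 e x ^ 2
      have hD : 0 ≤ D := sq_nonneg _
      have hY : 0 ≤ Y := sq_nonneg _
      have hQ : 0 ≤ c.εm ^ 2 * (2 / (c.amin * c.r₀) ^ 2) := by positivity
      have hA : 0 ≤ (c.amax * c.W) ^ 2 := sq_nonneg _
      nlinarith [mul_nonneg hQ hD, mul_nonneg (mul_nonneg hQ hA) hY, mul_nonneg hQ hY]
    refine h3.trans ?_
    rw [intervalIntegral.integral_const_mul, intervalIntegral.integral_add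
      ((intervalIntegrable_pipe hl.le).2 bd.itg) ((intervalIntegrable_pipe hl.le).2 by_.itg)]
    have h6 := X.bound_ρx e 0 h0
    have h7 : G.edgeMeshSize M e ^ 2 * ∫ x in (0 : ℝ)..G.len e, deriv (ρ e 0) x ^ 2 ≤ H ^ 2 * B ^ 2 :=
      mul_le_mul (by have := hH e; gcongr) h6 (integral_sq_nonneg hl.le _) (sq_nonneg _)
    simp only [sub_self, ne_eq, OfNat.ofNat_ne_zero, not_false_eq_true, zero_pow,
      intervalIntegral.integral_zero, mul_zero, add_zero] at h1
    calc _ ≤ K * (2 * (H ^ 2 * B ^ 2) + (B * H) ^ 2) := by gcongr; linarith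
      _ = _ := by ring
  have := tot_le_card_mul key
  nlinarith [sq_nonneg H]

lemma exists_error_bound {P : ℝ → ℝ} {c : Consts} {B q₀ q₁ q₂ : ℝ} (hB : 0 < B)
    (hPB : PressureBounds P c.r₀ c.r₁ c.W c.εm q₀ q₁ q₂) :
    ∃ C τ : ℝ, 0 < C ∧ 0 < τ ∧ ∀ (ε : ℝ) (a γ : E → ℝ) (hb : V → ℝ → ℝ)
      (ρ w ρt wt : E → ℝ → ℝ → ℝ) (M : E → ℕ) (Δ H : ℝ) (N : ℕ) (d m : ℕ → E → ℕ → ℝ),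
      G.Exact P c B ε a γ hb ρ w ρt wt → (∀ e, 0 < M e) → (∀ e, G.edgeMeshSize M e ≤ H) →
      0 < Δ → Δ ≤ τ → N * Δ ≤ c.T → G.IsInitial M a ρ w (d 0) (m 0) →
      (∀ n ≤ N, AdmState c M a (d n) (m n)) →
      (∀ n < N, G.IsStep P ε Δ a γ hb ((n + 1 : ℕ) * Δ) M (d n) (m n) (d (n + 1)) (m (n + 1))) →
      ∀ n ≤ N, G.tot (G.errSq ε M a ρ w (n * Δ) (d n) (m n))
        + ∑ k ∈ Finset.Icc 1 n, Δ * G.tot (G.errDiss M a w (k * Δ) (d k) (m k))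
        ≤ C * (Δ ^ 2 + H ^ 2) := by
  obtain ⟨κ, C₁, hκ, hC₁, hstep⟩ := G.exists_energy_step hB hPB
  obtain ⟨k, K, hk, hK, hbd⟩ := energyDensity_bounds hPB c.amin_pos c.a_le c.r₁_pos
  obtain ⟨C₀, hC₀, hinit⟩ := G.exists_initial_error (P := P) c (B := B)
  set q : ℝ := Fintype.card E * B ^ 2 with hq
  have hq0 : 0 ≤ q := by positivity
  set g := C₁ / k with hg
  have hg0 : 0 < g := by positivity
  have hT := c.T_pos
  set A := Real.exp (4 * g * c.T) * (K * C₀ + 2 * (K * q) + 2 * c.T * C₁) with hA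
  have hA0 : 0 < A := by positivity
  set μ := min k κ with hμ
  have hμ0 : 0 < μ := lt_min hk hκ
  refine ⟨A / μ, 1 / (2 * g), by positivity, by positivity, ?_⟩
  intro ε a γ hb ρ w ρt wt M Δ H N d m X hM hH hΔ hΔτ hNΔ hin hadm hst
  have htime : ∀ n ≤ N, (n : ℝ) * Δ ∈ Icc 0 c.T := fun n hn =>
    ⟨by positivity, le_trans (by gcongr) hNΔ⟩
  have ha := X.a_pos
  have hy : ∀ n ≤ N, G.tot (fun e x => G.fluxErr M a ρ w (n * Δ) e x ^ 2) ≤ q * H ^ 2 := by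
    intro n hn
    have := tot_le_card_mul (G := G) (fun e =>
      X.integral_fluxErr_sq_le (e := e) (hM e) (hH e) (htime n hn))
    calc _ ≤ _ := this
      _ = _ := by rw [hq]; ring
  have hbounds : ∀ n ≤ N, k * G.tot (G.errSq ε M a ρ w (n * Δ) (d n) (m n)) - K * (q * H ^ 2)
        ≤ G.tot (G.errEnergy P ε M a ρ w (n * Δ) (d n) (m n)) ∧
      G.tot (G.errEnergy P ε M a ρ w (n * Δ) (d n) (m n))
        ≤ K * (G.tot (G.errSq ε M a ρ w (n * Δ) (d n) (m n)) + q * H ^ 2) := by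
    intro n hn
    have ht := htime n hn
    have i1 : G.Integ (G.errSq ε M a ρ w (n * Δ) (d n) (m n)) := fun e =>
      (X.bdd_errSq (hM e) ht _ _).itg
    have i2 : G.Integ (fun e x => G.fluxErr M a ρ w (n * Δ) e x ^ 2) := fun e =>
      ((X.bdd_fluxErr (hM e) ht).pow 2).itg
    have i3 : G.Integ (G.errEnergy P ε M a ρ w (n * Δ) (d n) (m n)) := fun e =>
      (X.bdd_errEnergy hPB (hM e) ht _ _).itg
    have hpt : ∀ e, ∀ᵐ x ∂(pipeMeasure (G.len e)), _ := fun e => by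
      filter_upwards [(hadm n hn).ae ha (hM e), ae_mem_pipe (G.len e)] with x h1 hx
      have hx' := Ioo_subset_Icc_self hx
      exact hbd ε (a e) (G.dens M (d n) e x) (G.vel M a (d n) (m n) e x) (ρ e (n * Δ) x)
        (w e (n * Δ) x) (G.fluxErr M a ρ w (n * Δ) e x) X.ε_nonneg X.ε_le (X.a_mem e) h1.1
        (X.mem_J ht x hx') h1.2.1 (X.abs_w_le_W ht x hx')
    have h1 := tot_mono (Integ.sub (i1.cmul k) (i2.cmul K)) i3 fun e => (hpt e).mono fun x hx => hx.1
    have h2 := tot_mono i3 ((i1.add i2).cmul K) fun e => (hpt e).mono fun x hx => hx.2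
    rw [tot_sub (i1.cmul k) (i2.cmul K), tot_cmul, tot_cmul] at h1
    rw [tot_cmul, tot_add i1 i2] at h2
    have h3 := mul_le_mul_of_nonneg_left (hy n hn) hK.le
    constructor <;> linarith
  set b := C₁ * (Δ ^ 2 + H ^ 2) with hb'
  have hb0 : 0 ≤ b := by positivity
  let en : ℕ → ℝ := fun n => G.tot (G.errEnergy P ε M a ρ w (n * Δ) (d n) (m n)) + K * (q * H ^ 2)
  let F : ℕ → ℝ := fun n => κ * Δ * G.tot (G.errDiss M a w (n * Δ) (d n) (m n))
  have hSn : ∀ n : ℕ, 0 ≤ G.tot (G.errSq ε M a ρ w (n * Δ) (d n) (m n)) := fun n =>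
    tot_nonneg fun e x => distSq_nonneg _ _ _ _ _
  have hDn : ∀ n : ℕ, 0 ≤ G.tot (G.errDiss M a w (n * Δ) (d n) (m n)) := fun n =>
    tot_nonneg fun e x => dissDensity_nonneg _ _
  have hen : ∀ n ≤ N, k * G.tot (G.errSq ε M a ρ w (n * Δ) (d n) (m n)) ≤ en n := fun n hn => by
    have := (hbounds n hn).1
    simp only [en]; linarith
  have hgr := discrete_gronwall (a := en) (F := F) (N := N) (k := g) (Δ := Δ) (b := b) hg0.le hΔ.le hb0
    (by rw [le_div_iff₀ (by positivity)] at hΔτ; linarith)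
    (fun n hn => (mul_nonneg hk.le (hSn n)).trans (hen n hn))
    (fun n => mul_nonneg (by positivity) (hDn n)) (by
      intro n hn
      have h1 := hstep ε a γ hb ρ w ρt wt M ((n + 1 : ℕ) * Δ) (n * Δ) Δ H _ _ _ _ X hM hH
        (htime _ hn) (htime _ hn.le) hΔ (by push_cast; ring) (hadm _ hn) (hadm _ hn.le) (hst n hn)
      have h2 := hen (n + 1) hn
      have h3 := hen n hn.le
      have h4 : C₁ * (Δ * (G.tot (G.errSq ε M a ρ w ((n + 1 : ℕ) * Δ) (d (n + 1)) (m (n + 1)))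
          + G.tot (G.errSq ε M a ρ w (n * Δ) (d n) (m n)))) ≤ g * Δ * (en (n + 1) + en n) := by
        have : C₁ = g * k := by rw [hg]; field_simp
        rw [this]
        have := mul_le_mul_of_nonneg_left (add_le_add h2 h3) (mul_nonneg hg0.le hΔ.le)
        linarith
      simp only [en, F] at h4 ⊢
      rw [hb']
      linarith)
  intro n hn
  have h1 := hgr n hn
  have h2 := hen n hn
  have h3 : en 0 ≤ (K * C₀ + 2 * (K * q)) * H ^ 2 := by
    have i1 := hinit ε a γ hb ρ w ρt wt M H (d 0) (m 0) X hM hH (hadm 0 (Nat.zero_le _)) hin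
    have i2 := (hbounds 0 (Nat.zero_le _)).2
    simp only [Nat.cast_zero, zero_mul] at i2
    simp only [en, Nat.cast_zero, zero_mul]
    have := mul_le_mul_of_nonneg_left i1 hK.le
    linarith
  have h4 : Real.exp (4 * g * (N * Δ)) * (en 0 + 2 * (N * Δ) * b) ≤ A * (Δ ^ 2 + H ^ 2) := by
    have i1 : en 0 + 2 * (N * Δ) * b ≤ (K * C₀ + 2 * (K * q) + 2 * c.T * C₁) * (Δ ^ 2 + H ^ 2) := by
      have j1 : 2 * (N * Δ) * b ≤ 2 * c.T * b := by gcongr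
      have j2 : 0 ≤ (K * C₀ + 2 * (K * q)) * Δ ^ 2 := by positivity
      rw [hb'] at j1 ⊢
      linarith
    rw [hA]
    have hexp : Real.exp (4 * g * (N * Δ)) ≤ Real.exp (4 * g * c.T) := by
      apply Real.exp_le_exp.2; gcongr
    calc _ ≤ Real.exp (4 * g * (N * Δ)) * ((K * C₀ + 2 * (K * q) + 2 * c.T * C₁) * (Δ ^ 2 + H ^ 2)) := by
          gcongr
      _ ≤ Real.exp (4 * g * c.T) * ((K * C₀ + 2 * (K * q) + 2 * c.T * C₁) * (Δ ^ 2 + H ^ 2)) := by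
          gcongr
      _ = _ := by ring
  have h5 : μ * (G.tot (G.errSq ε M a ρ w (n * Δ) (d n) (m n))
        + ∑ k ∈ Finset.Icc 1 n, Δ * G.tot (G.errDiss M a w (k * Δ) (d k) (m k)))
      ≤ en n + ∑ j ∈ Finset.Icc 1 n, F j := by
    rw [mul_add, Finset.mul_sum]
    refine add_le_add ?_ (Finset.sum_le_sum fun j _ => ?_)
    · exact (mul_le_mul_of_nonneg_right (min_le_left _ _) (hSn n)).trans h2
    · have := mul_le_mul_of_nonneg_right (min_le_right k κ) (mul_nonneg hΔ.le (hDn j))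
      simp only [F]
      linarith
  rw [div_mul_eq_mul_div, le_div_iff₀ hμ0, mul_comm]
  exact h5.trans (h1.trans h4)

end PipeNetwork

lemma exists_mem_Ioo_of_ae {ℓ α β : ℝ} (hαβ : α < β) (h : Ioo α β ⊆ Ioo 0 ℓ) {p : ℝ → Prop}
    (hp : ∀ᵐ x ∂(pipeMeasure ℓ), p x) : ∃ x ∈ Ioo α β, p x := by
  rw [ae_restrict_iff' measurableSet_Ioo] at hp
  by_contra! hc
  have hpos : volume (Ioo α β) ≠ 0 := by
    rw [Real.volume_Ioo]; simpa using hαβ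
  apply hpos
  refine measure_mono_null (fun s hs => ?_) (ae_iff.1 hp)
  simp only [mem_ofPred_eq]
  intro hh
  exact hc s hs (hh (h hs))

namespace PipeNetwork

variable {V E : Type*} [Fintype V] [DecidableEq V] [Fintype E] (G : PipeNetwork V E)

/-! ### The variational form of one time step -/

/-- The momentum balance of one time step, tested with `r`, where `v'` is the old velocity. -/
noncomputable def stepForm (P : ℝ → ℝ) (ε Δ : ℝ) (a γ : E → ℝ) (hb : V → ℝ → ℝ) (t : ℝ) (M : E → ℕ)
    (v' : E → ℝ → ℝ) (d m r : E → ℕ → ℝ) : ℝ :=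
  G.tot (fun e x => ε ^ 2 * (G.vel M a d m e x - v' e x) * G.interp M r e x
    - Δ * (enth P ε (G.dens M d e x) (G.vel M a d m e x) * G.slopeFn M r e x)
    + Δ * (γ e * (|G.vel M a d m e x| * G.vel M a d m e x) * G.interp M r e x))
  + Δ * G.bdryTerm hb t (G.interp M r)

section

variable {G} {P : ℝ → ℝ} {ε Δ t : ℝ} {a γ : E → ℝ} {hb : V → ℝ → ℝ} {M : E → ℕ}
  {v' : E → ℝ → ℝ} {d m d' m' : E → ℕ → ℝ} {c : Consts} {q₀ q₁ q₂ : ℝ}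

lemma integ_stepForm (hM : ∀ e, 0 < M e) (hv : ∀ e, Bdd (G.len e) (v' e)) (P : ℝ → ℝ) (ε Δ : ℝ)
    (a γ : E → ℝ) (d m r : E → ℕ → ℝ) (e : E) :
    Bdd (G.len e) (fun x => ε ^ 2 * (G.vel M a d m e x - v' e x) * G.interp M r e x
      - Δ * (enth P ε (G.dens M d e x) (G.vel M a d m e x) * G.slopeFn M r e x)
      + Δ * (γ e * (|G.vel M a d m e x| * G.vel M a d m e x) * G.interp M r e x)) := by
  have b1 := bdd_vel (G := G) (hM e) a d m
  have b2 := bdd_interp (G := G) (hM e) r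
  exact ((((b1.sub (hv e)).cmul (ε ^ 2)).mul b2).sub
    (((bdd_enth (hM e) P ε a d m).mul (bdd_slopeFn (hM e) r)).cmul Δ)).add
    ((((b1.abs.mul b1).cmul (γ e)).mul b2).cmul Δ)

lemma stepForm_congr {v'' : E → ℝ → ℝ} (h : ∀ e, ∀ᵐ x ∂(pipeMeasure (G.len e)), v' e x = v'' e x)
    (r : E → ℕ → ℝ) :
    G.stepForm P ε Δ a γ hb t M v' d m r = G.stepForm P ε Δ a γ hb t M v'' d m r := by
  unfold stepForm
  congr 1
  refine tot_congr fun e => ?_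
  filter_upwards [h e] with x hx
  rw [hx]

/-- The momentum balance in terms of the form of the time step. -/
lemma momentum_iff (hM : ∀ e, 0 < M e) (hΔ : 0 < Δ) (hv : ∀ e, Bdd (G.len e) (v' e)) (r : E → ℕ → ℝ) :
    G.tot (fun e x => ε ^ 2 * ((G.vel M a d m e x - v' e x) / Δ) * G.interp M r e x)
      - G.tot (fun e x => enth P ε (G.dens M d e x) (G.vel M a d m e x) * G.slopeFn M r e x)
      + G.tot (fun e x => γ e * |G.vel M a d m e x| * G.vel M a d m e x * G.interp M r e x)
      = -G.bdryTerm hb t (G.interp M r) ↔ G.stepForm P ε Δ a γ hb t M v' d m r = 0 := by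
  have b1 := fun e => bdd_vel (G := G) (hM e) a d m
  have b2 := fun e => bdd_interp (G := G) (hM e) r
  have i1 : G.Integ (fun e x => ε ^ 2 * ((G.vel M a d m e x - v' e x) / Δ) * G.interp M r e x) :=
    fun e => (((((b1 e).sub (hv e)).div_const Δ).cmul (ε ^ 2)).mul (b2 e)).itg
  have i2 : G.Integ (fun e x => enth P ε (G.dens M d e x) (G.vel M a d m e x) * G.slopeFn M r e x) :=
    fun e => ((bdd_enth (hM e) P ε a d m).mul (bdd_slopeFn (hM e) r)).itg
  have i3 : G.Integ (fun e x => γ e * |G.vel M a d m e x| * G.vel M a d m e x * G.interp M r e x) :=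
    fun e => ((((b1 e).abs.cmul (γ e)).mul (b1 e)).mul (b2 e)).itg
  have h : G.stepForm P ε Δ a γ hb t M v' d m r
      = Δ * ((G.tot (fun e x => ε ^ 2 * ((G.vel M a d m e x - v' e x) / Δ) * G.interp M r e x)
      - G.tot (fun e x => enth P ε (G.dens M d e x) (G.vel M a d m e x) * G.slopeFn M r e x)
      + G.tot (fun e x => γ e * |G.vel M a d m e x| * G.vel M a d m e x * G.interp M r e x))
      + G.bdryTerm hb t (G.interp M r)) := by
    rw [← tot_sub i1 i2, ← tot_add (i1.sub i2) i3, mul_add, ← tot_cmul, stepForm]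
    congr 2
    funext e x
    field_simp
  rw [h, mul_eq_zero, or_iff_right hΔ.ne', eq_neg_iff_add_eq_zero]

lemma bdryTerm_add {u v : E → ℝ → ℝ} :
    G.bdryTerm hb t (fun e x => u e x + v e x) = G.bdryTerm hb t u + G.bdryTerm hb t v := by
  unfold bdryTerm
  rw [← Finset.sum_add_distrib]
  refine Finset.sum_congr rfl fun z _ => ?_
  rw [← Finset.sum_add_distrib]
  refine Finset.sum_congr rfl fun e _ => ?_
  simp only [atVertex]
  ring

lemma bdryTerm_cmul (k : ℝ) {u : E → ℝ → ℝ} :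
    G.bdryTerm hb t (fun e x => k * u e x) = k * G.bdryTerm hb t u := by
  unfold bdryTerm
  simp only [Finset.mul_sum]
  refine Finset.sum_congr rfl fun z _ => Finset.sum_congr rfl fun e _ => ?_
  simp only [atVertex]
  ring

lemma interp_add (r s : E → ℕ → ℝ) (e : E) (x : ℝ) :
    G.interp M (fun e i => r e i + s e i) e x = G.interp M r e x + G.interp M s e x := lin_add _ _ _ _

lemma interp_cmul (k : ℝ) (r : E → ℕ → ℝ) (e : E) (x : ℝ) :
    G.interp M (fun e i => k * r e i) e x = k * G.interp M r e x := lin_smul _ _ _ _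

lemma slopeFn_add (r s : E → ℕ → ℝ) (e : E) (x : ℝ) :
    G.slopeFn M (fun e i => r e i + s e i) e x = G.slopeFn M r e x + G.slopeFn M s e x :=
  slopes_add _ _ _ _

lemma slopeFn_cmul (k : ℝ) (r : E → ℕ → ℝ) (e : E) (x : ℝ) :
    G.slopeFn M (fun e i => k * r e i) e x = k * G.slopeFn M r e x :=
  slopes_smul _ _ _ _

lemma stepForm_add (hM : ∀ e, 0 < M e) (hv : ∀ e, Bdd (G.len e) (v' e)) (r s : E → ℕ → ℝ) :
    G.stepForm P ε Δ a γ hb t M v' d m (fun e i => r e i + s e i)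
      = G.stepForm P ε Δ a γ hb t M v' d m r + G.stepForm P ε Δ a γ hb t M v' d m s := by
  have i1 := fun e => (integ_stepForm hM hv P ε Δ a γ d m r e).itg
  have i2 := fun e => (integ_stepForm hM hv P ε Δ a γ d m s e).itg
  have h := tot_add i1 i2
  have hbd : G.bdryTerm hb t (G.interp M (fun e i => r e i + s e i))
      = G.bdryTerm hb t (G.interp M r) + G.bdryTerm hb t (G.interp M s) := by
    rw [← bdryTerm_add]
    congr 1
    funext e x
    exact interp_add r s e x
  unfold stepForm
  rw [hbd, mul_add, add_add_add_comm, ← h]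
  congr 2
  funext e x
  rw [interp_add, slopeFn_add]
  ring

lemma stepForm_cmul (k : ℝ) (r : E → ℕ → ℝ) :
    G.stepForm P ε Δ a γ hb t M v' d m (fun e i => k * r e i)
      = k * G.stepForm P ε Δ a γ hb t M v' d m r := by
  have hbd : G.bdryTerm hb t (G.interp M (fun e i => k * r e i))
      = k * G.bdryTerm hb t (G.interp M r) := by
    rw [← bdryTerm_cmul]
    congr 1
    funext e x
    exact interp_cmul k r e x
  unfold stepForm
  rw [hbd, mul_add, ← tot_cmul, mul_left_comm]
  congr 2
  funext e x
  rw [interp_cmul, slopeFn_cmul]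
  ring

/-- The difference of the form at two states. -/
lemma stepForm_sub (hM : ∀ e, 0 < M e) (hv : ∀ e, Bdd (G.len e) (v' e)) (d₂ m₂ r : E → ℕ → ℝ) :
    G.stepForm P ε Δ a γ hb t M v' d m r - G.stepForm P ε Δ a γ hb t M v' d₂ m₂ r
      = G.tot (fun e x => ε ^ 2 * (G.vel M a d m e x - G.vel M a d₂ m₂ e x) * G.interp M r e x
        - Δ * ((enth P ε (G.dens M d e x) (G.vel M a d m e x)
          - enth P ε (G.dens M d₂ e x) (G.vel M a d₂ m₂ e x)) * G.slopeFn M r e x)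
        + Δ * (γ e * (|G.vel M a d m e x| * G.vel M a d m e x
          - |G.vel M a d₂ m₂ e x| * G.vel M a d₂ m₂ e x) * G.interp M r e x)) := by
  have i1 := fun e => (integ_stepForm hM hv P ε Δ a γ d m r e).itg
  have i2 := fun e => (integ_stepForm hM hv P ε Δ a γ d₂ m₂ r e).itg
  have h := tot_sub i1 i2
  unfold stepForm
  rw [add_sub_add_right_eq_sub, ← h]
  congr 1
  funext e x
  ring

/-- The distance of two discrete states, including the dissipation. -/
noncomputable def stateDist (G : PipeNetwork V E) (ε Δ : ℝ) (M : E → ℕ) (a : E → ℝ)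
    (d m d₂ m₂ : E → ℕ → ℝ) (e : E) (x : ℝ) : ℝ :=
  distSq ε (G.dens M d e x) (G.vel M a d m e x) (G.dens M d₂ e x) (G.vel M a d₂ m₂ e x)
    + Δ * dissDensity (G.vel M a d m e x) (G.vel M a d₂ m₂ e x)

lemma bdd_stateDist (hM : ∀ e, 0 < M e) (ε Δ : ℝ) (a : E → ℝ) (d m d₂ m₂ : E → ℕ → ℝ) (e : E) :
    Bdd (G.len e) (G.stateDist ε Δ M a d m d₂ m₂ e) := by
  have b1 := bdd_vel (G := G) (hM e) a d m
  have b2 := bdd_vel (G := G) (hM e) a d₂ m₂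
  exact ((((bdd_dens (hM e) d).sub (bdd_dens (hM e) d₂)).pow 2).add
    (((b1.sub b2).pow 2).cmul (ε ^ 2))).add (((b1.abs.add b2.abs).mul ((b1.sub b2).pow 2)).cmul Δ)

lemma stateDist_nonneg (hΔ : 0 ≤ Δ) (d m d₂ m₂ : E → ℕ → ℝ) (e : E) (x : ℝ) :
    0 ≤ G.stateDist ε Δ M a d m d₂ m₂ e x :=
  add_nonneg (distSq_nonneg _ _ _ _ _) (mul_nonneg hΔ (dissDensity_nonneg _ _))

end

/-- Strong monotonicity of the form of the time step on the set of admissible states. -/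
lemma exists_stepForm_mono {P : ℝ → ℝ} {c : Consts} {q₀ q₁ q₂ : ℝ}
    (hPB : PressureBounds P c.r₀ c.r₁ c.W c.εm q₀ q₁ q₂) :
    ∃ k δ : ℝ, 0 < k ∧ 0 < δ ∧ ∀ (ε Δ t : ℝ) (a γ : E → ℝ) (hb : V → ℝ → ℝ) (M : E → ℕ)
      (v' : E → ℝ → ℝ) (d m d₂ m₂ : E → ℕ → ℝ),
      0 ≤ ε → ε ≤ c.εm → (∀ e, a e ∈ Icc c.amin c.amax) → (∀ e, γ e ∈ Icc c.γmin c.γmax) →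
      0 < Δ → Δ ≤ δ → (∀ e, 0 < M e) → (∀ e, Bdd (G.len e) (v' e)) →
      AdmState c M a d m → AdmState c M a d₂ m₂ →
      (∀ e, ∀ i < M e, a e * (d e i - d₂ e i)
        = -Δ * slopes (G.edgeMeshSize M e) (fun i => m e i - m₂ e i) i) →
      k * G.tot (G.stateDist ε Δ M a d m d₂ m₂)
        ≤ G.stepForm P ε Δ a γ hb t M v' d m (fun e i => m e i - m₂ e i)
          - G.stepForm P ε Δ a γ hb t M v' d₂ m₂ (fun e i => m e i - m₂ e i) := by
  obtain ⟨k, δ, hk, hδ, hmono⟩ := hPB.exists_mono_inequality c.amin_pos c.a_le c.γmin_pos c.γ_le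
  refine ⟨k, δ, hk, hδ, ?_⟩
  intro ε Δ t a γ hb M v' d m d₂ m₂ hε hεm ha hγ hΔ hΔδ hM hv hadm hadm₂ hslope
  have ha0 : ∀ e, 0 < a e := fun e => c.amin_pos.trans_le (ha e).1
  rw [stepForm_sub hM hv, ← tot_cmul]
  have i1 := fun e => (integ_stepForm hM hv P ε Δ a γ d m (fun e i => m e i - m₂ e i) e).itg
  have i2 := fun e => (integ_stepForm hM hv P ε Δ a γ d₂ m₂ (fun e i => m e i - m₂ e i) e).itg
  have i3 : G.Integ _ := fun e => (i1 e).sub (i2 e)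
  refine tot_mono (fun e => ((bdd_stateDist hM ε Δ a d m d₂ m₂ e).cmul k).itg) (fun e => ?_) fun e => ?_
  · refine Integrable.congr (i3 e) (Filter.Eventually.of_forall fun x => ?_)
    simp only
    ring
  · filter_upwards [ae_mem_cell (G.mesh_pos (hM e)) (G.mesh_mul (hM e))] with x hx
    obtain ⟨i, hi, hx⟩ := hx
    obtain ⟨g1, g2, g3⟩ := hadm.on_cell ha0 (hM e) hi hx
    obtain ⟨k1, k2, k3⟩ := hadm₂.on_cell ha0 (hM e) hi hx
    have hx' := Ioo_subset_Ico_self hx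
    have h := hmono ε (a e) (γ e) Δ _ _ _ _ hε hεm (ha e) (hγ e) hΔ hΔδ g1 k1 g2 k2
    have e1 : a e * (G.dens M d e x - G.dens M d₂ e x)
        = -Δ * G.slopeFn M (fun e i => m e i - m₂ e i) e x := by
      rw [dens, dens, slopeFn, pc_eq_of_mem (G.mesh_pos (hM e)) _ hx',
        pc_eq_of_mem (G.mesh_pos (hM e)) _ hx', pc_eq_of_mem (G.mesh_pos (hM e)) _ hx']
      exact hslope e i hi
    rw [e1, g3, k3] at h
    simp only [stateDist, interp_sub]
    linarith

/-- The solution of one time step is unique. -/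
lemma exists_step_unique {P : ℝ → ℝ} {c : Consts} {q₀ q₁ q₂ : ℝ}
    (hPB : PressureBounds P c.r₀ c.r₁ c.W c.εm q₀ q₁ q₂) :
    ∃ δ : ℝ, 0 < δ ∧ ∀ (ε Δ t : ℝ) (a γ : E → ℝ) (hb : V → ℝ → ℝ) (M : E → ℕ)
      (d' m' d₂' m₂' d m d₂ m₂ : E → ℕ → ℝ),
      0 ≤ ε → ε ≤ c.εm → (∀ e, a e ∈ Icc c.amin c.amax) → (∀ e, γ e ∈ Icc c.γmin c.γmax) →
      0 < Δ → Δ ≤ δ → (∀ e, 0 < M e) →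
      (∀ e, ∀ i < M e, d' e i = d₂' e i) → (∀ e, ∀ x ∈ Icc 0 (G.len e),
        G.interp M m' e x = G.interp M m₂' e x) →
      AdmState c M a d m → AdmState c M a d₂ m₂ →
      G.IsStep P ε Δ a γ hb t M d' m' d m → G.IsStep P ε Δ a γ hb t M d₂' m₂' d₂ m₂ →
      (∀ e, ∀ i < M e, d e i = d₂ e i) ∧
        ∀ e, ∀ x ∈ Icc 0 (G.len e), G.interp M m e x = G.interp M m₂ e x := by
  obtain ⟨k, δ, hk, hδ, hmono⟩ := G.exists_stepForm_mono hPB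
  refine ⟨δ, hδ, ?_⟩
  intro ε Δ t a γ hb M d' m' d₂' m₂' d m d₂ m₂ hε hεm ha hγ hΔ hΔδ hM hd' hm' hadm hadm₂ hst hst₂
  have ha0 : ∀ e, 0 < a e := fun e => c.amin_pos.trans_le (ha e).1
  have hbv := fun e => bdd_vel (G := G) (hM e) a d' m'
  have hbv₂ := fun e => bdd_vel (G := G) (hM e) a d₂' m₂'
  have hv' : ∀ e, ∀ᵐ x ∂(pipeMeasure (G.len e)), G.vel M a d₂' m₂' e x = G.vel M a d' m' e x := by
    intro e
    filter_upwards [ae_mem_cell (G.mesh_pos (hM e)) (G.mesh_mul (hM e)), ae_mem_pipe (G.len e)]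
      with x hx hxl
    obtain ⟨i, hi, hx⟩ := hx
    rw [vel, vel, hm' e x (Ioo_subset_Icc_self hxl), dens, dens,
      pc_eq_of_mem (G.mesh_pos (hM e)) _ (Ioo_subset_Ico_self hx),
      pc_eq_of_mem (G.mesh_pos (hM e)) _ (Ioo_subset_Ico_self hx), hd' e i hi]
  have hr := conservative_interp_sub hst.cons hst₂.cons
  have h1 := (momentum_iff hM hΔ hbv _).1 (hst.momentum _ hr)
  have h2 := (momentum_iff hM hΔ hbv₂ _).1 (hst₂.momentum _ hr)
  rw [stepForm_congr hv'] at h2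
  have h3 := hmono ε Δ t a γ hb M (G.vel M a d' m') d m d₂ m₂ hε hεm ha hγ hΔ hΔδ hM hbv hadm hadm₂ (by
    intro e i hi
    have j1 := hst.mass e i hi
    have j2 := hst₂.mass e i hi
    rw [slopes_sub, ← hd' e i hi] at *
    linarith)
  rw [h1, h2, sub_zero] at h3
  have hnn := stateDist_nonneg (G := G) (M := M) (a := a) (ε := ε) hΔ.le d m d₂ m₂
  have h4 : ∀ e, ∀ᵐ x ∂(pipeMeasure (G.len e)), G.stateDist ε Δ M a d m d₂ m₂ e x = 0 := by
    intro e
    have j1 := integral_le_tot (G := G) hnn e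
    have j2 : G.tot (G.stateDist ε Δ M a d m d₂ m₂) ≤ 0 := nonpos_of_mul_nonpos_right h3 hk
    rw [integral_pipe (G.len_pos e).le] at j1
    have j3 := (integral_eq_zero_iff_of_nonneg (hnn e) (bdd_stateDist hM ε Δ a d m d₂ m₂ e).itg).1
      (le_antisymm (j1.trans j2) (integral_nonneg (hnn e)))
    exact j3
  have h5 : ∀ e, ∀ᵐ x ∂(pipeMeasure (G.len e)), G.dens M d e x = G.dens M d₂ e x ∧
      G.vel M a d m e x = G.vel M a d₂ m₂ e x := by
    intro e
    filter_upwards [h4 e] with x hx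
    unfold stateDist at hx
    have n1 := distSq_nonneg ε (G.dens M d e x) (G.vel M a d m e x) (G.dens M d₂ e x) (G.vel M a d₂ m₂ e x)
    have n2 := mul_nonneg hΔ.le (dissDensity_nonneg (G.vel M a d m e x) (G.vel M a d₂ m₂ e x))
    have z1 : distSq ε (G.dens M d e x) (G.vel M a d m e x) (G.dens M d₂ e x) (G.vel M a d₂ m₂ e x) = 0 := by
      linarith
    have z2 : dissDensity (G.vel M a d m e x) (G.vel M a d₂ m₂ e x) = 0 := by
      have : Δ * dissDensity (G.vel M a d m e x) (G.vel M a d₂ m₂ e x) = 0 := by linarith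
      exact (mul_eq_zero.1 this).resolve_left hΔ.ne'
    constructor
    · unfold distSq at z1
      have p1 := sq_nonneg (G.dens M d e x - G.dens M d₂ e x)
      have p2 := mul_nonneg (sq_nonneg ε) (sq_nonneg (G.vel M a d m e x - G.vel M a d₂ m₂ e x))
      have : (G.dens M d e x - G.dens M d₂ e x) ^ 2 = 0 := by linarith
      exact sub_eq_zero.1 (pow_eq_zero_iff two_ne_zero |>.1 this)
    · have := abs_sub_cube_le (G.vel M a d m e x) (G.vel M a d₂ m₂ e x)
      unfold dissDensity at z2
      rw [z2] at this
      have h0 : |G.vel M a d m e x - G.vel M a d₂ m₂ e x| ^ 3 = 0 := le_antisymm this (by positivity)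
      exact sub_eq_zero.1 (abs_eq_zero.1 (pow_eq_zero_iff three_ne_zero |>.1 h0))
  constructor
  · intro e i hi
    have hh := G.mesh_pos (hM e)
    have hlt : (i * G.edgeMeshSize M e : ℝ) < (i + 1) * G.edgeMeshSize M e := by linarith
    have hsub : Ioo (i * G.edgeMeshSize M e : ℝ) ((i + 1) * G.edgeMeshSize M e) ⊆ Ioo 0 (G.len e) := by
      have := interior_mono (cell_subset hh (G.mesh_mul (hM e)) hi)
      rwa [cell, interior_Icc, interior_Icc] at this
    obtain ⟨x, hx, hp⟩ := exists_mem_Ioo_of_ae hlt hsub (h5 e)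
    have := hp.1
    rwa [dens, dens, pc_eq_of_mem hh _ (Ioo_subset_Ico_self hx),
      pc_eq_of_mem hh _ (Ioo_subset_Ico_self hx)] at this
  · intro e
    have : ∀ᵐ x ∂(pipeMeasure (G.len e)), G.interp M m e x = G.interp M m₂ e x := by
      filter_upwards [h5 e, hadm.ae ha0 (hM e), hadm₂.ae ha0 (hM e)] with x hx g k
      rw [← g.2.2, ← k.2.2, hx.1, hx.2]
    have h6 : G.interp M m e =ᵐ[volume.restrict (Icc 0 (G.len e))] G.interp M m₂ e := by
      rw [← Measure.restrict_congr_set (Ioo_ae_eq_Icc (μ := volume))]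
      exact this
    exact Measure.eqOn_Icc_of_ae_eq volume (G.len_pos e).ne h6
      (G.isPrimitive_interp (hM e) m).continuousOn (G.isPrimitive_interp (hM e) m₂).continuousOn

/-! ### Discrete solutions in terms of cell and nodal values -/

/-- A discrete solution in terms of its cell densities and nodal fluxes. -/
structure IsSchemeSolution (c : Consts) (P : ℝ → ℝ) (ε Δ : ℝ) (a γ : E → ℝ) (hb : V → ℝ → ℝ)
    (ρ w : E → ℝ → ℝ → ℝ) (N : ℕ) (M : E → ℕ) (d m : ℕ → E → ℕ → ℝ) : Prop where
  init : G.IsInitial M a ρ w (d 0) (m 0)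
  adm : ∀ n ≤ N, AdmState c M a (d n) (m n)
  step : ∀ n < N, G.IsStep P ε Δ a γ hb ((n + 1 : ℕ) * Δ) M (d n) (m n) (d (n + 1)) (m (n + 1))

open Classical in
/-- The characteristic function of a cell. -/
noncomputable def cellTest (M : E → ℕ) (e₀ : E) (i : ℕ) (e : E) (x : ℝ) : ℝ :=
  if e = e₀ then pc (G.edgeMeshSize M e) (fun k => if k = i then 1 else 0) x else 0

section

variable {G} {M : E → ℕ}

lemma inQ_dens (hM : ∀ e, 0 < M e) (d : E → ℕ → ℝ) : G.InQ M (G.dens M d) := fun e i _ =>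
  ⟨d e i, fun x hx => pc_eq_of_mem (G.mesh_pos (hM e)) _ (by
    unfold gridPoint at hx
    push_cast at hx
    exact Ioo_subset_Ico_self hx)⟩

lemma inQ_cellTest (hM : ∀ e, 0 < M e) (e₀ : E) (i : ℕ) : G.InQ M (G.cellTest M e₀ i) := by
  classical
  have := inQ_dens (G := G) hM (fun e k => if e = e₀ then (if k = i then 1 else 0) else 0)
  intro e j hj
  obtain ⟨k, hk⟩ := this e j hj
  refine ⟨k, fun x hx => ?_⟩
  rw [← hk x hx, cellTest, dens, pc]
  split_ifs <;> simp_all [pc]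

lemma tot_mul_cellTest (hM : ∀ e, 0 < M e) {e₀ : E} {i : ℕ} (hi : i < M e₀) {f : E → ℝ → ℝ}
    (hf : G.Integ f) : G.tot (fun e x => f e x * G.cellTest M e₀ i e x)
      = ∫ x in (i * G.edgeMeshSize M e₀)..((i + 1) * G.edgeMeshSize M e₀), f e₀ x := by
  classical
  unfold tot
  rw [Finset.sum_eq_single e₀]
  · simp only [cellTest, if_true]
    have := integral_pc_mul (G.mesh_pos (hM e₀)) (G.mesh_mul (hM e₀))
      (fun k => if k = i then 1 else 0) (hf e₀)
    simp only [mul_comm (pc _ _ _)] at this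
    rw [this]
    simp [hi]
  · intro e _ he
    simp [cellTest, he]
  · intro h
    exact absurd (Finset.mem_univ _) h

lemma inR_interp (hM : ∀ e, 0 < M e) {r : E → ℕ → ℝ} (hr : G.Conservative (G.interp M r)) :
    G.InR M (G.interp M r) := by
  refine ⟨fun e i _ => ?_, hr⟩
  refine ⟨r e i - slopes (G.edgeMeshSize M e) (r e) i * (i * G.edgeMeshSize M e),
    slopes (G.edgeMeshSize M e) (r e) i, fun x hx => ?_⟩
  unfold gridPoint at hx
  push_cast at hx
  rw [interp, lin_eq_of_mem (G.mesh_pos (hM e)) _ hx]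
  ring

lemma InR.eq_lin (hM : ∀ e, 0 < M e) {r : E → ℝ → ℝ} (hr : G.InR M r) {e : E} {i : ℕ} (hi : i < M e)
    {x : ℝ} (hx : x ∈ cell (G.edgeMeshSize M e) i) :
    r e x = lin (G.edgeMeshSize M e) (G.nodal M r e) x := by
  obtain ⟨k, l, hkl⟩ := hr.1 e i hi
  refine eq_lin_of_affine (G.mesh_pos (hM e)) (c := k) (d := l) (fun y hy => hkl y ?_) hx
  unfold gridPoint
  push_cast
  exact hy

lemma InR.eq_interp (hM : ∀ e, 0 < M e) {r : E → ℝ → ℝ} (hr : G.InR M r) {e : E} {x : ℝ}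
    (hx : x ∈ Icc 0 (G.len e)) : r e x = G.interp M (G.nodal M r) e x := by
  obtain ⟨i, hi, hxi⟩ := exists_mem_cell' (G.mesh_pos (hM e)) (G.mesh_mul (hM e)) (G.len_pos e) hx
  exact hr.eq_lin hM hi hxi

lemma InR.deriv_ae (hM : ∀ e, 0 < M e) {r : E → ℝ → ℝ} (hr : G.InR M r) (e : E) :
    ∀ᵐ x ∂(pipeMeasure (G.len e)), deriv (r e) x = G.slopeFn M (G.nodal M r) e x := by
  filter_upwards [ae_mem_cell (G.mesh_pos (hM e)) (G.mesh_mul (hM e))] with x hx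
  obtain ⟨i, hi, hx⟩ := hx
  exact deriv_eq_slope_of_eq_lin (G.mesh_pos (hM e)) (fun y hy => hr.eq_lin hM hi hy) hx

lemma InR.conservative (hM : ∀ e, 0 < M e) {r : E → ℝ → ℝ} (hr : G.InR M r) :
    G.Conservative (G.interp M (G.nodal M r)) := (G.conservative_interp_nodal hM).2 hr.2

lemma le_of_ae_le_Icc {α β K ℓ : ℝ} (hαβ : α < β) (hsub : Ioo α β ⊆ Ioo 0 ℓ) {f : ℝ → ℝ}
    (hf : ContinuousOn f (Icc α β)) (h : ∀ᵐ x ∂(pipeMeasure ℓ), x ∈ Ioo α β → f x ≤ K) :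
    ∀ x ∈ Icc α β, f x ≤ K := by
  have h1 : (fun x => max (f x) K) =ᵐ[volume.restrict (Icc α β)] fun _ => K := by
    rw [← Measure.restrict_congr_set (Ioo_ae_eq_Icc (μ := volume))]
    have h2 := ae_restrict_of_ae_restrict_of_subset hsub h
    filter_upwards [h2, ae_restrict_mem measurableSet_Ioo] with x hx hm
    exact max_eq_right (hx hm)
  have h3 := Measure.eqOn_Icc_of_ae_eq volume hαβ.ne h1 (hf.sup continuousOn_const) continuousOn_const
  intro x hx
  have := h3 hx
  simp only at this
  exact this ▸ le_max_left _ _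

lemma Ioo_cell_subset {e : E} (hM : 0 < M e) {i : ℕ} (hi : i < M e) :
    Ioo (i * G.edgeMeshSize M e : ℝ) ((i + 1) * G.edgeMeshSize M e) ⊆ Ioo 0 (G.len e) := by
  have := interior_mono (cell_subset (G.mesh_pos hM) (G.mesh_mul hM) hi)
  rwa [cell, interior_Icc, interior_Icc] at this

end

section

variable {G} {P : ℝ → ℝ} {c : Consts} {B ε : ℝ} {a γ : E → ℝ} {hb : V → ℝ → ℝ}
  {ρ w ρt wt : E → ℝ → ℝ → ℝ} {M : E → ℕ} {N : ℕ} {ρh mh : ℕ → E → ℝ → ℝ}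

/-- Admissible discrete solutions are given by their cell densities and nodal fluxes. -/
lemma exists_schemeSolution (X : G.Exact P c B ε a γ hb ρ w ρt wt) (hN : 0 < N) (hM : ∀ e, 0 < M e)
    (h : G.IsAdmissibleSolution P c.T ε a γ hb ρ w c.ρmin c.ρmax c.wmax N M ρh mh) :
    ∃ d m : ℕ → E → ℕ → ℝ, G.IsSchemeSolution c P ε (c.T / N) a γ hb ρ w N M d m ∧
      (∀ n ≤ N, ∀ e, ∀ᵐ x ∂(pipeMeasure (G.len e)), ρh n e x = G.dens M (d n) e x) ∧
      ∀ n ≤ N, ∀ e, ∀ x ∈ Icc 0 (G.len e), mh n e x = G.interp M (m n) e x := by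
  obtain ⟨hsol, hadm⟩ := h
  choose! d hd using hsol.memQ
  have hT := c.T_pos
  have hN' : (0 : ℝ) < N := by exact_mod_cast hN
  have hΔ : 0 < c.T / N := by positivity
  have hρ : ∀ n ≤ N, ∀ e, ∀ᵐ x ∂(pipeMeasure (G.len e)), ρh n e x = G.dens M (d n) e x := by
    intro n hn e
    filter_upwards [ae_mem_cell (G.mesh_pos (hM e)) (G.mesh_mul (hM e))] with x hx
    obtain ⟨i, hi, hx⟩ := hx
    rw [dens, pc_eq_of_mem (G.mesh_pos (hM e)) _ (Ioo_subset_Ico_self hx)]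
    exact hd n hn e i hi x (by unfold gridPoint; push_cast; exact hx)
  let m : ℕ → E → ℕ → ℝ := fun n => G.nodal M (mh n)
  have hm : ∀ n ≤ N, ∀ e, ∀ x ∈ Icc 0 (G.len e), mh n e x = G.interp M (m n) e x :=
    fun n hn e x hx => (hsol.memR n hn).eq_interp hM hx
  have hv : ∀ n ≤ N, ∀ e, ∀ᵐ x ∂(pipeMeasure (G.len e)),
      discreteVelocity a (ρh n) (mh n) e x = G.vel M a (d n) (m n) e x := by
    intro n hn e
    filter_upwards [hρ n hn e, ae_mem_pipe (G.len e)] with x hx hxl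
    rw [discreteVelocity, vel, hx, hm n hn e x (Ioo_subset_Icc_self hxl)]
  have ha := X.a_pos
  refine ⟨d, m, ⟨⟨fun e i hi => ?_, fun e i hi => hsol.initm e i hi⟩, fun n hn e i hi => ?_,
    fun n hn => ⟨fun e i hi => ?_, (hsol.memR _ hn).conservative hM, fun r hr => ?_⟩⟩, hρ, hm⟩
  · have h1 := hsol.initρ _ (inQ_cellTest hM e i)
    have h0 : (0 : ℝ) ∈ Icc 0 c.T := ⟨le_rfl, hT.le⟩
    have e1 : G.inner (ρh 0) (G.cellTest M e i)
        = G.tot (fun e' x => G.dens M (d 0) e' x * G.cellTest M e i e' x) := by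
      refine tot_congr fun e' => ?_
      filter_upwards [hρ 0 (Nat.zero_le _) e'] with x hx
      rw [hx]
    have e2 : G.inner (fun e => ρ e 0) (G.cellTest M e i)
        = G.tot (fun e' x => ρ e' 0 x * G.cellTest M e i e' x) := rfl
    rw [e1, e2, tot_mul_cellTest hM hi fun e => (bdd_dens (hM e) _).itg,
      tot_mul_cellTest hM hi fun e => (X.bdd_ρ h0).itg] at h1
    have hh := G.mesh_pos (hM e)
    rw [← h1]
    simp only [dens]
    rw [integral_pc_cell hh _ i (left_mem_cell hh i) (right_mem_cell hh i), eq_div_iff hh.ne']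
    ring
  · have hh := G.mesh_pos (hM e)
    have hlt : (i * G.edgeMeshSize M e : ℝ) < (i + 1) * G.edgeMeshSize M e := by linarith
    have hsub := Ioo_cell_subset (G := G) (hM e) hi
    have hae : ∀ᵐ x ∂(pipeMeasure (G.len e)),
        x ∈ Ioo (i * G.edgeMeshSize M e : ℝ) ((i + 1) * G.edgeMeshSize M e) →
        d n e i ∈ Icc c.r₀ c.r₁ ∧ |G.interp M (m n) e x| ≤ c.W * (a e * d n e i) := by
      filter_upwards [hρ n hn e, hv n hn e, hadm n hn e] with x h1 h2 h3 hx
      rw [h2, h1] at h3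
      have e1 : G.dens M (d n) e x = d n e i := pc_eq_of_mem hh _ (Ioo_subset_Ico_self hx)
      rw [e1] at h3
      refine ⟨⟨h3.1, h3.2.1⟩, ?_⟩
      have hpos : 0 < a e * d n e i := mul_pos (ha e) (c.r₀_pos.trans_le h3.1)
      have h4 := h3.2.2
      rwa [vel, e1, abs_div, abs_of_pos hpos, div_le_iff₀ hpos] at h4
    obtain ⟨x, hx, hp⟩ := exists_mem_Ioo_of_ae hlt hsub hae
    have hcont : ContinuousOn (fun x => |G.interp M (m n) e x|)
        (Icc (i * G.edgeMeshSize M e : ℝ) ((i + 1) * G.edgeMeshSize M e)) :=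
      ((G.isPrimitive_interp (hM e) (m n)).continuousOn.mono
        (cell_subset hh (G.mesh_mul (hM e)) hi)).abs
    have hb := le_of_ae_le_Icc hlt hsub hcont (hae.mono fun x hx hm => (hx hm).2)
    refine ⟨(hp hx).1, ?_, ?_⟩
    · have := hb _ (left_mem_cell hh i)
      simpa only [interp, lin_grid hh] using this
    · have := hb _ (right_mem_cell hh i)
      have e2 : G.interp M (m n) e ((i + 1) * G.edgeMeshSize M e) = m n e (i + 1) := by
        have := lin_grid hh (m n e) (i + 1)
        push_cast at this
        exact this
      simpa only [e2] using this
  · have h1 := hsol.mass n hn _ (inQ_cellTest hM e i)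
    have bd := fun e => bdd_dens (G := G) (hM e) (d n)
    have bd1 := fun e => bdd_dens (G := G) (hM e) (d (n + 1))
    have e1 : G.inner (fun e x => a e * ((ρh (n + 1) e x - ρh n e x) / (c.T / N))) (G.cellTest M e i)
        = G.tot (fun e' x => G.dens M (fun e i => a e * ((d (n + 1) e i - d n e i) / (c.T / N))) e' x
          * G.cellTest M e i e' x) := by
      refine tot_congr fun e' => ?_
      filter_upwards [hρ n hn.le e', hρ (n + 1) hn e'] with x hx hx1
      rw [hx, hx1]
      rfl
    have e2 : G.inner (fun e => deriv (mh (n + 1) e)) (G.cellTest M e i)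
        = G.tot (fun e' x => G.slopeFn M (m (n + 1)) e' x * G.cellTest M e i e' x) := by
      refine tot_congr fun e' => ?_
      filter_upwards [(hsol.memR (n + 1) hn).deriv_ae hM e'] with x hx
      rw [hx]
    have hh := G.mesh_pos (hM e)
    rw [e1, e2, tot_mul_cellTest hM hi fun e => (bdd_dens (hM e) _).itg,
      tot_mul_cellTest hM hi fun e => (bdd_slopeFn (hM e) _).itg] at h1
    simp only [dens, slopeFn] at h1
    rw [integral_pc_cell hh _ i (left_mem_cell hh i) (right_mem_cell hh i),
      integral_pc_cell hh _ i (left_mem_cell hh i) (right_mem_cell hh i), ← add_mul] at h1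
    have h2 := (mul_eq_zero.1 h1).resolve_right (by linarith : (_ : ℝ) ≠ 0)
    have h3 : a e * (d (n + 1) e i - d n e i) + c.T / N * slopes (G.edgeMeshSize M e) (m (n + 1) e) i
        = c.T / N * (a e * ((d (n + 1) e i - d n e i) / (c.T / N))
          + slopes (G.edgeMeshSize M e) (m (n + 1) e) i) := by
      field_simp
    rw [h3, h2, mul_zero]
  · have h1 := hsol.momentum n hn _ (inR_interp hM hr)
    rw [bdryTerm, ← h1]
    congr 1
    · congr 1
      · refine tot_congr fun e => ?_
        filter_upwards [hv n hn.le e, hv (n + 1) hn e] with x g1 g2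
        rw [g1, g2]
      · refine tot_congr fun e => ?_
        filter_upwards [hv (n + 1) hn e, hρ (n + 1) hn e, G.deriv_interp_ae (hM e) r] with x g1 g2 g3
        rw [g3, enthalpy, g1, g2, enth]
    · refine tot_congr fun e => ?_
      filter_upwards [hv (n + 1) hn e] with x g1
      rw [g1]

/-- A solution in terms of cell densities and nodal fluxes is an admissible discrete solution. -/
lemma IsSchemeSolution.isAdmissibleSolution (X : G.Exact P c B ε a γ hb ρ w ρt wt) (hN : 0 < N)
    (hM : ∀ e, 0 < M e) {d m : ℕ → E → ℕ → ℝ}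
    (h : G.IsSchemeSolution c P ε (c.T / N) a γ hb ρ w N M d m) :
    G.IsAdmissibleSolution P c.T ε a γ hb ρ w c.ρmin c.ρmax c.wmax N M
      (fun n => G.dens M (d n)) (fun n => G.interp M (m n)) := by
  have hT := c.T_pos
  have hN' : (0 : ℝ) < N := by exact_mod_cast hN
  have hΔ : 0 < c.T / N := by positivity
  have h0 : (0 : ℝ) ∈ Icc 0 c.T := ⟨le_rfl, hT.le⟩
  have hcons : ∀ n ≤ N, G.Conservative (G.interp M (m n)) := by
    intro n hn
    rcases n with _ | n
    · refine (G.conservative_iff_of_ends (u' := fluxAt a ρ w 0) (fun e => ?_) fun e => ?_).2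
        (X.balance 0 h0)
      · rw [G.interp_start (hM e), h.init.flux e 0 (Nat.zero_le _)]
        simp [nodal]
      · rw [G.interp_end (hM e), h.init.flux e (M e) le_rfl]
        simp [nodal, G.mesh_mul (hM e)]
    · exact (h.step n hn).cons
  refine ⟨⟨fun n _ => inQ_dens hM _, fun n hn => inR_interp hM (hcons n hn), fun q hq => ?_,
    fun e i hi => ?_, fun n hn q hq => ?_, fun n hn r hr => ?_⟩, fun n hn e => ?_⟩
  · choose! k hk using hq
    have hq' : ∀ e, ∀ᵐ x ∂(pipeMeasure (G.len e)), q e x = pc (G.edgeMeshSize M e) (k e) x := by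
      intro e
      filter_upwards [ae_mem_cell (G.mesh_pos (hM e)) (G.mesh_mul (hM e))] with x hx
      obtain ⟨i, hi, hx⟩ := hx
      rw [pc_eq_of_mem (G.mesh_pos (hM e)) _ (Ioo_subset_Ico_self hx)]
      exact hk e i hi x (by unfold gridPoint; push_cast; exact hx)
    unfold inner
    refine Finset.sum_congr rfl fun e _ => ?_
    have hh := G.mesh_pos (hM e)
    have e1 : ∀ f : ℝ → ℝ, ∫ x in (0 : ℝ)..G.len e, f x * q e x
        = ∫ x in (0 : ℝ)..G.len e, pc (G.edgeMeshSize M e) (k e) x * f x := fun f => by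
      apply integral_congr_pipe (G.len_pos e).le
      filter_upwards [hq' e] with x hx
      rw [hx, mul_comm]
    rw [e1, e1, integral_pc_mul hh (G.mesh_mul (hM e)) _ (bdd_dens (hM e) (d 0)).itg,
      integral_pc_mul hh (G.mesh_mul (hM e)) _ (X.bdd_ρ h0).itg]
    refine Finset.sum_congr rfl fun i hi => ?_
    simp only [dens]
    rw [integral_pc_cell hh _ i (left_mem_cell hh i) (right_mem_cell hh i),
      h.init.dens e i (Finset.mem_range.1 hi)]
    congr 1
    field_simp
    ring
  · have := h.init.flux e i hi
    simp only [gridPoint, interp]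
    rw [lin_grid (G.mesh_pos (hM e)), this, nodal]
  · have b1 : ∀ e, ∀ᵐ x ∂(pipeMeasure (G.len e)),
        a e * ((G.dens M (d (n + 1)) e x - G.dens M (d n) e x) / (c.T / N))
          = -deriv (G.interp M (m (n + 1)) e) x := by
      intro e
      filter_upwards [(h.step n hn).mass_ae (hM e), G.deriv_interp_ae (hM e) (m (n + 1))] with x g1 g2
      rw [g2, mul_div_assoc', div_eq_iff hΔ.ne']
      linarith
    unfold inner
    rw [← Finset.sum_add_distrib]
    refine Finset.sum_eq_zero fun e _ => ?_
    rw [← eq_neg_iff_add_eq_zero, ← intervalIntegral.integral_neg]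
    apply integral_congr_pipe (G.len_pos e).le
    filter_upwards [b1 e] with x hx
    rw [hx]
    ring
  · have h1 := (h.step n hn).momentum _ (hr.conservative hM)
    have h2 := G.bdryTerm_congr (hb := hb) (t := (n + 1 : ℕ) * (c.T / N)) (r := r)
      (r' := G.interp M (G.nodal M r)) (fun e => hr.eq_interp hM ⟨le_rfl, (G.len_pos e).le⟩)
      (fun e => hr.eq_interp hM ⟨(G.len_pos e).le, le_rfl⟩)
    rw [← h2] at h1
    refine Eq.trans ?_ h1
    congr 1
    · congr 1
      · refine tot_congr fun e => ?_
        filter_upwards [ae_mem_pipe (G.len e)] with x g1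
        rw [hr.eq_interp hM (Ioo_subset_Icc_self g1)]
        rfl
      · refine tot_congr fun e => ?_
        filter_upwards [hr.deriv_ae hM e] with x g3
        rw [g3]
        rfl
    · refine tot_congr fun e => ?_
      filter_upwards [ae_mem_pipe (G.len e)] with x g1
      rw [hr.eq_interp hM (Ioo_subset_Icc_self g1)]
      rfl
  · filter_upwards [(h.adm n hn).ae X.a_pos (hM e)] with x hx
    exact ⟨hx.1.1, hx.1.2, hx.2.1⟩

end

/-! ### States close to the exact solution -/

/-- Strict admissibility of a discrete state. -/
def StrictAdm (c : Consts) (M : E → ℕ) (a : E → ℝ) (d m : E → ℕ → ℝ) : Prop :=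
  ∀ e, ∀ i < M e, d e i ∈ Ioo c.r₀ c.r₁ ∧ |m e i| < c.W * (a e * d e i) ∧
    |m e (i + 1)| < c.W * (a e * d e i)

/-- The cell densities of the state with the new fluxes `m`. -/
noncomputable def newDens (Δ : ℝ) (a : E → ℝ) (M : E → ℕ) (d' m : E → ℕ → ℝ) (e : E) (i : ℕ) : ℝ :=
  d' e i - Δ / a e * slopes (G.edgeMeshSize M e) (m e) i

section

variable {G} {P : ℝ → ℝ} {c : Consts} {B ε : ℝ} {a γ : E → ℝ} {hb : V → ℝ → ℝ}
  {ρ w ρt wt : E → ℝ → ℝ → ℝ} {M : E → ℕ} {t t' Δ H : ℝ} {e : E} {d m d' m' : E → ℕ → ℝ}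

lemma StrictAdm.admState (h : StrictAdm c M a d m) : AdmState c M a d m := fun e i hi =>
  ⟨Ioo_subset_Icc_self (h e i hi).1, (h e i hi).2.1.le, (h e i hi).2.2.le⟩

namespace Exact

lemma strictAdm_of_close (X : G.Exact P c B ε a γ hb ρ w ρt wt) (hM : ∀ e, 0 < M e)
    (ht : t ∈ Icc 0 c.T)
    (hd : ∀ e, ∀ i < M e, ∀ x ∈ cell (G.edgeMeshSize M e) i, |d e i - ρ e t x| ≤ c.ρmin / 8)
    (hm : ∀ e, ∀ i ≤ M e, |m e i - G.nodal M (fluxAt a ρ w t) e i|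
      ≤ c.amin * c.wmax * c.ρmin / 8) : StrictAdm c M a d m := by
  intro e i hi
  have hρ := c.ρmin_pos
  have hρM := c.ρ_le
  have hw := c.wmax_pos
  have ha := X.a_pos e
  have hh := G.mesh_pos (hM e)
  have hnode : ∀ k ≤ M e, (k * G.edgeMeshSize M e : ℝ) ∈ cell (G.edgeMeshSize M e) i →
      |m e k| < c.W * (a e * d e i) := by
    intro k hk hkc
    have hmem := cell_subset hh (G.mesh_mul (hM e)) hi hkc
    have h1 := hm e k hk
    have h2 := abs_le.1 (hd e i hi _ hkc)
    obtain ⟨h3, h4⟩ := X.ρ_mem e t ht _ hmem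
    have h5 := X.w_mem e t ht _ hmem
    have h6 : |G.nodal M (fluxAt a ρ w t) e k| ≤ a e * (d e i + c.ρmin / 8) * c.wmax := by
      simp only [nodal, fluxAt, flux]
      rw [abs_mul, abs_mul, abs_of_pos ha, abs_of_pos (hρ.trans_le h3)]
      have h11 : ρ e t (k * G.edgeMeshSize M e) ≤ d e i + c.ρmin / 8 := by linarith [h2.1]
      have h12 : 0 ≤ a e * (d e i + c.ρmin / 8) := mul_nonneg ha.le (by linarith)
      gcongr
    have h7 : |m e k| ≤ c.amin * c.wmax * c.ρmin / 8 + a e * (d e i + c.ρmin / 8) * c.wmax := by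
      have := abs_add_le (m e k - G.nodal M (fluxAt a ρ w t) e k) (G.nodal M (fluxAt a ρ w t) e k)
      rw [sub_add_cancel] at this
      linarith
    refine h7.trans_lt ?_
    have h8 : c.amin * c.wmax * c.ρmin ≤ a e * c.wmax * c.ρmin := by
      have := (X.a_mem e).1
      gcongr
    have h9 : 0 < a e * c.wmax := by positivity
    have h10 : 0 < a e * c.wmax * (d e i / 2 - c.ρmin / 4) := mul_pos h9 (by linarith)
    unfold Consts.W
    linarith
  have hx0 := cell_subset hh (G.mesh_mul (hM e)) hi (left_mem_cell hh i)
  have h2 := abs_le.1 (hd e i hi _ (left_mem_cell hh i))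
  obtain ⟨h3, h4⟩ := X.ρ_mem e t ht _ hx0
  refine ⟨⟨?_, ?_⟩, hnode i hi.le (left_mem_cell hh i), hnode (i + 1) hi ?_⟩
  · unfold Consts.r₀; linarith
  · unfold Consts.r₁; linarith
  · push_cast
    exact right_mem_cell hh i

lemma abs_integral_ρt_le (X : G.Exact P c B ε a γ hb ρ w ρt wt) (hB : 0 < B) (ht : t ∈ Icc 0 c.T)
    {x y : ℝ} (hx : x ∈ Icc 0 (G.len e)) (hy : y ∈ Icc 0 (G.len e)) (hxy : x ≤ y) :
    |∫ r in x..y, ρt e t r| ≤ B * (y - x) := by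
  apply le_of_forall_pos_le_add
  intro δ hδ
  have hT := c.T_pos
  set Q := B * √(y - x) + 1 with hQ
  have hQ0 : 0 < Q := by positivity
  set τ := min (c.T / 2) (δ / Q) with hτ
  have hτ0 : 0 < τ := lt_min (by linarith) (by positivity)
  have hτT : τ ≤ c.T / 2 := min_le_left _ _
  obtain ⟨s, hs, hts⟩ : ∃ s ∈ Icc 0 c.T, |t - s| = τ := by
    rcases le_total (c.T / 2) t with h | h
    · exact ⟨t - τ, ⟨by linarith, by linarith [ht.2]⟩, by
        rw [sub_sub_cancel, abs_of_pos hτ0]⟩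
    · exact ⟨t + τ, ⟨by linarith [ht.1], by linarith⟩, by
        rw [sub_add_cancel_left, abs_neg, abs_of_pos hτ0]⟩
  have i1 := (X.sq_ρt e t ht).itg
  have i2 := ((X.bdd_ρ (e := e) ht).sub (X.bdd_ρ (e := e) hs))
  have s3 := i2.sq.sub ((X.sq_ρt e t ht).cmul (t - s))
  have h1 : |∫ r in x..y, (ρ e t r - ρ e s r)| ≤ B * τ * (y - x) := by
    rw [← abs_of_nonneg (sub_nonneg.2 hxy)]
    have := intervalIntegral.norm_integral_le_of_norm_le_const (a := x) (b := y)
      (f := fun r => ρ e t r - ρ e s r) (C := B * τ) (fun r hr => by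
        rw [uIoc_of_le hxy] at hr
        have := X.lip_ρ e t ht s hs r ⟨hx.1.trans hr.1.le, hr.2.trans hy.2⟩
        rwa [hts] at this)
    exact this
  have h2 : |∫ r in x..y, (ρ e t r - ρ e s r - (t - s) * ρt e t r)| ≤ √(y - x) * (B * τ ^ 2) := by
    have j1 := sq_integral_le_pipe s3 hx hy hxy
    have j2 := X.consist_ρ e t ht s hs
    rw [hts] at j2
    refine (intervalIntegral.abs_integral_le_integral_abs hxy).trans ?_
    refine le_of_abs_le (abs_le_of_sq_le_sq (j1.trans ?_) (by positivity))
    rw [mul_pow, Real.sq_sqrt (sub_nonneg.2 hxy)]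
    exact mul_le_mul_of_nonneg_left j2 (sub_nonneg.2 hxy)
  have h3 : (t - s) * ∫ r in x..y, ρt e t r = (∫ r in x..y, (ρ e t r - ρ e s r))
      - ∫ r in x..y, (ρ e t r - ρ e s r - (t - s) * ρt e t r) := by
    rw [intervalIntegral.integral_sub (i2.itg.ii_of_mem hx hy) ((i1.cmul _).ii_of_mem hx hy),
      intervalIntegral.integral_const_mul]
    ring
  have h4 : τ * |∫ r in x..y, ρt e t r| ≤ τ * (B * (y - x) + δ) := by
    rw [← hts, ← abs_mul, h3, hts]
    refine (abs_sub _ _).trans ((add_le_add h1 h2).trans ?_)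
    have h5 : B * √(y - x) * τ ≤ δ := by
      have : τ ≤ δ / Q := min_le_right _ _
      rw [le_div_iff₀ hQ0] at this
      have h6 : B * √(y - x) * τ ≤ τ * Q := by rw [hQ]; nlinarith
      linarith
    nlinarith
  exact le_of_mul_le_mul_left h4 hτ0

lemma abs_slopes_nodal_le (X : G.Exact P c B ε a γ hb ρ w ρt wt) (hB : 0 < B) (hM : 0 < M e)
    (ht : t ∈ Icc 0 c.T) {i : ℕ} (hi : i < M e) :
    |slopes (G.edgeMeshSize M e) (G.nodal M (fluxAt a ρ w t) e) i| ≤ a e * B := by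
  have hh := G.mesh_pos hM
  rw [X.slopes_nodal hM ht hi, abs_mul, abs_neg, abs_of_pos (X.a_pos e)]
  apply mul_le_mul_of_nonneg_left _ (X.a_pos e).le
  rw [abs_div, abs_of_pos hh, div_le_iff₀ hh]
  refine (X.abs_integral_ρt_le hB ht (cell_subset hh (G.mesh_mul hM) hi (left_mem_cell hh i))
    (cell_subset hh (G.mesh_mul hM) hi (right_mem_cell hh i)) (by linarith)).trans (le_of_eq (by ring))

end Exact

end

/-- The situation at the beginning of a time step. -/
structure StepSetup (P : ℝ → ℝ) (c : Consts) (B ε : ℝ) (a γ : E → ℝ) (hb : V → ℝ → ℝ)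
    (ρ w ρt wt : E → ℝ → ℝ → ℝ) (M : E → ℕ) (t t' Δ H CE σ : ℝ) (d' m' : E → ℕ → ℝ) : Prop where
  X : G.Exact P c B ε a γ hb ρ w ρt wt
  hM : ∀ e, 0 < M e
  hH : ∀ e, G.edgeMeshSize M e ≤ H
  ht : t ∈ Icc 0 c.T
  ht' : t' ∈ Icc 0 c.T
  hΔ : 0 < Δ
  hΔ1 : Δ ≤ 1
  htt : t = t' + Δ
  err : G.tot (G.errSq ε M a ρ w t' d' m') ≤ CE * (Δ ^ 2 + H ^ 2)
  close : ∀ e, ∀ i < M e, ∀ x ∈ cell (G.edgeMeshSize M e) i, |d' e i - ρ e t' x| ≤ σ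
  close_le : σ + 2 * B * Δ ≤ c.ρmin / 8

namespace StepSetup

variable {G} {P : ℝ → ℝ} {c : Consts} {B ε : ℝ} {a γ : E → ℝ} {hb : V → ℝ → ℝ}
  {ρ w ρt wt : E → ℝ → ℝ → ℝ} {M : E → ℕ} {t t' Δ H CE σ : ℝ} {d' m' : E → ℕ → ℝ} {e : E}
  (S : G.StepSetup P c B ε a γ hb ρ w ρt wt M t t' Δ H CE σ d' m') (hB : 0 < B)

include S hB

/-- The comparison state, with the interpolated exact flux, is close to the exact solution. -/
lemma cmp_close : ∀ e, ∀ i < M e, ∀ x ∈ cell (G.edgeMeshSize M e) i,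
    |G.newDens Δ a M d' (G.nodal M (fluxAt a ρ w t)) e i - ρ e t x| ≤ σ + 2 * B * Δ := by
  intro e i hi x hx
  have hΔ := S.hΔ
  have ha := S.X.a_pos e
  have hmem := cell_subset (G.mesh_pos (S.hM e)) (G.mesh_mul (S.hM e)) hi hx
  have h1 := S.close e i hi x hx
  have h2 := S.X.lip_ρ e t S.ht t' S.ht' x hmem
  rw [S.htt, add_sub_cancel_left, abs_of_pos hΔ, ← S.htt] at h2
  have h3 : |Δ / a e * slopes (G.edgeMeshSize M e) (G.nodal M (fluxAt a ρ w t) e) i| ≤ B * Δ := by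
    rw [abs_mul, abs_of_pos (div_pos hΔ ha)]
    calc _ ≤ Δ / a e * (a e * B) :=
          mul_le_mul_of_nonneg_left (S.X.abs_slopes_nodal_le hB (S.hM e) S.ht hi) (by positivity)
      _ = _ := by field_simp
  rw [abs_le] at *
  unfold newDens
  constructor <;> linarith [h1.1, h1.2, h2.1, h2.2, h3.1, h3.2]

lemma cmp_strict : StrictAdm c M a (G.newDens Δ a M d' (G.nodal M (fluxAt a ρ w t)))
    (G.nodal M (fluxAt a ρ w t)) := by
  have := c.amin_pos
  have := c.wmax_pos
  have := c.ρmin_pos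
  refine S.X.strictAdm_of_close S.hM S.ht
    (fun e i hi x hx => (S.cmp_close hB e i hi x hx).trans S.close_le) (fun e i hi => ?_)
  rw [sub_self, abs_zero]
  positivity

end StepSetup

/-- The exact solution at the new time, tested with the form of the time step. -/
lemma StepSetup.stepForm_eq {G : PipeNetwork V E} {P : ℝ → ℝ} {c : Consts} {B ε : ℝ} {a γ : E → ℝ}
    {hb : V → ℝ → ℝ} {ρ w ρt wt : E → ℝ → ℝ → ℝ} {M : E → ℕ} {t t' Δ H CE σ : ℝ}
    {d' m' : E → ℕ → ℝ} (S : G.StepSetup P c B ε a γ hb ρ w ρt wt M t t' Δ H CE σ d' m')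
    (d m r : E → ℕ → ℝ) (hr : G.Conservative (G.interp M r)) :
    G.stepForm P ε Δ a γ hb t M (G.vel M a d' m') d m r = G.tot (fun e x =>
      ε ^ 2 * ((G.vel M a d m e x - G.vel M a d' m' e x) - Δ * wt e t x) * G.interp M r e x
      - Δ * ((enth P ε (G.dens M d e x) (G.vel M a d m e x) - enth P ε (ρ e t x) (w e t x))
        * G.slopeFn M r e x)
      + Δ * (γ e * (|G.vel M a d m e x| * G.vel M a d m e x - |w e t x| * w e t x)
        * G.interp M r e x)) := by
  have X := S.X
  have ht := S.ht
  have h2 := X.weak t ht M S.hM r hr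
  have bR := fun e => bdd_interp (G := G) (S.hM e) r
  have bS := fun e => bdd_slopeFn (G := G) (S.hM e) r
  have bw := fun e => X.bdd_w (e := e) ht
  have i0 := fun e => (integ_stepForm S.hM (fun e => bdd_vel (G := G) (S.hM e) a d' m') P ε Δ a γ d m r e).itg
  have i4 : G.Integ (fun e x => ε ^ 2 * wt e t x * G.interp M r e x) :=
    fun e => ((X.sq_wt e t ht).cmul (ε ^ 2)).mul (bR e).sq
  have i5 : G.Integ (fun e x => enthalpyAt P ε ρ w t e x * G.slopeFn M r e x) :=
    fun e => ((X.prim_h e t ht).bdd.mul (bS e)).itg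
  have i6 : G.Integ (fun e x => γ e * |w e t x| * w e t x * G.interp M r e x) :=
    fun e => ((((bw e).abs.cmul (γ e)).mul (bw e)).mul (bR e)).itg
  have h4 := tot_add (i4.sub i5) i6
  rw [tot_sub i4 i5, h2] at h4
  have h5 := tot_sub i0 (((i4.sub i5).add i6).cmul Δ)
  rw [tot_cmul, h4] at h5
  unfold stepForm
  rw [mul_neg, sub_neg_eq_add] at h5
  rw [← h5]
  congr 1
  funext e x
  simp only [enthalpyAt, enthalpy, enth]
  ring

end PipeNetwork

lemma young_le {k : ℝ} (hk : 0 < k) (A B : ℝ) : A * B ≤ k / 8 * B ^ 2 + 2 / k * A ^ 2 := by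
  have : k / 8 * B ^ 2 + 2 / k * A ^ 2 - A * B = (k * B - 4 * A) ^ 2 / (8 * k) := by field_simp; ring
  have h : 0 ≤ (k * B - 4 * A) ^ 2 / (8 * k) := by positivity
  linarith

set_option maxHeartbeats 1000000 in
lemma PressureBounds.exists_consistency_le {P : ℝ → ℝ} {r₀ r₁ W εm q₀ q₁ q₂ amin amax γmin γmax k : ℝ}
    (hPB : PressureBounds P r₀ r₁ W εm q₀ q₁ q₂) (hr₁ : 0 < r₁) (ham : 0 < amin) (haM : amin ≤ amax)
    (hγm : 0 < γmin) (hγM : γmin ≤ γmax) (hk : 0 < k) :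
    ∃ C : ℝ, 0 < C ∧ ∀ ε a γ Δ r v rt vt s z p κ R : ℝ, 0 ≤ ε → ε ≤ εm → a ∈ Icc amin amax →
      γ ∈ Icc γmin γmax → 0 < Δ → r ∈ Icc r₀ r₁ → rt ∈ Icc r₀ r₁ → s ∈ Icc r₀ r₁ →
      |v| ≤ W → |vt| ≤ W → |z| ≤ W → a * (r - rt) = -Δ * κ → R = a * r * v - a * rt * vt →
      |ε ^ 2 * p * R - Δ * ((enth P ε rt vt - enth P ε s z) * κ)
          + Δ * (γ * (|vt| * vt - |z| * z) * R)|
        ≤ k / 2 * distSq ε r v rt vt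
          + C * ((rt - s) ^ 2 + (vt - z) ^ 2 + ε ^ 2 * p ^ 2 + Δ ^ 2) := by
  have hW := hPB.W_pos
  have hq₁ := hPB.q₁_pos
  have hr₀ := hPB.r₀_pos
  have hεm := hPB.εm_pos
  have haM0 : 0 < amax := ham.trans_le haM
  have hγM0 : 0 < γmax := hγm.trans_le hγM
  set C1 := 2 / k * (amax * r₁) ^ 2 + 2 / k * (amax * W * εm) ^ 2 with hC1
  set C2 := 2 / k * amax ^ 2 * (2 * q₁ ^ 2) with hC2
  set C3 := 2 / k * amax ^ 2 * (2 * (εm ^ 2 * W) ^ 2) with hC3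
  set C4 := γmax * (2 * W) * (amax * (3 * r₁ * W)) with hC4
  have p1 : 0 < C1 := by positivity
  have p2 : 0 < C2 := by positivity
  have p3 : 0 < C3 := by positivity
  have p4 : 0 < C4 := by positivity
  refine ⟨C1 + C2 + C3 + C4, by positivity, ?_⟩
  intro ε a γ Δ r v rt vt s z p κ R hε hεm' ha hγ hΔ hr hrt hs hv hvt hz hκ hR
  have ha0 : 0 < a := ham.trans_le ha.1
  have hγ0 : 0 < γ := hγm.trans_le hγ.1
  set x := |r - rt| with hx
  set y := |v - vt| with hy
  have hx0 : 0 ≤ x := abs_nonneg _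
  have hy0 : 0 ≤ y := abs_nonneg _
  have hx2 : x ^ 2 = (r - rt) ^ 2 := sq_abs _
  have hy2 : y ^ 2 = (v - vt) ^ 2 := sq_abs _
  have hRle : |R| ≤ amax * (r₁ * y + W * x) := by
    have e : R = a * (r * v - rt * vt) := by rw [hR]; ring
    rw [e, abs_mul, abs_of_pos ha0]
    have := abs_flux_sub_le (w := v) (s := rt) (hr₀.le.trans hr.1) hr.2 hvt
    have h2 := ha.2
    gcongr
  have hxr : x ≤ r₁ := abs_le.2 ⟨by linarith [hr.1, hrt.2], by linarith [hr.2, hrt.1]⟩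
  have hyW : y ≤ 2 * W := (abs_sub _ _).trans (by linarith)
  have hRb : |R| ≤ amax * (3 * r₁ * W) := by
    refine hRle.trans ?_
    gcongr
    have i1 : r₁ * y ≤ r₁ * (2 * W) := by gcongr
    have i2 : W * x ≤ W * r₁ := by gcongr
    linarith
  have t1 : |ε ^ 2 * p * R| ≤ k / 8 * (ε ^ 2 * y ^ 2) + k / 8 * x ^ 2 + C1 * (ε ^ 2 * p ^ 2) := by
    rw [abs_mul, abs_mul, abs_of_nonneg (sq_nonneg ε)]
    have i1 : ε ^ 2 * |p| * |R| ≤ ε ^ 2 * |p| * (amax * (r₁ * y + W * x)) := by gcongr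
    have i2 := young_le hk (amax * r₁ * (ε * |p|)) (ε * y)
    have i3 := young_le hk (amax * W * (ε ^ 2 * |p|)) x
    have e2 : (amax * r₁ * (ε * |p|)) ^ 2 = (amax * r₁) ^ 2 * (ε ^ 2 * p ^ 2) := by
      rw [mul_pow, mul_pow ε, sq_abs]
    have e3 : (amax * W * (ε ^ 2 * |p|)) ^ 2 ≤ (amax * W * εm) ^ 2 * (ε ^ 2 * p ^ 2) := by
      have : (amax * W * (ε ^ 2 * |p|)) ^ 2 = (amax * W * ε) ^ 2 * (ε ^ 2 * p ^ 2) := by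
        rw [mul_pow, mul_pow (ε ^ 2), sq_abs]; ring
      rw [this]
      gcongr
    have e4 : 2 / k * (amax * W * (ε ^ 2 * |p|)) ^ 2 ≤ 2 / k * ((amax * W * εm) ^ 2 * (ε ^ 2 * p ^ 2)) := by
      gcongr
    rw [e2] at i2
    rw [hC1]
    linarith [mul_pow ε y 2]
  have hHd : (enth P ε rt vt - enth P ε s z) ^ 2
      ≤ 2 * q₁ ^ 2 * (rt - s) ^ 2 + 2 * (εm ^ 2 * W) ^ 2 * (vt - z) ^ 2 := by
    have h1 := hPB.abs_enth_sub_le (ε := ε) hrt hs hvt hz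
    have h2 : ε ^ 2 * W * |vt - z| ≤ εm ^ 2 * W * |vt - z| := by gcongr
    rw [← sq_abs, ← sq_abs (rt - s), ← sq_abs (vt - z)]
    have h3 : |enth P ε rt vt - enth P ε s z| ≤ q₁ * |rt - s| + εm ^ 2 * W * |vt - z| := by linarith
    calc _ ≤ (q₁ * |rt - s| + εm ^ 2 * W * |vt - z|) ^ 2 := by gcongr
      _ ≤ _ := by linarith [sq_nonneg (q₁ * |rt - s| - εm ^ 2 * W * |vt - z|)]
  have t2 : |Δ * ((enth P ε rt vt - enth P ε s z) * κ)|
      ≤ k / 8 * x ^ 2 + C2 * (rt - s) ^ 2 + C3 * (vt - z) ^ 2 := by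
    set Hd := enth P ε rt vt - enth P ε s z
    have e : Δ * (Hd * κ) = -(Hd * (a * (r - rt))) := by rw [hκ]; ring
    rw [e, abs_neg, abs_mul, abs_mul, abs_of_pos ha0]
    have i1 : |Hd| * (a * x) ≤ amax * |Hd| * x := by
      have := ha.2
      have : |Hd| * (a * x) ≤ |Hd| * (amax * x) := by gcongr
      linarith
    have i2 := young_le hk (amax * |Hd|) x
    have e2 : (amax * |Hd|) ^ 2 = amax ^ 2 * Hd ^ 2 := by rw [mul_pow, sq_abs]
    rw [e2] at i2
    have i3 : 2 / k * (amax ^ 2 * Hd ^ 2) ≤ 2 / k * (amax ^ 2 * (2 * q₁ ^ 2 * (rt - s) ^ 2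
      + 2 * (εm ^ 2 * W) ^ 2 * (vt - z) ^ 2)) := by gcongr
    rw [hC2, hC3]
    linarith
  have t3 : |Δ * (γ * (|vt| * vt - |z| * z) * R)| ≤ C4 * (Δ ^ 2 + (vt - z) ^ 2) := by
    rw [abs_mul, abs_mul, abs_mul, abs_of_pos hΔ, abs_of_pos hγ0]
    have i1 := abs_mul_abs_sub_le vt z
    have i2 : |(|vt| * vt - |z| * z)| ≤ 2 * W * |vt - z| := i1.trans (by gcongr; linarith)
    have h2 := hγ.2
    have i3 : Δ * (γ * |(|vt| * vt - |z| * z)| * |R|)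
        ≤ Δ * (γmax * (2 * W * |vt - z|) * (amax * (3 * r₁ * W))) := by gcongr
    have i4 : Δ * |vt - z| ≤ Δ ^ 2 + (vt - z) ^ 2 := by
      have := mul_le_half_sq_add Δ |vt - z|
      rw [sq_abs] at this
      linarith [sq_nonneg Δ, sq_nonneg (vt - z)]
    have i5 := mul_le_mul_of_nonneg_left i4 p4.le
    rw [hC4] at i5 ⊢
    linarith
  have t4 := abs_add_le (ε ^ 2 * p * R - Δ * ((enth P ε rt vt - enth P ε s z) * κ))
    (Δ * (γ * (|vt| * vt - |z| * z) * R))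
  have t5 := abs_sub (ε ^ 2 * p * R) (Δ * ((enth P ε rt vt - enth P ε s z) * κ))
  unfold distSq
  rw [← hx2, ← hy2]
  have n1 := sq_nonneg (rt - s)
  have n2 := sq_nonneg (vt - z)
  have n3 := mul_nonneg (sq_nonneg ε) (sq_nonneg p)
  have n4 := sq_nonneg Δ
  have n5 := mul_nonneg (sq_nonneg ε) (sq_nonneg y)
  have n6 := sq_nonneg x
  have m1 := mul_nonneg p1.le n1
  have m2 := mul_nonneg p1.le n2
  have m3 := mul_nonneg p1.le n4
  have m4 := mul_nonneg p2.le n2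
  have m5 := mul_nonneg p2.le n3
  have m6 := mul_nonneg p2.le n4
  have m7 := mul_nonneg p3.le n1
  have m8 := mul_nonneg p3.le n3
  have m9 := mul_nonneg p3.le n4
  have m10 := mul_nonneg p4.le n1
  have m11 := mul_nonneg p4.le n3
  have m12 := mul_nonneg hk.le n5
  have m13 := mul_nonneg hk.le n6
  linarith

namespace PipeNetwork

variable {V E : Type*} [Fintype V] [DecidableEq V] [Fintype E] (G : PipeNetwork V E)

/-! ### Comparison of regularized discrete states with the exact solution -/

/-- The cell densities of the comparison state, whose flux interpolates the exact flux. -/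
noncomputable abbrev cmpDens (Δ : ℝ) (a : E → ℝ) (M : E → ℕ) (d' : E → ℕ → ℝ)
    (ρ w : E → ℝ → ℝ → ℝ) (t : ℝ) : E → ℕ → ℝ :=
  G.newDens Δ a M d' (G.nodal M (fluxAt a ρ w t))

/-- The velocity of the comparison state. -/
noncomputable abbrev cmpVel (Δ : ℝ) (a : E → ℝ) (M : E → ℕ) (d' : E → ℕ → ℝ)
    (ρ w : E → ℝ → ℝ → ℝ) (t : ℝ) : E → ℝ → ℝ :=
  G.vel M a (G.cmpDens Δ a M d' ρ w t) (G.nodal M (fluxAt a ρ w t))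

/-- The squares of the differences of the comparison state and the exact solution. -/
noncomputable def cmpSq (Δ : ℝ) (a : E → ℝ) (M : E → ℕ) (d' : E → ℕ → ℝ)
    (ρ w : E → ℝ → ℝ → ℝ) (t : ℝ) (e : E) (x : ℝ) : ℝ :=
  (G.dens M (G.cmpDens Δ a M d' ρ w t) e x - ρ e t x) ^ 2
    + (G.cmpVel Δ a M d' ρ w t e x - w e t x) ^ 2

/-- The square of the difference of the discrete and the exact time derivative of the velocity,
for the comparison state. -/
noncomputable def cmpAccSq (ε Δ : ℝ) (a : E → ℝ) (M : E → ℕ) (d' m' : E → ℕ → ℝ)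
    (ρ w wt : E → ℝ → ℝ → ℝ) (t : ℝ) (e : E) (x : ℝ) : ℝ :=
  ε ^ 2 * (G.cmpVel Δ a M d' ρ w t e x - G.vel M a d' m' e x - Δ * wt e t x) ^ 2

section

variable {G} {P : ℝ → ℝ} {c : Consts} {B ε : ℝ} {a γ : E → ℝ} {hb : V → ℝ → ℝ}
  {ρ w ρt wt : E → ℝ → ℝ → ℝ} {M : E → ℕ} {t t' Δ H CE σ : ℝ} {d' m' : E → ℕ → ℝ} {e : E}

lemma StepSetup.bdd_cmpSq (S : G.StepSetup P c B ε a γ hb ρ w ρt wt M t t' Δ H CE σ d' m') (e : E) :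
    Bdd (G.len e) (G.cmpSq Δ a M d' ρ w t e) :=
  (((bdd_dens (S.hM e) _).sub (S.X.bdd_ρ S.ht)).pow 2).add
    (((bdd_vel (S.hM e) a _ _).sub (S.X.bdd_w S.ht)).pow 2)

lemma StepSetup.sq_cmpAcc (S : G.StepSetup P c B ε a γ hb ρ w ρt wt M t t' Δ H CE σ d' m') (e : E) :
    Sq (G.len e) (fun x => G.cmpVel Δ a M d' ρ w t e x - G.vel M a d' m' e x - Δ * wt e t x) :=
  ((bdd_vel (S.hM e) a _ _).sub (bdd_vel (S.hM e) a d' m')).sq.sub ((S.X.sq_wt e t S.ht).cmul Δ)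

lemma StepSetup.itg_cmpAccSq (S : G.StepSetup P c B ε a γ hb ρ w ρt wt M t t' Δ H CE σ d' m') (e : E) :
    Itg (G.len e) (G.cmpAccSq ε Δ a M d' m' ρ w wt t e) :=
  (S.sq_cmpAcc e).sq.cmul (ε ^ 2)

end

set_option maxHeartbeats 1000000 in
lemma exists_cmp_bound {P : ℝ → ℝ} (c : Consts) {B : ℝ} (hB : 0 < B) {CE : ℝ} (hCE : 0 < CE) :
    ∃ C : ℝ, 0 < C ∧ ∀ (ε : ℝ) (a γ : E → ℝ) (hb : V → ℝ → ℝ)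
      (ρ w ρt wt : E → ℝ → ℝ → ℝ) (M : E → ℕ) (t t' Δ H σ : ℝ) (d' m' : E → ℕ → ℝ),
      G.StepSetup P c B ε a γ hb ρ w ρt wt M t t' Δ H CE σ d' m' →
      G.tot (G.cmpSq Δ a M d' ρ w t) ≤ C * (Δ ^ 2 + H ^ 2) ∧
      G.tot (G.cmpAccSq ε Δ a M d' m' ρ w wt t) ≤ C * (Δ ^ 2 + H ^ 2) := by
  have ham := c.amin_pos
  have haM := c.amax_pos
  have hr₀ := c.r₀_pos
  have hW := c.W_pos
  have hεm := c.εm_pos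
  set Q := 2 / (c.amin * c.r₀) ^ 2 with hQ
  have hQ0 : 0 < Q := by positivity
  set Lc := 1 + Q * (c.amax * c.W) ^ 2 with hLc
  have hLc0 : 0 < Lc := by positivity
  set n : ℝ := Fintype.card E * B ^ 2 with hn
  have hn0 : 0 ≤ n := by positivity
  set C1 := Lc * (2 * CE + 4 * n) + Q * n with hC1
  have hC10 : 0 < C1 := by positivity
  refine ⟨C1 + 3 * (c.εm ^ 2 * C1 + CE + c.εm ^ 2 * n), by positivity, ?_⟩
  intro ε a γ hb ρ w ρt wt M t t' Δ H σ d' m' S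
  have X := S.X
  have hΔ := S.hΔ
  have hH := S.hH
  have hM := S.hM
  have ht := S.ht
  have ht' := S.ht'
  have hΔ2 : Δ ^ 2 ≤ 1 := by exact pow_le_one₀ S.hΔ.le S.hΔ1
  set E2 := Δ ^ 2 + H ^ 2 with hE2
  have hE20 : 0 ≤ E2 := by positivity
  let α : E → ℝ → ℝ := fun e x => (ρ e t x - ρ e t' x) / Δ
    + G.slopeFn M (G.nodal M (fluxAt a ρ w t)) e x / a e
  have bα : ∀ e, Bdd (G.len e) (α e) := fun e =>
    (((X.bdd_ρ ht).sub (X.bdd_ρ ht')).div_const Δ).add ((bdd_slopeFn (hM e) _).div_const (a e))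
  have iα : G.Integ (fun e x => α e x ^ 2) := fun e => ((bα e).pow 2).itg
  have iy : G.Integ (fun e x => G.fluxErr M a ρ w t e x ^ 2) := fun e =>
    ((X.bdd_fluxErr (hM e) ht).pow 2).itg
  have iS' : G.Integ (G.errSq ε M a ρ w t' d' m') := fun e => (X.bdd_errSq (hM e) ht' d' m').itg
  have iβ : G.Integ (fun e x => ((w e t x - w e t' x) / Δ - wt e t x) ^ 2) := fun e =>
    (X.sq_consist_w ht ht' hΔ S.htt).1.sq
  have hα : G.tot (fun e x => α e x ^ 2) ≤ 2 * n * E2 := by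
    have := tot_le_card_mul (G := G) (fun e =>
      X.integral_consist_mass_sq_le (e := e) (hM e) (hH e) ht ht' hΔ S.htt)
    refine this.trans (le_of_eq ?_)
    rw [hn, hE2]; ring
  have hy : G.tot (fun e x => G.fluxErr M a ρ w t e x ^ 2) ≤ n * E2 := by
    have := tot_le_card_mul (G := G) (fun e => X.integral_fluxErr_sq_le (e := e) (hM e) (hH e) ht)
    have h2 : 0 ≤ n * Δ ^ 2 := by positivity
    have h3 : (Fintype.card E : ℝ) * (B * H) ^ 2 = n * H ^ 2 := by rw [hn]; ring
    rw [hE2]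
    linarith
  have hβ : G.tot (fun e x => ((w e t x - w e t' x) / Δ - wt e t x) ^ 2) ≤ n * E2 := by
    have := tot_le_card_mul (G := G) (fun e => (X.sq_consist_w (e := e) ht ht' hΔ S.htt).2)
    have h2 : 0 ≤ n * H ^ 2 := by positivity
    have h3 : (Fintype.card E : ℝ) * (B * Δ) ^ 2 = n * Δ ^ 2 := by rw [hn]; ring
    rw [hE2]
    linarith
  have hcmp : G.tot (G.cmpSq Δ a M d' ρ w t) ≤ C1 * E2 := by
    have h1 := tot_mono (G := G) (f := G.cmpSq Δ a M d' ρ w t)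
      (g := fun e x => Lc * (2 * G.errSq ε M a ρ w t' d' m' e x + 2 * α e x ^ 2)
        + Q * G.fluxErr M a ρ w t e x ^ 2)
      (fun e => (S.bdd_cmpSq e).itg) (((iS'.cmul 2).add (iα.cmul 2)).cmul Lc |>.add (iy.cmul Q)) (by
        intro e
        filter_upwards [(S.cmp_strict hB).admState.ae X.a_pos (hM e), ae_mem_pipe (G.len e)] with x g hx
        have hx' := Ioo_subset_Icc_self hx
        have ha := X.a_pos e
        have k1 := sq_vel_sub_le (s := ρ e t x) ham hr₀ (X.a_mem e) g.1.1 (X.abs_w_le_W ht x hx') g.2.2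
        have e3 : G.interp M (G.nodal M (fluxAt a ρ w t)) e x - a e * ρ e t x * w e t x
            = - G.fluxErr M a ρ w t e x := by
          simp only [fluxErr, fluxAt, flux]; ring
        rw [e3, neg_sq] at k1
        have e4 : G.dens M (G.cmpDens Δ a M d' ρ w t) e x - ρ e t x
            = (G.dens M d' e x - ρ e t' x) - Δ * α e x := by
          have : G.dens M (G.cmpDens Δ a M d' ρ w t) e x = G.dens M d' e x
            - Δ / a e * G.slopeFn M (G.nodal M (fluxAt a ρ w t)) e x := rfl
          rw [this]
          simp only [α]
          field_simp
          ring
        have e5 : (G.dens M (G.cmpDens Δ a M d' ρ w t) e x - ρ e t x) ^ 2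
            ≤ 2 * G.errSq ε M a ρ w t' d' m' e x + 2 * α e x ^ 2 := by
          rw [e4]
          have n1 : (G.dens M d' e x - ρ e t' x) ^ 2 ≤ G.errSq ε M a ρ w t' d' m' e x := by
            unfold errSq distSq
            have := mul_nonneg (sq_nonneg ε) (sq_nonneg (G.vel M a d' m' e x - w e t' x))
            linarith
          have n2 : (Δ * α e x) ^ 2 ≤ α e x ^ 2 := by
            rw [mul_pow]
            exact mul_le_of_le_one_left (sq_nonneg _) hΔ2
          linarith [sq_nonneg ((G.dens M d' e x - ρ e t' x) + Δ * α e x)]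
        unfold cmpSq
        have e6 := mul_le_mul_of_nonneg_left e5 hLc0.le
        rw [hLc] at e6 ⊢
        rw [← hQ] at k1
        linarith)
    rw [tot_add (((iS'.cmul 2).add (iα.cmul 2)).cmul Lc) (iy.cmul Q), tot_cmul, tot_cmul,
      tot_add (iS'.cmul 2) (iα.cmul 2), tot_cmul, tot_cmul] at h1
    refine h1.trans ?_
    have := S.err
    have j1 : 2 * G.tot (G.errSq ε M a ρ w t' d' m') + 2 * G.tot (fun e x => α e x ^ 2)
      ≤ (2 * CE + 4 * n) * E2 := by linarith
    have j2 := mul_le_mul_of_nonneg_left j1 hLc0.le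
    have j3 := mul_le_mul_of_nonneg_left hy hQ0.le
    rw [hC1]
    linarith
  have hnn : 0 ≤ 3 * (c.εm ^ 2 * C1 + CE + c.εm ^ 2 * n) * E2 := by positivity
  refine ⟨by linarith, ?_⟩
  have iC := fun e => (S.bdd_cmpSq e).itg
  have h1 := tot_mono (G := G) (f := G.cmpAccSq ε Δ a M d' m' ρ w wt t)
    (g := fun e x => 3 * (c.εm ^ 2 * G.cmpSq Δ a M d' ρ w t e x + G.errSq ε M a ρ w t' d' m' e x
      + c.εm ^ 2 * ((w e t x - w e t' x) / Δ - wt e t x) ^ 2))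
    (fun e => S.itg_cmpAccSq e) (((Integ.cmul (c.εm ^ 2) iC).add iS').add (iβ.cmul _) |>.cmul 3) (by
      intro e
      refine Filter.Eventually.of_forall fun x => ?_
      have e1 : G.cmpVel Δ a M d' ρ w t e x - G.vel M a d' m' e x - Δ * wt e t x
          = (G.cmpVel Δ a M d' ρ w t e x - w e t x) - (G.vel M a d' m' e x - w e t' x)
            + Δ * ((w e t x - w e t' x) / Δ - wt e t x) := by
        field_simp
        ring
      unfold cmpAccSq
      rw [e1]
      set p := G.cmpVel Δ a M d' ρ w t e x - w e t x with hp
      set q := G.vel M a d' m' e x - w e t' x with hq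
      set β := (w e t x - w e t' x) / Δ - wt e t x
      have hε2 : ε ^ 2 ≤ c.εm ^ 2 := by
        have := X.ε_nonneg
        have := X.ε_le
        gcongr
      have n1 : ε ^ 2 * p ^ 2 ≤ c.εm ^ 2 * G.cmpSq Δ a M d' ρ w t e x := by
        have : p ^ 2 ≤ G.cmpSq Δ a M d' ρ w t e x := by
          unfold cmpSq
          rw [← hp]
          linarith [sq_nonneg (G.dens M (G.cmpDens Δ a M d' ρ w t) e x - ρ e t x)]
        gcongr
      have n2 : ε ^ 2 * q ^ 2 ≤ G.errSq ε M a ρ w t' d' m' e x := by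
        unfold errSq distSq
        rw [← hq]
        linarith [sq_nonneg (G.dens M d' e x - ρ e t' x)]
      have n3 : ε ^ 2 * (Δ * β) ^ 2 ≤ c.εm ^ 2 * β ^ 2 := by
        have : (Δ * β) ^ 2 ≤ β ^ 2 := by
          rw [mul_pow]
          exact mul_le_of_le_one_left (sq_nonneg _) hΔ2
        gcongr
      have n4 : (p - q + Δ * β) ^ 2 ≤ 3 * (p ^ 2 + q ^ 2 + (Δ * β) ^ 2) := by
        linarith [sq_nonneg (p + q), sq_nonneg (p - Δ * β), sq_nonneg (q + Δ * β)]
      have n5 := mul_le_mul_of_nonneg_left n4 (sq_nonneg ε)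
      linarith)
  rw [tot_cmul, tot_add ((Integ.cmul (c.εm ^ 2) iC).add iS') (iβ.cmul _),
    tot_add (Integ.cmul (c.εm ^ 2) iC) iS', tot_cmul, tot_cmul] at h1
  have j1 := S.err
  have j2 := mul_le_mul_of_nonneg_left hcmp (sq_nonneg c.εm)
  have j3 := mul_le_mul_of_nonneg_left hβ (sq_nonneg c.εm)
  have j4 : 0 ≤ C1 * E2 := by positivity
  linarith

/-! ### Regularized discrete states -/

/-- The scalar product of nodal values. -/
def nodePair (M : E → ℕ) (r s : E → ℕ → ℝ) : ℝ := ∑ e, ∑ i ∈ Finset.range (M e + 1), r e i * s e i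

lemma nodePair_self_nonneg (M : E → ℕ) (r : E → ℕ → ℝ) : 0 ≤ nodePair M r r :=
  Finset.sum_nonneg fun _ _ => Finset.sum_nonneg fun _ _ => mul_self_nonneg _

/-- An admissible state that solves the regularized equations of a time step, which connect the step
(for `θ = 0`) with the comparison state (for `θ = 1`). -/
structure IsRegState (P : ℝ → ℝ) (c : Consts) (ε : ℝ) (a γ : E → ℝ) (hb : V → ℝ → ℝ)
    (ρ w : E → ℝ → ℝ → ℝ) (M : E → ℕ) (t Δ : ℝ) (d' m' : E → ℕ → ℝ) (θ lam : ℝ)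
    (m : E → ℕ → ℝ) : Prop where
  θ_mem : θ ∈ Icc (0 : ℝ) 1
  lam_nonneg : 0 ≤ lam
  adm : AdmState c M a (G.newDens Δ a M d' m) m
  cons : G.Conservative (G.interp M m)
  eqn : ∀ r, G.Conservative (G.interp M r) →
    G.stepForm P ε Δ a γ hb t M (G.vel M a d' m') (G.newDens Δ a M d' m) m r
      + θ * lam * nodePair M (fun e i => m e i - G.nodal M (fluxAt a ρ w t) e i) r
      = θ * G.stepForm P ε Δ a γ hb t M (G.vel M a d' m') (G.cmpDens Δ a M d' ρ w t)
        (G.nodal M (fluxAt a ρ w t)) r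

/-- The distance of a regularized state to the comparison state. -/
noncomputable def regDist (ε : ℝ) (a : E → ℝ) (ρ w : E → ℝ → ℝ → ℝ) (M : E → ℕ) (t Δ : ℝ)
    (d' m : E → ℕ → ℝ) : E → ℝ → ℝ :=
  G.stateDist ε Δ M a (G.newDens Δ a M d' m) m (G.cmpDens Δ a M d' ρ w t)
    (G.nodal M (fluxAt a ρ w t))

lemma newDens_sub {G : PipeNetwork V E} {Δ : ℝ} {a : E → ℝ} {M : E → ℕ} {d' : E → ℕ → ℝ}
    (ha : ∀ e, 0 < a e) (m m₂ : E → ℕ → ℝ) (e : E) (i : ℕ) :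
    a e * (G.newDens Δ a M d' m e i - G.newDens Δ a M d' m₂ e i)
      = -Δ * slopes (G.edgeMeshSize M e) (fun i => m e i - m₂ e i) i := by
  have := (ha e).ne'
  rw [slopes_sub]
  unfold newDens
  field_simp
  ring

lemma dens_newDens_sub {G : PipeNetwork V E} {Δ : ℝ} {a : E → ℝ} {M : E → ℕ} {d' : E → ℕ → ℝ}
    (ha : ∀ e, 0 < a e) (m m₂ : E → ℕ → ℝ) (e : E) (x : ℝ) :
    a e * (G.dens M (G.newDens Δ a M d' m) e x - G.dens M (G.newDens Δ a M d' m₂) e x)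
      = -Δ * G.slopeFn M (fun e i => m e i - m₂ e i) e x :=
  newDens_sub ha m m₂ e _

lemma exists_regDist_bound {P : ℝ → ℝ} {c : Consts} {B CE q₀ q₁ q₂ : ℝ} (hB : 0 < B) (hCE : 0 < CE)
    (hPB : PressureBounds P c.r₀ c.r₁ c.W c.εm q₀ q₁ q₂) :
    ∃ C δ : ℝ, 0 < C ∧ 0 < δ ∧ ∀ (ε : ℝ) (a γ : E → ℝ) (hb : V → ℝ → ℝ)
      (ρ w ρt wt : E → ℝ → ℝ → ℝ) (M : E → ℕ) (t t' Δ H σ θ lam : ℝ) (d' m' m : E → ℕ → ℝ),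
      G.StepSetup P c B ε a γ hb ρ w ρt wt M t t' Δ H CE σ d' m' → Δ ≤ δ →
      G.IsRegState P c ε a γ hb ρ w M t Δ d' m' θ lam m →
      G.tot (G.regDist ε a ρ w M t Δ d' m) ≤ C * (Δ ^ 2 + H ^ 2) := by
  obtain ⟨k, δ, hk, hδ, hmono⟩ := G.exists_stepForm_mono hPB
  obtain ⟨C1, hC1, hcons⟩ := hPB.exists_consistency_le c.r₁_pos c.amin_pos c.a_le c.γmin_pos c.γ_le hk
  obtain ⟨C2, hC2, hcmp⟩ := G.exists_cmp_bound (P := P) c hB hCE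
  have hL : 0 ≤ ∑ e, G.len e := Finset.sum_nonneg fun e _ => (G.len_pos e).le
  refine ⟨2 / k * (C1 * (2 * C2 + ∑ e, G.len e)), δ, by positivity, hδ, ?_⟩
  intro ε a γ hb ρ w ρt wt M t t' Δ H σ θ lam d' m' m S hΔδ R
  have X := S.X
  have ht := S.ht
  have hM := S.hM
  have hΔ := S.hΔ
  set m₂ := G.nodal M (fluxAt a ρ w t) with hm₂
  set d := G.newDens Δ a M d' m with hd
  set d₂ := G.cmpDens Δ a M d' ρ w t with hd₂
  have hadm₂ := (S.cmp_strict hB).admState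
  have hcons₂ : G.Conservative (G.interp M m₂) := (G.conservative_interp_nodal hM).2 (X.balance t ht)
  have hr := conservative_interp_sub R.cons hcons₂
  have h1 := hmono ε Δ t a γ hb M (G.vel M a d' m') d m d₂ m₂ X.ε_nonneg X.ε_le X.a_mem X.γ_mem hΔ hΔδ
    hM (fun e => bdd_vel (hM e) a d' m') R.adm hadm₂ (fun e i _ => newDens_sub X.a_pos m m₂ e i)
  have h2 := R.eqn _ hr
  have h3 : |G.stepForm P ε Δ a γ hb t M (G.vel M a d' m') d₂ m₂ (fun e i => m e i - m₂ e i)|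
      ≤ k / 2 * G.tot (G.regDist ε a ρ w M t Δ d' m)
        + C1 * ((2 * C2 + ∑ e, G.len e) * (Δ ^ 2 + H ^ 2)) := by
    have iD : G.Integ (G.regDist ε a ρ w M t Δ d' m) := fun e => (bdd_stateDist hM _ _ _ _ _ _ _ e).itg
    have iS : G.Integ (G.cmpSq Δ a M d' ρ w t) := fun e => (S.bdd_cmpSq e).itg
    have iA : G.Integ (G.cmpAccSq ε Δ a M d' m' ρ w wt t) := S.itg_cmpAccSq
    have iO : G.Integ (fun _ _ => Δ ^ 2) := fun e => (Bdd.const _).itg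
    have iB := ((iS.add iA).add iO).cmul C1
    have iT := (iD.cmul (k / 2)).add iB
    obtain ⟨g1, g2⟩ := hcmp _ _ _ _ _ _ _ _ _ _ _ _ _ _ _ _ S
    have tO : G.tot (fun _ _ => Δ ^ 2) = (∑ e, G.len e) * Δ ^ 2 := by
      unfold tot
      rw [Finset.sum_mul]
      exact Finset.sum_congr rfl fun e _ => by simp
    have tT : G.tot (fun e x => k / 2 * G.regDist ε a ρ w M t Δ d' m e x
        + C1 * (G.cmpSq Δ a M d' ρ w t e x + G.cmpAccSq ε Δ a M d' m' ρ w wt t e x + Δ ^ 2))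
        ≤ k / 2 * G.tot (G.regDist ε a ρ w M t Δ d' m)
        + C1 * ((2 * C2 + ∑ e, G.len e) * (Δ ^ 2 + H ^ 2)) := by
      rw [tot_add (iD.cmul (k / 2)) iB, tot_cmul, tot_cmul, tot_add (iS.add iA) iO, tot_add iS iA, tO]
      have : (∑ e, G.len e) * Δ ^ 2 ≤ (∑ e, G.len e) * (Δ ^ 2 + H ^ 2) :=
        mul_le_mul_of_nonneg_left (by linarith [sq_nonneg H]) hL
      gcongr
      linarith
    refine le_trans ?_ tT
    rw [S.stepForm_eq d₂ m₂ _ hr, abs_le]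
    have key : ∀ e, ∀ᵐ x ∂(pipeMeasure (G.len e)),
        |ε ^ 2 * ((G.vel M a d₂ m₂ e x - G.vel M a d' m' e x) - Δ * wt e t x)
          * G.interp M (fun e i => m e i - m₂ e i) e x
        - Δ * ((enth P ε (G.dens M d₂ e x) (G.vel M a d₂ m₂ e x) - enth P ε (ρ e t x) (w e t x))
          * G.slopeFn M (fun e i => m e i - m₂ e i) e x)
        + Δ * (γ e * (|G.vel M a d₂ m₂ e x| * G.vel M a d₂ m₂ e x - |w e t x| * w e t x)
          * G.interp M (fun e i => m e i - m₂ e i) e x)|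
        ≤ k / 2 * G.regDist ε a ρ w M t Δ d' m e x
        + C1 * (G.cmpSq Δ a M d' ρ w t e x + G.cmpAccSq ε Δ a M d' m' ρ w wt t e x + Δ ^ 2) := by
      intro e
      filter_upwards [R.adm.ae X.a_pos (hM e), hadm₂.ae X.a_pos (hM e), ae_mem_pipe (G.len e)]
        with x j1 j2 hx
      have hx' := Ioo_subset_Icc_self hx
      refine (hcons ε (a e) (γ e) Δ _ _ _ _ _ _ _ _ _ X.ε_nonneg X.ε_le (X.a_mem e) (X.γ_mem e) hΔ
        j1.1 j2.1 (X.mem_J ht x hx') j1.2.1 j2.2.1 (X.abs_w_le_W ht x hx')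
        (dens_newDens_sub X.a_pos m m₂ e x) ?_).trans ?_
      · rw [interp_sub, j1.2.2, j2.2.2]
      · have n1 := mul_nonneg hΔ.le (dissDensity_nonneg (G.vel M a d m e x) (G.vel M a d₂ m₂ e x))
        unfold regDist stateDist cmpSq cmpAccSq
        have n2 := mul_nonneg hk.le n1
        linarith
    have iF : G.Integ (fun e x =>
        ε ^ 2 * ((G.vel M a d₂ m₂ e x - G.vel M a d' m' e x) - Δ * wt e t x)
          * G.interp M (fun e i => m e i - m₂ e i) e x
        - Δ * ((enth P ε (G.dens M d₂ e x) (G.vel M a d₂ m₂ e x) - enth P ε (ρ e t x) (w e t x))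
          * G.slopeFn M (fun e i => m e i - m₂ e i) e x)
        + Δ * (γ e * (|G.vel M a d₂ m₂ e x| * G.vel M a d₂ m₂ e x - |w e t x| * w e t x)
          * G.interp M (fun e i => m e i - m₂ e i) e x)) := by
      intro e
      have bv := bdd_vel (G := G) (hM e) a d₂ m₂
      have bw := X.bdd_w (e := e) ht
      have bR := bdd_interp (G := G) (hM e) (fun e i => m e i - m₂ e i)
      exact ((((S.sq_cmpAcc e).cmul (ε ^ 2)).mul bR.sq).sub
        ((((bdd_enth (hM e) P ε a d₂ m₂).sub (X.prim_h e t ht).bdd).mul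
          (bdd_slopeFn (hM e) _)).cmul Δ).itg).add
        (((((bv.abs.mul bv).sub (bw.abs.mul bw)).cmul (γ e)).mul bR).cmul Δ).itg
    constructor
    · have := tot_mono (iT.cmul (-1)) iF (fun e => by
        filter_upwards [key e] with x hx
        linarith [(abs_le.1 hx).1])
      rw [tot_cmul] at this
      linarith
    · exact tot_mono iF iT (fun e => by
        filter_upwards [key e] with x hx
        exact (abs_le.1 hx).2)
  have n1 := mul_nonneg (mul_nonneg R.θ_mem.1 R.lam_nonneg)
    (nodePair_self_nonneg M (fun e i => m e i - m₂ e i))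
  set F := G.stepForm P ε Δ a γ hb t M (G.vel M a d' m') d₂ m₂ (fun e i => m e i - m₂ e i)
  have h4 : θ * F - F ≤ |F| := by
    have e1 : θ * F - F = (1 - θ) * (-F) := by ring
    have h0 := R.θ_mem
    rw [e1]
    calc _ ≤ (1 - θ) * |F| := mul_le_mul_of_nonneg_left (neg_le_abs F) (by linarith [h0.2])
      _ ≤ 1 * |F| := mul_le_mul_of_nonneg_right (by linarith [h0.1]) (abs_nonneg _)
      _ = _ := one_mul _
  have h5 : k * G.tot (G.regDist ε a ρ w M t Δ d' m) ≤ k / 2 * G.tot (G.regDist ε a ρ w M t Δ d' m)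
        + C1 * ((2 * C2 + ∑ e, G.len e) * (Δ ^ 2 + H ^ 2)) := by
    have : k * G.tot (G.regDist ε a ρ w M t Δ d' m) ≤ θ * F - F := by
      refine h1.trans ?_
      linarith
    linarith
  have h6 : 2 / k * (C1 * (2 * C2 + ∑ e, G.len e)) * (Δ ^ 2 + H ^ 2)
      = 2 / k * (C1 * ((2 * C2 + ∑ e, G.len e) * (Δ ^ 2 + H ^ 2))) := by ring
  rw [h6, div_mul_eq_mul_div, le_div_iff₀ hk]
  linarith

end PipeNetwork

/-! ### Pointwise bounds for fluxes and densities -/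

lemma sq_flux_sub_le {amax W r₁ a r w s z : ℝ} (ha0 : 0 ≤ a) (ha : a ≤ amax) (hr0 : 0 ≤ r)
    (hr : r ≤ r₁) (hz : |z| ≤ W) :
    (a * r * w - a * s * z) ^ 2
      ≤ 2 * amax ^ 2 * (r₁ ^ 2 * (w - z) ^ 2 + W ^ 2 * (r - s) ^ 2) := by
  have h1 := abs_flux_sub_le (w := w) (s := s) hr0 hr hz
  have hr₁ : 0 ≤ r₁ := hr0.trans hr
  have e : a * r * w - a * s * z = a * (r * w - s * z) := by ring
  rw [e, mul_pow, ← sq_abs (r * w - s * z), ← sq_abs (w - z), ← sq_abs (r - s)]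
  have h2 : |r * w - s * z| ^ 2 ≤ 2 * (r₁ ^ 2 * |w - z| ^ 2 + W ^ 2 * |r - s| ^ 2) := by
    calc _ ≤ (r₁ * |w - z| + W * |r - s|) ^ 2 := by gcongr
      _ ≤ _ := by nlinarith [sq_nonneg (r₁ * |w - z| - W * |r - s|)]
  calc _ ≤ amax ^ 2 * (2 * (r₁ ^ 2 * |w - z| ^ 2 + W ^ 2 * |r - s| ^ 2)) := by gcongr
    _ = _ := by ring

lemma cube_flux_sub_le {amax W r₁ a r w s z : ℝ} (ha0 : 0 ≤ a) (ha : a ≤ amax) (hr0 : 0 ≤ r)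
    (hr : r ≤ r₁) (hs0 : 0 ≤ s) (hs : s ≤ r₁) (hW : 0 ≤ W) (hz : |z| ≤ W) :
    |a * r * w - a * s * z| ^ 3
      ≤ 4 * amax ^ 3 * (r₁ ^ 3 * dissDensity w z + W ^ 3 * r₁ * (r - s) ^ 2) := by
  have h1 := abs_flux_sub_le (w := w) (s := s) hr0 hr hz
  have hr₁ : 0 ≤ r₁ := hr0.trans hr
  have e : a * r * w - a * s * z = a * (r * w - s * z) := by ring
  have hd := abs_sub_cube_le w z
  have hx : |r - s| ^ 3 ≤ r₁ * (r - s) ^ 2 := by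
    have : |r - s| ≤ r₁ := abs_le.2 ⟨by linarith, by linarith⟩
    calc |r - s| ^ 3 = |r - s| * (r - s) ^ 2 := by rw [← sq_abs (r - s)]; ring
      _ ≤ _ := by gcongr
  rw [e, abs_mul, mul_pow, abs_of_nonneg ha0]
  have h2 : |r * w - s * z| ^ 3 ≤ 4 * (r₁ ^ 3 * dissDensity w z + W ^ 3 * r₁ * (r - s) ^ 2) := by
    have h3 : |r * w - s * z| ^ 3 ≤ (r₁ * |w - z| + W * |r - s|) ^ 3 := by gcongr
    have h4 := add_pow_le (mul_nonneg hr₁ (abs_nonneg (w - z))) (mul_nonneg hW (abs_nonneg (r - s))) 3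
    have h5 : r₁ ^ 3 * |w - z| ^ 3 ≤ r₁ ^ 3 * dissDensity w z := by unfold dissDensity; gcongr
    have h6 : W ^ 3 * |r - s| ^ 3 ≤ W ^ 3 * (r₁ * (r - s) ^ 2) := by gcongr
    norm_num [mul_pow] at h4
    linarith
  have haM : 0 ≤ amax := ha0.trans ha
  calc _ ≤ amax ^ 3 * (4 * (r₁ ^ 3 * dissDensity w z + W ^ 3 * r₁ * (r - s) ^ 2)) := by gcongr
    _ = _ := by ring

lemma sq_enth_sub_le {P : ℝ → ℝ} {r₀ r₁ W εm q₀ q₁ q₂ ε r w s z : ℝ}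
    (hPB : PressureBounds P r₀ r₁ W εm q₀ q₁ q₂) (hε : 0 ≤ ε) (hεm : ε ≤ εm)
    (hr : r ∈ Icc r₀ r₁) (hs : s ∈ Icc r₀ r₁) (hw : |w| ≤ W) (hz : |z| ≤ W) :
    (enth P ε r w - enth P ε s z) ^ 2 ≤ 2 * (q₁ ^ 2 + (εm * W) ^ 2) * distSq ε r w s z := by
  have h1 := hPB.abs_enth_sub_le (ε := ε) hr hs hw hz
  have hW := hPB.W_pos
  have hq := hPB.q₁_pos
  rw [← sq_abs]
  have h2 : |enth P ε r w - enth P ε s z| ^ 2 ≤ (q₁ * |r - s| + ε ^ 2 * W * |w - z|) ^ 2 := by gcongr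
  have h3 : (ε ^ 2 * W * |w - z|) ^ 2 ≤ (εm * W) ^ 2 * (ε ^ 2 * (w - z) ^ 2) := by
    have : (ε ^ 2 * W * |w - z|) ^ 2 = (ε * W) ^ 2 * (ε ^ 2 * (w - z) ^ 2) := by
      rw [← sq_abs (w - z)]; ring
    rw [this]
    gcongr
  have h4 : (q₁ * |r - s|) ^ 2 = q₁ ^ 2 * (r - s) ^ 2 := by rw [mul_pow, sq_abs]
  have h5 := sq_nonneg (q₁ * |r - s| - ε ^ 2 * W * |w - z|)
  have h6 : 0 ≤ q₁ ^ 2 * (ε ^ 2 * (w - z) ^ 2) := by positivity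
  have h7 : 0 ≤ (εm * W) ^ 2 * (r - s) ^ 2 := by positivity
  unfold distSq
  nlinarith

/-- Small differences of fluxes and enthalpies imply small differences of the densities. -/
lemma PressureBounds.exists_density_close {P : ℝ → ℝ} {r₀ r₁ W εm q₀ q₁ q₂ amin amax : ℝ}
    (hPB : PressureBounds P r₀ r₁ W εm q₀ q₁ q₂) (hr₁ : 0 < r₁) (ham : 0 < amin) (haM : 0 < amax) :
    ∃ C : ℝ, 0 < C ∧ ∀ ε a r v rt vt s z θ κ σ : ℝ, 0 ≤ ε → ε ≤ εm → a ∈ Icc amin amax →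
      r ∈ Icc r₀ r₁ → rt ∈ Icc r₀ r₁ → s ∈ Icc r₀ r₁ → |v| ≤ W → |vt| ≤ W → |z| ≤ W →
      θ ∈ Icc (0 : ℝ) 1 → 0 ≤ κ → 0 ≤ σ → |rt - s| ≤ σ + κ → |a * r * v - a * s * z| ≤ 2 * κ →
      |a * rt * vt - a * s * z| ≤ κ →
      |(enth P ε r v - enth P ε s z) - θ * (enth P ε rt vt - enth P ε s z)| ≤ κ →
      (r - s) ^ 2 ≤ C * (κ + θ * σ) := by
  have hW := hPB.W_pos
  have hq₀ := hPB.q₀_pos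
  have hq₁ := hPB.q₁_pos
  have hr₀ := hPB.r₀_pos
  have hεm := hPB.εm_pos
  set L := q₁ + εm ^ 2 * W * ((1 + amax * W) / (amin * r₀)) with hL
  have hL0 : 0 < L := by positivity
  refine ⟨4 / q₀ * ((1 + L) * r₁ + 4 * εm ^ 2 * W / amin), by positivity, ?_⟩
  intro ε a r v rt vt s z θ κ σ hε hεm' ha hr hrt hs hv hvt hz hθ hκ hσ h1 h2 h3 h4
  have ha0 : 0 < a := ham.trans_le ha.1
  have hε2 : ε ^ 2 ≤ εm ^ 2 := by gcongr
  have k1 : |vt - z| ≤ (1 + amax * W) / (amin * r₀) * (σ + κ) := by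
    have e : a * rt * (vt - z) = (a * rt * vt - a * s * z) - a * z * (rt - s) := by ring
    have i1 : amin * r₀ * |vt - z| ≤ κ + amax * W * (σ + κ) := by
      calc amin * r₀ * |vt - z| ≤ |a * rt * (vt - z)| := by
            rw [abs_mul, abs_of_pos (mul_pos ha0 (hr₀.trans_le hrt.1))]
            have := mul_le_mul ha.1 hrt.1 hr₀.le ha0.le
            gcongr
        _ ≤ |a * rt * vt - a * s * z| + |a * z * (rt - s)| := by rw [e]; exact abs_sub _ _
        _ ≤ κ + amax * W * (σ + κ) := by
            rw [abs_mul, abs_mul, abs_of_pos ha0]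
            have := ha.2
            gcongr
    rw [div_mul_eq_mul_div, le_div_iff₀ (by positivity)]
    have : 0 ≤ amax * W := by positivity
    nlinarith
  have k2 : |enth P ε rt vt - enth P ε s z| ≤ L * (σ + κ) := by
    refine (hPB.abs_enth_sub_le hrt hs hvt hz).trans ?_
    have : q₁ * |rt - s| + ε ^ 2 * W * |vt - z|
        ≤ q₁ * (σ + κ) + εm ^ 2 * W * ((1 + amax * W) / (amin * r₀) * (σ + κ)) := by gcongr
    refine this.trans (le_of_eq ?_)
    rw [hL]; ring
  have k3 : |enth P ε r v - enth P ε s z| ≤ (1 + L) * (κ + θ * σ) := by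
    have i1 := abs_add_le ((enth P ε r v - enth P ε s z) - θ * (enth P ε rt vt - enth P ε s z))
      (θ * (enth P ε rt vt - enth P ε s z))
    rw [sub_add_cancel, abs_mul, abs_of_nonneg hθ.1] at i1
    have i2 : θ * |enth P ε rt vt - enth P ε s z| ≤ θ * (L * (σ + κ)) :=
      mul_le_mul_of_nonneg_left k2 hθ.1
    have i3 : θ * (L * κ) ≤ 1 * (L * κ) := mul_le_mul_of_nonneg_right hθ.2 (by positivity)
    have i4 := mul_nonneg hθ.1 hσ
    linarith
  have k4 : (enth P ε r v - enth P ε s z) * (r - s) ≤ (1 + L) * (κ + θ * σ) * r₁ := by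
    refine (le_abs_self _).trans ?_
    rw [abs_mul]
    have : |r - s| ≤ r₁ := abs_le.2 ⟨by linarith [hr.1, hs.2], by linarith [hr.2, hs.1]⟩
    have h5 : 0 ≤ (1 + L) * (κ + θ * σ) := by have := hθ.1; positivity
    gcongr
  have k5 : ε ^ 2 * (v - z) * (r * v - s * z) ≤ εm ^ 2 * (2 * W) * (2 * κ / amin) := by
    refine (le_abs_self _).trans ?_
    have i1 : |r * v - s * z| ≤ 2 * κ / amin := by
      rw [le_div_iff₀ ham]
      have e : a * r * v - a * s * z = a * (r * v - s * z) := by ring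
      rw [e, abs_mul, abs_of_pos ha0] at h2
      have := mul_le_mul_of_nonneg_right ha.1 (abs_nonneg (r * v - s * z))
      linarith
    have i2 : |v - z| ≤ 2 * W := (abs_sub _ _).trans (by linarith)
    rw [abs_mul, abs_mul, abs_of_nonneg (sq_nonneg ε)]
    gcongr
  have k6 := hPB.mono hε hεm' hr hs hv hz
  have k7 : 0 ≤ ε ^ 2 * r₀ * (v - z) ^ 2 := by positivity
  have k8 : q₀ * (r - s) ^ 2 ≤ 4 * ((1 + L) * r₁ + 4 * εm ^ 2 * W / amin) * (κ + θ * σ) := by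
    have : 0 ≤ 4 * εm ^ 2 * W / amin * (θ * σ) := by have := hθ.1; positivity
    have e : εm ^ 2 * (2 * W) * (2 * κ / amin) = 4 * εm ^ 2 * W / amin * κ := by ring
    linarith
  rw [div_mul_eq_mul_div, div_mul_eq_mul_div, le_div_iff₀ hq₀]
  linarith

/-- Bounds for the oscillation on cells and for the differences of averages imply a bound for the
oscillation on a pipe. -/
lemma abs_sub_le_of_averages {ℓ h K : ℝ} {m : ℕ} (hh : 0 < h) (hm : m * h = ℓ) (hK : 0 ≤ K)
    {f : ℝ → ℝ} (hf : Itg ℓ f)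
    (hloc : ∀ i < m, ∀ x ∈ Ico (i * h) ((i + 1) * h), ∀ y ∈ Ico (i * h) ((i + 1) * h),
      |f x - f y| ≤ K * √h)
    (havg : ∀ i j : ℕ, j < i → i < m → |(∫ x in (j * h)..((j + 1) * h), f x) / h
      - (∫ x in (i * h)..((i + 1) * h), f x) / h| ≤ K * √((i + 1) * h - j * h)) :
    ∀ x ∈ Ioo 0 ℓ, ∀ y ∈ Ioo 0 ℓ, |f x - f y| ≤ 3 * K * √(|x - y| + 2 * h) := by
  have key : ∀ i < m, ∀ x ∈ Ico (i * h) ((i + 1) * h),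
      |f x - (∫ y in (i * h)..((i + 1) * h), f y) / h| ≤ K * √h := by
    intro i hi x hx
    have fi := hf.ii_of_mem (cell_subset hh hm hi (left_mem_cell hh i))
      (cell_subset hh hm hi (right_mem_cell hh i))
    have e : f x - (∫ y in (i * h)..((i + 1) * h), f y) / h
        = (∫ y in (i * h)..((i + 1) * h), (f x - f y)) / h := by
      rw [intervalIntegral.integral_sub (by simp) fi, intervalIntegral.integral_const, smul_eq_mul]
      field_simp
      ring
    have hlt : (i * h : ℝ) ≤ (i + 1) * h := by linarith
    have b := intervalIntegral.norm_integral_le_of_norm_le_const_ae (a := (i * h : ℝ))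
      (b := (i + 1) * h) (f := fun y => f x - f y) (C := K * √h) (by
        have hne : ∀ᵐ r : ℝ, r ≠ (i + 1) * h := by simp [ae_iff]
        filter_upwards [hne] with y hy hym
        rw [uIoc_of_le hlt] at hym
        exact hloc i hi x hx y ⟨hym.1.le, lt_of_le_of_ne hym.2 hy⟩)
    have e2 : |((i : ℝ) + 1) * h - i * h| = h := by
      rw [show ((i : ℝ) + 1) * h - i * h = h by ring, abs_of_pos hh]
    rw [Real.norm_eq_abs, e2] at b
    rw [e, abs_div, abs_of_pos hh, div_le_iff₀ hh]
    exact b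
  intro x hx y hy
  obtain ⟨i, hi, hxi⟩ := exists_mem_cell hh hm (Ioo_subset_Ico_self hx)
  obtain ⟨j, hj, hyj⟩ := exists_mem_cell hh hm (Ioo_subset_Ico_self hy)
  wlog hij : j ≤ i generalizing x y i j
  · rw [abs_sub_comm, abs_sub_comm x y]
    exact this y hy x hx j hj hyj i hi hxi (le_of_not_ge hij)
  have hle : K * √h ≤ K * √(|x - y| + 2 * h) := by
    have := abs_nonneg (x - y)
    gcongr
    linarith
  have h0 : 0 ≤ K * √h := by positivity
  rcases hij.lt_or_eq with hlt | rfl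
  · have h1 := key i hi x hxi
    have h2 := key j hj y hyj
    have h3 := havg i j hlt hi
    have h4 : K * √((i + 1) * h - j * h) ≤ K * √(|x - y| + 2 * h) := by
      gcongr
      have := le_abs_self (x - y)
      linarith [hxi.1, hyj.2]
    rw [abs_le] at *
    constructor <;> linarith [h1.1, h1.2, h2.1, h2.2, h3.1, h3.2]
  · have := hloc j hj x hxi y hyj
    linarith

namespace PipeNetwork

variable {V E : Type*} [Fintype V] [DecidableEq V] [Fintype E] (G : PipeNetwork V E)

/-! ### Uniform bounds for regularized states -/

/-- A regularized state, together with bounds in the mean for the distance of the regularized state,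
the comparison state, and the exact solution. -/
structure RegSetup (P : ℝ → ℝ) (c : Consts) (B ε : ℝ) (a γ : E → ℝ) (hb : V → ℝ → ℝ)
    (ρ w ρt wt : E → ℝ → ℝ → ℝ) (M : E → ℕ) (t t' Δ H CE σ : ℝ) (d' m' : E → ℕ → ℝ)
    (θ lam K : ℝ) (m : E → ℕ → ℝ) : Prop where
  S : G.StepSetup P c B ε a γ hb ρ w ρt wt M t t' Δ H CE σ d' m'
  R : G.IsRegState P c ε a γ hb ρ w M t Δ d' m' θ lam m
  hB : 0 < B
  hK : 0 < K
  dist : G.tot (G.regDist ε a ρ w M t Δ d' m) ≤ K ^ 2 * Δ ^ 2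
  cmp : G.tot (G.cmpSq Δ a M d' ρ w t) ≤ K ^ 2 * Δ ^ 2
  acc : G.tot (G.cmpAccSq ε Δ a M d' m' ρ w wt t) ≤ K ^ 2 * Δ ^ 2
  lam_le : ∀ e, lam ≤ Δ * G.edgeMeshSize M e

/-- The residual of the momentum balance, up to the derivative of the enthalpy. -/
noncomputable def resid (ε Δ : ℝ) (a γ : E → ℝ) (w wt : E → ℝ → ℝ → ℝ) (M : E → ℕ) (t : ℝ)
    (d' m' d m : E → ℕ → ℝ) (e : E) (x : ℝ) : ℝ :=
  ε ^ 2 * ((G.vel M a d m e x - G.vel M a d' m' e x) - Δ * wt e t x)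
    + Δ * (γ e * (|G.vel M a d m e x| * G.vel M a d m e x - |w e t x| * w e t x))

/-- The error of the enthalpy of a discrete state. -/
noncomputable def enthErr (P : ℝ → ℝ) (ε : ℝ) (a : E → ℝ) (ρ w : E → ℝ → ℝ → ℝ) (M : E → ℕ) (t : ℝ)
    (d m : E → ℕ → ℝ) (e : E) (x : ℝ) : ℝ :=
  enth P ε (G.dens M d e x) (G.vel M a d m e x) - enth P ε (ρ e t x) (w e t x)

open Classical in
/-- A trapezoidal test function on one pipe. -/
noncomputable def localTest (e₀ : E) (j i : ℕ) (e : E) (k : ℕ) : ℝ :=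
  if e = e₀ then trapezoid j i k else 0

section

variable {G} {M : E → ℕ} {e₀ : E} {i j : ℕ}

lemma conservative_localTest (hM : ∀ e, 0 < M e) (hi : i < M e₀) :
    G.Conservative (G.interp M (localTest e₀ j i)) := by
  refine (G.conservative_iff_of_ends (u' := fun _ _ => 0) (fun e => ?_) (fun e => ?_)).2
    (fun v _ => by simp [atVertex])
  · rw [G.interp_start (hM e), localTest, trapezoid]
    simp
  · rw [G.interp_end (hM e), localTest, trapezoid]
    split_ifs with h1 h2
    · subst h1; omega
    · rfl
    · rfl

lemma localTest_self (e₀ : E) (j i : ℕ) : localTest e₀ j i e₀ = trapezoid j i := by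
  funext k
  simp [localTest]

lemma interp_localTest (e₀ : E) (j i : ℕ) (x : ℝ) :
    G.interp M (localTest e₀ j i) e₀ x = lin (G.edgeMeshSize M e₀) (trapezoid j i) x := by
  rw [interp, localTest_self]

lemma slopeFn_localTest (e₀ : E) (j i : ℕ) (x : ℝ) : G.slopeFn M (localTest e₀ j i) e₀ x
    = pc (G.edgeMeshSize M e₀) (slopes (G.edgeMeshSize M e₀) (trapezoid j i)) x := by
  rw [slopeFn, localTest_self]

lemma interp_localTest_of_ne {e : E} (h : e ≠ e₀) (x : ℝ) :
    G.interp M (localTest e₀ j i) e x = 0 := by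
  simp [interp, localTest, lin, h]

lemma slopeFn_localTest_of_ne {e : E} (h : e ≠ e₀) (x : ℝ) :
    G.slopeFn M (localTest e₀ j i) e x = 0 := by
  simp [slopeFn, localTest, pc, slopes, h]

lemma abs_nodePair_localTest_le {u : E → ℕ → ℝ} {U : ℝ} (hji : j < i) (hi : i < M e₀)
    (hu : ∀ k < M e₀, |u e₀ k| ≤ U) : |nodePair M u (localTest e₀ j i)| ≤ U * ((i : ℝ) - j) := by
  classical
  have h0 : nodePair M u (localTest e₀ j i) = ∑ k ∈ Finset.Ioc j i, u e₀ k := by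
    unfold nodePair
    rw [Finset.sum_eq_single e₀]
    · have hset : Finset.Ioc j i = {k ∈ Finset.range (M e₀ + 1) | j < k ∧ k ≤ i} := by
        ext k
        simp only [Finset.mem_Ioc, Finset.mem_filter, Finset.mem_range]
        omega
      rw [hset, Finset.sum_filter]
      refine Finset.sum_congr rfl fun k _ => ?_
      simp [localTest, trapezoid]
    · intro e _ he
      simp [localTest, he]
    · intro h
      exact absurd (Finset.mem_univ _) h
  rw [h0]
  calc _ ≤ ∑ k ∈ Finset.Ioc j i, |u e₀ k| := Finset.abs_sum_le_sum_abs _ _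
    _ ≤ ∑ k ∈ Finset.Ioc j i, U := Finset.sum_le_sum fun k hk =>
        hu k ((Finset.mem_Ioc.1 hk).2.trans_lt hi)
    _ = _ := by
      rw [Finset.sum_const, Nat.card_Ioc, nsmul_eq_mul, Nat.cast_sub hji.le, mul_comm]

end

section

variable {G} {P : ℝ → ℝ} {c : Consts} {B ε : ℝ} {a γ : E → ℝ} {hb : V → ℝ → ℝ}
  {ρ w ρt wt : E → ℝ → ℝ → ℝ} {M : E → ℕ} {t t' Δ H CE σ θ lam K : ℝ} {d' m' m : E → ℕ → ℝ} {e : E}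
  {i j : ℕ} {q₀ q₁ q₂ : ℝ}

lemma StepSetup.sq_resid (S : G.StepSetup P c B ε a γ hb ρ w ρt wt M t t' Δ H CE σ d' m')
    (d m : E → ℕ → ℝ) (e : E) : Sq (G.len e) (G.resid ε Δ a γ w wt M t d' m' d m e) := by
  have bv := bdd_vel (G := G) (S.hM e) a d m
  have bw := S.X.bdd_w (e := e) S.ht
  exact (((bv.sub (bdd_vel (S.hM e) a d' m')).sq.sub ((S.X.sq_wt e t S.ht).cmul Δ)).cmul (ε ^ 2)).add
    ((((bv.abs.mul bv).sub (bw.abs.mul bw)).cmul (γ e)).cmul Δ).sq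

lemma StepSetup.bdd_enthErr (S : G.StepSetup P c B ε a γ hb ρ w ρt wt M t t' Δ H CE σ d' m')
    (d m : E → ℕ → ℝ) (e : E) : Bdd (G.len e) (G.enthErr P ε a ρ w M t d m e) :=
  (bdd_enth (S.hM e) P ε a d m).sub (S.X.prim_h e t S.ht).bdd

lemma StepSetup.stepForm_localTest
    (S : G.StepSetup P c B ε a γ hb ρ w ρt wt M t t' Δ H CE σ d' m') (d m : E → ℕ → ℝ) (hji : j < i)
    (hi : i < M e) :
    G.stepForm P ε Δ a γ hb t M (G.vel M a d' m') d m (localTest e j i)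
      = (∫ x in (0 : ℝ)..G.len e, G.resid ε Δ a γ w wt M t d' m' d m e x
          * lin (G.edgeMeshSize M e) (trapezoid j i) x)
        - Δ * ((∫ x in (j * G.edgeMeshSize M e)..((j + 1) * G.edgeMeshSize M e),
            G.enthErr P ε a ρ w M t d m e x) / G.edgeMeshSize M e
          - (∫ x in (i * G.edgeMeshSize M e)..((i + 1) * G.edgeMeshSize M e),
            G.enthErr P ε a ρ w M t d m e x) / G.edgeMeshSize M e) := by
  have hh := G.mesh_pos (S.hM e)
  have hm := G.mesh_mul (S.hM e)
  have b := S.bdd_enthErr d m e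
  have i1 : Itg (G.len e) (fun x => G.resid ε Δ a γ w wt M t d' m' d m e x
      * lin (G.edgeMeshSize M e) (trapezoid j i) x) :=
    (S.sq_resid d m e).mul (isPrimitive_lin hh hm _).bdd.sq
  have i2 : Itg (G.len e) (fun x => Δ * (G.enthErr P ε a ρ w M t d m e x
      * pc (G.edgeMeshSize M e) (slopes (G.edgeMeshSize M e) (trapezoid j i)) x)) :=
    ((b.mul (bdd_pc hh hm _)).cmul Δ).itg
  rw [← integral_slopes_trapezoid hh hm hji hi b.itg, ← intervalIntegral.integral_const_mul,
    ← intervalIntegral.integral_sub ((intervalIntegrable_pipe (G.len_pos e).le).2 i1)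
      ((intervalIntegrable_pipe (G.len_pos e).le).2 i2),
    S.stepForm_eq d m _ (conservative_localTest S.hM hi)]
  unfold tot
  rw [Finset.sum_eq_single e]
  · congr 1
    funext x
    simp only
    rw [interp_localTest, slopeFn_localTest, resid, enthErr]
    ring
  · intro e' _ he
    simp [interp_localTest_of_ne he, slopeFn_localTest_of_ne he]
  · intro h
    exact absurd (Finset.mem_univ _) h

namespace RegSetup

variable (Z : G.RegSetup P c B ε a γ hb ρ w ρt wt M t t' Δ H CE σ d' m' θ lam K m)

include Z

lemma integral_regDist_le (e : E) :
    ∫ x in (0 : ℝ)..G.len e, G.regDist ε a ρ w M t Δ d' m e x ≤ K ^ 2 * Δ ^ 2 :=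
  (integral_le_tot (G := G) (fun e x => stateDist_nonneg Z.S.hΔ.le _ _ _ _ e x) e).trans Z.dist

lemma itg_regDist (e : E) : Itg (G.len e) (G.regDist ε a ρ w M t Δ d' m e) :=
  (bdd_stateDist Z.S.hM _ _ _ _ _ _ _ e).itg

lemma flux_holder {x y : ℝ} (hx : x ∈ Icc 0 (G.len e)) (hy : y ∈ Icc 0 (G.len e)) :
    |G.interp M (fun e i => m e i - G.nodal M (fluxAt a ρ w t) e i) e x
      - G.interp M (fun e i => m e i - G.nodal M (fluxAt a ρ w t) e i) e y|
      ≤ c.amax * K * √(|x - y|) := by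
  have hΔ := Z.S.hΔ
  have haM := c.amax_pos
  refine (G.isPrimitive_interp (Z.S.hM e) _).holder (mul_nonneg haM.le Z.hK.le) ?_ hx hy
  have ha := Z.S.X.a_pos e
  have b := bdd_slopeFn (G := G) (Z.S.hM e) (fun e i => m e i - G.nodal M (fluxAt a ρ w t) e i)
  calc _ ≤ ∫ x in (0 : ℝ)..G.len e, (c.amax / Δ) ^ 2 * G.regDist ε a ρ w M t Δ d' m e x := by
        refine integral_mono_pipe (G.len_pos e).le (b.pow 2).itg ((Z.itg_regDist e).cmul _)
          (Filter.Eventually.of_forall fun x => ?_)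
        have h1 := dens_newDens_sub (G := G) (Δ := Δ) (d' := d') (M := M) Z.S.X.a_pos m
          (G.nodal M (fluxAt a ρ w t)) e x
        set s := G.slopeFn M (fun e i => m e i - G.nodal M (fluxAt a ρ w t) e i) e x
        set D := G.dens M (G.newDens Δ a M d' m) e x
          - G.dens M (G.newDens Δ a M d' (G.nodal M (fluxAt a ρ w t))) e x with hD
        have h2 : D ^ 2 ≤ G.regDist ε a ρ w M t Δ d' m e x := by
          unfold regDist stateDist distSq
          rw [← hD]
          have := mul_nonneg hΔ.le (dissDensity_nonneg (G.vel M a (G.newDens Δ a M d' m) m e x)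
            (G.cmpVel Δ a M d' ρ w t e x))
          have := mul_nonneg (sq_nonneg ε) (sq_nonneg (G.vel M a (G.newDens Δ a M d' m) m e x
            - G.cmpVel Δ a M d' ρ w t e x))
          linarith
        have h3 : s = -(a e / Δ) * D := by field_simp; linarith
        have h4 := (Z.S.X.a_mem e).2
        rw [h3, mul_pow, neg_sq]
        gcongr
    _ = (c.amax / Δ) ^ 2 * ∫ x in (0 : ℝ)..G.len e, G.regDist ε a ρ w M t Δ d' m e x :=
        intervalIntegral.integral_const_mul _ _
    _ ≤ (c.amax / Δ) ^ 2 * (K ^ 2 * Δ ^ 2) :=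
        mul_le_mul_of_nonneg_left (Z.integral_regDist_le e) (by positivity)
    _ = _ := by field_simp

lemma integral_flux_cube_le (e : E) :
    ∫ x in (0 : ℝ)..G.len e, |G.interp M (fun e i => m e i - G.nodal M (fluxAt a ρ w t) e i) e x| ^ 3
      ≤ 4 * c.amax ^ 3 * (c.r₁ ^ 3 + c.W ^ 3 * c.r₁) * K ^ 2 * Δ := by
  have hΔ := Z.S.hΔ
  have hΔ1 := Z.S.hΔ1
  have haM := c.amax_pos
  have hr₁ := c.r₁_pos
  have hW := c.W_pos
  have hr₀ := c.r₀_pos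
  have ha := Z.S.X.a_pos e
  have hadm := (Z.S.cmp_strict Z.hB).admState
  calc _ ≤ ∫ x in (0 : ℝ)..G.len e, 4 * c.amax ^ 3 * (c.r₁ ^ 3 / Δ + c.W ^ 3 * c.r₁)
        * G.regDist ε a ρ w M t Δ d' m e x := by
        refine integral_mono_pipe (G.len_pos e).le ((bdd_interp (G := G) (Z.S.hM e) _).abs.pow 3).itg
          ((Z.itg_regDist e).cmul _) ?_
        filter_upwards [Z.R.adm.ae Z.S.X.a_pos (Z.S.hM e), hadm.ae Z.S.X.a_pos (Z.S.hM e)] with x g k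
        rw [interp_sub, ← g.2.2, ← k.2.2]
        refine (cube_flux_sub_le ha.le (Z.S.X.a_mem e).2 (hr₀.le.trans g.1.1) g.1.2
          (hr₀.le.trans k.1.1) k.1.2 hW.le k.2.1).trans ?_
        unfold regDist stateDist distSq
        set dd := dissDensity (G.vel M a (G.newDens Δ a M d' m) m e x) (G.vel M a (G.cmpDens Δ a M d'
          ρ w t) (G.nodal M (fluxAt a ρ w t)) e x)
        set D := (G.dens M (G.newDens Δ a M d' m) e x - G.dens M (G.cmpDens Δ a M d' ρ w t) e x) ^ 2
        have n1 : 0 ≤ dd := dissDensity_nonneg _ _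
        have n2 : 0 ≤ D := sq_nonneg _
        have n3 := mul_nonneg (sq_nonneg ε) (sq_nonneg (G.vel M a (G.newDens Δ a M d' m) m e x
            - G.vel M a (G.cmpDens Δ a M d' ρ w t) (G.nodal M (fluxAt a ρ w t)) e x))
        set F := ε ^ 2 * (G.vel M a (G.newDens Δ a M d' m) m e x
            - G.vel M a (G.cmpDens Δ a M d' ρ w t) (G.nodal M (fluxAt a ρ w t)) e x) ^ 2
        rw [mul_assoc (4 * c.amax ^ 3)]
        gcongr
        have e1 : (c.r₁ ^ 3 / Δ + c.W ^ 3 * c.r₁) * (D + F + Δ * dd)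
            = c.r₁ ^ 3 * dd + c.W ^ 3 * c.r₁ * D + (c.r₁ ^ 3 / Δ * (D + F)
              + c.W ^ 3 * c.r₁ * (F + Δ * dd)) := by field_simp; ring
        rw [e1]
        have : 0 ≤ c.r₁ ^ 3 / Δ * (D + F) + c.W ^ 3 * c.r₁ * (F + Δ * dd) := by positivity
        linarith
    _ = 4 * c.amax ^ 3 * (c.r₁ ^ 3 / Δ + c.W ^ 3 * c.r₁)
        * ∫ x in (0 : ℝ)..G.len e, G.regDist ε a ρ w M t Δ d' m e x :=
        intervalIntegral.integral_const_mul _ _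
    _ ≤ 4 * c.amax ^ 3 * (c.r₁ ^ 3 / Δ + c.W ^ 3 * c.r₁) * (K ^ 2 * Δ ^ 2) :=
        mul_le_mul_of_nonneg_left (Z.integral_regDist_le e) (by positivity)
    _ = 4 * c.amax ^ 3 * (c.r₁ ^ 3 + c.W ^ 3 * c.r₁ * Δ) * K ^ 2 * Δ := by field_simp
    _ ≤ _ := by
        have : c.W ^ 3 * c.r₁ * Δ ≤ c.W ^ 3 * c.r₁ := mul_le_of_le_one_right (by positivity) hΔ1
        gcongr

end RegSetup

end

end PipeNetwork

lemma sq_residual_le {ε εm γ γmax Δ W v vt z θ : ℝ} (hε : 0 ≤ ε) (hεm : ε ≤ εm) (hγ : 0 ≤ γ)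
    (hγm : γ ≤ γmax) (hΔ : 0 ≤ Δ) (hW : 0 ≤ W) (hθ : θ ∈ Icc (0 : ℝ) 1) (hv : |v| ≤ W) (hvt : |vt| ≤ W)
    (hz : |z| ≤ W) (A : ℝ) :
    (ε ^ 2 * (v - vt) + (1 - θ) * (ε ^ 2 * A)
        + Δ * (γ * ((|v| * v - |z| * z) - θ * (|vt| * vt - |z| * z)))) ^ 2
      ≤ 3 * (εm ^ 2 * (ε ^ 2 * (v - vt) ^ 2) + εm ^ 2 * (ε ^ 2 * A ^ 2)
        + (4 * γmax * W ^ 2) ^ 2 * Δ ^ 2) := by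
  have hf : ∀ p : ℝ, |p| ≤ W → |(|p| * p - |z| * z)| ≤ 2 * W ^ 2 := by
    intro p hp
    refine (abs_sub _ _).trans ?_
    rw [abs_mul, abs_mul, abs_abs, abs_abs]
    have := mul_le_mul hp hp (abs_nonneg p) hW
    have := mul_le_mul hz hz (abs_nonneg z) hW
    linarith
  have f1 := hf v hv
  have f2 := hf vt hvt
  set F1 := |v| * v - |z| * z
  set F2 := |vt| * vt - |z| * z
  have b1 : (ε ^ 2 * (v - vt)) ^ 2 ≤ εm ^ 2 * (ε ^ 2 * (v - vt) ^ 2) := by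
    calc _ = ε ^ 2 * (ε ^ 2 * (v - vt) ^ 2) := by ring
      _ ≤ _ := by gcongr
  have b2 : ((1 - θ) * (ε ^ 2 * A)) ^ 2 ≤ εm ^ 2 * (ε ^ 2 * A ^ 2) := by
    have j1 : (1 - θ) ^ 2 ≤ 1 := by nlinarith [hθ.1, hθ.2]
    rw [mul_pow]
    calc _ ≤ 1 * (ε ^ 2 * A) ^ 2 := by gcongr
      _ = ε ^ 2 * (ε ^ 2 * A ^ 2) := by ring
      _ ≤ _ := by gcongr
  have b3 : (Δ * (γ * (F1 - θ * F2))) ^ 2 ≤ (4 * γmax * W ^ 2) ^ 2 * Δ ^ 2 := by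
    have j1 : |F1 - θ * F2| ≤ 4 * W ^ 2 := by
      refine (abs_sub _ _).trans ?_
      rw [abs_mul, abs_of_nonneg hθ.1]
      have := mul_le_mul hθ.2 f2 (abs_nonneg F2) zero_le_one
      linarith
    have hγM := hγ.trans hγm
    rw [← sq_abs, abs_mul, abs_mul, abs_of_nonneg hΔ, abs_of_nonneg hγ]
    calc _ ≤ (Δ * (γmax * (4 * W ^ 2))) ^ 2 := by gcongr
      _ = _ := by ring
  set p := ε ^ 2 * (v - vt)
  set q := (1 - θ) * (ε ^ 2 * A)
  set r := Δ * (γ * (F1 - θ * F2))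
  nlinarith [sq_nonneg (p - q), sq_nonneg (p - r), sq_nonneg (q - r)]

namespace PipeNetwork

variable {V E : Type*} [Fintype V] [DecidableEq V] [Fintype E] (G : PipeNetwork V E)

/-- The difference of the enthalpy errors of a regularized state and of the comparison state. -/
noncomputable def regEnth (P : ℝ → ℝ) (ε : ℝ) (a : E → ℝ) (ρ w : E → ℝ → ℝ → ℝ) (M : E → ℕ) (t Δ θ : ℝ)
    (d' m : E → ℕ → ℝ) (e : E) (x : ℝ) : ℝ :=
  G.enthErr P ε a ρ w M t (G.newDens Δ a M d' m) m e x
    - θ * G.enthErr P ε a ρ w M t (G.cmpDens Δ a M d' ρ w t) (G.nodal M (fluxAt a ρ w t)) e x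

section

variable {G} {P : ℝ → ℝ} {c : Consts} {B ε : ℝ} {a γ : E → ℝ} {hb : V → ℝ → ℝ}
  {ρ w ρt wt : E → ℝ → ℝ → ℝ} {M : E → ℕ} {t t' Δ H CE σ θ lam K : ℝ} {d' m' m : E → ℕ → ℝ} {e : E}
  {i j : ℕ} {q₀ q₁ q₂ : ℝ}

lemma AdmState.abs_flux_le {d : E → ℕ → ℝ} (h : AdmState c M a d m)
    (ha : ∀ e, a e ∈ Icc c.amin c.amax) {k : ℕ} (hk : k < M e) :
    |m e k| ≤ c.W * (c.amax * c.r₁) := by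
  obtain ⟨h1, h2, -⟩ := h e k hk
  have hW := c.W_pos
  have hr := c.r₀_pos
  have haM := c.amax_pos
  refine h2.trans ?_
  have h3 := (ha e).2
  have h4 := h1.2
  have h5 : 0 ≤ d e k := hr.le.trans h1.1
  gcongr

/-- The oscillation of the enthalpy of a discrete state on a cell. -/
lemma AdmState.abs_enth_sub_le {d : E → ℕ → ℝ} (h : AdmState c M a d m)
    (ha : ∀ e, a e ∈ Icc c.amin c.amax) (hε : 0 ≤ ε) (hεm : ε ≤ c.εm) (hM : 0 < M e) (hi : i < M e)
    {x y : ℝ} (hx : x ∈ Ico (i * G.edgeMeshSize M e) ((i + 1) * G.edgeMeshSize M e))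
    (hy : y ∈ Ico (i * G.edgeMeshSize M e) ((i + 1) * G.edgeMeshSize M e)) :
    |enth P ε (G.dens M d e x) (G.vel M a d m e x) - enth P ε (G.dens M d e y) (G.vel M a d m e y)|
      ≤ c.εm ^ 2 * c.W / (c.amin * c.r₀) * |G.interp M m e x - G.interp M m e y| := by
  have ha0 : ∀ e, 0 < a e := fun e => c.amin_pos.trans_le (ha e).1
  have hW := c.W_pos
  have hr := c.r₀_pos
  have ham := c.amin_pos
  obtain ⟨g1, g2, g3⟩ := h.on_Ico ha0 hM hi hx
  obtain ⟨k1, k2, k3⟩ := h.on_Ico ha0 hM hi hy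
  have e1 : G.dens M d e x = G.dens M d e y := by
    rw [dens, dens, pc_eq_of_mem (G.mesh_pos hM) _ hx, pc_eq_of_mem (G.mesh_pos hM) _ hy]
  rw [← g3, ← k3, ← e1]
  set r := G.dens M d e x
  set v := G.vel M a d m e x
  set v' := G.vel M a d m e y
  have e2 : enth P ε r v - enth P ε r v' = ε ^ 2 * ((v + v') / 2 * (v - v')) := by unfold enth; ring
  have e3 : a e * r * v - a e * r * v' = a e * r * (v - v') := by ring
  rw [e2, e3, abs_mul, abs_mul, abs_mul, abs_of_nonneg (sq_nonneg ε),
    abs_of_pos (mul_pos (ha0 e) (hr.trans_le g1.1))]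
  have h1 : |(v + v') / 2| ≤ c.W := by
    rw [abs_le] at *; constructor <;> linarith
  have h2 : c.amin * c.r₀ ≤ a e * r := mul_le_mul (ha e).1 g1.1 hr.le (ha0 e).le
  calc _ ≤ c.εm ^ 2 * (c.W * |v - v'|) := by gcongr
    _ = c.εm ^ 2 * c.W / (c.amin * c.r₀) * (c.amin * c.r₀ * |v - v'|) := by field_simp
    _ ≤ _ := by gcongr

namespace RegSetup

variable (Z : G.RegSetup P c B ε a γ hb ρ w ρt wt M t t' Δ H CE σ d' m' θ lam K m)

include Z

lemma integral_cmpSq_le (e : E) :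
    ∫ x in (0 : ℝ)..G.len e, G.cmpSq Δ a M d' ρ w t e x ≤ K ^ 2 * Δ ^ 2 :=
  (integral_le_tot (G := G) (fun e x => by unfold cmpSq; positivity) e).trans Z.cmp

lemma integral_cmpAccSq_le (e : E) :
    ∫ x in (0 : ℝ)..G.len e, G.cmpAccSq ε Δ a M d' m' ρ w wt t e x ≤ K ^ 2 * Δ ^ 2 :=
  (integral_le_tot (G := G) (fun e x => by unfold cmpAccSq; positivity) e).trans Z.acc

lemma abs_nodal_sub_le {x y : ℝ} (hi : i < M e)
    (hx : x ∈ Ico (i * G.edgeMeshSize M e) ((i + 1) * G.edgeMeshSize M e))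
    (hy : y ∈ Ico (i * G.edgeMeshSize M e) ((i + 1) * G.edgeMeshSize M e)) :
    |G.interp M (G.nodal M (fluxAt a ρ w t)) e x - G.interp M (G.nodal M (fluxAt a ρ w t)) e y|
      ≤ c.amax * B * √(G.len e) * √(G.edgeMeshSize M e) := by
  have hh := G.mesh_pos (Z.S.hM e)
  have hB := Z.hB
  have haM := c.amax_pos
  rw [interp, interp, lin_eq_of_mem hh _ (Ico_subset_Icc_self hx),
    lin_eq_of_mem hh _ (Ico_subset_Icc_self hy)]
  have e1 : ∀ p s : ℝ, p + s * (x - i * G.edgeMeshSize M e) - (p + s * (y - i * G.edgeMeshSize M e))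
      = s * (x - y) := by intros; ring
  rw [e1, abs_mul]
  have h1 : |x - y| ≤ G.edgeMeshSize M e :=
    abs_le.2 ⟨by linarith [hx.1, hy.2], by linarith [hx.2, hy.1]⟩
  have h2 : G.edgeMeshSize M e ≤ √(G.len e) * √(G.edgeMeshSize M e) := by
    have h3 : G.edgeMeshSize M e ≤ G.len e := by
      have := G.mesh_mul (Z.S.hM e)
      have h4 : (1 : ℝ) ≤ M e := by exact_mod_cast Z.S.hM e
      nlinarith
    calc G.edgeMeshSize M e = √(G.edgeMeshSize M e) * √(G.edgeMeshSize M e) :=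
          (Real.mul_self_sqrt hh.le).symm
      _ ≤ _ := by gcongr
  have h3 := (Z.S.X.abs_slopes_nodal_le hB (Z.S.hM e) Z.S.ht hi).trans
    (mul_le_mul_of_nonneg_right (Z.S.X.a_mem e).2 hB.le)
  rw [mul_assoc (c.amax * B)]
  exact mul_le_mul h3 (h1.trans h2) (abs_nonneg _) (by positivity)

/-- The oscillation of the enthalpy difference on a cell. -/
lemma abs_regEnth_sub_le {x y : ℝ} (hi : i < M e)
    (hx : x ∈ Ico (i * G.edgeMeshSize M e) ((i + 1) * G.edgeMeshSize M e))
    (hy : y ∈ Ico (i * G.edgeMeshSize M e) ((i + 1) * G.edgeMeshSize M e)) :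
    |G.regEnth P ε a ρ w M t Δ θ d' m e x - G.regEnth P ε a ρ w M t Δ θ d' m e y|
      ≤ (c.εm ^ 2 * c.W / (c.amin * c.r₀) * (2 * (c.amax * B * √(G.len e)) + c.amax * K) + 2 * B)
        * √(G.edgeMeshSize M e) := by
  have hB := Z.hB
  have hK := Z.hK
  have haM := c.amax_pos
  have ham := c.amin_pos
  have hr₀ := c.r₀_pos
  have hW := c.W_pos
  have hh := G.mesh_pos (Z.S.hM e)
  have X := Z.S.X
  have hsub := cell_subset hh (G.mesh_mul (Z.S.hM e)) hi
  have hx' := hsub (Ico_subset_Icc_self hx)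
  have hy' := hsub (Ico_subset_Icc_self hy)
  have hxy : √(|x - y|) ≤ √(G.edgeMeshSize M e) := by
    gcongr
    exact abs_le.2 ⟨by linarith [hx.1, hy.2], by linarith [hx.2, hy.1]⟩
  set Q := c.εm ^ 2 * c.W / (c.amin * c.r₀) with hQ
  have hQ0 : 0 ≤ Q := by positivity
  set s := √(G.edgeMeshSize M e)
  have h1 := Z.abs_nodal_sub_le hi hx hy
  have h2 := Z.flux_holder hx' hy'
  have h2' : c.amax * K * √(|x - y|) ≤ c.amax * K * s := by gcongr
  have h3 : |G.interp M m e x - G.interp M m e y| ≤ (c.amax * B * √(G.len e) + c.amax * K) * s := by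
    rw [interp_sub, interp_sub] at h2
    rw [abs_le] at *
    constructor <;> linarith [h1.1, h1.2, h2.1, h2.2]
  have h4 := Z.R.adm.abs_enth_sub_le (P := P) X.a_mem X.ε_nonneg X.ε_le (Z.S.hM e) hi hx hy
  have h5 := (Z.S.cmp_strict hB).admState.abs_enth_sub_le (P := P) X.a_mem X.ε_nonneg X.ε_le
    (Z.S.hM e) hi hx hy
  have h6 := (X.prim_h e t Z.S.ht).holder hB.le (X.bound_h e t Z.S.ht) hx' hy'
  have h6' : B * √(|x - y|) ≤ B * s := by gcongr
  have h4' := h4.trans (mul_le_mul_of_nonneg_left h3 hQ0)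
  have h5' := h5.trans (mul_le_mul_of_nonneg_left h1 hQ0)
  have e1 : ∀ x, enthalpyAt P ε ρ w t e x = enth P ε (ρ e t x) (w e t x) := fun _ => rfl
  rw [e1, e1] at h6
  have h0 := Z.R.θ_mem
  set A1 := enth P ε (G.dens M (G.newDens Δ a M d' m) e x) (G.vel M a (G.newDens Δ a M d' m) m e x)
    - enth P ε (G.dens M (G.newDens Δ a M d' m) e y) (G.vel M a (G.newDens Δ a M d' m) m e y) with hA1
  set A2 := enth P ε (G.dens M (G.newDens Δ a M d' (G.nodal M (fluxAt a ρ w t))) e x)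
      (G.vel M a (G.newDens Δ a M d' (G.nodal M (fluxAt a ρ w t))) (G.nodal M (fluxAt a ρ w t)) e x)
    - enth P ε (G.dens M (G.newDens Δ a M d' (G.nodal M (fluxAt a ρ w t))) e y)
      (G.vel M a (G.newDens Δ a M d' (G.nodal M (fluxAt a ρ w t))) (G.nodal M (fluxAt a ρ w t)) e y)
    with hA2
  set A3 := enth P ε (ρ e t x) (w e t x) - enth P ε (ρ e t y) (w e t y) with hA3
  have e2 : G.regEnth P ε a ρ w M t Δ θ d' m e x - G.regEnth P ε a ρ w M t Δ θ d' m e y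
      = A1 - θ * A2 - (1 - θ) * A3 := by
    rw [hA1, hA2, hA3]
    unfold regEnth enthErr
    ring
  rw [e2]
  have b1 : |θ * A2| ≤ |A2| := by
    rw [abs_mul, abs_of_nonneg h0.1]; exact mul_le_of_le_one_left (abs_nonneg _) h0.2
  have b2 : |(1 - θ) * A3| ≤ |A3| := by
    rw [abs_mul, abs_of_nonneg (sub_nonneg.2 h0.2)]
    exact mul_le_of_le_one_left (abs_nonneg _) (by linarith [h0.1])
  have b3 := abs_sub (A1 - θ * A2) ((1 - θ) * A3)
  have b4 := abs_sub A1 (θ * A2)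
  have b5 : 0 ≤ B * s := by positivity
  linarith

lemma bdd_regEnth (e : E) : Bdd (G.len e) (G.regEnth P ε a ρ w M t Δ θ d' m e) :=
  (Z.S.bdd_enthErr _ _ e).sub ((Z.S.bdd_enthErr _ _ e).cmul θ)

lemma integral_regEnth_sq_le (hPB : PressureBounds P c.r₀ c.r₁ c.W c.εm q₀ q₁ q₂) (e : E) :
    ∫ x in (0 : ℝ)..G.len e, |G.regEnth P ε a ρ w M t Δ θ d' m e x| ^ 2
      ≤ 4 * (q₁ ^ 2 + (c.εm * c.W) ^ 2) * (2 + c.εm ^ 2) * K ^ 2 * Δ ^ 2 := by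
  have X := Z.S.X
  have hh := G.mesh_pos (Z.S.hM e)
  have hl := (G.len_pos e).le
  have ht := Z.S.ht
  have hadm := (Z.S.cmp_strict Z.hB).admState
  set q := 2 * (q₁ ^ 2 + (c.εm * c.W) ^ 2) with hq
  have hq0 : 0 ≤ q := by positivity
  have iD := Z.itg_regDist e
  have iC : Itg (G.len e) (G.cmpSq Δ a M d' ρ w t e) := (Z.S.bdd_cmpSq e).itg
  calc _ ≤ ∫ x in (0 : ℝ)..G.len e, 2 * q * (G.regDist ε a ρ w M t Δ d' m e x
        + (1 + c.εm ^ 2) * G.cmpSq Δ a M d' ρ w t e x) := by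
        refine integral_mono_pipe hl ((Z.bdd_regEnth e).abs.pow 2).itg
          ((iD.add (iC.cmul (1 + c.εm ^ 2))).cmul (2 * q)) ?_
        filter_upwards [Z.R.adm.ae X.a_pos (Z.S.hM e), hadm.ae X.a_pos (Z.S.hM e),
          ae_mem_pipe (G.len e)] with x g k hx
        have hx' := Ioo_subset_Icc_self hx
        have h1 := sq_enth_sub_le hPB X.ε_nonneg X.ε_le g.1 k.1 g.2.1 k.2.1
        have h2 := sq_enth_sub_le hPB X.ε_nonneg X.ε_le k.1 (X.mem_J ht x hx') k.2.1
          (X.abs_w_le_W ht x hx')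
        have h0 := Z.R.θ_mem
        rw [sq_abs]
        unfold regEnth enthErr
        set A := enth P ε (G.dens M (G.newDens Δ a M d' m) e x) (G.vel M a (G.newDens Δ a M d' m) m e x)
        set A2 := enth P ε (G.dens M (G.cmpDens Δ a M d' ρ w t) e x)
          (G.vel M a (G.cmpDens Δ a M d' ρ w t) (G.nodal M (fluxAt a ρ w t)) e x)
        set A3 := enth P ε (ρ e t x) (w e t x)
        have e1 : (A - A3 - θ * (A2 - A3)) ^ 2 ≤ 2 * ((A - A2) ^ 2 + (A2 - A3) ^ 2) := by
          have i1 : ((1 - θ) * (A2 - A3)) ^ 2 ≤ (A2 - A3) ^ 2 := by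
            rw [mul_pow]
            have : (1 - θ) ^ 2 ≤ 1 := by nlinarith [h0.1, h0.2]
            exact mul_le_of_le_one_left (sq_nonneg _) this
          nlinarith [sq_nonneg ((A - A2) - (1 - θ) * (A2 - A3))]
        have h3 : distSq ε (G.dens M (G.newDens Δ a M d' m) e x)
            (G.vel M a (G.newDens Δ a M d' m) m e x) (G.dens M (G.cmpDens Δ a M d' ρ w t) e x)
            (G.vel M a (G.cmpDens Δ a M d' ρ w t) (G.nodal M (fluxAt a ρ w t)) e x)
            ≤ G.regDist ε a ρ w M t Δ d' m e x := by
          unfold regDist stateDist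
          exact le_add_of_nonneg_right (mul_nonneg Z.S.hΔ.le (dissDensity_nonneg _ _))
        have h4 : distSq ε (G.dens M (G.cmpDens Δ a M d' ρ w t) e x)
            (G.vel M a (G.cmpDens Δ a M d' ρ w t) (G.nodal M (fluxAt a ρ w t)) e x) (ρ e t x) (w e t x)
            ≤ (1 + c.εm ^ 2) * G.cmpSq Δ a M d' ρ w t e x := by
          unfold distSq cmpSq cmpVel
          have i1 : ε ^ 2 ≤ c.εm ^ 2 := by
            have := X.ε_nonneg
            have := X.ε_le
            gcongr
          set D1 := (G.dens M (G.cmpDens Δ a M d' ρ w t) e x - ρ e t x) ^ 2 with hD1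
          set D2 := (G.vel M a (G.cmpDens Δ a M d' ρ w t) (G.nodal M (fluxAt a ρ w t)) e x
            - w e t x) ^ 2 with hD2
          have n1 : 0 ≤ D1 := by rw [hD1]; positivity
          have n2 : 0 ≤ D2 := by rw [hD2]; positivity
          have := mul_le_mul_of_nonneg_right i1 n2
          have := mul_nonneg (sq_nonneg c.εm) n1
          linarith
        have h5 := mul_le_mul_of_nonneg_left h3 hq0
        have h6 := mul_le_mul_of_nonneg_left h4 hq0
        linarith
    _ = 2 * q * ((∫ x in (0 : ℝ)..G.len e, G.regDist ε a ρ w M t Δ d' m e x)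
        + (1 + c.εm ^ 2) * ∫ x in (0 : ℝ)..G.len e, G.cmpSq Δ a M d' ρ w t e x) := by
        rw [intervalIntegral.integral_const_mul, intervalIntegral.integral_add
          ((intervalIntegrable_pipe hl).2 iD) ((intervalIntegrable_pipe hl).2 (iC.cmul _)),
          intervalIntegral.integral_const_mul]
    _ ≤ 2 * q * (K ^ 2 * Δ ^ 2 + (1 + c.εm ^ 2) * (K ^ 2 * Δ ^ 2)) := by
        have := Z.integral_regDist_le e
        have := Z.integral_cmpSq_le e
        gcongr
    _ = _ := by rw [hq]; ring

lemma integral_resid_sq_le (e : E) :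
    ∫ x in (0 : ℝ)..G.len e, (G.resid ε Δ a γ w wt M t d' m' (G.newDens Δ a M d' m) m e x
      - θ * G.resid ε Δ a γ w wt M t d' m' (G.cmpDens Δ a M d' ρ w t)
          (G.nodal M (fluxAt a ρ w t)) e x) ^ 2
      ≤ 3 * (2 * c.εm ^ 2 * K ^ 2 + (4 * c.γmax * c.W ^ 2) ^ 2 * G.len e) * Δ ^ 2 := by
  have X := Z.S.X
  have hl := (G.len_pos e).le
  have ht := Z.S.ht
  have hΔ := Z.S.hΔ
  have hW := c.W_pos
  have hadm := (Z.S.cmp_strict Z.hB).admState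
  have iD := Z.itg_regDist e
  have iA := Z.S.itg_cmpAccSq e
  have i0 := ((Z.S.sq_resid (G.newDens Δ a M d' m) m e).sub
    ((Z.S.sq_resid (G.cmpDens Δ a M d' ρ w t) (G.nodal M (fluxAt a ρ w t)) e).cmul θ)).sq
  set Kf := (4 * c.γmax * c.W ^ 2) ^ 2 with hKf
  have i1 := ((iD.cmul (c.εm ^ 2)).add (iA.cmul (c.εm ^ 2)))
  have iC : Itg (G.len e) (fun _ => Kf * Δ ^ 2) := (Bdd.const _).itg
  calc _ ≤ ∫ x in (0 : ℝ)..G.len e, 3 * (c.εm ^ 2 * G.regDist ε a ρ w M t Δ d' m e x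
        + c.εm ^ 2 * G.cmpAccSq ε Δ a M d' m' ρ w wt t e x + Kf * Δ ^ 2) := by
        refine integral_mono_pipe hl i0 ((i1.add iC).cmul 3) ?_
        filter_upwards [Z.R.adm.ae X.a_pos (Z.S.hM e), hadm.ae X.a_pos (Z.S.hM e),
          ae_mem_pipe (G.len e)] with x g k hx
        have hw := X.abs_w_le_W ht x (Ioo_subset_Icc_self hx)
        have hγ0 : 0 ≤ γ e := c.γmin_pos.le.trans (X.γ_mem e).1
        have key := sq_residual_le X.ε_nonneg X.ε_le hγ0 (X.γ_mem e).2 hΔ.le hW.le Z.R.θ_mem g.2.1 k.2.1 hw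
          (G.cmpVel Δ a M d' ρ w t e x - G.vel M a d' m' e x - Δ * wt e t x)
        have j1 : ε ^ 2 * (G.vel M a (G.newDens Δ a M d' m) m e x - G.cmpVel Δ a M d' ρ w t e x) ^ 2
            ≤ G.regDist ε a ρ w M t Δ d' m e x := by
          unfold regDist stateDist distSq
          have := mul_nonneg hΔ.le (dissDensity_nonneg (G.vel M a (G.newDens Δ a M d' m) m e x)
            (G.cmpVel Δ a M d' ρ w t e x))
          have := sq_nonneg (G.dens M (G.newDens Δ a M d' m) e x
            - G.dens M (G.cmpDens Δ a M d' ρ w t) e x)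
          linarith
        have j2 := mul_le_mul_of_nonneg_left j1 (sq_nonneg c.εm)
        refine le_trans (le_of_eq ?_) (key.trans ?_)
        · unfold resid
          ring
        · unfold cmpAccSq
          linarith
    _ = 3 * (c.εm ^ 2 * (∫ x in (0 : ℝ)..G.len e, G.regDist ε a ρ w M t Δ d' m e x)
        + c.εm ^ 2 * (∫ x in (0 : ℝ)..G.len e, G.cmpAccSq ε Δ a M d' m' ρ w wt t e x)
        + Kf * Δ ^ 2 * G.len e) := by
        have l1 := (intervalIntegrable_pipe hl).2 (iD.cmul (c.εm ^ 2))
        have l2 := (intervalIntegrable_pipe hl).2 (iA.cmul (c.εm ^ 2))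
        rw [intervalIntegral.integral_const_mul, intervalIntegral.integral_add
          (l1.add l2) ((intervalIntegrable_pipe hl).2 iC), intervalIntegral.integral_add l1 l2,
          intervalIntegral.integral_const_mul, intervalIntegral.integral_const_mul,
          intervalIntegral.integral_const, sub_zero, smul_eq_mul]
        ring
    _ ≤ 3 * (c.εm ^ 2 * (K ^ 2 * Δ ^ 2) + c.εm ^ 2 * (K ^ 2 * Δ ^ 2) + Kf * Δ ^ 2 * G.len e) := by
        have := Z.integral_regDist_le e
        have := Z.integral_cmpAccSq_le e
        gcongr
    _ = _ := by ring

/-- The differences of the cell averages of the enthalpy difference. -/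
lemma abs_average_regEnth_sub_le (hji : j < i) (hi : i < M e) :
    |(∫ x in (j * G.edgeMeshSize M e)..((j + 1) * G.edgeMeshSize M e),
        G.regEnth P ε a ρ w M t Δ θ d' m e x) / G.edgeMeshSize M e
      - (∫ x in (i * G.edgeMeshSize M e)..((i + 1) * G.edgeMeshSize M e),
        G.regEnth P ε a ρ w M t Δ θ d' m e x) / G.edgeMeshSize M e|
      ≤ (√(3 * (2 * c.εm ^ 2 * K ^ 2 + (4 * c.γmax * c.W ^ 2) ^ 2 * G.len e))
          + 2 * (c.W * (c.amax * c.r₁)) * √(G.len e))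
        * √(((i : ℝ) + 1) * G.edgeMeshSize M e - j * G.edgeMeshSize M e) := by
  have X := Z.S.X
  have hM := Z.S.hM
  have hh := G.mesh_pos (hM e)
  have hm := G.mesh_mul (hM e)
  have hΔ := Z.S.hΔ
  have h0 := Z.R.θ_mem
  set m₂ := G.nodal M (fluxAt a ρ w t)
  set U := c.W * (c.amax * c.r₁) with hU
  have hU0 : 0 ≤ U := by
    have := c.W_pos; have := c.amax_pos; have := c.r₁_pos; positivity
  set h := G.edgeMeshSize M e with hhd
  have hij : (j : ℝ) + 1 ≤ i := by exact_mod_cast hji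
  have him : (i : ℝ) + 1 ≤ M e := by exact_mod_cast hi
  have hadm := (Z.S.cmp_strict Z.hB).admState
  have hcell := fun k (hk : k < M e) => And.intro (cell_subset hh hm hk (left_mem_cell hh k))
    (cell_subset hh hm hk (right_mem_cell hh k))
  set g := fun x => G.resid ε Δ a γ w wt M t d' m' (G.newDens Δ a M d' m) m e x
      - θ * G.resid ε Δ a γ w wt M t d' m' (G.cmpDens Δ a M d' ρ w t) m₂ e x with hg
  have sg : Sq (G.len e) g := (Z.S.sq_resid _ _ e).sub ((Z.S.sq_resid _ _ e).cmul θ)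
  have key : Δ * ((∫ x in (j * h)..((j + 1) * h), G.regEnth P ε a ρ w M t Δ θ d' m e x) / h
      - (∫ x in (i * h)..((i + 1) * h), G.regEnth P ε a ρ w M t Δ θ d' m e x) / h)
      = (∫ x in (0 : ℝ)..G.len e, g x * lin h (trapezoid j i) x)
        + θ * lam * nodePair M (fun e i => m e i - m₂ e i) (localTest e j i) := by
    have h1 := Z.R.eqn _ (conservative_localTest (j := j) hM hi)
    rw [Z.S.stepForm_localTest _ _ hji hi, Z.S.stepForm_localTest _ _ hji hi] at h1
    have b1 := (Z.S.bdd_enthErr (G.newDens Δ a M d' m) m e).itg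
    have b2 := ((Z.S.bdd_enthErr (G.cmpDens Δ a M d' ρ w t) m₂ e).cmul θ).itg
    have sp : ∀ k < M e, ∫ x in (k * h)..((k + 1) * h), G.regEnth P ε a ρ w M t Δ θ d' m e x
        = (∫ x in (k * h)..((k + 1) * h), G.enthErr P ε a ρ w M t (G.newDens Δ a M d' m) m e x)
          - θ * ∫ x in (k * h)..((k + 1) * h),
            G.enthErr P ε a ρ w M t (G.cmpDens Δ a M d' ρ w t) m₂ e x := by
      intro k hk
      rw [← intervalIntegral.integral_const_mul, ← intervalIntegral.integral_sub
        (b1.ii_of_mem (hcell k hk).1 (hcell k hk).2) (b2.ii_of_mem (hcell k hk).1 (hcell k hk).2)]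
      rfl
    have sg2 : ∫ x in (0 : ℝ)..G.len e, g x * lin h (trapezoid j i) x
        = (∫ x in (0 : ℝ)..G.len e, G.resid ε Δ a γ w wt M t d' m' (G.newDens Δ a M d' m) m e x
            * lin h (trapezoid j i) x)
          - θ * ∫ x in (0 : ℝ)..G.len e, G.resid ε Δ a γ w wt M t d' m' (G.cmpDens Δ a M d' ρ w t) m₂ e x
            * lin h (trapezoid j i) x := by
      have bl := (isPrimitive_lin hh hm (trapezoid j i)).bdd.sq
      have c1 := (intervalIntegrable_pipe (G.len_pos e).le).2
        ((Z.S.sq_resid (G.newDens Δ a M d' m) m e).mul bl)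
      have c2 := (intervalIntegrable_pipe (G.len_pos e).le).2
        (((Z.S.sq_resid (G.cmpDens Δ a M d' ρ w t) m₂ e).mul bl).cmul θ)
      rw [← intervalIntegral.integral_const_mul, ← intervalIntegral.integral_sub c1 c2]
      congr 1
      funext x
      rw [hg]
      ring
    rw [sp j (hji.trans hi), sp i hi, sg2]
    linear_combination -h1
  have n1 : |nodePair M (fun e i => m e i - m₂ e i) (localTest e j i)| ≤ 2 * U * ((i : ℝ) - j) := by
    refine abs_nodePair_localTest_le hji hi fun k hk => (abs_sub _ _).trans ?_
    have := Z.R.adm.abs_flux_le X.a_mem hk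
    have := hadm.abs_flux_le X.a_mem hk
    linarith
  have n2 := abs_integral_mul_trapezoid_le hh hm hji hi sg
  set L := ((i : ℝ) + 1) * h - j * h with hL
  have hL0 : 0 ≤ L := by rw [hL]; nlinarith
  have hLl : L ≤ G.len e := by
    rw [hL, ← hm]
    have : 0 ≤ (j : ℝ) * h := by positivity
    nlinarith
  set KR := 3 * (2 * c.εm ^ 2 * K ^ 2 + (4 * c.γmax * c.W ^ 2) ^ 2 * G.len e) with hKR
  have n3 : |∫ x in (0 : ℝ)..G.len e, g x * lin h (trapezoid j i) x| ≤ Δ * (√KR * √L) := by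
    refine n2.trans ?_
    have hI : L * ∫ x in (0 : ℝ)..G.len e, g x ^ 2 ≤ Δ ^ 2 * (KR * L) := by
      have := mul_le_mul_of_nonneg_left (Z.integral_resid_sq_le e) hL0
      linarith
    have hKR0 : 0 ≤ KR := by have := (G.len_pos e).le; positivity
    calc _ ≤ √(Δ ^ 2 * (KR * L)) := Real.sqrt_le_sqrt hI
      _ = _ := by rw [Real.sqrt_mul (sq_nonneg Δ), Real.sqrt_sq hΔ.le, Real.sqrt_mul hKR0]
  have n4 : |θ * lam * nodePair M (fun e i => m e i - m₂ e i) (localTest e j i)|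
      ≤ Δ * (2 * U * √(G.len e) * √L) := by
    rw [abs_mul, abs_mul, abs_of_nonneg h0.1, abs_of_nonneg Z.R.lam_nonneg]
    have j1 : θ * lam ≤ Δ * h :=
      (mul_le_of_le_one_left Z.R.lam_nonneg h0.2).trans (Z.lam_le e)
    have j2 : ((i : ℝ) - j) * h ≤ √(G.len e) * √L := by
      calc _ ≤ L := by rw [hL]; nlinarith
        _ = √L * √L := (Real.mul_self_sqrt hL0).symm
        _ ≤ _ := by gcongr
    have j3 : 0 ≤ 2 * U * ((i : ℝ) - j) := mul_nonneg (by linarith) (by linarith)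
    calc _ ≤ Δ * h * (2 * U * ((i : ℝ) - j)) :=
          mul_le_mul j1 n1 (abs_nonneg _) (by positivity)
      _ = Δ * (2 * U * (((i : ℝ) - j) * h)) := by ring
      _ ≤ Δ * (2 * U * (√(G.len e) * √L)) := by gcongr
      _ = _ := by ring
  have n5 := abs_add_le (∫ x in (0 : ℝ)..G.len e, g x * lin h (trapezoid j i) x)
    (θ * lam * nodePair M (fun e i => m e i - m₂ e i) (localTest e j i))
  rw [← key, abs_mul, abs_of_pos hΔ] at n5
  refine le_of_mul_le_mul_left (n5.trans ?_) hΔ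
  linarith

end RegSetup

end

/-! ### Strict admissibility of regularized states -/

lemma exists_regSetup {P : ℝ → ℝ} {c : Consts} {B CE c₂ q₀ q₁ q₂ : ℝ} (hB : 0 < B) (hCE : 0 < CE)
    (hPB : PressureBounds P c.r₀ c.r₁ c.W c.εm q₀ q₁ q₂) :
    ∃ K δ : ℝ, 0 < K ∧ 0 < δ ∧ ∀ (ε : ℝ) (a γ : E → ℝ) (hb : V → ℝ → ℝ)
      (ρ w ρt wt : E → ℝ → ℝ → ℝ) (M : E → ℕ) (t t' Δ H σ θ lam : ℝ) (d' m' m : E → ℕ → ℝ),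
      G.StepSetup P c B ε a γ hb ρ w ρt wt M t t' Δ H CE σ d' m' → Δ ≤ δ → 0 ≤ H → H ≤ c₂ * Δ →
      G.IsRegState P c ε a γ hb ρ w M t Δ d' m' θ lam m →
      (∀ e, lam ≤ Δ * G.edgeMeshSize M e) →
      G.RegSetup P c B ε a γ hb ρ w ρt wt M t t' Δ H CE σ d' m' θ lam K m := by
  obtain ⟨C1, δ, hC1, hδ, h1⟩ := G.exists_regDist_bound hB hCE hPB
  obtain ⟨C2, hC2, h2⟩ := G.exists_cmp_bound (P := P) c hB hCE
  set K := √((C1 + C2) * (1 + c₂ ^ 2)) with hK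
  have hpos : 0 < (C1 + C2) * (1 + c₂ ^ 2) := by positivity
  refine ⟨K, δ, Real.sqrt_pos.2 hpos, hδ, ?_⟩
  intro ε a γ hb ρ w ρt wt M t t' Δ H σ θ lam d' m' m S hΔ hH0 hH R hlam
  have h3 := h1 _ _ _ _ _ _ _ _ _ _ _ _ _ _ _ _ _ _ _ S hΔ R
  obtain ⟨h4, h5⟩ := h2 _ _ _ _ _ _ _ _ _ _ _ _ _ _ _ _ S
  have h6 : Δ ^ 2 + H ^ 2 ≤ (1 + c₂ ^ 2) * Δ ^ 2 := by
    have : H ^ 2 ≤ (c₂ * Δ) ^ 2 := by gcongr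
    linarith
  have e1 : K ^ 2 * Δ ^ 2 = C1 * ((1 + c₂ ^ 2) * Δ ^ 2) + C2 * ((1 + c₂ ^ 2) * Δ ^ 2) := by
    rw [hK, Real.sq_sqrt hpos.le]; ring
  have h7 : 0 ≤ (1 + c₂ ^ 2) * Δ ^ 2 := by positivity
  have h8 := mul_le_mul_of_nonneg_left h6 hC1.le
  have h9 := mul_le_mul_of_nonneg_left h6 hC2.le
  have := mul_nonneg hC1.le h7
  have := mul_nonneg hC2.le h7
  exact ⟨S, R, hB, Real.sqrt_pos.2 hpos, by linarith, by linarith, by linarith, hlam⟩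

lemma exists_sup_bounds {P : ℝ → ℝ} {c : Consts} {B CE c₂ K κ q₀ q₁ q₂ : ℝ} (hB : 0 < B)
    (hc₂ : 0 < c₂) (hK : 0 < K) (hκ : 0 < κ)
    (hPB : PressureBounds P c.r₀ c.r₁ c.W c.εm q₀ q₁ q₂) :
    ∃ δ : ℝ, 0 < δ ∧ ∀ (ε : ℝ) (a γ : E → ℝ) (hb : V → ℝ → ℝ)
      (ρ w ρt wt : E → ℝ → ℝ → ℝ) (M : E → ℕ) (t t' Δ H σ θ lam : ℝ) (d' m' m : E → ℕ → ℝ),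
      G.RegSetup P c B ε a γ hb ρ w ρt wt M t t' Δ H CE σ d' m' θ lam K m → Δ ≤ δ → H ≤ c₂ * Δ →
      ∀ e, (∀ x ∈ Icc 0 (G.len e),
          |G.interp M (fun e i => m e i - G.nodal M (fluxAt a ρ w t) e i) e x| ≤ κ) ∧
        ∀ x ∈ Ioo 0 (G.len e), |G.regEnth P ε a ρ w M t Δ θ d' m e x| ≤ κ := by
  have haM := c.amax_pos
  have ham := c.amin_pos
  have hr₀ := c.r₀_pos
  have hr₁ := c.r₁_pos
  have hW := c.W_pos
  have hγ := c.γmax_pos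
  have hq₁ := hPB.q₁_pos
  let K1 : E → ℝ := fun e =>
    c.εm ^ 2 * c.W / (c.amin * c.r₀) * (2 * (c.amax * B * √(G.len e)) + c.amax * K) + 2 * B
  let K2 : E → ℝ := fun e => √(3 * (2 * c.εm ^ 2 * K ^ 2 + (4 * c.γmax * c.W ^ 2) ^ 2 * G.len e))
    + 2 * (c.W * (c.amax * c.r₁)) * √(G.len e)
  have hK1 : ∀ e, 0 < K1 e := fun e => by
    have := (G.len_pos e)
    positivity
  have hK2 : ∀ e, 0 ≤ K2 e := fun e => by positivity
  set Q3 := 4 * c.amax ^ 3 * (c.r₁ ^ 3 + c.W ^ 3 * c.r₁) * K ^ 2 with hQ3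
  set Q2 := 4 * (q₁ ^ 2 + (c.εm * c.W) ^ 2) * (2 + c.εm ^ 2) * K ^ 2 with hQ2
  have hQ3p : 0 < Q3 := by positivity
  have hQ2p : 0 < Q2 := by positivity
  choose η₁ hη₁ f₁ using fun e => exists_sup_small 3 (G.len_pos e) (mul_pos haM hK) hκ
  choose η₂ hη₂ f₂ using fun e =>
    exists_sup_small 2 (G.len_pos e) (mul_pos three_pos (add_pos_of_pos_of_nonneg (hK1 e) (hK2 e))) hκ
  obtain ⟨η, hη, hle⟩ := exists_pos_forall_le (E := E) (η := fun e => min (η₁ e) (η₂ e))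
    (fun e => lt_min (hη₁ e) (hη₂ e))
  refine ⟨min (η / Q3) (min (η / Q2) (η / (2 * c₂))), by positivity, ?_⟩
  intro ε a γ hb ρ w ρt wt M t t' Δ H σ θ lam d' m' m Z hΔδ hH e
  have hΔ := Z.S.hΔ
  have hΔ1 := Z.S.hΔ1
  have hM := Z.S.hM
  have hh := G.mesh_pos (hM e)
  have hm := G.mesh_mul (hM e)
  have hl := G.len_pos e
  have d1 : Q3 * Δ ≤ η := by
    have := (le_div_iff₀ hQ3p).1 (hΔδ.trans (min_le_left _ _))
    linarith
  have d2 : Q2 * Δ ^ 2 ≤ η := by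
    have := (le_div_iff₀ hQ2p).1 (hΔδ.trans ((min_le_right _ _).trans (min_le_left _ _)))
    have h2 : Δ ^ 2 ≤ Δ := by nlinarith
    have := mul_le_mul_of_nonneg_left h2 hQ2p.le
    linarith
  have d3 : 2 * G.edgeMeshSize M e ≤ η := by
    have := (le_div_iff₀ (by positivity)).1 (hΔδ.trans ((min_le_right _ _).trans (min_le_right _ _)))
    have := Z.S.hH e
    linarith
  have l1 : η ≤ η₁ e := (hle e).trans (min_le_left _ _)
  have l2 : η ≤ η₂ e := (hle e).trans (min_le_right _ _)
  constructor
  · have bI := bdd_interp (G := G) (hM e) (fun e i => m e i - G.nodal M (fluxAt a ρ w t) e i)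
    have h1 := f₁ e (G.interp M (fun e i => m e i - G.nodal M (fluxAt a ρ w t) e i) e) 0 le_rfl
      (hη₁ e).le (fun x hx y hy => by
        rw [add_zero]
        exact Z.flux_holder (Ioo_subset_Icc_self hx) (Ioo_subset_Icc_self hy))
      ((intervalIntegrable_pipe hl.le).2 (bI.abs.pow 3).itg)
      ((Z.integral_flux_cube_le e).trans (d1.trans l1))
    exact le_of_ae_le_Icc hl subset_rfl
      (G.isPrimitive_interp (hM e) _).continuousOn.abs (Filter.Eventually.of_forall h1)
  · have hKe : 0 ≤ K1 e + K2 e := add_nonneg (hK1 e).le (hK2 e)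
    refine f₂ e _ (2 * G.edgeMeshSize M e) (by positivity) (d3.trans l2) ?_
      ((intervalIntegrable_pipe hl.le).2 ((Z.bdd_regEnth e).abs.pow 2).itg)
      ((Z.integral_regEnth_sq_le hPB e).trans (d2.trans l2))
    refine abs_sub_le_of_averages hh hm hKe (Z.bdd_regEnth e).itg ?_ ?_
    · intro i hi x hx y hy
      refine (Z.abs_regEnth_sub_le hi hx hy).trans ?_
      have : K1 e ≤ K1 e + K2 e := le_add_of_nonneg_right (hK2 e)
      gcongr
    · intro i j hji hi
      refine (Z.abs_average_regEnth_sub_le hji hi).trans ?_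
      have : K2 e ≤ K1 e + K2 e := le_add_of_nonneg_left (hK1 e).le
      gcongr

/-- The interpolation error of the exact flux in the supremum norm. -/
lemma Exact.abs_fluxErr_le {G : PipeNetwork V E} {P : ℝ → ℝ} {c : Consts} {B ε : ℝ} {a γ : E → ℝ}
    {hb : V → ℝ → ℝ} {ρ w ρt wt : E → ℝ → ℝ → ℝ} {M : E → ℕ} {t : ℝ}
    (X : G.Exact P c B ε a γ hb ρ w ρt wt) (hB : 0 < B) (ht : t ∈ Icc 0 c.T) {e : E} (hM : 0 < M e)
    {x : ℝ} (hx : x ∈ Icc 0 (G.len e)) :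
    |G.fluxErr M a ρ w t e x| ≤ B * √(G.edgeMeshSize M e) := by
  have hh := G.mesh_pos hM
  have hm := G.mesh_mul hM
  obtain ⟨i, hi, hxi⟩ := exists_mem_cell' hh hm (G.len_pos e) hx
  have key : ∀ y ∈ cell (G.edgeMeshSize M e) i,
      |fluxAt a ρ w t e x - fluxAt a ρ w t e y| ≤ B * √(G.edgeMeshSize M e) := by
    intro y hy
    refine ((X.prim_m e t ht).holder hB.le (X.bound_m e t ht) hx (cell_subset hh hm hi hy)).trans ?_
    gcongr
    exact abs_le.2 ⟨by linarith [hxi.1, hy.2], by linarith [hxi.2, hy.1]⟩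
  refine abs_sub_lin_le hh _ hxi (key _ (left_mem_cell hh i)) ?_
  have := key _ (right_mem_cell hh i)
  rw [nodal]
  push_cast
  exact this

/-- Regularized states are strictly admissible, and solutions of the time step remain close to the
exact solution. -/
lemma exists_reg_strict {P : ℝ → ℝ} {c : Consts} {B q₀ q₁ q₂ : ℝ} (hB : 0 < B)
    (hPB : PressureBounds P c.r₀ c.r₁ c.W c.εm q₀ q₁ q₂) :
    ∃ σ : ℝ, 0 < σ ∧ σ ≤ c.ρmin / 16 ∧ ∀ CE c₂ : ℝ, 0 < CE → 0 < c₂ → ∃ δ : ℝ, 0 < δ ∧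
      ∀ (ε : ℝ) (a γ : E → ℝ) (hb : V → ℝ → ℝ)
      (ρ w ρt wt : E → ℝ → ℝ → ℝ) (M : E → ℕ) (t t' Δ H θ lam : ℝ) (d' m' m : E → ℕ → ℝ),
      G.StepSetup P c B ε a γ hb ρ w ρt wt M t t' Δ H CE σ d' m' → Δ ≤ δ → 0 ≤ H → H ≤ c₂ * Δ →
      G.IsRegState P c ε a γ hb ρ w M t Δ d' m' θ lam m →
      (∀ e, lam ≤ Δ * G.edgeMeshSize M e) →
      StrictAdm c M a (G.newDens Δ a M d' m) m ∧ (θ = 0 →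
        ∀ e, ∀ i < M e, ∀ x ∈ cell (G.edgeMeshSize M e) i,
          |G.newDens Δ a M d' m e i - ρ e t x| ≤ σ) := by
  have hρ := c.ρmin_pos
  have ham := c.amin_pos
  have hw := c.wmax_pos
  obtain ⟨Cs, hCs, hclose⟩ := hPB.exists_density_close c.r₁_pos c.amin_pos c.amax_pos
  set μ := c.ρmin / 8 with hμ
  have hμ0 : 0 < μ := by positivity
  set σ := min (c.ρmin / 16) (μ ^ 2 / (2 * Cs)) with hσ
  have hσ0 : 0 < σ := by positivity
  set κ := min (μ ^ 2 / (2 * Cs)) (min (σ ^ 2 / Cs) (c.amin * c.wmax * c.ρmin / 8)) with hκ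
  have hκ0 : 0 < κ := by positivity
  refine ⟨σ, hσ0, min_le_left _ _, fun CE c₂ hCE hc₂ => ?_⟩
  obtain ⟨K, δ₁, hK, hδ₁, hset⟩ := G.exists_regSetup (c₂ := c₂) hB hCE hPB
  obtain ⟨δ₂, hδ₂, hsup⟩ := G.exists_sup_bounds (CE := CE) hB hc₂ hK hκ0 hPB
  refine ⟨min δ₁ (min δ₂ (min (κ / (2 * B)) (κ ^ 2 / (B ^ 2 * c₂)))), by positivity, ?_⟩
  intro ε a γ hb ρ w ρt wt M t t' Δ H θ lam d' m' m S hΔδ hH0 hH R hlam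
  have hd1 := hΔδ.trans (min_le_left _ _)
  have hd2 := hΔδ.trans ((min_le_right _ _).trans (min_le_left _ _))
  have hd3 := hΔδ.trans ((min_le_right _ _).trans ((min_le_right _ _).trans (min_le_left _ _)))
  have hd4 := hΔδ.trans ((min_le_right _ _).trans ((min_le_right _ _).trans (min_le_right _ _)))
  rw [le_div_iff₀ (by positivity)] at hd3 hd4
  have Z := hset _ _ _ _ _ _ _ _ _ _ _ _ _ _ _ _ _ _ _ S hd1 hH0 hH R hlam
  have hs := hsup _ _ _ _ _ _ _ _ _ _ _ _ _ _ _ _ _ _ _ Z hd2 hH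
  have X := S.X
  have hM := S.hM
  have ht := S.ht
  have hadm := (S.cmp_strict hB).admState
  have hfe : ∀ e, ∀ x ∈ Icc 0 (G.len e), |G.fluxErr M a ρ w t e x| ≤ κ := by
    intro e x hx
    refine (X.abs_fluxErr_le hB ht (hM e) hx).trans (le_of_abs_le (abs_le_of_sq_le_sq ?_ hκ0.le))
    rw [mul_pow, Real.sq_sqrt (G.mesh_pos (hM e)).le]
    have : B ^ 2 * G.edgeMeshSize M e ≤ B ^ 2 * (c₂ * Δ) :=
      mul_le_mul_of_nonneg_left ((S.hH e).trans hH) (by positivity)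
    linarith
  have key : ∀ e, ∀ i < M e, ∀ x ∈ cell (G.edgeMeshSize M e) i,
      (G.newDens Δ a M d' m e i - ρ e t x) ^ 2 ≤ Cs * (κ + θ * σ) := by
    intro e i hi
    have hh := G.mesh_pos (hM e)
    have hlt : (i * G.edgeMeshSize M e : ℝ) < (i + 1) * G.edgeMeshSize M e := by linarith
    have hsub := cell_subset hh (G.mesh_mul (hM e)) hi
    refine le_of_ae_le_Icc hlt (Ioo_cell_subset (hM e) hi) ?_ (Filter.Eventually.of_forall ?_)
    · exact (continuousOn_const.sub ((X.prim_ρ e t ht).continuousOn.mono hsub)).pow 2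
    · intro x hx
      have hx' := hsub (Ioo_subset_Icc_self hx)
      obtain ⟨g1, g2, g3⟩ := R.adm.on_cell X.a_pos (hM e) hi hx
      obtain ⟨k1, k2, k3⟩ := hadm.on_cell X.a_pos (hM e) hi hx
      have e1 : ∀ d : E → ℕ → ℝ, G.dens M d e x = d e i := fun d =>
        pc_eq_of_mem hh _ (Ioo_subset_Ico_self hx)
      have f1 := (hs e).1 x hx'
      rw [interp_sub] at f1
      have f2 := hfe e x hx'
      have e2 : fluxAt a ρ w t e x = a e * ρ e t x * w e t x := rfl
      rw [fluxErr, e2] at f2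
      rw [← e1 (G.newDens Δ a M d' m)]
      refine hclose ε (a e) _ _ _ _ _ _ θ κ σ X.ε_nonneg X.ε_le (X.a_mem e) g1 k1 (X.mem_J ht x hx')
        g2 k2 (X.abs_w_le_W ht x hx') R.θ_mem hκ0.le hσ0.le ?_ ?_ ?_
        ((hs e).2 x (Ioo_cell_subset (hM e) hi hx))
      · rw [e1]
        refine (S.cmp_close hB e i hi x (Ioo_subset_Icc_self hx)).trans ?_
        linarith
      · rw [g3]
        rw [abs_le] at *
        constructor <;> linarith [f1.1, f1.2, f2.1, f2.2]
      · rw [k3, abs_sub_comm]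
        exact f2
  have hCκ1 : Cs * κ ≤ μ ^ 2 / 2 := by
    have : κ ≤ μ ^ 2 / (2 * Cs) := min_le_left _ _
    rw [le_div_iff₀ (by positivity)] at this
    linarith
  have hCκ2 : Cs * κ ≤ σ ^ 2 := by
    have : κ ≤ σ ^ 2 / Cs := (min_le_right _ _).trans (min_le_left _ _)
    rw [le_div_iff₀ hCs] at this
    linarith
  have hCσ : Cs * σ ≤ μ ^ 2 / 2 := by
    have : σ ≤ μ ^ 2 / (2 * Cs) := min_le_right _ _
    rw [le_div_iff₀ (by positivity)] at this
    linarith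
  refine ⟨X.strictAdm_of_close hM ht (fun e i hi x hx => ?_) (fun e i hi => ?_), fun h0 e i hi x hx => ?_⟩
  · refine abs_le_of_sq_le_sq ((key e i hi x hx).trans ?_) hμ0.le
    have : θ * (Cs * σ) ≤ 1 * (Cs * σ) := mul_le_mul_of_nonneg_right R.θ_mem.2 (by positivity)
    rw [hμ] at hCκ1 hCσ
    linarith
  · have hh := G.mesh_pos (hM e)
    have hmem : (i * G.edgeMeshSize M e : ℝ) ∈ Icc 0 (G.len e) := by
      refine ⟨by positivity, ?_⟩
      rw [← G.mesh_mul (hM e)]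
      gcongr
    have := (hs e).1 _ hmem
    rw [interp, lin_grid hh] at this
    exact this.trans ((min_le_right _ _).trans (min_le_right _ _))
  · refine abs_le_of_sq_le_sq ((key e i hi x hx).trans ?_) hσ0.le
    rw [h0]
    linarith

/-! ### Solvability of one time step -/

section

variable {G} {P : ℝ → ℝ} {c : Consts} {ε Δ t lam : ℝ} {a γ : E → ℝ} {hb : V → ℝ → ℝ} {M : E → ℕ}
  {v' : E → ℝ → ℝ} {d' m₂ : E → ℕ → ℝ} {q₀ q₁ q₂ : ℝ}

lemma interp_congr (hM : ∀ e, 0 < M e) {m m₃ : E → ℕ → ℝ} (hm : ∀ e, ∀ i ≤ M e, m e i = m₃ e i)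
    {e : E} {x : ℝ} (hx : x ∈ Icc 0 (G.len e)) : G.interp M m e x = G.interp M m₃ e x := by
  obtain ⟨i, hi, hxi⟩ := exists_mem_cell' (G.mesh_pos (hM e)) (G.mesh_mul (hM e)) (G.len_pos e) hx
  rw [interp, interp, lin_eq_of_mem (G.mesh_pos (hM e)) _ hxi,
    lin_eq_of_mem (G.mesh_pos (hM e)) _ hxi, slopes, slopes, hm e i hi.le, hm e (i + 1) hi]

lemma conservative_interp_congr (hM : ∀ e, 0 < M e) {m m₃ : E → ℕ → ℝ}
    (hm : ∀ e, ∀ i ≤ M e, m e i = m₃ e i) (h : G.Conservative (G.interp M m)) :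
    G.Conservative (G.interp M m₃) :=
  (G.conservative_iff_of_ends (fun e => interp_congr hM hm ⟨le_rfl, (G.len_pos e).le⟩)
    (fun e => interp_congr hM hm ⟨(G.len_pos e).le, le_rfl⟩)).1 h

lemma newDens_congr {m m₃ : E → ℕ → ℝ} (hm : ∀ e, ∀ i ≤ M e, m e i = m₃ e i) {e : E} {i : ℕ}
    (hi : i < M e) : G.newDens Δ a M d' m e i = G.newDens Δ a M d' m₃ e i := by
  rw [newDens, newDens, slopes, slopes, hm e i hi.le, hm e (i + 1) hi]

lemma stepForm_newDens_congr (hM : ∀ e, 0 < M e) {m m₃ r r₃ : E → ℕ → ℝ}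
    (hm : ∀ e, ∀ i ≤ M e, m e i = m₃ e i) (hr : ∀ e, ∀ i ≤ M e, r e i = r₃ e i) :
    G.stepForm P ε Δ a γ hb t M v' (G.newDens Δ a M d' m) m r
      = G.stepForm P ε Δ a γ hb t M v' (G.newDens Δ a M d' m₃) m₃ r₃ := by
  unfold stepForm
  congr 1
  · refine tot_congr fun e => ?_
    filter_upwards [ae_mem_cell (G.mesh_pos (hM e)) (G.mesh_mul (hM e)), ae_mem_pipe (G.len e)]
      with x hx hxl
    obtain ⟨i, hi, hx⟩ := hx
    have hx' := Ioo_subset_Ico_self hx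
    have e1 : G.dens M (G.newDens Δ a M d' m) e x = G.dens M (G.newDens Δ a M d' m₃) e x := by
      rw [dens, dens, pc_eq_of_mem (G.mesh_pos (hM e)) _ hx', pc_eq_of_mem (G.mesh_pos (hM e)) _ hx',
        newDens_congr hm hi]
    have e2 : G.slopeFn M r e x = G.slopeFn M r₃ e x := by
      rw [slopeFn, slopeFn, pc_eq_of_mem (G.mesh_pos (hM e)) _ hx',
        pc_eq_of_mem (G.mesh_pos (hM e)) _ hx', slopes, slopes, hr e i hi.le, hr e (i + 1) hi]
    rw [vel, vel, e1, e2, interp_congr hM hm (Ioo_subset_Icc_self hxl),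
      interp_congr hM hr (Ioo_subset_Icc_self hxl)]
  · congr 1
    exact G.bdryTerm_congr (fun e => interp_congr hM hr ⟨le_rfl, (G.len_pos e).le⟩)
      (fun e => interp_congr hM hr ⟨(G.len_pos e).le, le_rfl⟩)

lemma AdmState.abs_nodal_flux_le {d m : E → ℕ → ℝ} (h : AdmState c M a d m)
    (ha : ∀ e, a e ∈ Icc c.amin c.amax) (hM : ∀ e, 0 < M e) {e : E} {k : ℕ} (hk : k ≤ M e) :
    |m e k| ≤ c.W * (c.amax * c.r₁) := by
  rcases hk.lt_or_eq with hk | rfl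
  · exact h.abs_flux_le ha hk
  · obtain ⟨h1, -, h2⟩ := h e (M e - 1) (Nat.sub_lt (hM e) one_pos)
    have e1 : M e - 1 + 1 = M e := Nat.sub_add_cancel (hM e)
    rw [e1] at h2
    have hW := c.W_pos
    have hr := c.r₀_pos
    have haM := c.amax_pos
    refine h2.trans ?_
    have h3 := (ha e).2
    have h4 := h1.2
    have h5 : 0 ≤ d e (M e - 1) := hr.le.trans h1.1
    gcongr

/-- Lipschitz continuity of the form of the time step on the set of admissible states. -/
lemma exists_stepForm_lipschitz (hPB : PressureBounds P c.r₀ c.r₁ c.W c.εm q₀ q₁ q₂)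
    (hε : 0 ≤ ε) (hεm : ε ≤ c.εm) (ha : ∀ e, a e ∈ Icc c.amin c.amax)
    (hγ : ∀ e, γ e ∈ Icc c.γmin c.γmax) (hΔ : 0 < Δ) (hM : ∀ e, 0 < M e)
    (hv : ∀ e, Bdd (G.len e) (v' e)) :
    ∃ L : ℝ, 0 ≤ L ∧ ∀ (m m₃ r : E → ℕ → ℝ) (p q : ℝ), 0 ≤ p → 0 ≤ q →
      AdmState c M a (G.newDens Δ a M d' m) m → AdmState c M a (G.newDens Δ a M d' m₃) m₃ →
      (∀ e, ∀ i ≤ M e, |m e i - m₃ e i| ≤ p) → (∀ e, ∀ i ≤ M e, |r e i| ≤ q) →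
      |G.stepForm P ε Δ a γ hb t M v' (G.newDens Δ a M d' m) m r
        - G.stepForm P ε Δ a γ hb t M v' (G.newDens Δ a M d' m₃) m₃ r| ≤ L * p * q := by
  have ham := c.amin_pos
  have haM := c.amax_pos
  have hr₀ := c.r₀_pos
  have hW := c.W_pos
  have hγM := c.γmax_pos
  have hq₁ := hPB.q₁_pos
  have ha0 : ∀ e, 0 < a e := fun e => ham.trans_le (ha e).1
  obtain ⟨h₀, hh₀, hle⟩ := exists_pos_forall_le (fun e => G.mesh_pos (hM e))
  set Cd := Δ / c.amin * (2 / h₀) with hCd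
  set Cv := (1 + c.amax * c.W * Cd) / (c.amin * c.r₀) with hCv
  have hCd0 : 0 < Cd := by positivity
  have hCv0 : 0 < Cv := by positivity
  set L := c.εm ^ 2 * Cv + Δ * ((q₁ * Cd + c.εm ^ 2 * c.W * Cv) * (2 / h₀))
    + Δ * (c.γmax * (2 * c.W * Cv)) with hL
  have hL0 : 0 < L := by positivity
  have hlen : 0 ≤ ∑ e, G.len e := Finset.sum_nonneg fun e _ => (G.len_pos e).le
  refine ⟨L * ∑ e, G.len e, by positivity, ?_⟩
  intro m m₃ r p q hp hq hadm hadm₃ hmp hrq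
  rw [stepForm_sub hM hv]
  have hslope : ∀ (s : E → ℕ → ℝ) (b : ℝ), 0 ≤ b → (∀ e, ∀ i ≤ M e, |s e i| ≤ b) → ∀ e, ∀ i < M e,
      |slopes (G.edgeMeshSize M e) (s e) i| ≤ 2 / h₀ * b := by
    intro s b hb hs e i hi
    have hh := G.mesh_pos (hM e)
    rw [slopes, abs_div, abs_of_pos hh, div_le_iff₀ hh]
    have h1 := (abs_sub (s e (i + 1)) (s e i)).trans (add_le_add (hs e (i + 1) hi) (hs e i hi.le))
    have h2 : 2 * b = 2 / h₀ * b * h₀ := by field_simp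
    have h3 : 2 / h₀ * b * h₀ ≤ 2 / h₀ * b * G.edgeMeshSize M e :=
      mul_le_mul_of_nonneg_left (hle e) (by positivity)
    linarith
  have key : ∀ e, ∀ x ∈ Ioo 0 (G.len e), (∃ i < M e, x ∈ Ioo (i * G.edgeMeshSize M e)
      ((i + 1) * G.edgeMeshSize M e)) →
      |ε ^ 2 * (G.vel M a (G.newDens Δ a M d' m) m e x - G.vel M a (G.newDens Δ a M d' m₃) m₃ e x)
          * G.interp M r e x
        - Δ * ((enth P ε (G.dens M (G.newDens Δ a M d' m) e x) (G.vel M a (G.newDens Δ a M d' m) m e x)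
          - enth P ε (G.dens M (G.newDens Δ a M d' m₃) e x)
            (G.vel M a (G.newDens Δ a M d' m₃) m₃ e x)) * G.slopeFn M r e x)
        + Δ * (γ e * (|G.vel M a (G.newDens Δ a M d' m) m e x| * G.vel M a (G.newDens Δ a M d' m) m e x
          - |G.vel M a (G.newDens Δ a M d' m₃) m₃ e x| * G.vel M a (G.newDens Δ a M d' m₃) m₃ e x)
            * G.interp M r e x)| ≤ L * p * q := by
    rintro e x - ⟨i, hi, hx⟩
    have hh := G.mesh_pos (hM e)
    have hx' := Ioo_subset_Ico_self hx
    obtain ⟨g1, g2, g3⟩ := hadm.on_cell ha0 (hM e) hi hx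
    obtain ⟨k1, k2, k3⟩ := hadm₃.on_cell ha0 (hM e) hi hx
    have hR : |G.interp M r e x| ≤ q :=
      abs_lin_le hh _ (Ioo_subset_Icc_self hx) (hrq e i hi.le) (hrq e (i + 1) hi)
    have hS : |G.slopeFn M r e x| ≤ 2 / h₀ * q := by
      rw [slopeFn, pc_eq_of_mem hh _ hx']
      exact hslope r q hq hrq e i hi
    have hμ : |G.interp M m e x - G.interp M m₃ e x| ≤ p := by
      rw [← interp_sub]
      exact abs_lin_le hh _ (Ioo_subset_Icc_self hx) (hmp e i hi.le) (hmp e (i + 1) hi)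
    have hD : |G.dens M (G.newDens Δ a M d' m) e x - G.dens M (G.newDens Δ a M d' m₃) e x|
        ≤ Cd * p := by
      rw [dens, dens, pc_eq_of_mem hh _ hx', pc_eq_of_mem hh _ hx']
      have h1 := newDens_sub (G := G) (Δ := Δ) (d' := d') (M := M) ha0 m m₃ e i
      have h2 : G.newDens Δ a M d' m e i - G.newDens Δ a M d' m₃ e i
          = -(Δ / a e * slopes (G.edgeMeshSize M e) (fun i => m e i - m₃ e i) i) := by
        have := (ha0 e).ne'
        field_simp
        linarith
      rw [h2, abs_neg, abs_mul, abs_of_pos (div_pos hΔ (ha0 e))]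
      have h3 := hslope (fun e i => m e i - m₃ e i) p hp hmp e i hi
      have h4 := (ha e).1
      calc _ ≤ Δ / c.amin * (2 / h₀ * p) := by gcongr
        _ = _ := by rw [hCd]; ring
    rw [← g3, ← k3] at hμ
    set R := G.interp M r e x
    set s := G.slopeFn M r e x
    set d := G.dens M (G.newDens Δ a M d' m) e x
    set d₃ := G.dens M (G.newDens Δ a M d' m₃) e x
    set v := G.vel M a (G.newDens Δ a M d' m) m e x
    set v₃ := G.vel M a (G.newDens Δ a M d' m₃) m₃ e x
    have hV : |v - v₃| ≤ Cv * p := by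
      have e1 : a e * d * (v - v₃) = (a e * d * v - a e * d₃ * v₃) - a e * v₃ * (d - d₃) := by ring
      have h1 : c.amin * c.r₀ * |v - v₃| ≤ p + c.amax * c.W * (Cd * p) := by
        have ha1 := ha0 e
        have ha2 := (ha e).2
        calc c.amin * c.r₀ * |v - v₃| ≤ |a e * d * (v - v₃)| := by
              rw [abs_mul, abs_of_pos (mul_pos ha1 (hr₀.trans_le g1.1))]
              have := mul_le_mul (ha e).1 g1.1 hr₀.le ha1.le
              gcongr
          _ ≤ |a e * d * v - a e * d₃ * v₃| + |a e * v₃ * (d - d₃)| := by rw [e1]; exact abs_sub _ _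
          _ ≤ p + c.amax * c.W * (Cd * p) := by
              rw [abs_mul, abs_mul, abs_of_pos ha1]
              gcongr
      rw [hCv, div_mul_eq_mul_div, le_div_iff₀ (by positivity)]
      linarith
    have hH : |enth P ε d v - enth P ε d₃ v₃| ≤ (q₁ * Cd + c.εm ^ 2 * c.W * Cv) * p := by
      refine (hPB.abs_enth_sub_le g1 k1 g2 k2).trans ?_
      calc _ ≤ q₁ * (Cd * p) + c.εm ^ 2 * c.W * (Cv * p) := by gcongr
        _ = _ := by ring
    have hF : |(|v| * v - |v₃| * v₃)| ≤ 2 * c.W * (Cv * p) := by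
      refine (abs_mul_abs_sub_le v v₃).trans ?_
      gcongr
      linarith
    have hγ0 : 0 ≤ γ e := c.γmin_pos.le.trans (hγ e).1
    have hγ1 := (hγ e).2
    have b1 : |ε ^ 2 * (v - v₃) * R| ≤ c.εm ^ 2 * (Cv * p) * q := by
      rw [abs_mul, abs_mul, abs_of_nonneg (sq_nonneg ε)]
      gcongr
    have b2 : |Δ * ((enth P ε d v - enth P ε d₃ v₃) * s)|
        ≤ Δ * ((q₁ * Cd + c.εm ^ 2 * c.W * Cv) * p * (2 / h₀ * q)) := by
      rw [abs_mul, abs_mul, abs_of_pos hΔ]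
      gcongr
    have b3 : |Δ * (γ e * (|v| * v - |v₃| * v₃) * R)| ≤ Δ * (c.γmax * (2 * c.W * (Cv * p)) * q) := by
      rw [abs_mul, abs_mul, abs_mul, abs_of_pos hΔ, abs_of_nonneg hγ0]
      gcongr
    have b4 := abs_add_le (ε ^ 2 * (v - v₃) * R - Δ * ((enth P ε d v - enth P ε d₃ v₃) * s))
      (Δ * (γ e * (|v| * v - |v₃| * v₃) * R))
    have b5 := abs_sub (ε ^ 2 * (v - v₃) * R) (Δ * ((enth P ε d v - enth P ε d₃ v₃) * s))
    refine b4.trans ?_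
    rw [hL]
    linarith
  calc _ ≤ ∑ e, L * p * q * G.len e := by
        unfold tot
        refine (Finset.abs_sum_le_sum_abs _ _).trans (Finset.sum_le_sum fun e _ => ?_)
        have h1 := intervalIntegral.norm_integral_le_of_norm_le_const_ae (a := 0) (b := G.len e)
          (f := fun x => ε ^ 2 * (G.vel M a (G.newDens Δ a M d' m) m e x
            - G.vel M a (G.newDens Δ a M d' m₃) m₃ e x) * G.interp M r e x
          - Δ * ((enth P ε (G.dens M (G.newDens Δ a M d' m) e x)
              (G.vel M a (G.newDens Δ a M d' m) m e x)
            - enth P ε (G.dens M (G.newDens Δ a M d' m₃) e x)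
              (G.vel M a (G.newDens Δ a M d' m₃) m₃ e x)) * G.slopeFn M r e x)
          + Δ * (γ e * (|G.vel M a (G.newDens Δ a M d' m) m e x|
              * G.vel M a (G.newDens Δ a M d' m) m e x
            - |G.vel M a (G.newDens Δ a M d' m₃) m₃ e x| * G.vel M a (G.newDens Δ a M d' m₃) m₃ e x)
              * G.interp M r e x)) (C := L * p * q) (by
            have h2 := (ae_restrict_iff' measurableSet_Ioo).1
              (ae_mem_cell (G.mesh_pos (hM e)) (G.mesh_mul (hM e)))
            have hne : ∀ᵐ r : ℝ, r ≠ G.len e := by simp [ae_iff]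
            filter_upwards [h2, hne] with x hx hn hxm
            rw [uIoc_of_le (G.len_pos e).le] at hxm
            have hx0 : x ∈ Ioo 0 (G.len e) := ⟨hxm.1, lt_of_le_of_ne hxm.2 hn⟩
            exact key e x hx0 (hx hx0))
        rwa [sub_zero, abs_of_pos (G.len_pos e)] at h1
    _ = _ := by rw [← Finset.mul_sum]; ring

end

/-! ### The space of conservative nodal values -/

/-- The grid points of the network, where the grid points of different pipes are distinguished. -/
abbrev GridIdx (M : E → ℕ) : Type _ := Σ e, Fin (M e + 1)

/-- The nodal values given by a vector. -/
noncomputable def extend {M : E → ℕ} (v : EuclideanSpace ℝ (GridIdx M)) (e : E) (i : ℕ) : ℝ :=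
  if h : i < M e + 1 then v ⟨e, ⟨i, h⟩⟩ else 0

/-- The vector of nodal values. -/
noncomputable def truncate (M : E → ℕ) (r : E → ℕ → ℝ) : EuclideanSpace ℝ (GridIdx M) :=
  WithLp.toLp 2 fun j => r j.1 j.2

section

variable {M : E → ℕ}

lemma extend_truncate (r : E → ℕ → ℝ) {e : E} {i : ℕ} (hi : i ≤ M e) :
    extend (truncate M r) e i = r e i := by
  simp [extend, truncate, Nat.lt_succ_of_le hi]

lemma extend_add (x y : EuclideanSpace ℝ (GridIdx M)) :
    extend (x + y) = fun e i => extend x e i + extend y e i := by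
  funext e i
  unfold extend
  split_ifs <;> simp

lemma extend_smul (k : ℝ) (x : EuclideanSpace ℝ (GridIdx M)) :
    extend (k • x) = fun e i => k * extend x e i := by
  funext e i
  unfold extend
  split_ifs <;> simp

lemma extend_sub (x y : EuclideanSpace ℝ (GridIdx M)) :
    extend (x - y) = fun e i => extend x e i - extend y e i := by
  funext e i
  unfold extend
  split_ifs <;> simp

lemma abs_extend_le (x : EuclideanSpace ℝ (GridIdx M)) (e : E) (i : ℕ) : |extend x e i| ≤ ‖x‖ := by
  unfold extend
  split_ifs
  · exact PiLp.norm_apply_le x _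
  · simp

lemma continuous_extend (e : E) (i : ℕ) :
    Continuous fun x : EuclideanSpace ℝ (GridIdx M) => extend x e i := by
  unfold extend
  split_ifs
  · fun_prop
  · exact continuous_const

lemma inner_eq_nodePair (x y : EuclideanSpace ℝ (GridIdx M)) :
    Inner.inner ℝ x y = nodePair M (extend x) (extend y) := by
  rw [PiLp.inner_apply, Fintype.sum_sigma, nodePair]
  refine Finset.sum_congr rfl fun e _ => ?_
  rw [Finset.sum_range]
  refine Finset.sum_congr rfl fun i _ => ?_
  simp [extend, Nat.lt_succ_iff.1 i.2, mul_comm]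

lemma nodePair_congr {r r₃ s s₃ : E → ℕ → ℝ} (hr : ∀ e, ∀ i ≤ M e, r e i = r₃ e i)
    (hs : ∀ e, ∀ i ≤ M e, s e i = s₃ e i) : nodePair M r s = nodePair M r₃ s₃ := by
  unfold nodePair
  refine Finset.sum_congr rfl fun e _ => Finset.sum_congr rfl fun i hi => ?_
  have hi' := Nat.lt_succ_iff.1 (Finset.mem_range.1 hi)
  rw [hr e i hi', hs e i hi']

end

/-- The space of the nodal values of conservative functions. -/
noncomputable def nodalSpace (M : E → ℕ) : Submodule ℝ (EuclideanSpace ℝ (GridIdx M)) where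
  carrier := {v | G.Conservative (G.interp M (extend v))}
  add_mem' {x y} hx hy := by
    intro v hv
    have h1 := hx v hv
    have h2 := hy v hv
    rw [← add_zero (0 : ℝ)]
    nth_rewrite 1 [← h1]
    rw [← h2, ← Finset.sum_add_distrib]
    refine Finset.sum_congr rfl fun e _ => ?_
    rw [← add_mul, extend_add]
    simp only [atVertex, interp_add]
  zero_mem' := by
    intro v _
    refine Finset.sum_eq_zero fun e _ => ?_
    have : G.interp M (extend (0 : EuclideanSpace ℝ (GridIdx M))) e = fun _ => 0 := by
      funext x
      have h := extend_smul 0 (0 : EuclideanSpace ℝ (GridIdx M))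
      rw [smul_zero] at h
      rw [h, interp_cmul, zero_mul]
    simp [atVertex, this]
  smul_mem' k x hx := by
    intro v hv
    have h1 := hx v hv
    rw [← mul_zero k, ← h1, Finset.mul_sum]
    refine Finset.sum_congr rfl fun e _ => ?_
    rw [← mul_assoc, extend_smul]
    simp only [atVertex, interp_cmul]

section

variable {G} {P : ℝ → ℝ} {c : Consts} {ε Δ t : ℝ} {a γ : E → ℝ} {hb : V → ℝ → ℝ} {M : E → ℕ}
  {v' : E → ℝ → ℝ} {d' : E → ℕ → ℝ}

lemma continuous_newDens_extend (e : E) (i : ℕ) :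
    Continuous fun x : G.nodalSpace M => G.newDens Δ a M d' (extend x.1) e i := by
  have h : ∀ k, Continuous fun x : G.nodalSpace M => extend x.1 e k :=
    fun k => (continuous_extend e k).comp continuous_subtype_val
  unfold newDens slopes
  exact continuous_const.sub (continuous_const.mul (((h (i + 1)).sub (h i)).div_const _))

/-- The admissible states with the densities given by the mass balance. -/
def admSet (G : PipeNetwork V E) (c : Consts) (M : E → ℕ) (a : E → ℝ) (Δ : ℝ) (d' : E → ℕ → ℝ) :
    Set (G.nodalSpace M) :=
  {x | AdmState c M a (G.newDens Δ a M d' (extend x.1)) (extend x.1)}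

lemma isCompact_admSet (ha : ∀ e, a e ∈ Icc c.amin c.amax) (hM : ∀ e, 0 < M e) :
    IsCompact (admSet G c M a Δ d') := by
  have hcont : ∀ e i, Continuous fun x : G.nodalSpace M => extend x.1 e i :=
    fun e i => (continuous_extend e i).comp continuous_subtype_val
  have hcd : ∀ e i, Continuous fun x : G.nodalSpace M =>
      G.newDens Δ a M d' (extend x.1) e i := continuous_newDens_extend
  refine Metric.isCompact_of_isClosed_isBounded ?_ ?_
  · simp only [admSet, AdmState, ofPred_forall, ofPred_and]
    refine isClosed_iInter fun e => isClosed_iInter fun i => isClosed_iInter fun _ => ?_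
    refine (isClosed_Icc.preimage (hcd e i)).inter (IsClosed.inter ?_ ?_)
    · exact isClosed_le (hcont e i).abs (continuous_const.mul (continuous_const.mul (hcd e i)))
    · exact isClosed_le (hcont e (i + 1)).abs (continuous_const.mul (continuous_const.mul (hcd e i)))
  · rw [isBounded_iff_forall_norm_le]
    set R := c.W * (c.amax * c.r₁) with hR
    refine ⟨√(∑ e, ∑ _i ∈ Finset.range (M e + 1), R ^ 2), fun x hx => Real.le_sqrt_of_sq_le ?_⟩
    rw [← real_inner_self_eq_norm_sq, Submodule.coe_inner, inner_eq_nodePair]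
    refine Finset.sum_le_sum fun e _ => Finset.sum_le_sum fun i hi => ?_
    rw [← sq, ← sq_abs]
    have := AdmState.abs_nodal_flux_le hx ha hM (Nat.lt_succ_iff.1 (Finset.mem_range.1 hi))
    gcongr

lemma mem_interior_admSet {x : G.nodalSpace M}
    (h : StrictAdm c M a (G.newDens Δ a M d' (extend x.1)) (extend x.1)) :
    x ∈ interior (admSet G c M a Δ d') := by
  have hcont : ∀ e i, Continuous fun x : G.nodalSpace M => extend x.1 e i :=
    fun e i => (continuous_extend e i).comp continuous_subtype_val
  have hcd : ∀ e i, Continuous fun x : G.nodalSpace M =>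
      G.newDens Δ a M d' (extend x.1) e i := continuous_newDens_extend
  rw [mem_interior_iff_mem_nhds]
  have : ∀ᶠ y : G.nodalSpace M in nhds x, ∀ e, ∀ i ∈ Iio (M e),
      G.newDens Δ a M d' (extend y.1) e i ∈ Ioo c.r₀ c.r₁ ∧
      |extend y.1 e i|
        < c.W * (a e * G.newDens Δ a M d' (extend y.1) e i) ∧
      |extend y.1 e (i + 1)|
        < c.W * (a e * G.newDens Δ a M d' (extend y.1) e i) := by
    rw [Filter.eventually_all]
    intro e
    rw [Filter.eventually_all_finite (finite_Iio _)]
    intro i hi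
    obtain ⟨h1, h2, h3⟩ := h e i hi
    refine ((hcd e i).continuousAt.eventually (isOpen_Ioo.mem_nhds h1)).and (Filter.Eventually.and ?_ ?_)
    · exact (hcont e i).abs.continuousAt.eventually_lt
        (continuous_const.mul (continuous_const.mul (hcd e i))).continuousAt h2
    · exact (hcont e (i + 1)).abs.continuousAt.eventually_lt
        (continuous_const.mul (continuous_const.mul (hcd e i))).continuousAt h3
  filter_upwards [this] with y hy
  exact StrictAdm.admState hy

/-- The operator on the space of conservative nodal values that represents the form of a step. -/
lemma exists_stepOperator (hM : ∀ e, 0 < M e) (hv : ∀ e, Bdd (G.len e) (v' e)) :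
    ∃ A : G.nodalSpace M → G.nodalSpace M, ∀ x r : G.nodalSpace M,
      Inner.inner ℝ (A x) r = G.stepForm P ε Δ a γ hb t M v'
        (G.newDens Δ a M d' (extend x.1)) (extend x.1)
        (extend r.1) := by
  have key : ∀ x : G.nodalSpace M, ∃ z : G.nodalSpace M, ∀ r : G.nodalSpace M,
      Inner.inner ℝ z r = G.stepForm P ε Δ a γ hb t M v'
        (G.newDens Δ a M d' (extend x.1)) (extend x.1)
        (extend r.1) := by
    intro x
    let f : G.nodalSpace M →ₗ[ℝ] ℝ :=
      { toFun := fun r => G.stepForm P ε Δ a γ hb t M v'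
          (G.newDens Δ a M d' (extend x.1)) (extend x.1)
          (extend r.1)
        map_add' := fun r s => by
          rw [Submodule.coe_add, extend_add, stepForm_add hM hv]
        map_smul' := fun k r => by
          rw [Submodule.coe_smul, extend_smul, stepForm_cmul, smul_eq_mul, RingHom.id_apply] }
    refine ⟨(InnerProductSpace.toDual ℝ (G.nodalSpace M)).symm (LinearMap.toContinuousLinearMap f),
      fun r => ?_⟩
    rw [InnerProductSpace.toDual_symm_apply]
    rfl
  choose A hA using key
  exact ⟨A, hA⟩

end

set_option maxHeartbeats 1000000 in
/-- Existence of an admissible solution of one step of the scheme. -/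
lemma exists_step {P : ℝ → ℝ} {c : Consts} {B q₀ q₁ q₂ : ℝ} (hB : 0 < B)
    (hPB : PressureBounds P c.r₀ c.r₁ c.W c.εm q₀ q₁ q₂) :
    ∃ σ : ℝ, 0 < σ ∧ σ ≤ c.ρmin / 16 ∧ ∀ CE c₂ : ℝ, 0 < CE → 0 < c₂ → ∃ δ : ℝ, 0 < δ ∧
      ∀ (ε : ℝ) (a γ : E → ℝ) (hb : V → ℝ → ℝ)
      (ρ w ρt wt : E → ℝ → ℝ → ℝ) (M : E → ℕ) (t t' Δ H : ℝ) (d' m' : E → ℕ → ℝ),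
      G.StepSetup P c B ε a γ hb ρ w ρt wt M t t' Δ H CE σ d' m' → Δ ≤ δ → 0 ≤ H → H ≤ c₂ * Δ →
      ∃ m, AdmState c M a (G.newDens Δ a M d' m) m ∧
        G.IsStep P ε Δ a γ hb t M d' m' (G.newDens Δ a M d' m) m ∧
        ∀ e, ∀ i < M e, ∀ x ∈ cell (G.edgeMeshSize M e) i,
          |G.newDens Δ a M d' m e i - ρ e t x| ≤ σ := by
  obtain ⟨σ, hσ, hσρ, hreg⟩ := G.exists_reg_strict hB hPB
  obtain ⟨k, δ₁, hk, hδ₁, hmono⟩ := G.exists_stepForm_mono hPB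
  refine ⟨σ, hσ, hσρ, fun CE c₂ hCE hc₂ => ?_⟩
  obtain ⟨δ₂, hδ₂, hreg⟩ := hreg CE c₂ hCE hc₂
  refine ⟨min δ₁ δ₂, lt_min hδ₁ hδ₂, ?_⟩
  intro ε a γ hb ρ w ρt wt M t t' Δ H d' m' S hΔδ hH hHc
  have X := S.X
  have hM := S.hM
  have hΔ := S.hΔ
  have hv := fun e => bdd_vel (G := G) (hM e) a d' m'
  obtain ⟨h₀, hh₀, hle⟩ := exists_pos_forall_le (fun e => G.mesh_pos (hM e))
  obtain ⟨A, hA⟩ := exists_stepOperator (P := P) (ε := ε) (Δ := Δ) (t := t) (a := a) (γ := γ)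
    (hb := hb) (d' := d') hM hv
  obtain ⟨L, hL, hLip⟩ := exists_stepForm_lipschitz (G := G) (t := t) (hb := hb) (d' := d') hPB
    X.ε_nonneg X.ε_le X.a_mem X.γ_mem hΔ hM hv
  set m₀ := G.nodal M (fluxAt a ρ w t) with hm₀
  have htr : ∀ r : E → ℕ → ℝ, ∀ e, ∀ i ≤ M e, extend (truncate M r) e i = r e i :=
    fun r e i hi => extend_truncate r hi
  have hmem : ∀ r : E → ℕ → ℝ, G.Conservative (G.interp M r) → truncate M r ∈ G.nodalSpace M :=
    fun r hr => conservative_interp_congr hM (fun e i hi => (htr r e i hi).symm) hr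
  set x₀ : G.nodalSpace M := ⟨truncate M m₀,
    hmem m₀ ((G.conservative_interp_nodal hM).2 (X.balance t S.ht))⟩ with hx₀
  have hx₀K : x₀ ∈ admSet G c M a Δ d' := by
    intro e i hi
    have h := (S.cmp_strict hB).admState e i hi
    rw [newDens_congr (htr m₀) hi, htr m₀ e i hi.le, htr m₀ e (i + 1) hi]
    exact h
  have hLipA : ∀ x ∈ admSet G c M a Δ d', ∀ y ∈ admSet G c M a Δ d',
      ‖A x - A y‖ ≤ L * ‖x - y‖ := by
    intro x hx y hy
    rcases (norm_nonneg (A x - A y)).eq_or_lt with h0 | h0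
    · rw [← h0]; positivity
    · refine le_of_mul_le_mul_right ?_ h0
      rw [← sq, ← real_inner_self_eq_norm_sq]
      nth_rewrite 1 [inner_sub_left]
      rw [hA, hA]
      refine (le_abs_self _).trans (hLip _ _ _ _ _ (norm_nonneg _) (norm_nonneg _) hx hy
        (fun e i _ => ?_) fun e i _ => abs_extend_le _ e i)
      have := abs_extend_le ((x - y : G.nodalSpace M) : EuclideanSpace ℝ (GridIdx M)) e i
      rwa [Submodule.coe_sub, extend_sub] at this
  have hmonoA : ∀ x ∈ admSet G c M a Δ d', ∀ y ∈ admSet G c M a Δ d',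
      0 ≤ Inner.inner ℝ (A x - A y) (x - y) := by
    intro x hx y hy
    rw [inner_sub_left, hA, hA, Submodule.coe_sub, extend_sub]
    refine le_trans ?_ (hmono ε Δ t a γ hb M _ _ _ _ _ X.ε_nonneg X.ε_le X.a_mem X.γ_mem hΔ
      (hΔδ.trans (min_le_left _ _)) hM hv hx hy (fun e i _ => newDens_sub X.a_pos _ _ e i))
    exact mul_nonneg hk.le (tot_nonneg fun e x => stateDist_nonneg hΔ.le _ _ _ _ e x)
  have hcond : ∀ r (hr : G.Conservative (G.interp M r)), ∀ x : G.nodalSpace M,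
      G.stepForm P ε Δ a γ hb t M (G.vel M a d' m')
        (G.newDens Δ a M d' (extend x.1)) (extend x.1) r
      = Inner.inner ℝ (A x) (⟨truncate M r, hmem r hr⟩ : G.nodalSpace M) := by
    intro r hr x
    rw [hA]
    exact stepForm_newDens_congr hM (fun _ _ _ => rfl) fun e i hi => (htr r e i hi).symm
  obtain ⟨x, hxK, hx⟩ := exists_zero_of_continuation (isCompact_admSet X.a_mem hM) hLipA hmonoA hx₀K
    (κ := Δ * h₀) (by positivity) (fun θ hθ x hx hz => by
      refine mem_interior_admSet (hreg ε a γ hb ρ w ρt wt M t t' Δ H θ (Δ * h₀) d' m' _ S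
        (hΔδ.trans (min_le_right _ _)) hH hHc ⟨Ioc_subset_Icc_self hθ, by positivity, hx, x.2, ?_⟩
        fun e => by have := hle e; gcongr).1
      intro r hr
      have h1 := congrArg (fun z => Inner.inner ℝ z (⟨truncate M r, hmem r hr⟩ : G.nodalSpace M)) hz
      simp only [inner_add_left, real_inner_smul_left] at h1
      rw [← hcond r hr x, ← hcond r hr x₀, Submodule.coe_inner, inner_eq_nodePair,
        Submodule.coe_sub, extend_sub] at h1
      rw [nodePair_congr (M := M) (r₃ := fun e i => extend x.1 e i
        - m₀ e i) (s₃ := r) (fun e i hi => by rw [htr m₀ e i hi]) (htr r)] at h1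
      rw [h1]
      congr 1
      exact stepForm_newDens_congr hM (htr m₀) fun _ _ _ => rfl)
  set m := extend x.1 with hm
  have hzero : ∀ r, G.Conservative (G.interp M r) →
      G.stepForm P ε Δ a γ hb t M (G.vel M a d' m') (G.newDens Δ a M d' m) m r = 0 := by
    intro r hr
    rw [hcond r hr x, hx, inner_zero_left]
  refine ⟨m, hxK, ⟨fun e i _ => ?_, x.2, fun r hr => (momentum_iff hM hΔ hv r).2 (hzero r hr)⟩, ?_⟩
  · have := (X.a_pos e).ne'
    unfold newDens
    field_simp
    ring
  · exact (hreg ε a γ hb ρ w ρt wt M t t' Δ H 0 0 d' m' m S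
      (hΔδ.trans (min_le_right _ _)) hH hHc ⟨⟨le_rfl, zero_le_one⟩, le_rfl, hxK, x.2,
        fun r hr => by rw [hzero r hr]; ring⟩ fun e => by
          have := G.mesh_pos (hM e); positivity).2 rfl

/-! ### Existence of discrete solutions -/

lemma Exact.abs_average_sub_le {G : PipeNetwork V E} {P : ℝ → ℝ} {c : Consts} {B ε : ℝ} {a γ : E → ℝ}
    {hb : V → ℝ → ℝ} {ρ w ρt wt : E → ℝ → ℝ → ℝ} {M : E → ℕ} {t : ℝ}
    (X : G.Exact P c B ε a γ hb ρ w ρt wt) (hB : 0 < B) (ht : t ∈ Icc 0 c.T) {e : E} (hM : 0 < M e)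
    {i : ℕ} (hi : i < M e) {x : ℝ} (hx : x ∈ cell (G.edgeMeshSize M e) i) :
    |(∫ y in (i * G.edgeMeshSize M e)..((i + 1) * G.edgeMeshSize M e), ρ e t y)
      / G.edgeMeshSize M e - ρ e t x| ≤ B * √(G.edgeMeshSize M e) := by
  have hh := G.mesh_pos hM
  have hm := G.mesh_mul hM
  have hsub := cell_subset hh hm hi
  have hle : (i * G.edgeMeshSize M e : ℝ) ≤ (i + 1) * G.edgeMeshSize M e := by linarith
  have hii : IntervalIntegrable (ρ e t) volume (i * G.edgeMeshSize M e)
      ((i + 1) * G.edgeMeshSize M e) :=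
    (X.bdd_ρ (e := e) ht).itg.ii_of_mem (hsub (left_mem_cell hh i)) (hsub (right_mem_cell hh i))
  have key : ‖∫ y in (i * G.edgeMeshSize M e)..((i + 1) * G.edgeMeshSize M e), (ρ e t y - ρ e t x)‖
      ≤ B * √(G.edgeMeshSize M e)
        * |(i + 1) * G.edgeMeshSize M e - i * G.edgeMeshSize M e| := by
    apply intervalIntegral.norm_integral_le_of_norm_le_const
    intro y hy
    rw [uIoc_of_le hle] at hy
    have hy' : y ∈ cell (G.edgeMeshSize M e) i := Ioc_subset_Icc_self hy
    refine ((X.prim_ρ e t ht).holder hB.le (X.bound_ρx e t ht) (hsub hy') (hsub hx)).trans ?_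
    gcongr
    exact abs_le.2 ⟨by linarith [hx.2, hy'.1], by linarith [hx.1, hy'.2]⟩
  have e1 : ((i : ℝ) + 1) * G.edgeMeshSize M e - i * G.edgeMeshSize M e = G.edgeMeshSize M e := by ring
  rw [intervalIntegral.integral_sub hii intervalIntegrable_const, intervalIntegral.integral_const, e1,
    abs_of_pos hh, Real.norm_eq_abs, smul_eq_mul] at key
  rw [← mul_le_mul_iff_left₀ hh, ← abs_of_pos hh, ← abs_mul, abs_of_pos hh, sub_mul,
    div_mul_cancel₀ _ hh.ne', mul_comm (ρ e t x)]
  exact key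

lemma exists_schemeSolution_of_small {P : ℝ → ℝ} {c : Consts} {B q₀ q₁ q₂ c₂ : ℝ} (hB : 0 < B)
    (hPB : PressureBounds P c.r₀ c.r₁ c.W c.εm q₀ q₁ q₂) (hc₂ : 0 < c₂) :
    ∃ δ : ℝ, 0 < δ ∧ ∀ (ε : ℝ) (a γ : E → ℝ) (hb : V → ℝ → ℝ)
      (ρ w ρt wt : E → ℝ → ℝ → ℝ) (M : E → ℕ) (Δ H : ℝ) (N : ℕ),
      G.Exact P c B ε a γ hb ρ w ρt wt → (∀ e, 0 < M e) → (∀ e, G.edgeMeshSize M e ≤ H) →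
      0 < Δ → Δ ≤ δ → N * Δ ≤ c.T → 0 ≤ H → H ≤ c₂ * Δ →
      ∃ d m, G.IsSchemeSolution c P ε Δ a γ hb ρ w N M d m := by
  obtain ⟨CE, τ, hCE, hτ, herr⟩ := G.exists_error_bound hB hPB
  obtain ⟨σ, hσ, hσρ, hstep⟩ := G.exists_step hB hPB
  obtain ⟨δ, hδ, hstep⟩ := hstep CE c₂ hCE hc₂
  have hρ := c.ρmin_pos
  have ham := c.amin_pos
  have hwm := c.wmax_pos
  refine ⟨min (min τ δ) (min (min 1 (c.ρmin / (32 * B))) (σ ^ 2 / (B ^ 2 * c₂))), by positivity, ?_⟩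
  intro ε a γ hb ρ w ρt wt M Δ H N X hM hH hΔ hΔδ hNT hH0 hHc
  have hΔτ : Δ ≤ τ := hΔδ.trans ((min_le_left _ _).trans (min_le_left _ _))
  have hΔδ' : Δ ≤ δ := hΔδ.trans ((min_le_left _ _).trans (min_le_right _ _))
  have hΔ1 : Δ ≤ 1 := hΔδ.trans ((min_le_right _ _).trans ((min_le_left _ _).trans (min_le_left _ _)))
  have hΔρ : Δ ≤ c.ρmin / (32 * B) :=
    hΔδ.trans ((min_le_right _ _).trans ((min_le_left _ _).trans (min_le_right _ _)))
  have hΔσ : Δ ≤ σ ^ 2 / (B ^ 2 * c₂) := hΔδ.trans ((min_le_right _ _).trans (min_le_right _ _))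
  have hcl : σ + 2 * B * Δ ≤ c.ρmin / 8 := by
    rw [le_div_iff₀ (by positivity)] at hΔρ
    linarith
  have hBσ : ∀ e, B * √(G.edgeMeshSize M e) ≤ σ := by
    intro e
    refine le_of_abs_le (abs_le_of_sq_le_sq ?_ hσ.le)
    have h1 := (hH e).trans hHc
    rw [mul_pow, Real.sq_sqrt (G.mesh_pos (hM e)).le]
    rw [le_div_iff₀ (by positivity)] at hΔσ
    calc B ^ 2 * G.edgeMeshSize M e ≤ B ^ 2 * (c₂ * Δ) := by gcongr
      _ ≤ σ ^ 2 := by linarith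
  have main : ∀ n ≤ N, ∃ d m, G.IsSchemeSolution c P ε Δ a γ hb ρ w n M d m ∧
      ∀ e, ∀ i < M e, ∀ x ∈ cell (G.edgeMeshSize M e) i, |d n e i - ρ e (n * Δ) x| ≤ σ := by
    intro n
    induction n with
    | zero =>
      intro _
      have h0 : (0 : ℝ) ∈ Icc 0 c.T := ⟨le_rfl, c.T_pos.le⟩
      set d : ℕ → E → ℕ → ℝ := fun _ e i => (∫ y in (i * G.edgeMeshSize M e)..((i + 1)
        * G.edgeMeshSize M e), ρ e 0 y) / G.edgeMeshSize M e with hd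
      have hclose : ∀ e, ∀ i < M e, ∀ x ∈ cell (G.edgeMeshSize M e) i,
          |d 0 e i - ρ e 0 x| ≤ σ :=
        fun e i hi x hx => (X.abs_average_sub_le hB h0 (hM e) hi hx).trans (hBσ e)
      refine ⟨d, fun _ => G.nodal M (fluxAt a ρ w 0), ⟨⟨fun _ _ _ => rfl, fun _ _ _ => rfl⟩, ?_, ?_⟩, ?_⟩
      · intro k hk
        obtain rfl := Nat.le_zero.1 hk
        refine (X.strictAdm_of_close hM h0 (fun e i hi x hx => (hclose e i hi x hx).trans
          (by linarith)) fun e i _ => ?_).admState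
        rw [sub_self, abs_zero]
        positivity
      · intro k hk
        exact absurd hk (Nat.not_lt_zero k)
      · simpa using hclose
    | succ n ih =>
      intro hn
      obtain ⟨d, m, hS, hclose⟩ := ih (Nat.le_of_succ_le hn)
      have hT : ((n + 1 : ℕ) : ℝ) * Δ ≤ c.T := by
        refine le_trans ?_ hNT
        have : ((n + 1 : ℕ) : ℝ) ≤ N := by exact_mod_cast hn
        gcongr
      have e1 : ((n + 1 : ℕ) : ℝ) * Δ = n * Δ + Δ := by push_cast; ring
      have hn0 : (0 : ℝ) ≤ n * Δ := by positivity
      have hnT : (n : ℝ) * Δ ≤ c.T := by linarith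
      have hE := herr ε a γ hb ρ w ρt wt M Δ H n d m X hM hH hΔ hΔτ hnT hS.init hS.adm hS.step n le_rfl
      have hD : 0 ≤ ∑ k ∈ Finset.Icc 1 n, Δ * G.tot (G.errDiss M a w (k * Δ) (d k) (m k)) :=
        Finset.sum_nonneg fun k _ => mul_nonneg hΔ.le (tot_nonneg fun _ _ => dissDensity_nonneg _ _)
      obtain ⟨mn, hadm, hst, hcl'⟩ := hstep ε a γ hb ρ w ρt wt M ((n + 1 : ℕ) * Δ) (n * Δ) Δ H (d n) (m n)
        { X := X, hM := hM, hH := hH, ht := ⟨by linarith, hT⟩, ht' := ⟨hn0, hnT⟩, hΔ := hΔ,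
          hΔ1 := hΔ1, htt := e1, err := by linarith, close := hclose,
          close_le := hcl } hΔδ' hH0 hHc
      set dn := G.newDens Δ a M (d n) mn
      refine ⟨fun k => if k ≤ n then d k else dn, fun k => if k ≤ n then m k else mn,
        ⟨?_, ?_, ?_⟩, ?_⟩
      · simpa using hS.init
      · intro k hk
        by_cases hkn : k ≤ n
        · simpa [hkn] using hS.adm k hkn
        · simpa [hkn] using hadm
      · intro k hk
        by_cases hkn : k < n
        · have h1 : k + 1 ≤ n := hkn
          simp only [hkn.le, h1, if_true]
          exact hS.step k hkn
        · obtain rfl : k = n := by omega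
          simp only [le_refl, if_true, Nat.not_succ_le_self, if_false]
          exact hst
      · simpa using hcl'
  obtain ⟨d, m, h, -⟩ := main N le_rfl
  exact ⟨d, m, h⟩

/-! ### The error in terms of the mass flux -/

lemma Exact.normPow_le {G : PipeNetwork V E} {P : ℝ → ℝ} {c : Consts} {B ε : ℝ} {a γ : E → ℝ}
    {hb : V → ℝ → ℝ} {ρ w ρt wt : E → ℝ → ℝ → ℝ} {M : E → ℕ} {t : ℝ} {d m : E → ℕ → ℝ}
    {ρh mh : E → ℝ → ℝ} (X : G.Exact P c B ε a γ hb ρ w ρt wt) (hM : ∀ e, 0 < M e)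
    (ht : t ∈ Icc 0 c.T) (hadm : AdmState c M a d m)
    (hρ : ∀ e, ∀ᵐ x ∂(pipeMeasure (G.len e)), ρh e x = G.dens M d e x)
    (hm : ∀ e, ∀ x ∈ Icc 0 (G.len e), mh e x = G.interp M m e x) :
    G.normPow 2 (fun e x => ρ e t x - ρh e x) + ε ^ 2 * G.normPow 2 (fun e x => fluxAt a ρ w t e x - mh e x)
      ≤ (1 + 2 * c.amax ^ 2 * (c.r₁ ^ 2 + c.εm ^ 2 * c.W ^ 2)) * G.tot (G.errSq ε M a ρ w t d m) ∧
    G.normPow 3 (fun e x => fluxAt a ρ w t e x - mh e x)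
      ≤ 4 * c.amax ^ 3 * c.r₁ ^ 3 * G.tot (G.errDiss M a w t d m)
        + 4 * c.amax ^ 3 * (c.W ^ 3 * c.r₁) * G.tot (G.errSq ε M a ρ w t d m) := by
  have haM := c.amax_pos
  have hr₁ := c.r₁_pos
  have hW := c.W_pos
  have hε := X.ε_nonneg
  have hεm := X.ε_le
  have bS := fun e => X.bdd_errSq (e := e) (hM e) ht d m
  have bD := fun e => X.bdd_errDiss (e := e) (hM e) ht d m
  have bρ := fun e => (X.bdd_ρ (e := e) ht).sub (bdd_dens (hM e) d)
  have bm : ∀ e, Bdd (G.len e) (fun x => fluxAt a ρ w t e x - G.interp M m e x) := fun e =>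
    (((X.bdd_ρ (e := e) ht).cmul (a e)).mul (X.bdd_w (e := e) ht)).sub (bdd_interp (hM e) m)
  have eρ : G.normPow 2 (fun e x => ρ e t x - ρh e x)
      = G.tot (fun e x => (ρ e t x - G.dens M d e x) ^ 2) := by
    refine tot_congr fun e => ?_
    filter_upwards [hρ e] with x hx
    rw [hx, sq_abs]
  have em : ∀ p : ℕ, G.normPow p (fun e x => fluxAt a ρ w t e x - mh e x)
      = G.tot (fun e x => |fluxAt a ρ w t e x - G.interp M m e x| ^ p) := by
    intro p
    refine tot_congr fun e => ?_
    filter_upwards [ae_mem_pipe (G.len e)] with x hx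
    rw [hm e x (Ioo_subset_Icc_self hx)]
  have ptw : ∀ e, ∀ᵐ x ∂(pipeMeasure (G.len e)), ∃ r z : ℝ, G.dens M d e x = r ∧
      G.vel M a d m e x = z ∧ G.interp M m e x = a e * r * z ∧ r ∈ Icc 0 c.r₁ ∧
      ρ e t x ∈ Icc 0 c.r₁ ∧ |w e t x| ≤ c.W := by
    intro e
    filter_upwards [hadm.ae X.a_pos (hM e), ae_mem_pipe (G.len e)] with x ⟨h1, h2, h3⟩ hx
    have h4 := X.mem_J ht x (Ioo_subset_Icc_self hx)
    exact ⟨_, _, rfl, rfl, h3.symm, ⟨c.r₀_pos.le.trans h1.1, h1.2⟩, ⟨c.r₀_pos.le.trans h4.1, h4.2⟩,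
      X.abs_w_le_W ht x (Ioo_subset_Icc_self hx)⟩
  constructor
  · rw [eρ, em 2, ← tot_cmul, ← tot_cmul, ← tot_add (fun e => ((bρ e).pow 2).itg)
      (fun e => (((bm e).abs.pow 2).cmul _).itg)]
    refine tot_mono (fun e => (((bρ e).pow 2).add (((bm e).abs.pow 2).cmul _)).itg)
      (fun e => ((bS e).cmul _).itg) fun e => ?_
    filter_upwards [ptw e] with x ⟨r, z, h1, h2, h3, h4, h5, h6⟩
    have h7 := sq_flux_sub_le (w := z) (s := ρ e t x) (X.a_pos e).le (X.a_mem e).2 h4.1 h4.2 h6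
    rw [sq_abs, h3]
    simp only [errSq, distSq, h1, h2, fluxAt, flux]
    have h8 : (a e * ρ e t x * w e t x - a e * r * z) ^ 2
        = (a e * r * z - a e * ρ e t x * w e t x) ^ 2 := by ring
    rw [h8]
    have h9 : ε ^ 2 ≤ c.εm ^ 2 := by gcongr
    set p := (r - ρ e t x) ^ 2
    set q := (z - w e t x) ^ 2
    have hp : 0 ≤ p := sq_nonneg _
    have hq : 0 ≤ q := sq_nonneg _
    have h10 : (ρ e t x - r) ^ 2 = p := by ring
    rw [h10]
    have h11 : ε ^ 2 * (a e * r * z - a e * ρ e t x * w e t x) ^ 2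
        ≤ ε ^ 2 * (2 * c.amax ^ 2 * (c.r₁ ^ 2 * q + c.W ^ 2 * p)) := by gcongr
    have h12 : ε ^ 2 * (2 * c.amax ^ 2 * (c.W ^ 2 * p)) ≤ c.εm ^ 2 * (2 * c.amax ^ 2 * (c.W ^ 2 * p)) := by
      gcongr
    have h13 : 0 ≤ ε ^ 2 * q * (1 + 2 * c.amax ^ 2 * (c.εm ^ 2 * c.W ^ 2)) := by positivity
    have h14 : 0 ≤ 2 * c.amax ^ 2 * c.r₁ ^ 2 * p := by positivity
    linarith
  · rw [em 3, ← tot_cmul, ← tot_cmul, ← tot_add (fun e => ((bD e).cmul _).itg)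
      (fun e => ((bS e).cmul _).itg)]
    refine tot_mono (fun e => ((bm e).abs.pow 3).itg)
      (fun e => (((bD e).cmul _).add ((bS e).cmul _)).itg) fun e => ?_
    filter_upwards [ptw e] with x ⟨r, z, h1, h2, h3, h4, h5, h6⟩
    have h7 := cube_flux_sub_le (w := z) (X.a_pos e).le (X.a_mem e).2 h4.1 h4.2 h5.1 h5.2 hW.le h6
    rw [abs_sub_comm, h3]
    simp only [errSq, errDiss, distSq, h1, h2, fluxAt, flux]
    have h8 : 0 ≤ 4 * c.amax ^ 3 * (c.W ^ 3 * c.r₁) * (ε ^ 2 * (z - w e t x) ^ 2) := by positivity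
    linarith

/-- The error estimate for discrete solutions. -/
lemma exists_error_estimate {P : ℝ → ℝ} {c : Consts} {B q₀ q₁ q₂ : ℝ} (hB : 0 < B)
    (hPB : PressureBounds P c.r₀ c.r₁ c.W c.εm q₀ q₁ q₂) :
    ∃ C τ : ℝ, 0 < C ∧ 0 < τ ∧ ∀ (ε : ℝ) (a γ : E → ℝ) (hb : V → ℝ → ℝ)
      (ρ w ρt wt : E → ℝ → ℝ → ℝ) (M : E → ℕ) (H : ℝ) (N : ℕ) (ρh mh : ℕ → E → ℝ → ℝ),
      G.Exact P c B ε a γ hb ρ w ρt wt → 0 < N → (∀ e, 0 < M e) → (∀ e, G.edgeMeshSize M e ≤ H) →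
      c.T / N ≤ τ → G.IsAdmissibleSolution P c.T ε a γ hb ρ w c.ρmin c.ρmax c.wmax N M ρh mh →
      ∀ n ≤ N, G.normPow 2 (fun e x => ρ e (n * (c.T / N)) x - ρh n e x)
        + ε ^ 2 * G.normPow 2 (fun e x => fluxAt a ρ w (n * (c.T / N)) e x - mh n e x)
        + ∑ k ∈ Finset.Icc 1 n, c.T / N * G.normPow 3 (fun e x =>
            fluxAt a ρ w (k * (c.T / N)) e x - mh k e x)
        ≤ C * ((c.T / N) ^ 2 + H ^ 2) := by
  obtain ⟨CE, τ, hCE, hτ, herr⟩ := G.exists_error_bound hB hPB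
  have haM := c.amax_pos
  have hr₁ := c.r₁_pos
  have hW := c.W_pos
  have hT := c.T_pos
  set K₁ := 1 + 2 * c.amax ^ 2 * (c.r₁ ^ 2 + c.εm ^ 2 * c.W ^ 2) with hK₁
  set K₂ := 4 * c.amax ^ 3 * c.r₁ ^ 3 with hK₂
  set K₃ := 4 * c.amax ^ 3 * (c.W ^ 3 * c.r₁) with hK₃
  have h₁ : 0 < K₁ := by positivity
  have h₂ : 0 < K₂ := by positivity
  have h₃ : 0 < K₃ := by positivity
  refine ⟨K₁ * CE + (K₂ * CE + K₃ * CE * c.T), τ, by positivity, hτ, ?_⟩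
  intro ε a γ hb ρ w ρt wt M H N ρh mh X hN hM hH hΔτ hsol n hn
  obtain ⟨d, m, hS, hρ, hm⟩ := exists_schemeSolution X hN hM hsol
  have hN' : (0 : ℝ) < N := by exact_mod_cast hN
  set Δ := c.T / N with hΔdef
  have hΔ : 0 < Δ := by positivity
  have hNΔ : N * Δ = c.T := by rw [hΔdef]; field_simp
  have htime : ∀ k ≤ N, (k : ℝ) * Δ ∈ Icc 0 c.T := fun k hk =>
    ⟨by positivity, hNΔ ▸ mul_le_mul_of_nonneg_right (by exact_mod_cast hk) hΔ.le⟩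
  have hE := herr ε a γ hb ρ w ρt wt M Δ H N d m X hM hH hΔ hΔτ hNΔ.le hS.init hS.adm hS.step
  have hbd := fun k hk => X.normPow_le hM (htime k hk) (hS.adm k hk) (hρ k hk) (hm k hk)
  have hSq0 : ∀ k : ℕ, 0 ≤ G.tot (G.errSq ε M a ρ w (k * Δ) (d k) (m k)) := fun k =>
    tot_nonneg fun _ _ => distSq_nonneg _ _ _ _ _
  have hD0 : ∀ n : ℕ, 0 ≤ ∑ k ∈ Finset.Icc 1 n, Δ * G.tot (G.errDiss M a w (k * Δ) (d k) (m k)) :=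
    fun n => Finset.sum_nonneg fun k _ =>
      mul_nonneg hΔ.le (tot_nonneg fun _ _ => dissDensity_nonneg _ _)
  have hSq : ∀ k ≤ N, G.tot (G.errSq ε M a ρ w (k * Δ) (d k) (m k)) ≤ CE * (Δ ^ 2 + H ^ 2) :=
    fun k hk => by linarith [hE k hk, hD0 k]
  have hD : ∑ k ∈ Finset.Icc 1 n, Δ * G.tot (G.errDiss M a w (k * Δ) (d k) (m k))
      ≤ CE * (Δ ^ 2 + H ^ 2) := by linarith [hE n hn, hSq0 n]
  have hsum : ∑ k ∈ Finset.Icc 1 n, Δ * G.normPow 3 (fun e x => fluxAt a ρ w (k * Δ) e x - mh k e x)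
      ≤ K₂ * ∑ k ∈ Finset.Icc 1 n, Δ * G.tot (G.errDiss M a w (k * Δ) (d k) (m k))
        + ∑ _k ∈ Finset.Icc 1 n, Δ * (K₃ * (CE * (Δ ^ 2 + H ^ 2))) := by
    rw [Finset.mul_sum, ← Finset.sum_add_distrib]
    refine Finset.sum_le_sum fun k hk => ?_
    have hkN := (Finset.mem_Icc.1 hk).2.trans hn
    have h4 := mul_le_mul_of_nonneg_left (hbd k hkN).2 hΔ.le
    have h5 : Δ * (K₃ * G.tot (G.errSq ε M a ρ w (k * Δ) (d k) (m k)))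
        ≤ Δ * (K₃ * (CE * (Δ ^ 2 + H ^ 2))) := by
      have := hSq k hkN
      gcongr
    linarith
  rw [Finset.sum_const, Nat.card_Icc, add_tsub_cancel_right, nsmul_eq_mul, ← mul_assoc] at hsum
  have h6 : (n : ℝ) * Δ * (K₃ * (CE * (Δ ^ 2 + H ^ 2))) ≤ c.T * (K₃ * (CE * (Δ ^ 2 + H ^ 2))) := by
    have := (htime n hn).2
    gcongr
  have h7 := mul_le_mul_of_nonneg_left hD h₂.le
  have h8 := mul_le_mul_of_nonneg_left (hSq n hn) h₁.le
  have h9 := (hbd n hn).1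
  linarith

/-- Uniqueness of admissible discrete solutions. -/
lemma exists_solution_unique {P : ℝ → ℝ} {c : Consts} {B q₀ q₁ q₂ : ℝ}
    (hPB : PressureBounds P c.r₀ c.r₁ c.W c.εm q₀ q₁ q₂) :
    ∃ τ : ℝ, 0 < τ ∧ ∀ (ε : ℝ) (a γ : E → ℝ) (hb : V → ℝ → ℝ)
      (ρ w ρt wt : E → ℝ → ℝ → ℝ) (M : E → ℕ) (N : ℕ) (ρh mh ρh' mh' : ℕ → E → ℝ → ℝ),
      G.Exact P c B ε a γ hb ρ w ρt wt → 0 < N → (∀ e, 0 < M e) → c.T / N ≤ τ →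
      G.IsAdmissibleSolution P c.T ε a γ hb ρ w c.ρmin c.ρmax c.wmax N M ρh mh →
      G.IsAdmissibleSolution P c.T ε a γ hb ρ w c.ρmin c.ρmax c.wmax N M ρh' mh' →
      ∀ n ≤ N, ∀ e, (∀ᵐ x ∂(volume.restrict (Ioo 0 (G.len e))), ρh n e x = ρh' n e x) ∧
        ∀ x ∈ Icc 0 (G.len e), mh n e x = mh' n e x := by
  obtain ⟨τ, hτ, huniq⟩ := G.exists_step_unique hPB
  refine ⟨τ, hτ, ?_⟩
  intro ε a γ hb ρ w ρt wt M N ρh mh ρh' mh' X hN hM hΔτ hsol hsol'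
  obtain ⟨d, m, hS, hρ, hm⟩ := exists_schemeSolution X hN hM hsol
  obtain ⟨d', m', hS', hρ', hm'⟩ := exists_schemeSolution X hN hM hsol'
  have hΔ : 0 < c.T / N := div_pos c.T_pos (by exact_mod_cast hN)
  have main : ∀ n ≤ N, (∀ e, ∀ i < M e, d n e i = d' n e i) ∧
      ∀ e, ∀ x ∈ Icc 0 (G.len e), G.interp M (m n) e x = G.interp M (m' n) e x := by
    intro n
    induction n with
    | zero =>
      intro _
      exact ⟨fun e i hi => (hS.init.dens e i hi).trans (hS'.init.dens e i hi).symm,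
        fun e x hx => interp_congr hM
          (fun e i hi => (hS.init.flux e i hi).trans (hS'.init.flux e i hi).symm) hx⟩
    | succ n ih =>
      intro hn
      obtain ⟨h1, h2⟩ := ih (Nat.le_of_succ_le hn)
      exact huniq ε _ _ a γ hb M _ _ _ _ _ _ _ _ X.ε_nonneg X.ε_le X.a_mem X.γ_mem hΔ hΔτ hM h1 h2
        (hS.adm _ hn) (hS'.adm _ hn) (hS.step n hn) (hS'.step n hn)
  intro n hn e
  obtain ⟨h1, h2⟩ := main n hn
  refine ⟨?_, fun x hx => by rw [hm n hn e x hx, hm' n hn e x hx, h2 e x hx]⟩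
  filter_upwards [hρ n hn e, hρ' n hn e, ae_mem_cell (G.mesh_pos (hM e)) (G.mesh_mul (hM e))]
    with x h3 h4 h5
  obtain ⟨i, hi, h5⟩ := h5
  rw [h3, h4, dens, dens, pc_eq_of_mem (G.mesh_pos (hM e)) _ (Ioo_subset_Ico_self h5),
    pc_eq_of_mem (G.mesh_pos (hM e)) _ (Ioo_subset_Ico_self h5), h1 e i hi]

end PipeNetwork

end GasNet

theorem theorem5p1 {V E : Type*} [Fintype V] [DecidableEq V] [Fintype E] [Nonempty E]
    (G : GasNet.PipeNetwork V E) (P : ℝ → ℝ)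
    (hPsmooth : ContDiffOn ℝ ∞ P (Set.Ioi 0))
    (hPconvex : ∃ μ : ℝ, 0 < μ ∧ StrongConvexOn (Set.Ioi 0) μ P)
    (T εmax γmin γmax amin amax ρmin ρmax wmax Cbar : ℝ)
    (hT : 0 < T) (hεmax : 0 < εmax) (hγmin : 0 < γmin) (hγmax : 0 < γmax)
    (hamin : 0 < amin) (hamax : 0 < amax) (hρmin : 0 < ρmin) (hρmax : 0 < ρmax)
    (hwmax : 0 < wmax) (hCbar : 0 < Cbar)
    (hsubsonic : ∀ r ∈ Set.Icc (2 * ρmin / 3) (3 * ρmax / 2),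
      4 * εmax ^ 2 * wmax ^ 2 ≤ r * deriv (deriv P) r) :
    ∃ C : ℝ, 0 < C ∧ ∀ c₁ c₂ : ℝ, 0 < c₁ → 0 < c₂ → ∃ τ₀ : ℝ, 0 < τ₀ ∧
      ∀ (ε : ℝ) (a γ : E → ℝ) (hb : V → ℝ → ℝ) (ρ w : E → ℝ → ℝ → ℝ),
        0 ≤ ε → ε ≤ εmax →
        (∀ e, γmin ≤ γ e ∧ γ e ≤ γmax) →
        (∀ e, amin ≤ a e ∧ a e ≤ amax) →
        G.IsClassicalSolution P T ε a γ hb ρ w →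
        (∀ e, ∀ t ∈ Set.Icc 0 T, ∀ x ∈ Set.Icc 0 (G.len e),
          ρmin ≤ ρ e t x ∧ ρ e t x ≤ ρmax ∧ -wmax ≤ w e t x ∧ w e t x ≤ wmax) →
        (∀ e, GasNet.IsSmoothTrajectory T (G.len e) Cbar (ρ e) ∧
          GasNet.IsSmoothTrajectory T (G.len e) Cbar (w e)) →
        ∀ (N : ℕ) (M : E → ℕ), 0 < N → (∀ e, 0 < M e) →
          T / N ≤ τ₀ → c₁ * (T / N) ≤ G.meshSize M → G.meshSize M ≤ c₂ * (T / N) →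
          -- existence of a discrete admissible state solution
          (∃ ρh mh, G.IsAdmissibleSolution P T ε a γ hb ρ w ρmin ρmax wmax N M ρh mh) ∧
          -- its uniqueness
          (∀ ρh mh ρh' mh',
              G.IsAdmissibleSolution P T ε a γ hb ρ w ρmin ρmax wmax N M ρh mh →
              G.IsAdmissibleSolution P T ε a γ hb ρ w ρmin ρmax wmax N M ρh' mh' →
              ∀ n ≤ N, ∀ e,
              (∀ᵐ x ∂(MeasureTheory.volume.restrict (Set.Ioo 0 (G.len e))),
                ρh n e x = ρh' n e x) ∧
              ∀ x ∈ Set.Icc 0 (G.len e), mh n e x = mh' n e x) ∧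
          -- the error estimate
          (∀ ρh mh, G.IsAdmissibleSolution P T ε a γ hb ρ w ρmin ρmax wmax N M ρh mh →
            ∀ n ≤ N,
            G.normPow 2 (fun e x => ρ e (n * (T / N)) x - ρh n e x)
              + ε ^ 2 * G.normPow 2 (fun e x =>
                  GasNet.PipeNetwork.fluxAt a ρ w (n * (T / N)) e x - mh n e x)
              + ∑ k ∈ Finset.Icc 1 n,
                  T / N * G.normPow 3 (fun e x =>
                    GasNet.PipeNetwork.fluxAt a ρ w (k * (T / N)) e x - mh k e x)
              ≤ C * ((T / N) ^ 2 + G.meshSize M ^ 2)) := by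
  by_cases hle : γmin ≤ γmax ∧ amin ≤ amax ∧ ρmin ≤ ρmax
  swap
  · refine ⟨1, one_pos, fun c₁ c₂ _ _ => ⟨1, one_pos, ?_⟩⟩
    intro ε a γ hb ρ w _ _ hγ ha _ hρ _
    obtain ⟨e⟩ := ‹Nonempty E›
    have h := hρ e 0 ⟨le_rfl, hT.le⟩ 0 ⟨le_rfl, (G.len_pos e).le⟩
    exact absurd ⟨(hγ e).1.trans (hγ e).2, (ha e).1.trans (ha e).2, h.1.trans h.2.1⟩ hle
  obtain ⟨hγle, hale, hρle⟩ := hle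
  let c : GasNet.Consts :=
    { T := T, εm := εmax, γmin := γmin, γmax := γmax, amin := amin, amax := amax, ρmin := ρmin,
      ρmax := ρmax, wmax := wmax, T_pos := hT, εm_pos := hεmax, γmin_pos := hγmin, γ_le := hγle,
      amin_pos := hamin, a_le := hale, ρmin_pos := hρmin, ρ_le := hρle, wmax_pos := hwmax }
  obtain ⟨q₀, q₁, q₂, hPB⟩ := GasNet.exists_pressureBounds c hPsmooth hsubsonic
  obtain ⟨B, hB, hexact⟩ := G.exists_exact hPB hCbar
  obtain ⟨C, τ₁, hC, hτ₁, herr⟩ := G.exists_error_estimate hB hPB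
  obtain ⟨τ₂, hτ₂, huniq⟩ := G.exists_solution_unique (B := B) hPB
  refine ⟨C, hC, fun c₁ c₂ _ hc₂ => ?_⟩
  obtain ⟨τ₃, hτ₃, hexist⟩ := G.exists_schemeSolution_of_small hB hPB hc₂
  refine ⟨min τ₁ (min τ₂ τ₃), lt_min hτ₁ (lt_min hτ₂ hτ₃), ?_⟩
  intro ε a γ hb ρ w hε hεm hγ ha hsol hbd hsmooth N M hN hM hτ _ hH
  have X := hexact ε a γ hb ρ w hε hεm hγ ha hsol hbd hsmooth
  have hmesh : ∀ e, G.edgeMeshSize M e ≤ G.meshSize M := fun e =>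
    Finset.le_sup' (G.edgeMeshSize M) (Finset.mem_univ e)
  have hN' : (0 : ℝ) < N := by exact_mod_cast hN
  have hH0 : 0 ≤ G.meshSize M := by
    obtain ⟨e⟩ := ‹Nonempty E›
    exact (G.mesh_pos (hM e)).le.trans (hmesh e)
  refine ⟨?_, fun ρh mh ρh' mh' h h' => huniq ε a γ hb ρ w _ _ M N ρh mh ρh' mh' X hN hM
    (hτ.trans ((min_le_right _ _).trans (min_le_left _ _))) h h',
    fun ρh mh h => herr ε a γ hb ρ w _ _ M _ N ρh mh X hN hM hmesh (hτ.trans (min_le_left _ _)) h⟩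
  obtain ⟨d, m, hS⟩ := hexist ε a γ hb ρ w _ _ M (T / N) _ N X hM hmesh (by positivity)
    (hτ.trans ((min_le_right _ _).trans (min_le_right _ _))) (mul_div_cancel₀ T hN'.ne').le hH0 hH
  exact ⟨_, _, hS.isAdmissibleSolution X hN hM⟩
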